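/- **Setting.** Let $d\in\{2,3\}$ and let $\Omega\subset\mathbb R^d$ be a bounded polygonal/polyhedral domain lying on one side of its boundary ($\Omega=\operatorname{int}\overline\Omega$), decomposed into a finite conforming mesh $\mathcal T_h$ of open polygons/polyhedra $P$ with flat faces (edges if $d=2$); $\mathcal E_h=\mathcal E_h^o\cup\mathcal E_h^\partial$ is the set of faces, split into interior and boundary ones. The mesh is regular: for some $\rho>0$, every element $P$ is star-shaped with respect to a ball of radius $\rho h_P$, every face $f$ is star-shaped with respect to a ball (in its hyperplane) of radius $\rho h_f$, and $h_f\ge\rho h_P$ if $f\subset\partial P$ ($h$ denotes the diameter). Let $\mathcal K$ be a smooth, bounded, symmetric, uniformly positive definite tensor on $\Omega$, $f\in L^2(\Omega)$, and $k\ge 0$. $P_j(D)$ denotes the polynomials of degree $\le j$ on $D$ ($P_{-1}=\{0\}$), $\pi_{j,n}=\dim P_j(\mathbb R^n)$, $\Pi_j^0$ and $\boldsymbol\Pi_j^0$ are the elementwise $L^2$-projections onto $P_j(P)$ and $(P_j(P))^d$, $\mathcal G_k(P)=\nabla P_{k+1}(P)$, and $\mathcal G_k(P)^\perp$ is its $L^2(P)$-orthogonal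 complement in $(P_k(P))^d$. *Spaces.* $\mathbf V_h^k(P)$ is the space of $\mathbf v\in \mathbf H(\mathrm{div};P)\cap \mathbf H(\mathrm{curl};P)$ with $\mathbf v\cdot\mathbf n|_f\in P_k(f)$ for all faces $f\subset\partial P$, $\operatorname{div}\mathbf v\in P_k(P)$ and $\operatorname{curl}\mathbf v\in\operatorname{curl}(P_k(P))^d$ (for $d=2$: $\operatorname{rot}\mathbf v\in P_{k-1}(P)$); $\mathbf V_h^k=\{\mathbf v\in \mathbf H(\mathrm{div};\Omega):\mathbf v|_P\in \mathbf V_h^k(P)\ \forall P\}$. For $r=k+1$, $W_h^r(P)=\{q\in H^1(P):\partial_n q|_f\in P_{r-1}(f)\ \forall f\subset\partial P,\ \Delta q\in P_r(P)\}$. Fix any linear projection $\Pi_r^*:W_h^r(P)\to P_r(P)$ that depends only on the moments of $q$ against $P_{r-1}(f)$, $f\subset\partial P$, and against $P_{r-2}(P)$. Then $N_h^r(P)$ is the space of $q\in W_h^r(P)$ such that $q-\Pi_r^*q$ is $L^2(P)$-orthogonal to the monomials of degree exactly $r-1$ and exactly $r$ in $(x-x_P)/h_P$ ($x_P$ the center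 of mass of $P$), and $N_h^r$ is the space of $q\in L^2(\Omega)$ with $q|_P\in N_h^r(P)$ for all $P$, $\int_f[q]m\,d\sigma=0$ for all $f\in\mathcal E_h^o$, and $\int_f q\,m\,d\sigma=0$ for all $f\in\mathcal E_h^\partial$, for all $m\in P_{r-1}(f)$. *Schemes.* For any bilinear stabilizing forms $S^P$, let $$a_h^P(p,q)=(\mathcal K\boldsymbol\Pi_k^0\nabla p,\boldsymbol\Pi_k^0\nabla q)_P+S^P((I-\Pi_{k+1}^0)p,(I-\Pi_{k+1}^0)q),\qquad a_h=\sum_P a_h^P .$$ The mixed virtual volume method (MVVM) is: find $(\mathbf u_h,p_h)\in\mathbf V_h^k\times N_h^{k+1}$ such that for every $P\in\mathcal T_h$ $$\text{(a)}\ \int_P\mathbf u_h\cdot\nabla\chi\,dx+a_h^P(p_h,\chi)=0\quad\forall\chi\in N_h^{k+1}(P),$$ $$\text{(b)}\ \int_P(\mathbf u_h+\mathcal K\boldsymbol\Pi_k^0\nabla p_h)\cdot\mathbf v\,dx=0\quad\forall\mathbf v\in\mathcal G_k(P)^\perp\ (k\ge1),$$ $$\text{(c)}\ \int_P\operatorname{div}\mathbf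 u_h\,\phi\,dx=\int_P\Pi_k^0f\,\phi\,dx\quad\forall\phi\in P_k(P).$$ The nonconforming virtual element method (NCVEM) of order $k+1$ is: find $p_h\in N_h^{k+1}$ with $a_h(p_h,\chi)=(\Pi_k^0f,\chi)$ for all $\chi\in N_h^{k+1}$. **Theorem.** 1. *Euler's formula.* If $n_P$ is the number of faces of $P$, then $\sum_P n_P=2\#\mathcal E_h^o+\#\mathcal E_h^\partial$; in particular $n\,\#\mathcal T_h=2\#\mathcal E_h^o+\#\mathcal E_h^\partial$ if $n_P=n$ for all $P$. 2. *The scheme is square.* The spaces are finite-dimensional. The number of unknowns $\dim(\mathbf V_h^k\times N_h^{k+1})$ is $$\pi_{k,d-1}\#\mathcal E_h+(\pi_{k,d}-1+d\pi_{k,d}-\pi_{k+1,d}+1)\#\mathcal T_h+\pi_{k,d-1}\#\mathcal E_h^o+\pi_{k-1,d}\#\mathcal T_h,$$ the number of equations $\sum_P(\dim N_h^{k+1}(P)-1+\dim\mathcal G_k(P)^\perp+\dim P_k(P))$ is $$\sum_P\bigl(\pi_{k,d-1}n_P+\pi_{k-1,d}-1+d\pi_{k,d}-\pi_{k+1,d}+1+\pi_{k,d}\bigr),$$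 and these two numbers are equal. (The constants belong to $N_h^{k+1}(P)$ and give the trivial equation in (a), whence the $-1$.) 3. *Equivalence.* If $(\mathbf u_h,p_h)$ solves the MVVM, then $\operatorname{div}\mathbf u_h=\Pi_k^0f$ on every $P$, and $p_h$ solves the NCVEM of order $k+1$. Conversely, for every solution $p_h$ of the NCVEM there is exactly one $\mathbf u_h$ such that $(\mathbf u_h,p_h)$ solves the MVVM. 4. *Local recovery.* Let $(\mathbf u_h,p_h)$ solve the MVVM and let $P\in\mathcal T_h$. Then, with $\mathbf n$ the outward unit normal, $$\int_{\partial P}\mathbf u_h\cdot\mathbf n\,\chi\,d\sigma=(\Pi_k^0f,\chi)_P-a_h^P(p_h,\chi)\quad\forall\chi\in N_h^{k+1}(P).$$ For each face $f\subset\partial P$ and $m\in P_k(f)$ there is $\chi\in N_h^{k+1}(P)$, independent of the source and of the solution, with $\int_f\chi m'\,d\sigma=\int_f m m'\,d\sigma$ for all $m'\in P_k(f)$, vanishing moments against $P_k(e)$ on the other faces $e$ of $P$ and against $P_{k-1}(P)$, and with this $\chi$ one has $\int_f\mathbf u_h\cdot\mathbf n\,m\,d\sigma=(\Pi_k^0f,\chi)_P-a_h^P(p_h,\chi)$.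 Moreover $$\int_P\mathbf u_h\cdot\nabla q\,dx=\int_{\partial P}\mathbf u_h\cdot\mathbf n\,q\,d\sigma-\int_P\Pi_k^0f\,q\,dx\quad\forall q\in P_k(P),$$ and for all $\mathbf v\in\mathcal G_k(P)^\perp$ $$\int_P\mathbf u_h\cdot\mathbf v\,dx=-\int_P\mathcal K\boldsymbol\Pi_k^0\nabla p_h\cdot\mathbf v\,dx=-\int_P\nabla p_h\cdot\boldsymbol\Pi_k^0(\mathcal K\mathbf v)\,dx=-\int_{\partial P}p_h\,\boldsymbol\Pi_k^0(\mathcal K\mathbf v)\cdot\mathbf n\,d\sigma+\int_Pp_h\operatorname{div}\boldsymbol\Pi_k^0(\mathcal K\mathbf v)\,dx.$$ Furthermore $P_{k+1}(P)\subset N_h^{k+1}(P)$, and $\boldsymbol\Pi_k^0\mathbf u_h|_P$ is the only $\mathbf w\in(P_k(P))^d$ with $(\mathbf w,\nabla q)_P=-a_h^P(p_h,q)$ for all $q\in P_{k+1}(P)$ and $(\mathbf w,\mathbf v)_P=-(\mathcal K\boldsymbol\Pi_k^0\nabla p_h,\mathbf v)_P$ for all $\mathbf v\in\mathcal G_k(P)^\perp$.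 Finally, $\mathbf u_h|_P$ is a function of $f|_P$ and $p_h|_P$ alone. -/

import Mathlib

open MeasureTheory Filter Topology
open scoped ContDiff RealInnerProductSpace

noncomputable section

namespace MVVM

/-! ### Euclidean space, Lebesgue spaces -/

/-- Euclidean space `ℝⁿ`. -/
abbrev Sp (n : ℕ) := EuclideanSpace ℝ (Fin n)

/-- `L²(D)`. -/
abbrev L2 {n : ℕ} (D : Set (Sp n)) := Lp ℝ 2 (volume.restrict D)

/-- `(L²(D))ⁿ`, with the Euclidean norm on the values. -/
abbrev L2V {n : ℕ} (D : Set (Sp n)) := Lp (Sp n) 2 (volume.restrict D)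

/-- Restriction `L²(D) → L²(D')` for `D' ⊆ D`. -/
def res {n : ℕ} {F : Type*} [NormedAddCommGroup F] [NormedSpace ℝ F] {D D' : Set (Sp n)}
    (h : D' ⊆ D) :
    Lp F 2 (volume.restrict D) →ₗ[ℝ] Lp F 2 (volume.restrict D') where
  toFun v := ((Lp.memLp v).mono_measure (Measure.restrict_mono_set volume h)).toLp v
  map_add' v w := by
    have := ae_mono (Measure.restrict_mono_set volume h) (Lp.coeFn_add v w)
    rw [← MemLp.toLp_add]
    exact MemLp.toLp_congr _ _ this
  map_smul' c v := by
    have := ae_mono (Measure.restrict_mono_set volume h) (Lp.coeFn_smul c v)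
    rw [RingHom.id_apply, ← MemLp.toLp_const_smul]
    exact MemLp.toLp_congr _ _ this

/-! ### Polynomials -/

/-- `P_k(ℝⁿ)`: polynomials in `n` variables of total degree at most `k`; for `k = -1` it is `{0}`. -/
def polyDeg (n : ℕ) (k : ℤ) : Submodule ℝ (MvPolynomial (Fin n) ℝ) :=
  MvPolynomial.restrictSupport ℝ {a | (a.degree : ℤ) ≤ k}

/-- `π_{k,n} = dim P_k(ℝⁿ)`. -/
def polyDim (k : ℤ) (n : ℕ) : ℕ := Module.finrank ℝ (polyDeg n k)

instance polyDeg_finite (n : ℕ) (k : ℤ) : Module.Finite ℝ (polyDeg n k) := by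
  have h : polyDeg n k ≤ MvPolynomial.restrictTotalDegree (Fin n) ℝ k.toNat := by
    apply MvPolynomial.restrictSupport_mono
    intro a ha
    simp only [Set.mem_ofPred_eq] at ha ⊢
    change a.degree ≤ k.toNat
    omega
  exact Submodule.finiteDimensional_of_le h

/-- Value of a polynomial at a point. -/
def pval {n : ℕ} : MvPolynomial (Fin n) ℝ →ₗ[ℝ] (Sp n → ℝ) where
  toFun p x := MvPolynomial.eval (fun i => x i) p
  map_add' p q := by ext x; simp
  map_smul' c p := by ext x; simp [MvPolynomial.smul_eval]

/-- Value of a vector of polynomials at a point. -/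
def pvalV {n : ℕ} : (Fin n → MvPolynomial (Fin n) ℝ) →ₗ[ℝ] (Sp n → Sp n) where
  toFun p x := WithLp.toLp 2 fun i => pval (p i) x
  map_add' p q := by ext x i; simp
  map_smul' c p := by ext x i; simp

/-- Gradient of a polynomial, as a vector of polynomials. -/
def pgrad {n : ℕ} : MvPolynomial (Fin n) ℝ →ₗ[ℝ] (Fin n → MvPolynomial (Fin n) ℝ) where
  toFun p i := MvPolynomial.pderiv i p
  map_add' p q := by ext1 i; simp
  map_smul' c p := by ext1 i; simp

/-- Divergence of a vector of polynomials. -/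
def pdiv {n : ℕ} (w : Fin n → MvPolynomial (Fin n) ℝ) : MvPolynomial (Fin n) ℝ :=
  ∑ i, MvPolynomial.pderiv i (w i)

/-- The classes in `L²(D)` that have a representative of the form `ev a`. -/
def aeImage {n : ℕ} {F A : Type*} [NormedAddCommGroup F] [NormedSpace ℝ F] [AddCommGroup A]
    [Module ℝ A] (D : Set (Sp n)) (ev : A →ₗ[ℝ] (Sp n → F)) :
    Submodule ℝ (Lp F 2 (volume.restrict D)) where
  carrier := {q | ∃ a, q =ᵐ[volume.restrict D] ev a}
  zero_mem' := ⟨0, by rw [map_zero]; exact Lp.coeFn_zero _ _ _⟩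
  add_mem' := by
    rintro q q' ⟨a, ha⟩ ⟨b, hb⟩
    refine ⟨a + b, ?_⟩
    filter_upwards [Lp.coeFn_add q q', ha, hb] with x h1 h2 h3
    rw [h1, Pi.add_apply, h2, h3, map_add, Pi.add_apply]
  smul_mem' := by
    rintro c q ⟨a, ha⟩
    refine ⟨c • a, ?_⟩
    filter_upwards [Lp.coeFn_smul c q, ha] with x h1 h2
    rw [h1, Pi.smul_apply, h2, map_smul, Pi.smul_apply]

instance aeImage_finite {n : ℕ} {F A : Type*} [NormedAddCommGroup F] [NormedSpace ℝ F]
    [AddCommGroup A] [Module ℝ A] [Module.Finite ℝ A] (D : Set (Sp n))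
    (ev : A →ₗ[ℝ] (Sp n → F)) : FiniteDimensional ℝ (aeImage D ev) := by
  let G : Submodule ℝ (A × Lp F 2 (volume.restrict D)) :=
    { carrier := {z | z.2 =ᵐ[volume.restrict D] ev z.1}
      zero_mem' := by
        change ((0 : Lp F 2 (volume.restrict D)) : Sp n → F) =ᵐ[volume.restrict D] ev 0
        rw [map_zero]; exact Lp.coeFn_zero _ _ _
      add_mem' := by
        rintro ⟨a, q⟩ ⟨b, q'⟩ ha hb
        change ((q + q' : Lp F 2 (volume.restrict D)) : Sp n → F)
          =ᵐ[volume.restrict D] ev (a + b)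
        filter_upwards [Lp.coeFn_add q q', ha, hb] with x h1 h2 h3
        simp_all
      smul_mem' := by
        rintro c ⟨a, q⟩ ha
        change ((c • q : Lp F 2 (volume.restrict D)) : Sp n → F)
          =ᵐ[volume.restrict D] ev (c • a)
        filter_upwards [Lp.coeFn_smul c q, ha] with x h1 h2
        simp_all }
  have hinj : Function.Injective ((LinearMap.fst ℝ A (Lp F 2 (volume.restrict D))) ∘ₗ G.subtype) := by
    rw [← LinearMap.ker_eq_bot, LinearMap.ker_eq_bot']
    rintro ⟨⟨a, q⟩, hz⟩ h0
    have ha : a = 0 := h0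
    subst ha
    have hz' : q =ᵐ[volume.restrict D] ev 0 := hz
    have hq : q = 0 := by
      apply Lp.ext
      rw [map_zero] at hz'
      exact hz'.trans (Lp.coeFn_zero _ _ _).symm
    subst hq
    rfl
  have hG : FiniteDimensional ℝ G := Module.Finite.of_injective _ hinj
  have : aeImage D ev = G.map (LinearMap.snd ℝ A _) := by
    ext q
    constructor
    · rintro ⟨a, ha⟩; exact ⟨(a, q), ha, rfl⟩
    · rintro ⟨⟨a, q'⟩, ha, rfl⟩; exact ⟨a, ha⟩
  rw [this]
  infer_instance

/-- `P_k(D)`, as a subspace of `L²(D)`. -/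
def polyL2 {n : ℕ} (D : Set (Sp n)) (k : ℤ) : Submodule ℝ (L2 D) :=
  aeImage D (pval ∘ₗ (polyDeg n k).subtype)

/-- `(P_k(D))ⁿ`, as a subspace of `(L²(D))ⁿ`. -/
def polyL2V {n : ℕ} (D : Set (Sp n)) (k : ℤ) : Submodule ℝ (L2V D) :=
  aeImage D (pvalV ∘ₗ (LinearMap.pi fun i => (polyDeg n k).subtype ∘ₗ LinearMap.proj i :
    (Fin n → polyDeg n k) →ₗ[ℝ] (Fin n → MvPolynomial (Fin n) ℝ)))

instance {n : ℕ} (D : Set (Sp n)) (k : ℤ) : FiniteDimensional ℝ (polyL2 D k) :=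
  aeImage_finite D _

instance {n : ℕ} (D : Set (Sp n)) (k : ℤ) : FiniteDimensional ℝ (polyL2V D k) :=
  aeImage_finite D _

/-- `𝒢_k(D) = ∇ P_{k+1}(D)`. -/
def gradPoly {n : ℕ} (D : Set (Sp n)) (k : ℤ) : Submodule ℝ (L2V D) :=
  aeImage D (pvalV ∘ₗ pgrad ∘ₗ (polyDeg n (k + 1)).subtype)

/-- `𝒢_k(D)^⊥`: the `L²`-orthogonal complement of `𝒢_k(D)` in `(P_k(D))ⁿ`. -/
def gradPolyPerp {n : ℕ} (D : Set (Sp n)) (k : ℤ) : Submodule ℝ (L2V D) :=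
  polyL2V D k ⊓ (gradPoly D k)ᗮ

/-- The `L²`-projection `Π_k^0 : L²(D) → P_k(D)`. -/
def proj {n : ℕ} (D : Set (Sp n)) (k : ℤ) (q : L2 D) : L2 D := (polyL2 D k).starProjection q

/-- The `L²`-projection `𝚷_k^0 : (L²(D))ⁿ → (P_k(D))ⁿ`. -/
def projV {n : ℕ} (D : Set (Sp n)) (k : ℤ) (v : L2V D) : L2V D := (polyL2V D k).starProjection v

/-! ### Weak derivatives -/

/-- Test functions `C_c^∞(D)` (extended by zero); `D = univ` gives `C_c^∞(ℝⁿ)`. -/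
def IsTest {n : ℕ} (D : Set (Sp n)) (φ : Sp n → ℝ) : Prop :=
  ContDiff ℝ ∞ φ ∧ HasCompactSupport φ ∧ tsupport φ ⊆ D

/-- `g` is the weak gradient of `q` on `D`. -/
def IsWeakGrad {n : ℕ} (D : Set (Sp n)) (q : L2 D) (g : L2V D) : Prop :=
  ∀ φ, IsTest D φ → ∫ x in D, q x • gradient φ x = - ∫ x in D, φ x • g x

/-- `s` is the weak divergence of `v` on `D`. -/
def IsWeakDiv {n : ℕ} (D : Set (Sp n)) (v : L2V D) (s : L2 D) : Prop :=
  ∀ φ, IsTest D φ → ∫ x in D, ⟪v x, gradient φ x⟫ = - ∫ x in D, φ x * s x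

/-- The curl of `v` in the weak sense is `c`, the curl being read as the antisymmetric matrix
`(∂ᵢvⱼ - ∂ⱼvᵢ)ᵢⱼ`; its entries are up to sign `rot v` if `n = 2` and the components of
`curl v` if `n = 3`. -/
def IsWeakCurl {n : ℕ} (D : Set (Sp n)) (v : L2V D) (c : Fin n → Fin n → Sp n → ℝ) : Prop :=
  ∀ i j, ∀ φ, IsTest D φ →
    ∫ x in D, (v x j * gradient φ x i - v x i * gradient φ x j) = - ∫ x in D, φ x * c i j x

/-- Curl of a vector of polynomials, as an antisymmetric matrix. -/
def pcurl {n : ℕ} (w : Fin n → MvPolynomial (Fin n) ℝ) (i j : Fin n) : Sp n → ℝ :=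
  pval (MvPolynomial.pderiv i (w j) - MvPolynomial.pderiv j (w i))

open Classical in
/-- `∇q` for `q ∈ H¹(D)`. -/
def wgrad {n : ℕ} (D : Set (Sp n)) (q : L2 D) : L2V D :=
  if h : ∃ g, IsWeakGrad D q g then h.choose else 0

open Classical in
/-- `div v` for `v ∈ H(div; D)`. -/
def wdiv {n : ℕ} (D : Set (Sp n)) (v : L2V D) : L2 D :=
  if h : ∃ s, IsWeakDiv D v s then h.choose else 0

section linearity

variable {n : ℕ} {D : Set (Sp n)}

lemma cont_gradient {φ : Sp n → ℝ} (h : ContDiff ℝ ∞ φ) : Continuous (gradient φ) := by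
  have := h.continuous_fderiv (by simp)
  exact (InnerProductSpace.toDual ℝ (Sp n)).symm.continuous.comp this

lemma gradient_add' {φ ψ : Sp n → ℝ} (h : ContDiff ℝ ∞ φ) (h' : ContDiff ℝ ∞ ψ) (x : Sp n) :
    gradient (fun x => φ x + ψ x) x = gradient φ x + gradient ψ x := by
  unfold gradient
  rw [fderiv_fun_add (h.differentiable (by simp) x) (h'.differentiable (by simp) x), map_add]

lemma gradient_smul' {φ : Sp n → ℝ} (h : ContDiff ℝ ∞ φ) (c : ℝ) (x : Sp n) :
    gradient (fun x => c * φ x) x = c • gradient φ x := by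
  unfold gradient
  rw [fderiv_const_mul (h.differentiable (by simp) x), map_smul]

lemma supp_gradient {φ : Sp n → ℝ} (h : HasCompactSupport φ) : HasCompactSupport (gradient φ) := by
  have := h.fderiv (𝕜 := ℝ)
  exact this.comp_left (g := (InnerProductSpace.toDual ℝ (Sp n)).symm) (map_zero _)

lemma memLp_test {F : Type*} [NormedAddCommGroup F] {ψ : Sp n → F} (h : Continuous ψ)
    (h' : HasCompactSupport ψ) : MemLp ψ 2 (volume.restrict D) :=
  (h.memLp_of_hasCompactSupport h').restrict D

lemma integrable_inner' {v ψ : Sp n → Sp n} (hv : MemLp v 2 (volume.restrict D))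
    (hψ : MemLp ψ 2 (volume.restrict D)) :
    Integrable (fun x => ⟪v x, ψ x⟫) (volume.restrict D) := by
  refine (L2.integrable_inner (𝕜 := ℝ) hv.toLp hψ.toLp).congr ?_
  filter_upwards [hv.coeFn_toLp, hψ.coeFn_toLp] with x h1 h2
  rw [h1, h2]

lemma integrable_mul' {v ψ : Sp n → ℝ} (hv : MemLp v 2 (volume.restrict D))
    (hψ : MemLp ψ 2 (volume.restrict D)) :
    Integrable (fun x => v x * ψ x) (volume.restrict D) := hv.integrable_mul hψ

lemma integrable_smul' {v : Sp n → ℝ} {ψ : Sp n → Sp n} (hv : MemLp v 2 (volume.restrict D))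
    (hψ : MemLp ψ 2 (volume.restrict D)) :
    Integrable (fun x => v x • ψ x) (volume.restrict D) := by
  exact memLp_one_iff_integrable.1 (hψ.smul (r := 1) hv)

lemma memLp_coord {v : Sp n → Sp n} (hv : MemLp v 2 (volume.restrict D)) (i : Fin n) :
    MemLp (fun x => v x i) 2 (volume.restrict D) :=
  (EuclideanSpace.proj (𝕜 := ℝ) i).comp_memLp' hv

lemma IsWeakGrad.add {q q' : L2 D} {g g' : L2V D} (h : IsWeakGrad D q g) (h' : IsWeakGrad D q' g') :
    IsWeakGrad D (q + q') (g + g') := by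
  intro φ hφ
  have e1 : ∫ x in D, (q + q' : L2 D) x • gradient φ x
      = ∫ x in D, (q x • gradient φ x + q' x • gradient φ x) := by
    apply integral_congr_ae
    filter_upwards [Lp.coeFn_add q q'] with x hx
    rw [hx, Pi.add_apply, add_smul]
  have e2 : ∫ x in D, φ x • (g + g' : L2V D) x = ∫ x in D, (φ x • g x + φ x • g' x) := by
    apply integral_congr_ae
    filter_upwards [Lp.coeFn_add g g'] with x hx
    rw [hx, Pi.add_apply, smul_add]
  have m1 := memLp_test (D := D) (cont_gradient hφ.1) (supp_gradient hφ.2.1)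
  have m2 := memLp_test (D := D) hφ.1.continuous hφ.2.1
  rw [e1, e2, integral_add (integrable_smul' (Lp.memLp q) m1) (integrable_smul' (Lp.memLp q') m1),
    integral_add (integrable_smul' m2 (Lp.memLp g)) (integrable_smul' m2 (Lp.memLp g')),
    h φ hφ, h' φ hφ]
  abel

lemma IsWeakGrad.smul {q : L2 D} {g : L2V D} (c : ℝ) (h : IsWeakGrad D q g) :
    IsWeakGrad D (c • q) (c • g) := by
  intro φ hφ
  have e1 : ∫ x in D, (c • q : L2 D) x • gradient φ x = ∫ x in D, c • (q x • gradient φ x) := by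
    apply integral_congr_ae
    filter_upwards [Lp.coeFn_smul c q] with x hx
    rw [hx, Pi.smul_apply, smul_assoc]
  have e2 : ∫ x in D, φ x • (c • g : L2V D) x = ∫ x in D, c • (φ x • g x) := by
    apply integral_congr_ae
    filter_upwards [Lp.coeFn_smul c g] with x hx
    rw [hx, Pi.smul_apply, smul_comm]
  rw [e1, e2, integral_smul, integral_smul, h φ hφ, smul_neg]

lemma IsWeakGrad.zero : IsWeakGrad D 0 0 := by
  intro φ _
  have e1 : ∫ x in D, (0 : L2 D) x • gradient φ x = ∫ x in D, (0 : Sp n) := by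
    apply integral_congr_ae
    filter_upwards [Lp.coeFn_zero ℝ 2 (volume.restrict D)] with x hx
    rw [hx]; simp
  have e2 : ∫ x in D, φ x • (0 : L2V D) x = ∫ x in D, (0 : Sp n) := by
    apply integral_congr_ae
    filter_upwards [Lp.coeFn_zero (Sp n) 2 (volume.restrict D)] with x hx
    rw [hx]; simp
  rw [e1, e2]; simp

lemma IsWeakDiv.add {v v' : L2V D} {s s' : L2 D} (h : IsWeakDiv D v s) (h' : IsWeakDiv D v' s') :
    IsWeakDiv D (v + v') (s + s') := by
  intro φ hφ
  have e1 : ∫ x in D, ⟪(v + v' : L2V D) x, gradient φ x⟫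
      = ∫ x in D, (⟪v x, gradient φ x⟫ + ⟪v' x, gradient φ x⟫) := by
    apply integral_congr_ae
    filter_upwards [Lp.coeFn_add v v'] with x hx
    rw [hx, Pi.add_apply, inner_add_left]
  have e2 : ∫ x in D, φ x * (s + s' : L2 D) x = ∫ x in D, (φ x * s x + φ x * s' x) := by
    apply integral_congr_ae
    filter_upwards [Lp.coeFn_add s s'] with x hx
    rw [hx, Pi.add_apply, mul_add]
  have m1 := memLp_test (D := D) (cont_gradient hφ.1) (supp_gradient hφ.2.1)
  have m2 := memLp_test (D := D) hφ.1.continuous hφ.2.1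
  rw [e1, e2, integral_add (integrable_inner' (Lp.memLp v) m1) (integrable_inner' (Lp.memLp v') m1),
    integral_add (integrable_mul' m2 (Lp.memLp s)) (integrable_mul' m2 (Lp.memLp s')),
    h φ hφ, h' φ hφ]
  ring

lemma IsWeakDiv.smul {v : L2V D} {s : L2 D} (c : ℝ) (h : IsWeakDiv D v s) :
    IsWeakDiv D (c • v) (c • s) := by
  intro φ hφ
  have e1 : ∫ x in D, ⟪(c • v : L2V D) x, gradient φ x⟫ = ∫ x in D, c * ⟪v x, gradient φ x⟫ := by
    apply integral_congr_ae
    filter_upwards [Lp.coeFn_smul c v] with x hx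
    rw [hx, Pi.smul_apply, real_inner_smul_left]
  have e2 : ∫ x in D, φ x * (c • s : L2 D) x = ∫ x in D, c * (φ x * s x) := by
    apply integral_congr_ae
    filter_upwards [Lp.coeFn_smul c s] with x hx
    rw [hx, Pi.smul_apply, smul_eq_mul]; ring
  rw [e1, e2, integral_const_mul, integral_const_mul, h φ hφ, mul_neg]

lemma IsWeakDiv.zero : IsWeakDiv D 0 0 := by
  intro φ _
  have e1 : ∫ x in D, ⟪(0 : L2V D) x, gradient φ x⟫ = ∫ x in D, (0 : ℝ) := by
    apply integral_congr_ae
    filter_upwards [Lp.coeFn_zero (Sp n) 2 (volume.restrict D)] with x hx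
    rw [hx]; simp
  have e2 : ∫ x in D, φ x * (0 : L2 D) x = ∫ x in D, (0 : ℝ) := by
    apply integral_congr_ae
    filter_upwards [Lp.coeFn_zero ℝ 2 (volume.restrict D)] with x hx
    rw [hx]; simp
  rw [e1, e2]; simp

lemma continuous_pval (p : MvPolynomial (Fin n) ℝ) : Continuous (pval p : Sp n → ℝ) := by
  change Continuous fun x : Sp n => MvPolynomial.eval (fun i => x i) p
  have : Continuous fun x : Sp n => (fun i => x i : Fin n → ℝ) := by fun_prop
  exact (MvPolynomial.continuous_eval p).comp this

lemma integrable_test_pval {φ : Sp n → ℝ} (h : Continuous φ) (h' : HasCompactSupport φ)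
    (p : MvPolynomial (Fin n) ℝ) : Integrable (fun x => φ x * pval p x) (volume.restrict D) :=
  ((h.mul (continuous_pval p)).integrable_of_hasCompactSupport h'.mul_right).restrict

lemma pcurl_add (w w' : Fin n → MvPolynomial (Fin n) ℝ) (i j : Fin n) (x : Sp n) :
    pcurl (w + w') i j x = pcurl w i j x + pcurl w' i j x := by
  simp [pcurl]; ring

lemma pcurl_smul (c : ℝ) (w : Fin n → MvPolynomial (Fin n) ℝ) (i j : Fin n) (x : Sp n) :
    pcurl (c • w) i j x = c * pcurl w i j x := by
  simp [pcurl]; ring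

lemma IsWeakCurl.add {v v' : L2V D} {w w' : Fin n → MvPolynomial (Fin n) ℝ}
    (h : IsWeakCurl D v (pcurl w)) (h' : IsWeakCurl D v' (pcurl w')) :
    IsWeakCurl D (v + v') (pcurl (w + w')) := by
  intro i j φ hφ
  have e1 : ∫ x in D, ((v + v' : L2V D) x j * gradient φ x i - (v + v' : L2V D) x i * gradient φ x j)
      = ∫ x in D, ((v x j * gradient φ x i - v x i * gradient φ x j)
        + (v' x j * gradient φ x i - v' x i * gradient φ x j)) := by
    apply integral_congr_ae
    filter_upwards [Lp.coeFn_add v v'] with x hx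
    rw [hx]; simp; ring
  have e2 : ∫ x in D, φ x * pcurl (w + w') i j x
      = ∫ x in D, (φ x * pcurl w i j x + φ x * pcurl w' i j x) := by
    congr 1; ext x; rw [pcurl_add]; ring
  have m1 := memLp_test (D := D) (cont_gradient hφ.1) (supp_gradient hφ.2.1)
  have I : ∀ z : L2V D, Integrable (fun x => z x j * gradient φ x i - z x i * gradient φ x j)
      (volume.restrict D) := fun z =>
    (integrable_mul' (memLp_coord (Lp.memLp z) j) (memLp_coord m1 i)).sub
      (integrable_mul' (memLp_coord (Lp.memLp z) i) (memLp_coord m1 j))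
  have J : ∀ z, Integrable (fun x => φ x * pcurl z i j x) (volume.restrict D) := fun z =>
    integrable_test_pval hφ.1.continuous hφ.2.1 _
  rw [e1, e2, integral_add (I v) (I v'), integral_add (J w) (J w'), h i j φ hφ, h' i j φ hφ]
  ring

lemma IsWeakCurl.smul {v : L2V D} {w : Fin n → MvPolynomial (Fin n) ℝ} (c : ℝ)
    (h : IsWeakCurl D v (pcurl w)) : IsWeakCurl D (c • v) (pcurl (c • w)) := by
  intro i j φ hφ
  have e1 : ∫ x in D, ((c • v : L2V D) x j * gradient φ x i - (c • v : L2V D) x i * gradient φ x j)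
      = ∫ x in D, c * (v x j * gradient φ x i - v x i * gradient φ x j) := by
    apply integral_congr_ae
    filter_upwards [Lp.coeFn_smul c v] with x hx
    rw [hx]; simp; ring
  have e2 : ∫ x in D, φ x * pcurl (c • w) i j x = ∫ x in D, c * (φ x * pcurl w i j x) := by
    congr 1; ext x; rw [pcurl_smul]; ring
  rw [e1, e2, integral_const_mul, integral_const_mul, h i j φ hφ, mul_neg]

lemma IsWeakCurl.zero : IsWeakCurl D 0 (pcurl 0) := by
  intro i j φ _
  have e1 : ∫ x in D, ((0 : L2V D) x j * gradient φ x i - (0 : L2V D) x i * gradient φ x j)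
      = ∫ x in D, (0 : ℝ) := by
    apply integral_congr_ae
    filter_upwards [Lp.coeFn_zero (Sp n) 2 (volume.restrict D)] with x hx
    rw [hx]; simp
  rw [e1]; simp [pcurl]

lemma memLp_of_bounded (hb : Bornology.IsBounded D) (hD : MeasurableSet D) {h : Sp n → ℝ}
    (hc : Continuous h) : MemLp h 2 (volume.restrict D) := by
  have : IsFiniteMeasure (volume.restrict D) :=
    ⟨by rw [Measure.restrict_apply_univ]; exact hb.measure_lt_top⟩
  obtain ⟨C, hC⟩ := hb.isCompact_closure.exists_bound_of_continuousOn hc.continuousOn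
  refine MemLp.of_bound hc.aestronglyMeasurable C ?_
  filter_upwards [ae_restrict_mem hD] with x hx
  exact hC x (subset_closure hx)

end linearity

/-! ### Polygonal and polyhedral meshes -/

/-- A flat `m`-dimensional polytope in `ℝ^{m+1}` (an open segment if `m = 1`, an open plane polygon
if `m = 2`), given in orthonormal coordinates of its hyperplane. Its relative boundary lies in
finitely many proper affine subspaces of the hyperplane. -/
structure PolyFace (m : ℕ) where
  chart : Sp m →ᵃⁱ[ℝ] Sp (m + 1)
  dom : Set (Sp m)
  isOpen_dom : IsOpen dom
  nonempty_dom : dom.Nonempty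
  bounded_dom : Bornology.IsBounded dom
  flat_frontier : ∃ s : Finset (AffineSubspace ℝ (Sp m)),
    (∀ A ∈ s, A ≠ ⊤) ∧ frontier dom ⊆ ⋃ A ∈ s, (A : Set (Sp m))

/-- The face as a subset of `ℝ^{m+1}`. -/
def PolyFace.carrier {m : ℕ} (f : PolyFace m) : Set (Sp (m + 1)) := f.chart '' f.dom

/-- A decomposition of a bounded polygonal or polyhedral domain of `ℝ^{m+1}` into open elements
(indexed by `T`) with flat faces (indexed by `E`). Distinct faces meet at most in their relative
boundaries; a hanging node or edge is allowed and splits the face in which it lies. The condition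
`domain_regular` says that the domain lies on one side of its boundary (it has no cracks). -/
structure PolyMesh (m : ℕ) (T E : Type*) where
  domain : Set (Sp (m + 1))
  isOpen_domain : IsOpen domain
  isConnected_domain : IsConnected domain
  bounded_domain : Bornology.IsBounded domain
  domain_regular : interior (closure domain) = domain
  cell : T → Set (Sp (m + 1))
  isOpen_cell : ∀ P, IsOpen (cell P)
  nonempty_cell : ∀ P, (cell P).Nonempty
  cell_subset : ∀ P, cell P ⊆ domain
  disjoint_cell : ∀ P Q, P ≠ Q → Disjoint (cell P) (cell Q)
  cover : closure domain = ⋃ P, closure (cell P)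
  face : E → PolyFace m
  disjoint_face : ∀ e f, e ≠ f → Disjoint (face e).carrier (closure (face f).carrier)
  face_used : ∀ f, ∃ P, (face f).carrier ⊆ frontier (cell P)
  frontier_cell : ∀ P, frontier (cell P) =
    ⋃ f ∈ {f | (face f).carrier ⊆ frontier (cell P)}, closure (face f).carrier

/-- `s` is star-shaped with respect to all points of some ball of radius `r`. -/
def StarBall {n : ℕ} (s : Set (Sp n)) (r : ℝ) : Prop :=
  ∃ c, ∀ y ∈ Metric.ball c r, StarConvex ℝ y s

namespace PolyMesh

variable {m : ℕ} {T E : Type*} (M : PolyMesh m T E)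

/-- Shape regularity with constant `ρ`. (If `m = 1` the condition on the faces says that they are
segments.) -/
structure Regular (ρ : ℝ) : Prop where
  face_size : ∀ P f, (M.face f).carrier ⊆ frontier (M.cell P) →
    ρ * Metric.diam (M.cell P) ≤ Metric.diam (M.face f).carrier
  cell_star : ∀ P, StarBall (M.cell P) (ρ * Metric.diam (M.cell P))
  face_star : ∀ f, StarBall (M.face f).dom (ρ * Metric.diam (M.face f).carrier)

lemma bounded_cell (P : T) : Bornology.IsBounded (M.cell P) :=
  M.bounded_domain.subset (M.cell_subset P)

/-- Restriction to an element of a function on the domain. -/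
abbrev rest {F : Type*} [NormedAddCommGroup F] [NormedSpace ℝ F] (P : T)
    (v : Lp F 2 (volume.restrict M.domain)) : Lp F 2 (volume.restrict (M.cell P)) :=
  res (M.cell_subset P) v

/-- `L²(f)` for a face `f`, in the coordinates of the face; integrals over `f` with respect to the
surface measure are integrals over `(M.face f).dom` in these coordinates. -/
abbrev L2F (f : E) := L2 (M.face f).dom

/-! ### Traces -/

/-- `ν` is the outward unit normal of the element `P` on its face `f`. -/
def IsOuterNormal (P : T) (f : E) (ν : Sp (m + 1)) : Prop :=
  ‖ν‖ = 1 ∧ (∀ w : Sp m, ⟪ν, (M.face f).chart.linear w⟫ = 0) ∧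
    ∀ y ∈ (M.face f).dom, ∀ᶠ t in 𝓝[>] (0 : ℝ),
      (M.face f).chart y - t • ν ∈ M.cell P ∧ (M.face f).chart y + t • ν ∉ M.cell P

open Classical in
/-- The outward unit normal of the element `P` on its face `f`. -/
def outerNormal (P : T) (f : E) : Sp (m + 1) :=
  if h : ∃ ν, M.IsOuterNormal P f ν then h.choose else 0

/-- `t ∈ L²(f)` is the trace of `q ∈ H¹(P)` on the face `f`: for some sequence of smooth functions
`φⱼ → q` in `H¹(P)`, the restrictions of `φⱼ` to `f` converge to `t` in `L²(f)`. -/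
def IsTrace (P : T) (f : E) (q : L2 (M.cell P)) (t : M.L2F f) : Prop :=
  ∃ (g : L2V (M.cell P)) (φ : ℕ → Sp (m + 1) → ℝ), IsWeakGrad (M.cell P) q g ∧
    (∀ j, IsTest Set.univ (φ j)) ∧
    Tendsto (fun j => eLpNorm (fun x => φ j x - q x) 2 (volume.restrict (M.cell P))) atTop (𝓝 0) ∧
    Tendsto (fun j => eLpNorm (fun x => gradient (φ j) x - g x) 2 (volume.restrict (M.cell P)))
      atTop (𝓝 0) ∧
    Tendsto (fun j => eLpNorm (fun y => φ j ((M.face f).chart y) - t y) 2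
      (volume.restrict (M.face f).dom)) atTop (𝓝 0)

/-- The moment `∫_f t μ dσ` on a face. -/
def faceMoment (f : E) (t : M.L2F f) (μ : MvPolynomial (Fin m) ℝ) : ℝ :=
  ∫ y in (M.face f).dom, t y * pval μ y

lemma integrable_mul_pval (f : E) (t : M.L2F f) (μ : MvPolynomial (Fin m) ℝ) :
    Integrable (fun y => t y * pval μ y) (volume.restrict (M.face f).dom) :=
  integrable_mul' (Lp.memLp t) (memLp_of_bounded (M.face f).bounded_dom
    (M.face f).isOpen_dom.measurableSet (continuous_pval μ))

lemma faceMoment_add (f : E) (t t' : M.L2F f) (μ : MvPolynomial (Fin m) ℝ) :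
    M.faceMoment f (t + t') μ = M.faceMoment f t μ + M.faceMoment f t' μ := by
  unfold faceMoment
  rw [← integral_add (M.integrable_mul_pval f t μ) (M.integrable_mul_pval f t' μ)]
  apply integral_congr_ae
  filter_upwards [Lp.coeFn_add t t'] with x hx
  rw [hx, Pi.add_apply, add_mul]

lemma faceMoment_smul (f : E) (c : ℝ) (t : M.L2F f) (μ : MvPolynomial (Fin m) ℝ) :
    M.faceMoment f (c • t) μ = c * M.faceMoment f t μ := by
  unfold faceMoment
  rw [← integral_const_mul]
  apply integral_congr_ae
  filter_upwards [Lp.coeFn_smul c t] with x hx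
  rw [hx, Pi.smul_apply, smul_eq_mul, mul_assoc]

lemma faceMoment_zero (f : E) (μ : MvPolynomial (Fin m) ℝ) : M.faceMoment f 0 μ = 0 := by
  simpa using M.faceMoment_smul f 0 0 μ

section linearity

variable {M}

lemma integrable_face {f : E} {φ : Sp (m + 1) → ℝ} (hφ : IsTest Set.univ φ)
    (p : MvPolynomial (Fin m) ℝ) :
    Integrable (fun y => pval p y * φ ((M.face f).chart y))
      (volume.restrict (M.face f).dom) := by
  have h1 : HasCompactSupport (φ ∘ (M.face f).chart) :=
    hφ.2.1.comp_isClosedEmbedding (M.face f).chart.isometry.isClosedEmbedding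
  have h2 : Continuous (φ ∘ (M.face f).chart) :=
    hφ.1.continuous.comp (M.face f).chart.isometry.continuous
  exact (((continuous_pval p).mul h2).integrable_of_hasCompactSupport h1.mul_left).restrict

lemma tendsto_add_aux {n : ℕ} {F : Type*} [NormedAddCommGroup F] {D : Set (Sp n)}
    {a b : ℕ → Sp n → F} {u v w : Sp n → F}
    (ha : ∀ j, Continuous (a j)) (hb : ∀ j, Continuous (b j))
    (hu : AEStronglyMeasurable u (volume.restrict D))
    (hv : AEStronglyMeasurable v (volume.restrict D)) (hw : w =ᵐ[volume.restrict D] u + v)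
    (h1 : Tendsto (fun j => eLpNorm (fun x => a j x - u x) 2 (volume.restrict D)) atTop (𝓝 0))
    (h2 : Tendsto (fun j => eLpNorm (fun x => b j x - v x) 2 (volume.restrict D)) atTop (𝓝 0)) :
    Tendsto (fun j => eLpNorm (fun x => (a j x + b j x) - w x) 2 (volume.restrict D))
      atTop (𝓝 0) := by
  have h3 := h1.add h2
  rw [add_zero] at h3
  refine tendsto_of_tendsto_of_tendsto_of_le_of_le tendsto_const_nhds h3 (fun _ => bot_le) ?_
  intro j
  have e : eLpNorm (fun x => (a j x + b j x) - w x) 2 (volume.restrict D)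
      = eLpNorm ((fun x => a j x - u x) + (fun x => b j x - v x)) 2 (volume.restrict D) := by
    apply eLpNorm_congr_ae
    filter_upwards [hw] with x hx
    simp only [hx, Pi.add_apply]; abel
  change eLpNorm (fun x => (a j x + b j x) - w x) 2 (volume.restrict D) ≤ _
  rw [e]
  exact eLpNorm_add_le ((ha j).aestronglyMeasurable.sub hu) ((hb j).aestronglyMeasurable.sub hv)
    (by norm_num)

lemma tendsto_smul_aux {n : ℕ} {F : Type*} [NormedAddCommGroup F] [NormedSpace ℝ F]
    {D : Set (Sp n)} {a : ℕ → Sp n → F} {u w : Sp n → F} (c : ℝ)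
    (hw : w =ᵐ[volume.restrict D] c • u)
    (h1 : Tendsto (fun j => eLpNorm (fun x => a j x - u x) 2 (volume.restrict D)) atTop (𝓝 0)) :
    Tendsto (fun j => eLpNorm (fun x => c • a j x - w x) 2 (volume.restrict D))
      atTop (𝓝 0) := by
  have e : ∀ j, eLpNorm (fun x => c • a j x - w x) 2 (volume.restrict D)
      = ‖c‖ₑ * eLpNorm (fun x => a j x - u x) 2 (volume.restrict D) := by
    intro j
    rw [← eLpNorm_const_smul]
    apply eLpNorm_congr_ae
    filter_upwards [hw] with x hx
    simp only [hx, Pi.smul_apply, smul_sub]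
  simp_rw [e]
  have := ENNReal.Tendsto.const_mul (a := ‖c‖ₑ) h1 (Or.inr (by simp))
  simpa using this

lemma IsTest.add {n : ℕ} {φ ψ : Sp n → ℝ} (h : IsTest Set.univ φ) (h' : IsTest Set.univ ψ) :
    IsTest Set.univ (fun x => φ x + ψ x) :=
  ⟨h.1.add h'.1, h.2.1.add h'.2.1, Set.subset_univ _⟩

lemma IsTest.smul {n : ℕ} {φ : Sp n → ℝ} (c : ℝ) (h : IsTest Set.univ φ) :
    IsTest Set.univ (fun x => c * φ x) :=
  ⟨contDiff_const.mul h.1, h.2.1.mul_left, Set.subset_univ _⟩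

lemma IsTrace.add {P : T} {f : E} {q q' : L2 (M.cell P)} {t t' : M.L2F f}
    (h : M.IsTrace P f q t) (h' : M.IsTrace P f q' t') : M.IsTrace P f (q + q') (t + t') := by
  obtain ⟨g, φ, hg, hφ, h1, h2, h3⟩ := h
  obtain ⟨g', ψ, hg', hψ, h1', h2', h3'⟩ := h'
  refine ⟨g + g', fun j x => φ j x + ψ j x, hg.add hg', fun j => IsTest.add (hφ j) (hψ j),
    ?_, ?_, ?_⟩
  · exact tendsto_add_aux (fun j => (hφ j).1.continuous) (fun j => (hψ j).1.continuous)
      (Lp.aestronglyMeasurable q) (Lp.aestronglyMeasurable q') (Lp.coeFn_add q q') h1 h1'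
  · simp_rw [fun j x => gradient_add' (hφ j).1 (hψ j).1 x]
    exact tendsto_add_aux (fun j => cont_gradient (hφ j).1) (fun j => cont_gradient (hψ j).1)
      (Lp.aestronglyMeasurable g) (Lp.aestronglyMeasurable g') (Lp.coeFn_add g g') h2 h2'
  · exact tendsto_add_aux
      (fun j => (hφ j).1.continuous.comp (M.face f).chart.isometry.continuous)
      (fun j => (hψ j).1.continuous.comp (M.face f).chart.isometry.continuous)
      (Lp.aestronglyMeasurable t) (Lp.aestronglyMeasurable t') (Lp.coeFn_add t t') h3 h3'

lemma IsTrace.smul {P : T} {f : E} {q : L2 (M.cell P)} {t : M.L2F f} (c : ℝ)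
    (h : M.IsTrace P f q t) : M.IsTrace P f (c • q) (c • t) := by
  obtain ⟨g, φ, hg, hφ, h1, h2, h3⟩ := h
  refine ⟨c • g, fun j x => c * φ j x, hg.smul c, fun j => IsTest.smul c (hφ j), ?_, ?_, ?_⟩
  · exact tendsto_smul_aux c (Lp.coeFn_smul c q) h1
  · simp_rw [fun j x => gradient_smul' (hφ j).1 c x]
    exact tendsto_smul_aux c (Lp.coeFn_smul c g) h2
  · exact tendsto_smul_aux c (Lp.coeFn_smul c t) h3

lemma IsTrace.zero {P : T} {f : E} : M.IsTrace P f 0 0 := by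
  have hz : IsTest Set.univ (fun _ : Sp (m + 1) => (0 : ℝ)) :=
    ⟨contDiff_const, HasCompactSupport.zero, Set.subset_univ _⟩
  have aux : ∀ {n : ℕ} {F : Type} [NormedAddCommGroup F] (D : Set (Sp n)),
      Tendsto (fun _ : ℕ => eLpNorm (fun x => (0 : F) - (0 : Lp F 2 (volume.restrict D)) x) 2
        (volume.restrict D)) atTop (𝓝 0) := by
    intro n F _ D
    have : eLpNorm (fun x => (0 : F) - (0 : Lp F 2 (volume.restrict D)) x) 2
        (volume.restrict D) = 0 := by
      have e := Lp.coeFn_zero F 2 (volume.restrict D)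
      rw [eLpNorm_congr_ae (g := fun _ => (0 : F)) (by
        filter_upwards [e] with x hx
        rw [hx]; simp)]
      exact eLpNorm_zero
    rw [this]; exact tendsto_const_nhds
  refine ⟨0, fun _ _ => 0, IsWeakGrad.zero, fun _ => hz, aux _, ?_, aux _⟩
  have : ∀ x : Sp (m + 1), gradient (fun _ : Sp (m + 1) => (0 : ℝ)) x = 0 := by
    intro x; simp
  simp_rw [this]
  exact aux _

end linearity

/-- The scaled monomial `((x - x_D) / h_D)^α`, with `x_D` the center of mass and `h_D` the
diameter of `D`. -/
def scaledMono {n : ℕ} (D : Set (Sp n)) (α : Fin n →₀ ℕ) (x : Sp n) : ℝ :=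
  ∏ i, ((x i - (⨍ z in D, z) i) / Metric.diam D) ^ α i

lemma integrable_mul_mono (P : T) (q : L2 (M.cell P)) (α : Fin (m + 1) →₀ ℕ) :
    Integrable (fun x => q x * scaledMono (M.cell P) α x) (volume.restrict (M.cell P)) := by
  refine integrable_mul' (Lp.memLp q)
    (memLp_of_bounded (M.bounded_cell P) (M.isOpen_cell P).measurableSet ?_)
  unfold scaledMono
  fun_prop

/-! ### The coefficient and the local bilinear form -/

/-- A smooth, bounded, symmetric and uniformly positive definite tensor field on `D`. -/
structure IsDiffusion {n : ℕ} (D : Set (Sp n)) (K : Sp n → Sp n →L[ℝ] Sp n) : Prop where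
  smooth : ContDiffOn ℝ ∞ K D
  bounded : ∃ C, ∀ x ∈ D, ‖K x‖ ≤ C
  symm : ∀ x ∈ D, ∀ ξ η, ⟪K x ξ, η⟫ = ⟪ξ, K x η⟫
  posDef : ∃ κ > 0, ∀ x ∈ D, ∀ ξ, κ * ‖ξ‖ ^ 2 ≤ ⟪K x ξ, ξ⟫

open Classical in
/-- The field `K v ∈ (L²(D))ⁿ`. -/
def mulK {n : ℕ} (D : Set (Sp n)) (K : Sp n → Sp n →L[ℝ] Sp n) (v : L2V D) : L2V D :=
  if h : MemLp (fun x => K x (v x)) 2 (volume.restrict D) then h.toLp else 0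

/-- The local form of order `r = k + 1`,
`a_h^P(p, q) = (K 𝚷_k^0 ∇p, 𝚷_k^0 ∇q)_P + S^P((I - Π_{k+1}^0) p, (I - Π_{k+1}^0) q)`. -/
def formLoc (K : Sp (m + 1) → Sp (m + 1) →L[ℝ] Sp (m + 1))
    (S : ∀ P, L2 (M.cell P) →ₗ[ℝ] L2 (M.cell P) →ₗ[ℝ] ℝ) (k : ℕ) (P : T)
    (p q : L2 (M.cell P)) : ℝ :=
  (∫ x in M.cell P, ⟪K x (projV (M.cell P) k (wgrad (M.cell P) p) x),
      projV (M.cell P) k (wgrad (M.cell P) q) x⟫)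
    + S P (p - proj (M.cell P) (k + 1) p) (q - proj (M.cell P) (k + 1) q)

/-! ### Faces of an element, normal traces -/

variable [Fintype E]

open Classical in
/-- The faces of an element. -/
def faces (P : T) : Finset E :=
  Finset.univ.filter fun f => (M.face f).carrier ⊆ frontier (M.cell P)

open Classical in
/-- The interior faces. -/
def intFaces : Finset E := Finset.univ.filter fun f => (M.face f).carrier ⊆ M.domain

open Classical in
/-- The boundary faces. -/
def bdFaces : Finset E := Finset.univ.filter fun f => (M.face f).carrier ⊆ frontier M.domain

/-- `t` collects the traces of `q` on all faces of `P`. -/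
def IsTraceFamily (P : T) (q : L2 (M.cell P)) (t : ∀ f, M.L2F f) : Prop :=
  ∀ f ∈ M.faces P, M.IsTrace P f q (t f)

/-- The outward normal trace on `∂P` of a field `v` with divergence `s` is the polynomial `g f` on
each face `f` of `P`: Green's formula
`∫_P (v · ∇φ + s φ) dx = ∑_f ∫_f g_f φ dσ` holds for all smooth `φ`. -/
def HasNormalTrace (P : T) (v : L2V (M.cell P)) (s : L2 (M.cell P))
    (g : E → MvPolynomial (Fin m) ℝ) : Prop :=
  ∀ φ, IsTest Set.univ φ →
    ∫ x in M.cell P, (⟪v x, gradient φ x⟫ + s x * φ x) =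
      ∑ f ∈ M.faces P, ∫ y in (M.face f).dom, pval (g f) y * φ ((M.face f).chart y)

section linearity

variable {M}

lemma HasNormalTrace.add {P : T} {v v' : L2V (M.cell P)} {s s' : L2 (M.cell P)}
    {g g' : E → MvPolynomial (Fin m) ℝ} (h : M.HasNormalTrace P v s g)
    (h' : M.HasNormalTrace P v' s' g') : M.HasNormalTrace P (v + v') (s + s') (g + g') := by
  intro φ hφ
  have e1 : ∫ x in M.cell P, (⟪(v + v' : L2V (M.cell P)) x, gradient φ x⟫
        + (s + s' : L2 (M.cell P)) x * φ x)
      = ∫ x in M.cell P, ((⟪v x, gradient φ x⟫ + s x * φ x)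
        + (⟪v' x, gradient φ x⟫ + s' x * φ x)) := by
    apply integral_congr_ae
    filter_upwards [Lp.coeFn_add v v', Lp.coeFn_add s s'] with x hx hx'
    rw [hx, hx', Pi.add_apply, Pi.add_apply, inner_add_left]; ring
  have m1 := memLp_test (D := M.cell P) (cont_gradient hφ.1) (supp_gradient hφ.2.1)
  have m2 := memLp_test (D := M.cell P) hφ.1.continuous hφ.2.1
  have I : ∀ (z : L2V (M.cell P)) (r : L2 (M.cell P)),
      Integrable (fun x => ⟪z x, gradient φ x⟫ + r x * φ x) (volume.restrict (M.cell P)) :=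
    fun z r => (integrable_inner' (Lp.memLp z) m1).add (integrable_mul' (Lp.memLp r) m2)
  rw [e1, integral_add (I v s) (I v' s'), h φ hφ, h' φ hφ, ← Finset.sum_add_distrib]
  refine Finset.sum_congr rfl fun f _ => ?_
  rw [← integral_add (integrable_face hφ _) (integrable_face hφ _)]
  congr 1; ext y
  simp; ring

lemma HasNormalTrace.smul {P : T} {v : L2V (M.cell P)} {s : L2 (M.cell P)}
    {g : E → MvPolynomial (Fin m) ℝ} (c : ℝ) (h : M.HasNormalTrace P v s g) :
    M.HasNormalTrace P (c • v) (c • s) (c • g) := by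
  intro φ hφ
  have e1 : ∫ x in M.cell P, (⟪(c • v : L2V (M.cell P)) x, gradient φ x⟫
        + (c • s : L2 (M.cell P)) x * φ x)
      = ∫ x in M.cell P, c * (⟪v x, gradient φ x⟫ + s x * φ x) := by
    apply integral_congr_ae
    filter_upwards [Lp.coeFn_smul c v, Lp.coeFn_smul c s] with x hx hx'
    rw [hx, hx', Pi.smul_apply, Pi.smul_apply, real_inner_smul_left, smul_eq_mul]; ring
  rw [e1, integral_const_mul, h φ hφ, Finset.mul_sum]
  refine Finset.sum_congr rfl fun f _ => ?_
  rw [← integral_const_mul]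
  congr 1; ext y
  simp; ring

lemma HasNormalTrace.zero {P : T} : M.HasNormalTrace P 0 0 0 := by
  intro φ _
  have e1 : ∫ x in M.cell P, (⟪(0 : L2V (M.cell P)) x, gradient φ x⟫
        + (0 : L2 (M.cell P)) x * φ x) = ∫ x in M.cell P, (0 : ℝ) := by
    apply integral_congr_ae
    filter_upwards [Lp.coeFn_zero (Sp (m + 1)) 2 (volume.restrict (M.cell P)),
      Lp.coeFn_zero ℝ 2 (volume.restrict (M.cell P))] with x hx hx'
    rw [hx, hx']; simp
  rw [e1]; simp

end linearity

/-! ### The `H(div)`-conforming virtual element space -/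

/-- The local space `V_h^k(P)`: fields in `H(div; P) ∩ H(curl; P)` with normal trace in `P_k(f)` on
every face `f`, divergence in `P_k(P)`, and curl in `curl (P_k(P))^d` (this is `P_{k-1}(P)` for the
scalar curl in dimension two). -/
def velLoc (k : ℕ) (P : T) : Submodule ℝ (L2V (M.cell P)) where
  carrier := {v | (∃ s ∈ polyL2 (M.cell P) k, IsWeakDiv (M.cell P) v s ∧
      ∃ g : E → MvPolynomial (Fin m) ℝ, (∀ f, g f ∈ polyDeg m k) ∧ M.HasNormalTrace P v s g) ∧
    ∃ w : Fin (m + 1) → MvPolynomial (Fin (m + 1)) ℝ, (∀ i, w i ∈ polyDeg (m + 1) k) ∧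
      IsWeakCurl (M.cell P) v (pcurl w)}
  zero_mem' := ⟨⟨0, zero_mem _, IsWeakDiv.zero, 0, fun _ => zero_mem _, HasNormalTrace.zero⟩,
    0, fun _ => zero_mem _, IsWeakCurl.zero⟩
  add_mem' := by
    rintro v v' ⟨⟨s, hs, hd, g, hg, hn⟩, w, hw, hc⟩ ⟨⟨s', hs', hd', g', hg', hn'⟩, w', hw', hc'⟩
    exact ⟨⟨s + s', add_mem hs hs', hd.add hd', g + g', fun f => add_mem (hg f) (hg' f),
      hn.add hn'⟩, w + w', fun i => add_mem (hw i) (hw' i), hc.add hc'⟩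
  smul_mem' := by
    rintro c v ⟨⟨s, hs, hd, g, hg, hn⟩, w, hw, hc⟩
    exact ⟨⟨c • s, Submodule.smul_mem _ c hs, hd.smul c, c • g,
      fun f => Submodule.smul_mem _ c (hg f), hn.smul c⟩, c • w,
      fun i => Submodule.smul_mem _ c (hw i), hc.smul c⟩

/-- The global space `V_h^k`. -/
def vel (k : ℕ) : Submodule ℝ (L2V M.domain) where
  carrier := {v | (∃ s, IsWeakDiv M.domain v s) ∧ ∀ P, M.rest P v ∈ M.velLoc k P}
  zero_mem' := ⟨⟨0, IsWeakDiv.zero⟩, fun P => by simp [rest]⟩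
  add_mem' := by
    rintro v v' ⟨⟨s, hs⟩, h⟩ ⟨⟨s', hs'⟩, h'⟩
    refine ⟨⟨s + s', hs.add hs'⟩, fun P => ?_⟩
    simp only [rest, map_add]
    exact add_mem (h P) (h' P)
  smul_mem' := by
    rintro c v ⟨⟨s, hs⟩, h⟩
    refine ⟨⟨c • s, hs.smul c⟩, fun P => ?_⟩
    simp only [rest, map_smul]
    exact Submodule.smul_mem _ c (h P)

/-! ### The nonconforming virtual element space -/

/-- The auxiliary local space `W_h^r(P)`: functions in `H¹(P)` with normal derivative in
`P_{r-1}(f)` on every face `f` and Laplacian in `P_r(P)`. -/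
def auxLoc (r : ℕ) (P : T) : Submodule ℝ (L2 (M.cell P)) where
  carrier := {q | ∃ g, IsWeakGrad (M.cell P) q g ∧
    ∃ s ∈ polyL2 (M.cell P) r, IsWeakDiv (M.cell P) g s ∧
      ∃ d : E → MvPolynomial (Fin m) ℝ, (∀ f, d f ∈ polyDeg m ((r : ℤ) - 1)) ∧
        M.HasNormalTrace P g s d}
  zero_mem' := ⟨0, IsWeakGrad.zero, 0, zero_mem _, IsWeakDiv.zero, 0, fun _ => zero_mem _,
    HasNormalTrace.zero⟩
  add_mem' := by
    rintro q q' ⟨g, hg, s, hs, hd, d, hd', hn⟩ ⟨g', kg, s', ks, kd, d', kd', kn⟩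
    exact ⟨g + g', hg.add kg, s + s', add_mem hs ks, hd.add kd, d + d',
      fun f => add_mem (hd' f) (kd' f), hn.add kn⟩
  smul_mem' := by
    rintro c q ⟨g, hg, s, hs, hd, d, hd', hn⟩
    exact ⟨c • g, hg.smul c, c • s, Submodule.smul_mem _ c hs, hd.smul c, c • d,
      fun f => Submodule.smul_mem _ c (hd' f), hn.smul c⟩

/-- The projection `Π*_r` on one element: a linear map onto `P_r(P)` which is the identity there
and which on `W_h^r(P)` is determined by the degrees of freedom of the nonconforming space, that is
by the moments of order at most `r - 1` on the faces and of order at most `r - 2` in `P`.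
(Values outside `W_h^r(P)` are irrelevant.) -/
structure IsDofProjection (r : ℕ) (P : T)
    (pr : L2 (M.cell P) →ₗ[ℝ] L2 (M.cell P)) : Prop where
  range : ∀ q ∈ M.auxLoc r P, pr q ∈ polyL2 (M.cell P) r
  fixes : ∀ q ∈ polyL2 (M.cell P) r, pr q = q
  from_dofs : ∀ q ∈ M.auxLoc r P,
    (∃ t, M.IsTraceFamily P q t ∧ ∀ f ∈ M.faces P, ∀ μ ∈ polyDeg m ((r : ℤ) - 1),
      M.faceMoment f (t f) μ = 0) →
    (∀ μ ∈ polyDeg (m + 1) ((r : ℤ) - 2), ∫ x in M.cell P, q x * pval μ x = 0) → pr q = 0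

/-- The local space `N_h^r(P)`: functions `q ∈ W_h^r(P)` for which `q - Π*_r q` is orthogonal to the
scaled monomials of degree `r - 1` and `r`. -/
def ncLoc (pr : ∀ P, L2 (M.cell P) →ₗ[ℝ] L2 (M.cell P)) (r : ℕ) (P : T) :
    Submodule ℝ (L2 (M.cell P)) where
  carrier := {q | q ∈ M.auxLoc r P ∧ ∀ α : Fin (m + 1) →₀ ℕ, α.degree + 1 = r ∨ α.degree = r →
    ∫ x in M.cell P, (q - pr P q : L2 (M.cell P)) x * scaledMono (M.cell P) α x = 0}
  zero_mem' := by
    refine ⟨zero_mem _, fun α _ => ?_⟩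
    rw [map_zero, sub_zero]
    refine (integral_congr_ae (g := fun _ => (0 : ℝ)) ?_).trans (by simp)
    filter_upwards [Lp.coeFn_zero ℝ 2 (volume.restrict (M.cell P))] with x hx
    rw [hx]; simp
  add_mem' := by
    rintro q q' ⟨h, hm⟩ ⟨h', hm'⟩
    refine ⟨add_mem h h', fun α hα => ?_⟩
    have e : ((q + q') - pr P (q + q') : L2 (M.cell P)) = (q - pr P q) + (q' - pr P q') := by
      rw [map_add]; abel
    rw [e]
    have e2 : ∫ x in M.cell P, ((q - pr P q) + (q' - pr P q') : L2 (M.cell P)) x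
          * scaledMono (M.cell P) α x
        = ∫ x in M.cell P, ((q - pr P q : L2 (M.cell P)) x * scaledMono (M.cell P) α x
          + (q' - pr P q' : L2 (M.cell P)) x * scaledMono (M.cell P) α x) := by
      apply integral_congr_ae
      filter_upwards [Lp.coeFn_add (q - pr P q) (q' - pr P q')] with x hx
      rw [hx, Pi.add_apply, add_mul]
    rw [e2, integral_add (M.integrable_mul_mono P _ α) (M.integrable_mul_mono P _ α), hm α hα,
      hm' α hα, add_zero]
  smul_mem' := by
    rintro c q ⟨h, hm⟩
    refine ⟨Submodule.smul_mem _ c h, fun α hα => ?_⟩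
    have e : (c • q - pr P (c • q) : L2 (M.cell P)) = c • (q - pr P q) := by
      rw [map_smul, smul_sub]
    rw [e]
    have e2 : ∫ x in M.cell P, (c • (q - pr P q) : L2 (M.cell P)) x * scaledMono (M.cell P) α x
        = ∫ x in M.cell P, c * ((q - pr P q : L2 (M.cell P)) x * scaledMono (M.cell P) α x) := by
      apply integral_congr_ae
      filter_upwards [Lp.coeFn_smul c (q - pr P q)] with x hx
      rw [hx, Pi.smul_apply, smul_eq_mul, mul_assoc]
    rw [e2, integral_const_mul, hm α hα, mul_zero]

/-- The global space `N_h^r`: functions that are elementwise in `N_h^r(P)`, whose jumps on interior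
faces and whose traces on boundary faces have vanishing moments of order at most `r - 1`. -/
def nc (pr : ∀ P, L2 (M.cell P) →ₗ[ℝ] L2 (M.cell P)) (r : ℕ) : Submodule ℝ (L2 M.domain) where
  carrier := {q | (∀ P, M.rest P q ∈ M.ncLoc pr r P) ∧
    ∃ t : ∀ (_ : T) (f : E), M.L2F f, (∀ P, M.IsTraceFamily P (M.rest P q) (t P)) ∧
      (∀ f ∈ M.intFaces, ∀ P Q, f ∈ M.faces P → f ∈ M.faces Q →
        ∀ μ ∈ polyDeg m ((r : ℤ) - 1), M.faceMoment f (t P f) μ = M.faceMoment f (t Q f) μ) ∧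
      (∀ f ∈ M.bdFaces, ∀ P, f ∈ M.faces P →
        ∀ μ ∈ polyDeg m ((r : ℤ) - 1), M.faceMoment f (t P f) μ = 0)}
  zero_mem' := by
    refine ⟨fun P => by simp [rest], fun _ _ => 0, fun P f _ => ?_, fun f _ P Q _ _ μ _ => rfl,
      fun f _ P _ μ _ => M.faceMoment_zero f μ⟩
    simp only [rest, map_zero]
    exact IsTrace.zero
  add_mem' := by
    rintro q q' ⟨h, t, ht, h1, h2⟩ ⟨h', t', ht', h1', h2'⟩
    refine ⟨fun P => ?_, fun P f => t P f + t' P f, fun P f hf => ?_,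
      fun f hf P Q hP hQ μ hμ => ?_, fun f hf P hP μ hμ => ?_⟩
    · simp only [rest, map_add]
      exact add_mem (h P) (h' P)
    · simp only [rest, map_add]
      exact (ht P f hf).add (ht' P f hf)
    · rw [faceMoment_add, faceMoment_add, h1 f hf P Q hP hQ μ hμ, h1' f hf P Q hP hQ μ hμ]
    · rw [faceMoment_add, h2 f hf P hP μ hμ, h2' f hf P hP μ hμ, add_zero]
  smul_mem' := by
    rintro c q ⟨h, t, ht, h1, h2⟩
    refine ⟨fun P => ?_, fun P f => c • t P f, fun P f hf => ?_,
      fun f hf P Q hP hQ μ hμ => ?_, fun f hf P hP μ hμ => ?_⟩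
    · simp only [rest, map_smul]
      exact Submodule.smul_mem _ c (h P)
    · simp only [rest, map_smul]
      exact (ht P f hf).smul c
    · rw [faceMoment_smul, faceMoment_smul, h1 f hf P Q hP hQ μ hμ]
    · rw [faceMoment_smul, h2 f hf P hP μ hμ, mul_zero]

/-! ### The two schemes -/

/-- `(u, p)` solves the mixed virtual volume method of order `k` with source `F`. -/
structure IsMVVM (K : Sp (m + 1) → Sp (m + 1) →L[ℝ] Sp (m + 1))
    (S : ∀ P, L2 (M.cell P) →ₗ[ℝ] L2 (M.cell P) →ₗ[ℝ] ℝ)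
    (pr : ∀ P, L2 (M.cell P) →ₗ[ℝ] L2 (M.cell P)) (k : ℕ) (F : L2 M.domain)
    (u : L2V M.domain) (p : L2 M.domain) : Prop where
  mem_vel : u ∈ M.vel k
  mem_nc : p ∈ M.nc pr (k + 1)
  eq_a : ∀ P, ∀ χ ∈ M.ncLoc pr (k + 1) P,
    (∫ x in M.cell P, ⟪M.rest P u x, wgrad (M.cell P) χ x⟫)
      + M.formLoc K S k P (M.rest P p) χ = 0
  eq_b : 1 ≤ k → ∀ P, ∀ v ∈ gradPolyPerp (M.cell P) k,
    ∫ x in M.cell P, ⟪M.rest P u x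
      + K x (projV (M.cell P) k (wgrad (M.cell P) (M.rest P p)) x), v x⟫ = 0
  eq_c : ∀ P, ∀ φ ∈ polyL2 (M.cell P) k,
    ∫ x in M.cell P, wdiv (M.cell P) (M.rest P u) x * φ x
      = ∫ x in M.cell P, proj (M.cell P) k (M.rest P F) x * φ x

/-- The number of unknowns of the mixed virtual volume method, `dim (V_h^k × N_h^{k+1})`. -/
def numUnknowns (pr : ∀ P, L2 (M.cell P) →ₗ[ℝ] L2 (M.cell P)) (k : ℕ) : ℤ :=
  Module.finrank ℝ (M.vel k × M.nc pr (k + 1))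

/-- `g` is the normal trace `v · n` of `v` on `∂P`, a polynomial of degree at most `k` on each face. -/
def IsNormalTrace (k : ℕ) (P : T) (v : L2V (M.cell P)) (g : E → MvPolynomial (Fin m) ℝ) : Prop :=
  (∀ f, g f ∈ polyDeg m k) ∧ M.HasNormalTrace P v (wdiv (M.cell P) v) g

variable [Fintype T]

/-- `p` solves the nonconforming virtual element method of order `k + 1` with source `F`. -/
structure IsNCVEM (K : Sp (m + 1) → Sp (m + 1) →L[ℝ] Sp (m + 1))
    (S : ∀ P, L2 (M.cell P) →ₗ[ℝ] L2 (M.cell P) →ₗ[ℝ] ℝ)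
    (pr : ∀ P, L2 (M.cell P) →ₗ[ℝ] L2 (M.cell P)) (k : ℕ) (F : L2 M.domain)
    (p : L2 M.domain) : Prop where
  mem_nc : p ∈ M.nc pr (k + 1)
  eq : ∀ χ ∈ M.nc pr (k + 1),
    ∑ P, M.formLoc K S k P (M.rest P p) (M.rest P χ)
      = ∑ P, ∫ x in M.cell P, proj (M.cell P) k (M.rest P F) x * M.rest P χ x

/-- The number of equations of the mixed virtual volume method: on each element one for every
member of a basis of each test space, except that the constant test function gives the trivial
equation `0 = 0` and is not counted. -/
def numEquations (pr : ∀ P, L2 (M.cell P) →ₗ[ℝ] L2 (M.cell P)) (k : ℕ) : ℤ :=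
  ∑ P, ((Module.finrank ℝ (M.ncLoc pr (k + 1) P) : ℤ) - 1
    + Module.finrank ℝ (gradPolyPerp (M.cell P) k) + Module.finrank ℝ (polyL2 (M.cell P) k))

end PolyMesh

end MVVM

end

open MVVM

set_option linter.unusedSectionVars false

noncomputable section

namespace MVVM

/-! ### Uniqueness of weak derivatives, and polynomials as classes in L² -/

section

variable {n : ℕ} {D : Set (Sp n)}

/-! The two schemes are linked by hybridization. If `u` solves the mixed scheme, Green's formula
with div u = Π_k⁰f turns equation (a) into a flux identity on each element: the sum over the faces
of ∫ u·n χ equals (Π_k⁰f, χ)_P - a_h^P(p_h, χ). For a global test function the fluxes cancel: u·n is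
a polynomial of degree at most k that changes sign across an interior face, while the moments of χ
of this degree agree from both sides and vanish on the boundary. This is the nonconforming scheme
(`IsMVVM.isNCVEM`).

Conversely, let p_h solve the nonconforming scheme and let Λ_P(χ) be the right-hand side above. A
local function with vanishing face moments extends by zero to a global one, so Λ_P depends on the
face moments alone and is represented by polynomials γ_P of degree at most k on the faces. A
function whose only face moments sit on one interior face gives γ_P + γ_Q = 0 there (`exists_flux`).
The test function 1 gives the compatibility of γ_P with Π_k⁰f, because a_h^P(p_h, 1) = 0. So there
is a local velocity with normal trace γ_P, divergence Π_k⁰f and the moments against 𝒢_k^⊥ that (b)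
prescribes. These velocities glue to a field in H(div), and Green's formula read backwards gives
(a).

What remains is unisolvence of the two local spaces. For velocities it rests on the orthogonal
splitting of L² into the closure of the gradients (`gradClosure`) and its complement, the fields
with zero divergence and zero normal trace. The gradient part is produced by a Neumann problem
(`exists_neumann`). The complementary part is produced by projecting polynomials of 𝒢_k^⊥, which
meets the gradients only in 0 (`exists_solenoidal`). For W_h^r, Green's formula with ∇q shows that
the face moments of degree r-1 and the interior moments of degree r determine q. They can be
prescribed by a dimension count: Neumann data obey at most one condition, and the constants
compensate for it (`exists_mem_auxLoc`). In N_h^r the interior moments of degrees r-1 and r are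
slaved to the others through Π*_r (`exists_mem_ncLoc`). The dimensions follow, and the equality of
unknowns and equations reduces to Euler's formula, a double count of incidences in which an interior
face belongs to two elements and a boundary face to one.

All analysis comes from star-shapedness with respect to a ball. Contraction followed by
mollification gives density of smooth functions and the Poincaré lemma, and averaging over segments
gives Poincaré's inequality. Cutting an element into cones over its faces gives a radial identity
(`integral_radial`). It yields the trace inequality, and, by moving the apex inside the ball, the
divergence theorem. -/

lemma ae_eq_of_forall_test {F : Type*} [NormedAddCommGroup F] [NormedSpace ℝ F] [CompleteSpace F]
    (hD : IsOpen D) (g g' : Lp F 2 (volume.restrict D))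
    (h : ∀ φ, IsTest D φ → ∫ x in D, φ x • g x = ∫ x in D, φ x • g' x) : g = g' := by
  have hmem : ∀ g : Lp F 2 (volume.restrict D), LocallyIntegrableOn g D volume := by
    intro g x hx
    obtain ⟨ε, hε, hb⟩ := Metric.isOpen_iff.1 hD x hx
    refine ⟨Metric.ball x ε, mem_nhdsWithin_of_mem_nhds (Metric.ball_mem_nhds x hε), ?_⟩
    have : MemLp g 2 (volume.restrict (Metric.ball x ε)) :=
      (Lp.memLp g).mono_measure (Measure.restrict_mono_set volume hb)
    have : IsFiniteMeasure (volume.restrict (Metric.ball x ε)) :=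
      ⟨by rw [Measure.restrict_apply_univ]; exact measure_ball_lt_top⟩
    exact MemLp.integrable (q := 2) (by norm_num) ‹_›
  have key := hD.ae_eq_zero_of_integral_contDiff_smul_eq_zero (μ := volume)
    (f := fun x => g x - g' x) ((hmem g).sub (hmem g')) (fun φ h1 h2 h3 => by
      have e : ∫ x, φ x • (g x - g' x) = ∫ x in D, φ x • (g x - g' x) := by
        refine (setIntegral_eq_integral_of_forall_compl_eq_zero fun x hx => ?_).symm
        rw [image_eq_zero_of_notMem_tsupport (fun hx' => hx (h3 hx')), zero_smul]
      have hφ : MemLp φ 2 (volume.restrict D) := memLp_test h1.continuous h2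
      have I : ∀ g : Lp F 2 (volume.restrict D), Integrable (fun x => φ x • g x)
          (volume.restrict D) := fun g =>
        memLp_one_iff_integrable.1 ((Lp.memLp g).smul (r := 1) hφ)
      rw [e]
      simp_rw [smul_sub]
      rw [integral_sub (I g) (I g'), h φ ⟨h1, h2, h3⟩, sub_self])
  apply Lp.ext
  filter_upwards [(ae_restrict_iff' hD.measurableSet).2 key] with x hx
  exact sub_eq_zero.1 hx

lemma IsWeakGrad.unique (hD : IsOpen D) {q : L2 D} {g g' : L2V D} (h : IsWeakGrad D q g)
    (h' : IsWeakGrad D q g') : g = g' :=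
  ae_eq_of_forall_test hD g g' fun φ hφ => neg_injective ((h φ hφ).symm.trans (h' φ hφ))

lemma IsWeakDiv.unique (hD : IsOpen D) {v : L2V D} {s s' : L2 D} (h : IsWeakDiv D v s)
    (h' : IsWeakDiv D v s') : s = s' :=
  ae_eq_of_forall_test hD s s' fun φ hφ => neg_injective ((h φ hφ).symm.trans (h' φ hφ))

/-- `wgrad` is defined by choice; uniqueness on an open set makes the choice irrelevant, and every
later evaluation of `wgrad` goes through this equality. -/
lemma IsWeakGrad.wgrad_eq (hD : IsOpen D) {q : L2 D} {g : L2V D} (h : IsWeakGrad D q g) :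
    wgrad D q = g := by
  have h' : ∃ g, IsWeakGrad D q g := ⟨g, h⟩
  unfold wgrad
  rw [dif_pos h']
  exact h'.choose_spec.unique hD h

lemma IsWeakDiv.wdiv_eq (hD : IsOpen D) {v : L2V D} {s : L2 D} (h : IsWeakDiv D v s) :
    wdiv D v = s := by
  have h' : ∃ s, IsWeakDiv D v s := ⟨s, h⟩
  unfold wdiv
  rw [dif_pos h']
  exact h'.choose_spec.unique hD h

lemma l2_inner_eq (p q : L2 D) : ⟪p, q⟫ = ∫ x in D, p x * q x := by
  rw [L2.inner_def]
  congr 1; ext x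
  simp [mul_comm]

/-! ### Polynomials as functions -/

lemma contDiff_pval (p : MvPolynomial (Fin n) ℝ) : ContDiff ℝ ∞ (pval p : Sp n → ℝ) := by
  induction p using MvPolynomial.induction_on with
  | C a =>
    have : (pval (MvPolynomial.C a) : Sp n → ℝ) = fun _ => a := by ext x; simp [pval]
    rw [this]; exact contDiff_const
  | add p q hp hq => rw [map_add]; exact hp.add hq
  | mul_X p i hp =>
    have : (pval (p * MvPolynomial.X i) : Sp n → ℝ) = fun x => pval p x * x i := by
      ext x; simp [pval]
    rw [this]
    exact hp.mul (EuclideanSpace.proj (𝕜 := ℝ) i).contDiff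

lemma hasFDerivAt_pval (p : MvPolynomial (Fin n) ℝ) (x : Sp n) :
    HasFDerivAt (pval p) (InnerProductSpace.toDual ℝ (Sp n) (pvalV (pgrad p) x)) x := by
  induction p using MvPolynomial.induction_on with
  | C a =>
    have h1 : (pval (MvPolynomial.C a) : Sp n → ℝ) = fun _ => a := by ext x; simp [pval]
    have h2 : pvalV (pgrad (MvPolynomial.C a)) x = 0 := by
      ext i; simp [pvalV, pgrad, pval]
    rw [h1, h2, map_zero]; exact hasFDerivAt_const a x
  | add p q hp hq =>
    rw [map_add, map_add, map_add, Pi.add_apply, map_add]; exact hp.add hq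
  | mul_X p i hp =>
    have h1 : (pval (p * MvPolynomial.X i) : Sp n → ℝ) = fun x => pval p x * x i := by
      ext x; simp [pval]
    have h2 : pvalV (pgrad (p * MvPolynomial.X i)) x
        = pval p x • EuclideanSpace.single i (1 : ℝ) + x i • pvalV (pgrad p) x := by
      ext j
      by_cases hij : i = j <;>
      simp [pvalV, pgrad, pval, MvPolynomial.pderiv_X, Pi.single_apply,
        hij, mul_comm, add_comm, eq_comm]
    have h3 := hp.mul ((EuclideanSpace.proj i : Sp n →L[ℝ] ℝ).hasFDerivAt (x := x))
    have h4 : InnerProductSpace.toDual ℝ (Sp n)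
          (pval p x • EuclideanSpace.single i (1 : ℝ) + x i • pvalV (pgrad p) x)
        = pval p x • (EuclideanSpace.proj i : Sp n →L[ℝ] ℝ)
          + x i • InnerProductSpace.toDual ℝ (Sp n) (pvalV (pgrad p) x) := by
      ext w
      simp [EuclideanSpace.inner_single_left]
    rw [h1, h2, h4]
    exact h3

lemma gradient_pval (p : MvPolynomial (Fin n) ℝ) (x : Sp n) :
    gradient (pval p) x = pvalV (pgrad p) x := by
  unfold gradient
  rw [(hasFDerivAt_pval p x).fderiv, LinearIsometryEquiv.symm_apply_apply]

lemma continuous_pvalV (w : Fin n → MvPolynomial (Fin n) ℝ) : Continuous (pvalV w) := by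
  change Continuous fun x => WithLp.toLp 2 fun i => pval (w i) x
  have := fun i => continuous_pval (w i)
  fun_prop

/-- An open set contains a ball for the sup metric, that is a product of intervals, and a polynomial
that vanishes on a product of infinite sets is zero. -/
lemma eq_zero_of_pval_eq_zero (hD : IsOpen D) (hne : D.Nonempty) {p : MvPolynomial (Fin n) ℝ}
    (h : ∀ x ∈ D, pval p x = 0) : p = 0 := by
  obtain ⟨x, hx⟩ := hne
  have hD' : IsOpen ((WithLp.toLp 2 : (Fin n → ℝ) → Sp n) ⁻¹' D) :=
    hD.preimage (PiLp.continuous_toLp 2 _)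
  obtain ⟨ε, hε, hb⟩ := Metric.isOpen_iff.1 hD' (fun i => x i) hx
  refine MvPolynomial.funext_set (fun i => Metric.ball (x i) ε) (fun i => ?_) fun y hy => ?_
  · rw [Real.ball_eq_Ioo]; exact Set.Ioo_infinite (by linarith)
  · rw [map_zero]
    have : y ∈ Metric.ball (fun i => x i) ε := by
      rw [ball_pi _ hε]; exact hy
    exact h _ (hb this)

lemma memLp_pval (hD : IsOpen D) (hb : Bornology.IsBounded D) (p : MvPolynomial (Fin n) ℝ) :
    MemLp (pval p) 2 (volume.restrict D) :=
  memLp_of_bounded hb hD.measurableSet (continuous_pval p)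

lemma memLp_of_bounded' {F : Type*} [NormedAddCommGroup F] (hb : Bornology.IsBounded D)
    (hD : IsOpen D) {h : Sp n → F}
    [SecondCountableTopologyEither (Sp n) F] (hc : Continuous h) :
    MemLp h 2 (volume.restrict D) := by
  have : IsFiniteMeasure (volume.restrict D) :=
    ⟨by rw [Measure.restrict_apply_univ]; exact hb.measure_lt_top⟩
  obtain ⟨C, hC⟩ := hb.isCompact_closure.exists_bound_of_continuousOn hc.continuousOn
  refine MemLp.of_bound hc.aestronglyMeasurable C ?_
  filter_upwards [ae_restrict_mem hD.measurableSet] with x hx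
  exact hC x (subset_closure hx)

lemma memLp_pvalV (hD : IsOpen D) (hb : Bornology.IsBounded D)
    (w : Fin n → MvPolynomial (Fin n) ℝ) : MemLp (pvalV w) 2 (volume.restrict D) :=
  memLp_of_bounded' hb hD (continuous_pvalV w)

/-- The class of a polynomial in `L²(D)`. -/
def pcls (hD : IsOpen D) (hb : Bornology.IsBounded D) : MvPolynomial (Fin n) ℝ →ₗ[ℝ] L2 D where
  toFun p := (memLp_pval hD hb p).toLp
  map_add' p q := by
    rw [← MemLp.toLp_add]
    exact MemLp.toLp_congr _ _ (by rw [map_add])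
  map_smul' c p := by
    rw [RingHom.id_apply, ← MemLp.toLp_const_smul]
    exact MemLp.toLp_congr _ _ (by rw [map_smul])

/-- The class of a vector of polynomials in `(L²(D))ⁿ`. -/
def pclsV (hD : IsOpen D) (hb : Bornology.IsBounded D) :
    (Fin n → MvPolynomial (Fin n) ℝ) →ₗ[ℝ] L2V D where
  toFun p := (memLp_pvalV hD hb p).toLp
  map_add' p q := by
    rw [← MemLp.toLp_add]
    exact MemLp.toLp_congr _ _ (by rw [map_add])
  map_smul' c p := by
    rw [RingHom.id_apply, ← MemLp.toLp_const_smul]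
    exact MemLp.toLp_congr _ _ (by rw [map_smul])

section classes

variable (hD : IsOpen D) (hb : Bornology.IsBounded D)

lemma coeFn_pcls (p : MvPolynomial (Fin n) ℝ) : pcls hD hb p =ᵐ[volume.restrict D] pval p :=
  MemLp.coeFn_toLp (memLp_pval hD hb p)

lemma coeFn_pclsV (w : Fin n → MvPolynomial (Fin n) ℝ) :
    pclsV hD hb w =ᵐ[volume.restrict D] pvalV w :=
  MemLp.coeFn_toLp (memLp_pvalV hD hb w)

lemma eqOn_of_ae_eq {F : Type*} [TopologicalSpace F] [T2Space F] (hD : IsOpen D) {u v : Sp n → F}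
    (hu : Continuous u) (hv : Continuous v) (h : u =ᵐ[volume.restrict D] v) : Set.EqOn u v D :=
  Measure.eqOn_open_of_ae_eq h hD hu.continuousOn hv.continuousOn

lemma eq_pcls_iff {q : L2 D} {p : MvPolynomial (Fin n) ℝ} :
    q = pcls hD hb p ↔ q =ᵐ[volume.restrict D] pval p := by
  constructor
  · rintro rfl; exact coeFn_pcls hD hb p
  · intro h; exact Lp.ext (h.trans (coeFn_pcls hD hb p).symm)

lemma eq_pclsV_iff {q : L2V D} {p : Fin n → MvPolynomial (Fin n) ℝ} :
    q = pclsV hD hb p ↔ q =ᵐ[volume.restrict D] pvalV p := by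
  constructor
  · rintro rfl; exact coeFn_pclsV hD hb p
  · intro h; exact Lp.ext (h.trans (coeFn_pclsV hD hb p).symm)

lemma pcls_injective (hne : D.Nonempty) : Function.Injective (pcls hD hb) := by
  rw [injective_iff_map_eq_zero]
  intro p hp
  refine eq_zero_of_pval_eq_zero hD hne ?_
  have h := (coeFn_pcls hD hb p).symm
  rw [hp] at h
  exact eqOn_of_ae_eq hD (continuous_pval p) continuous_const
    (h.trans (Lp.coeFn_zero _ _ _))

lemma pclsV_injective (hne : D.Nonempty) : Function.Injective (pclsV hD hb) := by
  rw [injective_iff_map_eq_zero]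
  intro p hp
  have h := (coeFn_pclsV hD hb p).symm
  rw [hp] at h
  have h' := eqOn_of_ae_eq hD (continuous_pvalV p) continuous_const
    (h.trans (Lp.coeFn_zero _ _ _))
  funext i
  refine eq_zero_of_pval_eq_zero hD hne fun x hx => ?_
  have := congrArg (fun z : Sp n => z i) (h' hx)
  simpa [pvalV] using this

lemma mem_polyL2_iff {k : ℤ} {q : L2 D} :
    q ∈ polyL2 D k ↔ ∃ p ∈ polyDeg n k, q = pcls hD hb p := by
  simp_rw [eq_pcls_iff hD hb]
  exact ⟨fun ⟨a, ha⟩ => ⟨a, a.2, ha⟩, fun ⟨p, hp, h⟩ => ⟨⟨p, hp⟩, h⟩⟩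

lemma mem_polyL2V_iff {k : ℤ} {q : L2V D} :
    q ∈ polyL2V D k ↔ ∃ w : Fin n → MvPolynomial (Fin n) ℝ, (∀ i, w i ∈ polyDeg n k) ∧
      q = pclsV hD hb w := by
  simp_rw [eq_pclsV_iff hD hb]
  exact ⟨fun ⟨a, ha⟩ => ⟨fun i => a i, fun i => (a i).2, ha⟩,
    fun ⟨p, hp, h⟩ => ⟨fun i => ⟨p i, hp i⟩, h⟩⟩

lemma mem_gradPoly_iff {k : ℤ} {q : L2V D} :
    q ∈ gradPoly D k ↔ ∃ p ∈ polyDeg n (k + 1), q = pclsV hD hb (pgrad p) := by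
  simp_rw [eq_pclsV_iff hD hb]
  exact ⟨fun ⟨a, ha⟩ => ⟨a, a.2, ha⟩, fun ⟨p, hp, h⟩ => ⟨⟨p, hp⟩, h⟩⟩

lemma polyL2_eq_map (k : ℤ) : polyL2 D k = (polyDeg n k).map (pcls hD hb) := by
  ext q
  rw [mem_polyL2_iff hD hb, Submodule.mem_map]
  simp only [eq_comm]

lemma gradPoly_eq_map (k : ℤ) :
    gradPoly D k = ((polyDeg n (k + 1)).map pgrad).map (pclsV hD hb) := by
  ext q
  rw [mem_gradPoly_iff hD hb, ← Submodule.map_comp, Submodule.mem_map]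
  simp only [eq_comm, LinearMap.comp_apply]

lemma polyL2V_eq_map (k : ℤ) :
    polyL2V D k = (Submodule.pi Set.univ fun _ : Fin n => polyDeg n k).map (pclsV hD hb) := by
  ext q
  rw [mem_polyL2V_iff hD hb, Submodule.mem_map]
  simp [Submodule.mem_pi, eq_comm]

end classes

end

/-! ### Polynomial algebra, dimensions, and integration by parts against test functions -/

section

open MvPolynomial

variable {n : ℕ} {D : Set (Sp n)}

/-! ### Degrees -/

lemma mem_polyDeg_iff {k : ℤ} {p : MvPolynomial (Fin n) ℝ} :
    p ∈ polyDeg n k ↔ ∀ a, coeff a p ≠ 0 → (a.degree : ℤ) ≤ k := by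
  unfold polyDeg
  rw [mem_restrictSupport_iff]
  simp [Set.subset_def, mem_support_iff]

lemma mem_polyDeg_natCast_iff {k : ℕ} {p : MvPolynomial (Fin n) ℝ} :
    p ∈ polyDeg n k ↔ p.totalDegree ≤ k := by
  rw [mem_polyDeg_iff, totalDegree, Finset.sup_le_iff]
  simp only [mem_support_iff, Nat.cast_le]
  rfl

lemma polyDeg_mono {j k : ℤ} (h : j ≤ k) : polyDeg n j ≤ polyDeg n k := fun _ hp =>
  mem_polyDeg_iff.2 fun a ha => (mem_polyDeg_iff.1 hp a ha).trans h

lemma polyDeg_eq_bot {k : ℤ} (hk : k < 0) : polyDeg n k = ⊥ := by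
  rw [eq_bot_iff]
  intro p hp
  rw [Submodule.mem_bot]
  ext a
  by_contra h
  have := mem_polyDeg_iff.1 hp a (by simpa using h)
  omega

lemma C_mem_polyDeg (c : ℝ) {k : ℤ} (hk : 0 ≤ k) : C c ∈ polyDeg n k := by
  refine mem_polyDeg_iff.2 fun a ha => ?_
  rw [coeff_C] at ha
  split_ifs at ha with h
  · simpa [← h] using hk
  · exact absurd rfl ha

lemma mem_polyDeg_zero {p : MvPolynomial (Fin n) ℝ} : p ∈ polyDeg n 0 ↔ ∃ c, p = C c := by
  constructor
  · intro h
    have h' : p.totalDegree ≤ 0 := mem_polyDeg_natCast_iff.1 (by exact_mod_cast h)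
    exact ⟨_, totalDegree_eq_zero_iff_eq_C.1 (by omega)⟩
  · rintro ⟨c, rfl⟩; exact C_mem_polyDeg c le_rfl

lemma pderiv_mem_polyDeg {k : ℤ} {p : MvPolynomial (Fin n) ℝ} (hp : p ∈ polyDeg n k) (i : Fin n) :
    pderiv i p ∈ polyDeg n (k - 1) := by
  refine mem_polyDeg_iff.2 fun a ha => ?_
  rw [coeff_pderiv] at ha
  have := mem_polyDeg_iff.1 hp (a + Finsupp.single i 1) (by aesop)
  simp at this
  omega

lemma X_mul_mem_polyDeg {k : ℤ} {p : MvPolynomial (Fin n) ℝ} (hp : p ∈ polyDeg n k) (i : Fin n) :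
    X i * p ∈ polyDeg n (k + 1) := by
  classical
  refine mem_polyDeg_iff.2 fun a ha => ?_
  rw [coeff_X_mul'] at ha
  split_ifs at ha with h
  · have := mem_polyDeg_iff.1 hp _ ha
    have e : a = (a - Finsupp.single i 1) + Finsupp.single i 1 := by
      ext j
      by_cases hj : j = i
      · subst hj
        simp at h ⊢; omega
      · simp [Ne.symm hj]
    rw [e, map_add]
    simp
    omega
  · exact absurd rfl ha

lemma totalDegree_bind₁_le {l : ℕ} (g : Fin n → MvPolynomial (Fin l) ℝ)
    (hg : ∀ i, (g i).totalDegree ≤ 1) (p : MvPolynomial (Fin n) ℝ) :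
    (bind₁ g p).totalDegree ≤ p.totalDegree := by
  rw [bind₁, aeval_def, eval₂_eq]
  refine totalDegree_finsetSum_le fun a ha => ?_
  refine (totalDegree_mul _ _).trans ?_
  have h1 : (algebraMap ℝ (MvPolynomial (Fin l) ℝ) (coeff a p)).totalDegree = 0 := by
    rw [algebraMap_eq]; exact totalDegree_C _
  rw [h1, zero_add]
  refine (totalDegree_finsetProd _ _).trans ?_
  refine le_trans (Finset.sum_le_sum fun i _ => (totalDegree_pow _ _).trans
    (Nat.mul_le_mul_left _ (hg i))) ?_
  simp only [mul_one]
  exact le_totalDegree ha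

lemma bind₁_mem_polyDeg {l : ℕ} {k : ℤ} (g : Fin n → MvPolynomial (Fin l) ℝ)
    (hg : ∀ i, (g i).totalDegree ≤ 1) {p : MvPolynomial (Fin n) ℝ} (hp : p ∈ polyDeg n k) :
    bind₁ g p ∈ polyDeg l k := by
  rcases lt_or_ge k 0 with hk | hk
  · rw [polyDeg_eq_bot hk, Submodule.mem_bot] at hp
    rw [hp, map_zero]; exact zero_mem _
  · lift k to ℕ using hk
    rw [mem_polyDeg_natCast_iff] at hp ⊢
    exact (totalDegree_bind₁_le g hg p).trans hp

lemma pval_bind₁ {l : ℕ} (g : Fin n → MvPolynomial (Fin l) ℝ) (p : MvPolynomial (Fin n) ℝ)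
    (y : Sp l) : pval (bind₁ g p) y = pval p (WithLp.toLp 2 fun i => pval (g i) y) := by
  change eval _ _ = eval _ _
  rw [← aeval_eq_eval, aeval_bind₁]
  rfl

/-- Composition of a polynomial with an affine map, as a polynomial. -/
lemma exists_pval_comp_affine {l : ℕ} (A : Sp l →ᵃ[ℝ] Sp n) :
    ∃ g : Fin n → MvPolynomial (Fin l) ℝ, (∀ i, (g i).totalDegree ≤ 1) ∧
      ∀ p y, pval (bind₁ g p) y = pval p (A y) := by
  let g : Fin n → MvPolynomial (Fin l) ℝ := fun i =>
    C (A 0 i) + ∑ j, C (A.linear (EuclideanSpace.single j 1) i) * X j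
  refine ⟨g, fun i => ?_, fun p y => ?_⟩
  · refine (totalDegree_add _ _).trans (max_le (by simp) (totalDegree_finsetSum_le fun j _ => ?_))
    refine (totalDegree_mul _ _).trans ?_
    rw [totalDegree_C, totalDegree_X]
  · rw [pval_bind₁]
    refine congrArg (pval p) ?_
    have e : A y = A.linear y + A 0 := by
      have := A.map_vadd 0 y
      simpa using this
    have e2 : y = ∑ j, y j • EuclideanSpace.single j (1 : ℝ) := by
      ext i; simp [Pi.single_apply]
    have e3 : A.linear y = ∑ j, y j • A.linear (EuclideanSpace.single j 1) := by
      conv_lhs => rw [e2, map_sum]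
      simp
    rw [e, e3]
    refine PiLp.ext fun i => ?_
    simp [g, pval, add_comm, mul_comm]

/-! ### Euler's operator and the Poincaré lemma for polynomials -/

/-- Euler's operator `∑ xᵢ ∂ᵢ`. -/
def euler : MvPolynomial (Fin n) ℝ →ₗ[ℝ] MvPolynomial (Fin n) ℝ :=
  ∑ i, LinearMap.mulLeft ℝ (X i) ∘ₗ (pderiv i).toLinearMap

lemma euler_apply (p : MvPolynomial (Fin n) ℝ) : euler p = ∑ i, X i * pderiv i p := by
  simp [euler]

/-- Monomials are eigenvectors of Euler's operator with their degree as eigenvalue. Hence the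
operator can be inverted off the constants, which drives both `pgrad_eq_zero_iff` and the polynomial
Poincaré lemma `exists_pgrad_eq`. -/
lemma coeff_euler (p : MvPolynomial (Fin n) ℝ) (a : Fin n →₀ ℕ) :
    coeff a (euler p) = a.degree * coeff a p := by
  classical
  induction p using MvPolynomial.induction_on' with
  | monomial b r =>
    rw [euler_apply]
    simp only [X_mul_pderiv_monomial]
    rw [← Finset.sum_smul, coeff_smul, coeff_monomial]
    split_ifs with h
    · subst h
      simp [Finsupp.degree_eq_sum]
    · simp
  | add p q hp hq => rw [map_add, coeff_add, hp, hq, coeff_add]; ring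

lemma pgrad_eq_zero_iff {p : MvPolynomial (Fin n) ℝ} : pgrad p = 0 ↔ ∃ c, p = C c := by
  constructor
  · intro h
    refine ⟨coeff 0 p, ?_⟩
    ext a
    have h1 := coeff_euler p a
    have h2 : euler p = 0 := by
      rw [euler_apply]
      refine Finset.sum_eq_zero fun i _ => ?_
      have : pderiv i p = 0 := congrFun h i
      rw [this, mul_zero]
    rw [h2, coeff_zero] at h1
    rw [coeff_C]
    split_ifs with ha
    · rw [← ha]
    · rcases mul_eq_zero.1 h1.symm with h3 | h3
      · exact absurd ((Finsupp.degree_eq_zero_iff a).1 (by simpa using h3)) (Ne.symm ha)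
      · exact h3
  · rintro ⟨c, rfl⟩
    funext i
    exact pderiv_C

lemma pderiv_comm (i j : Fin n) (p : MvPolynomial (Fin n) ℝ) :
    pderiv i (pderiv j p) = pderiv j (pderiv i p) := by
  ext a
  simp only [coeff_pderiv]
  rw [add_right_comm]
  by_cases h : i = j
  · subst h; rfl
  · simp [h, Ne.symm h]; ring

lemma pderiv_euler (i : Fin n) (p : MvPolynomial (Fin n) ℝ) :
    pderiv i (euler p) = pderiv i p + euler (pderiv i p) := by
  rw [euler_apply, euler_apply, map_sum]
  simp only [pderiv_mul, pderiv_X, pderiv_comm i]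
  rw [Finset.sum_add_distrib]
  simp [Pi.single_apply]

/-- With s = ∑ xᵢ wᵢ the potential q is the solution of `euler q = s`. Vanishing curl gives ∂ⱼs = wⱼ
+ `euler wⱼ`, whereas ∂ⱼ(`euler q`) = ∂ⱼq + `euler (∂ⱼq)`, and 1 + `euler` is injective, having
eigenvalues 1 + degree. -/
lemma exists_pgrad_eq {k : ℤ} {w : Fin n → MvPolynomial (Fin n) ℝ} (hw : ∀ i, w i ∈ polyDeg n k)
    (hcurl : ∀ i j, pderiv i (w j) = pderiv j (w i)) : ∃ q ∈ polyDeg n (k + 1), pgrad q = w := by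
  classical
  -- `T` divides each monomial by its degree. The constant monomial is sent to 0 since 0⁻¹ = 0; this
  -- is harmless because `s` has no constant term.
  let T : MvPolynomial (Fin n) ℝ →ₗ[ℝ] MvPolynomial (Fin n) ℝ :=
    (basisMonomials (Fin n) ℝ).constr ℝ fun a => monomial a ((a.degree : ℝ)⁻¹)
  have hT : ∀ p a, coeff a (T p) = (a.degree : ℝ)⁻¹ * coeff a p := by
    intro p a
    induction p using MvPolynomial.induction_on' with
    | monomial b r =>
      have e : monomial b r = r • basisMonomials (Fin n) ℝ b := by
        rw [coe_basisMonomials, smul_monomial, smul_eq_mul, mul_one]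
      rw [e, map_smul, Module.Basis.constr_basis, coeff_smul, coeff_smul, coeff_monomial,
        coe_basisMonomials, coeff_monomial]
      split_ifs with h
      · subst h; simp [mul_comm]
      · simp
    | add p q hp hq => rw [map_add, coeff_add, hp, hq, coeff_add]; ring
  let s := ∑ i, X i * w i
  have hs0 : coeff 0 s = 0 := by simp [s, coeff_sum, coeff_X_mul']
  have hE : euler (T s) = s := by
    ext a
    rw [coeff_euler, hT]
    by_cases ha : a.degree = 0
    · have : a = 0 := (Finsupp.degree_eq_zero_iff a).1 ha
      subst this; rw [hs0]; simp
    · have : (a.degree : ℝ) ≠ 0 := by exact_mod_cast ha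
      field_simp
  refine ⟨T s, ?_, ?_⟩
  · refine mem_polyDeg_iff.2 fun a ha => ?_
    have hs : s ∈ polyDeg n (k + 1) := sum_mem fun i _ => X_mul_mem_polyDeg (hw i) i
    rw [hT] at ha
    exact mem_polyDeg_iff.1 hs a (right_ne_zero_of_mul ha)
  · funext j
    change pderiv j (T s) = w j
    have h1 : pderiv j (T s) + euler (pderiv j (T s)) = w j + euler (w j) := by
      rw [← pderiv_euler, hE, euler_apply, map_sum]
      simp only [pderiv_mul, pderiv_X, hcurl j]
      rw [Finset.sum_add_distrib]
      simp [Pi.single_apply]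
    ext a
    have h2 := congrArg (coeff a) h1
    rw [coeff_add, coeff_add, coeff_euler, coeff_euler] at h2
    have : (1 + (a.degree : ℝ)) ≠ 0 := by positivity
    apply mul_left_cancel₀ this
    linarith

/-! ### Dimensions -/

lemma finrank_map_of_injective {V W : Type*} [AddCommGroup V] [Module ℝ V] [AddCommGroup W]
    [Module ℝ W] {f : V →ₗ[ℝ] W} (hf : Function.Injective f) (p : Submodule ℝ V) :
    Module.finrank ℝ (p.map f) = Module.finrank ℝ p :=
  (Submodule.equivMapOfInjective f hf p).symm.finrank_eq

lemma finrank_polyL2 (hD : IsOpen D) (hb : Bornology.IsBounded D) (hne : D.Nonempty) (k : ℤ) :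
    Module.finrank ℝ (polyL2 D k) = polyDim k n := by
  rw [polyL2_eq_map hD hb, finrank_map_of_injective (pcls_injective hD hb hne)]
  rfl

lemma finrank_polyL2V (hD : IsOpen D) (hb : Bornology.IsBounded D) (hne : D.Nonempty) (k : ℤ) :
    Module.finrank ℝ (polyL2V D k) = n * polyDim k n := by
  let e : (Submodule.pi Set.univ fun _ : Fin n => polyDeg n k) ≃ₗ[ℝ] (Fin n → polyDeg n k) :=
    { toFun := fun w i => ⟨w.1 i, w.2 i trivial⟩
      invFun := fun w => ⟨fun i => w i, fun i _ => (w i).2⟩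
      map_add' := fun _ _ => rfl
      map_smul' := fun _ _ => rfl
      left_inv := fun _ => rfl
      right_inv := fun _ => rfl }
  rw [polyL2V_eq_map hD hb, finrank_map_of_injective (pclsV_injective hD hb hne), e.finrank_eq]
  simp [Module.finrank_pi_fintype, polyDim]

lemma finrank_gradPoly (hD : IsOpen D) (hb : Bornology.IsBounded D) (hne : D.Nonempty) (k : ℕ) :
    Module.finrank ℝ (gradPoly D k) + 1 = polyDim (k + 1) n := by
  rw [gradPoly_eq_map hD hb, finrank_map_of_injective (pclsV_injective hD hb hne)]
  let f : polyDeg n ((k : ℤ) + 1) →ₗ[ℝ] (Fin n → MvPolynomial (Fin n) ℝ) :=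
    pgrad ∘ₗ (polyDeg n ((k : ℤ) + 1)).subtype
  have h1 : (polyDeg n ((k : ℤ) + 1)).map pgrad = LinearMap.range f := by
    rw [LinearMap.range_comp, Submodule.range_subtype]
  have h2 : Module.finrank ℝ (LinearMap.ker f) = 1 := by
    let o : LinearMap.ker f := ⟨⟨C 1, C_mem_polyDeg 1 (by positivity)⟩, pgrad_eq_zero_iff.2 ⟨1, rfl⟩⟩
    refine finrank_eq_one o ?_ ?_
    · intro h
      have : (C 1 : MvPolynomial (Fin n) ℝ) = 0 := congrArg (fun z => z.1.1) h
      simp at this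
    · rintro ⟨⟨p, hp⟩, hp'⟩
      obtain ⟨c, hc⟩ := pgrad_eq_zero_iff.1 hp'
      refine ⟨c, ?_⟩
      ext1; ext1
      change c • C 1 = p
      change p = C c at hc
      rw [hc, smul_eq_C_mul, ← C_mul, mul_one]
  have := f.finrank_range_add_finrank_ker
  rw [h1]
  rw [h2] at this
  exact this

lemma gradPoly_le_polyL2V (hD : IsOpen D) (hb : Bornology.IsBounded D) (k : ℕ) :
    gradPoly D k ≤ polyL2V D k := by
  intro v hv
  obtain ⟨p, hp, rfl⟩ := (mem_gradPoly_iff hD hb).1 hv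
  refine (mem_polyL2V_iff hD hb).2 ⟨_, fun i => ?_, rfl⟩
  have := pderiv_mem_polyDeg hp i
  rwa [add_sub_cancel_right] at this

instance gradPoly_finite (k : ℤ) : FiniteDimensional ℝ (gradPoly D k) := aeImage_finite D _

instance gradPolyPerp_finite (k : ℤ) : FiniteDimensional ℝ (gradPolyPerp D k) :=
  Submodule.finiteDimensional_inf_left _ _

lemma finrank_gradPolyPerp (hD : IsOpen D) (hb : Bornology.IsBounded D) (hne : D.Nonempty)
    (k : ℕ) : (Module.finrank ℝ (gradPolyPerp D k) : ℤ)
      = n * polyDim k n - polyDim (k + 1) n + 1 := by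
  have h1 := Submodule.finrank_add_inf_finrank_orthogonal (gradPoly_le_polyL2V hD hb k)
  have h2 := finrank_gradPoly hD hb hne k
  rw [finrank_polyL2V hD hb hne, inf_comm] at h1
  unfold gradPolyPerp
  zify at h1 h2
  linarith

/-! ### Integration by parts against test functions -/

lemma gradient_apply (φ : Sp n → ℝ) (x : Sp n) (i : Fin n) :
    gradient φ x i = fderiv ℝ φ x (EuclideanSpace.single i 1) := by
  have : ⟪EuclideanSpace.single i (1 : ℝ), gradient φ x⟫
      = fderiv ℝ φ x (EuclideanSpace.single i 1) := by
    rw [real_inner_comm]; unfold gradient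
    exact InnerProductSpace.toDual_symm_apply
  rw [← this, EuclideanSpace.inner_single_left]
  simp

lemma continuous_gradient_apply {φ : Sp n → ℝ} (h : ContDiff ℝ ∞ φ) (i : Fin n) :
    Continuous fun x => gradient φ x i :=
  (EuclideanSpace.proj i : Sp n →L[ℝ] ℝ).continuous.comp (cont_gradient h)

lemma IsTest.eq_zero {φ : Sp n → ℝ} (h : IsTest D φ) {x : Sp n} (hx : x ∉ D) : φ x = 0 :=
  image_eq_zero_of_notMem_tsupport fun hx' => hx (h.2.2 hx')

lemma IsTest.gradient_eq_zero {φ : Sp n → ℝ} (h : IsTest D φ) {x : Sp n} (hx : x ∉ D) :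
    gradient φ x = 0 := by
  unfold gradient
  rw [image_eq_zero_of_notMem_tsupport (f := fderiv ℝ φ)
    (fun hx' => hx (h.2.2 (tsupport_fderiv_subset ℝ hx'))), map_zero]

lemma IsTest.mono {D' : Set (Sp n)} {φ : Sp n → ℝ} (h : IsTest D φ) (hD : D ⊆ D') : IsTest D' φ :=
  ⟨h.1, h.2.1, h.2.2.trans hD⟩

/-- The test function and its gradient vanish off `D`, so both integrals extend to the whole space
and no boundary term can arise, whatever the shape of `D`. -/
lemma integral_mul_gradient_test {u φ : Sp n → ℝ} (hu : ContDiff ℝ ∞ u) (hφ : IsTest D φ)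
    (i : Fin n) :
    ∫ x in D, u x * gradient φ x i = - ∫ x in D, φ x * gradient u x i := by
  have hs : HasCompactSupport fun x => gradient φ x i := by
    have := supp_gradient hφ.2.1
    exact this.comp_left (g := fun z : Sp n => z i) rfl
  rw [setIntegral_eq_integral_of_forall_compl_eq_zero (fun x hx => by
      rw [hφ.gradient_eq_zero hx]; simp),
    setIntegral_eq_integral_of_forall_compl_eq_zero (fun x hx => by
      rw [hφ.eq_zero hx, zero_mul])]
  simp_rw [mul_comm (φ _), gradient_apply]
  refine integral_mul_fderiv_eq_neg_fderiv_mul_of_integrable ?_ ?_ ?_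
    (fun x _ => hu.differentiable (by simp) x) (fun x _ => hφ.1.differentiable (by simp) x)
  · simp_rw [← gradient_apply]
    exact ((continuous_gradient_apply hu i).mul hφ.1.continuous).integrable_of_hasCompactSupport
      hφ.2.1.mul_left
  · simp_rw [← gradient_apply]
    exact (hu.continuous.mul (continuous_gradient_apply hφ.1 i)).integrable_of_hasCompactSupport
      hs.mul_left
  · exact (hu.continuous.mul hφ.1.continuous).integrable_of_hasCompactSupport hφ.2.1.mul_left

lemma integral_apply_coord {μ : Measure (Sp n)} {f : Sp n → Sp n} (hf : Integrable f μ)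
    (i : Fin n) : (∫ x, f x ∂μ) i = ∫ x, f x i ∂μ :=
  ((EuclideanSpace.proj i : Sp n →L[ℝ] ℝ).integral_comp_comm hf).symm

lemma isWeakGrad_iff {q : L2 D} {g : L2V D} :
    IsWeakGrad D q g ↔ ∀ i φ, IsTest D φ →
      ∫ x in D, q x * gradient φ x i = - ∫ x in D, φ x * g x i := by
  have key : ∀ φ, IsTest D φ → ∀ i, (∫ x in D, q x • gradient φ x) i
      = ∫ x in D, q x * gradient φ x i ∧ (∫ x in D, φ x • g x) i = ∫ x in D, φ x * g x i := by
    intro φ hφ i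
    have m1 := memLp_test (D := D) (cont_gradient hφ.1) (supp_gradient hφ.2.1)
    have m2 := memLp_test (D := D) hφ.1.continuous hφ.2.1
    rw [integral_apply_coord (integrable_smul' (Lp.memLp q) m1),
      integral_apply_coord (integrable_smul' m2 (Lp.memLp g))]
    simp
  constructor
  · intro h i φ hφ
    rw [← (key φ hφ i).1, ← (key φ hφ i).2, h φ hφ]; rfl
  · intro h φ hφ
    ext i
    rw [(key φ hφ i).1, h i φ hφ, ← (key φ hφ i).2]; rfl

lemma isWeakGrad_of_contDiff {u : Sp n → ℝ} (hu : ContDiff ℝ ∞ u) {q : L2 D} {g : L2V D}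
    (hq : q =ᵐ[volume.restrict D] u) (hg : g =ᵐ[volume.restrict D] gradient u) :
    IsWeakGrad D q g := by
  refine isWeakGrad_iff.2 fun i φ hφ => ?_
  rw [integral_congr_ae (g := fun x => u x * gradient φ x i) (hq.mono fun x hx => by simp [hx]),
    integral_congr_ae (f := fun x => φ x * g x i) (g := fun x => φ x * gradient u x i)
      (hg.mono fun x hx => by simp [hx])]
  exact integral_mul_gradient_test hu hφ i

lemma isWeakGrad_pcls (hD : IsOpen D) (hb : Bornology.IsBounded D) (p : MvPolynomial (Fin n) ℝ) :
    IsWeakGrad D (pcls hD hb p) (pclsV hD hb (pgrad p)) := by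
  refine isWeakGrad_of_contDiff (contDiff_pval p) (coeFn_pcls hD hb p) ?_
  filter_upwards [coeFn_pclsV hD hb (pgrad p)] with x hx
  rw [hx, gradient_pval]

lemma wgrad_pcls (hD : IsOpen D) (hb : Bornology.IsBounded D) (p : MvPolynomial (Fin n) ℝ) :
    wgrad D (pcls hD hb p) = pclsV hD hb (pgrad p) :=
  (isWeakGrad_pcls hD hb p).wgrad_eq hD

lemma pvalV_apply (w : Fin n → MvPolynomial (Fin n) ℝ) (x : Sp n) (i : Fin n) :
    pvalV w x i = pval (w i) x := rfl

lemma gradient_pval_apply (p : MvPolynomial (Fin n) ℝ) (x : Sp n) (i : Fin n) :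
    gradient (pval p) x i = pval (pderiv i p) x := by
  rw [gradient_pval]; rfl

lemma isWeakCurl_pclsV (hD : IsOpen D) (hb : Bornology.IsBounded D)
    (w : Fin n → MvPolynomial (Fin n) ℝ) : IsWeakCurl D (pclsV hD hb w) (pcurl w) := by
  intro i j φ hφ
  have m : ∀ i, Integrable (fun x => φ x * pval (pderiv i (w j)) x) (volume.restrict D) :=
    fun i => integrable_test_pval hφ.1.continuous hφ.2.1 _
  have e : ∫ x in D, ((pclsV hD hb w) x j * gradient φ x i - (pclsV hD hb w) x i * gradient φ x j)
      = ∫ x in D, (pval (w j) x * gradient φ x i - pval (w i) x * gradient φ x j) := by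
    refine integral_congr_ae ?_
    filter_upwards [coeFn_pclsV hD hb w] with x hx
    rw [hx]; rfl
  have m1 := memLp_test (D := D) (cont_gradient hφ.1) (supp_gradient hφ.2.1)
  have J : ∀ i j, Integrable (fun x => pval (w j) x * gradient φ x i) (volume.restrict D) :=
    fun i j => integrable_mul' (memLp_pval hD hb _) (memLp_coord m1 i)
  rw [e, integral_sub (J i j) (J j i), integral_mul_gradient_test (contDiff_pval _) hφ,
    integral_mul_gradient_test (contDiff_pval _) hφ]
  simp_rw [gradient_pval_apply, pcurl, map_sub, Pi.sub_apply, mul_sub]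
  rw [integral_sub (integrable_test_pval hφ.1.continuous hφ.2.1 _)
    (integrable_test_pval hφ.1.continuous hφ.2.1 _)]
  ring

lemma inner_eq_sum (x y : Sp n) : ⟪x, y⟫ = ∑ i, x i * y i := by
  rw [PiLp.inner_apply]
  simp [mul_comm]

lemma isWeakDiv_pclsV (hD : IsOpen D) (hb : Bornology.IsBounded D)
    (w : Fin n → MvPolynomial (Fin n) ℝ) : IsWeakDiv D (pclsV hD hb w) (pcls hD hb (pdiv w)) := by
  intro φ hφ
  have m1 := memLp_test (D := D) (cont_gradient hφ.1) (supp_gradient hφ.2.1)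
  have e : ∫ x in D, ⟪(pclsV hD hb w) x, gradient φ x⟫
      = ∫ x in D, ∑ i, pval (w i) x * gradient φ x i := by
    refine integral_congr_ae ?_
    filter_upwards [coeFn_pclsV hD hb w] with x hx
    rw [hx, inner_eq_sum]; rfl
  have e' : ∫ x in D, φ x * (pcls hD hb (pdiv w)) x
      = ∫ x in D, ∑ i, φ x * pval (pderiv i (w i)) x := by
    refine integral_congr_ae ?_
    filter_upwards [coeFn_pcls hD hb (pdiv w)] with x hx
    rw [hx, pdiv, map_sum, Finset.sum_apply, Finset.mul_sum]
  rw [e, e', integral_finsetSum _ fun i _ => integrable_mul' (memLp_pval hD hb _) (memLp_coord m1 i),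
    integral_finsetSum _ fun i _ => integrable_test_pval hφ.1.continuous hφ.2.1 _,
    ← Finset.sum_neg_distrib]
  refine Finset.sum_congr rfl fun i _ => ?_
  rw [integral_mul_gradient_test (contDiff_pval _) hφ]
  simp_rw [gradient_pval_apply]

end

/-! ### Star-shaped domains; regularization by contraction and mollification -/

section

variable {n : ℕ} {D : Set (Sp n)} {c : Sp n} {r : ℝ}

/-- A bounded open set that is star-shaped with respect to the ball of centre `c` and radius `r`. -/
structure StarDom (D : Set (Sp n)) (c : Sp n) (r : ℝ) : Prop where
  isOpen : IsOpen D
  isBounded : Bornology.IsBounded D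
  nonempty : D.Nonempty
  pos : 0 < r
  star : ∀ y ∈ Metric.ball c r, StarConvex ℝ y D

namespace StarDom

lemma ball_subset (h : StarDom D c r) : Metric.ball c r ⊆ D := by
  intro y hy
  obtain ⟨z, hz⟩ := h.nonempty
  simpa using h.star y hy hz zero_le_one le_rfl (by norm_num)

/-- The ball of star centres absorbs the error: z is replaced by a nearby z' of `D` and y by y +
t/(1-t) (z - z'), which leaves the point y + t (z - y) unchanged and keeps the centre in the ball.
-/
lemma mem_of_mem_closure (h : StarDom D c r) {y z : Sp n} (hy : y ∈ Metric.ball c r)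
    (hz : z ∈ closure D) {t : ℝ} (ht : 0 ≤ t) (ht1 : t < 1) : y + t • (z - y) ∈ D := by
  have h1 : 0 < 1 - t := by linarith
  have hcont : Continuous fun z' : Sp n => y + (t / (1 - t)) • (z - z') := by fun_prop
  have hmem : (fun z' : Sp n => y + (t / (1 - t)) • (z - z')) ⁻¹' Metric.ball c r ∈ 𝓝 z :=
    hcont.continuousAt.preimage_mem_nhds (by
      simpa using Metric.isOpen_ball.mem_nhds hy)
  obtain ⟨z', hz', hz'D⟩ := mem_closure_iff_nhds.1 hz _ hmem
  have := h.star _ hz' hz'D h1.le ht (by ring)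
  convert this using 1
  rw [smul_add, smul_smul, mul_div_cancel₀ _ h1.ne', smul_sub, smul_sub, sub_smul, one_smul]
  abel

lemma isFiniteMeasure (h : StarDom D c r) : IsFiniteMeasure (volume.restrict D) :=
  ⟨by rw [Measure.restrict_apply_univ]; exact h.isBounded.measure_lt_top⟩

end StarDom

/-! ### Regularization -/

/-- The contraction factor used in the regularization. -/
def regScale (j : ℕ) : ℝ := 1 - 1 / (j + 2)

lemma regScale_lt_one (j : ℕ) : regScale j < 1 := by
  unfold regScale
  have : (0 : ℝ) < 1 / (j + 2) := by positivity
  linarith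

/-- The shift by 2 in `regScale` is made for this bound: it keeps the Jacobian of the inverse
contraction below 2ⁿ for all `j`. -/
lemma half_le_regScale (j : ℕ) : 1 / 2 ≤ regScale j := by
  unfold regScale
  have : (1 : ℝ) / (j + 2) ≤ 1 / 2 := by
    apply one_div_le_one_div_of_le <;> [norm_num; skip]
    have : (0 : ℝ) ≤ j := by positivity
    linarith
  linarith

lemma tendsto_regScale : Tendsto regScale atTop (𝓝 1) := by
  have h : Tendsto (fun j : ℕ => (1 : ℝ) / ((j + 2 : ℕ) : ℝ)) atTop (𝓝 0) :=
    (tendsto_const_div_atTop_nhds_zero_nat 1).comp (tendsto_add_atTop_nat 2)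
  have := h.const_sub 1
  have e : regScale = fun j : ℕ => 1 - 1 / ((j + 2 : ℕ) : ℝ) := by ext j; simp [regScale]
  rw [e]
  simpa using this

/-- The bump function used in the regularization. -/
def regBump (n : ℕ) {r : ℝ} (hr : 0 < r) (j : ℕ) : ContDiffBump (0 : Sp n) where
  -- With λ = `regScale j`, the ball of radius (1-λ)r about a point of the contracted closure of `D`
  -- lies in `D`; half of this radius keeps the closed support inside.
  rIn := (1 - regScale j) * r / 4
  rOut := (1 - regScale j) * r / 2
  rIn_pos := by have := regScale_lt_one j; have : 0 < 1 - regScale j := by linarith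
                positivity
  rIn_lt_rOut := by
    have := regScale_lt_one j
    have : 0 < (1 - regScale j) * r := mul_pos (by linarith) hr
    linarith

/-- The mollifier. -/
def regKer (n : ℕ) {r : ℝ} (hr : 0 < r) (j : ℕ) : Sp n → ℝ := (regBump n hr j).normed volume

/-- Contraction towards `c` followed by mollification. -/
def reg {F : Type*} [NormedAddCommGroup F] [NormedSpace ℝ F] (c : Sp n) (hr : 0 < r) (j : ℕ)
    (v : Sp n → F) (x : Sp n) : F :=
  convolution (regKer n hr j) v (ContinuousLinearMap.lsmul ℝ ℝ) volume (c + regScale j • (x - c))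

section reg

variable {F : Type*} [NormedAddCommGroup F] [NormedSpace ℝ F] (hr : 0 < r) (j : ℕ)

lemma contDiff_regKer : ContDiff ℝ ∞ (regKer n hr j) := (regBump n hr j).contDiff_normed

lemma hasCompactSupport_regKer : HasCompactSupport (regKer n hr j) :=
  (regBump n hr j).hasCompactSupport_normed

lemma tsupport_regKer :
    tsupport (regKer n hr j) = Metric.closedBall 0 ((1 - regScale j) * r / 2) :=
  (regBump n hr j).tsupport_normed_eq

lemma regKer_nonneg (x : Sp n) : 0 ≤ regKer n hr j x := (regBump n hr j).nonneg_normed x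

lemma integral_regKer : ∫ x, regKer n hr j x = 1 := (regBump n hr j).integral_normed

lemma lintegral_regKer : ∫⁻ x, ENNReal.ofReal (regKer n hr j x) = 1 := by
  rw [← ofReal_integral_eq_lintegral_ofReal, integral_regKer, ENNReal.ofReal_one]
  · exact (contDiff_regKer hr j).continuous.integrable_of_hasCompactSupport
      (hasCompactSupport_regKer hr j)
  · exact Filter.Eventually.of_forall (regKer_nonneg hr j)

lemma contDiff_reg {v : Sp n → F} (hv : LocallyIntegrable v volume) :
    ContDiff ℝ ∞ (reg c hr j v) := by
  have h1 := (hasCompactSupport_regKer (n := n) hr j).contDiff_convolution_left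
    (ContinuousLinearMap.lsmul ℝ ℝ : ℝ →L[ℝ] F →L[ℝ] F) (n := ⊤) (contDiff_regKer hr j) hv
  have h2 : ContDiff ℝ ∞ fun x : Sp n => c + regScale j • (x - c) := by fun_prop
  exact h1.comp h2

lemma reg_eq (v : Sp n → F) (x : Sp n) :
    reg c hr j v x = ∫ y, regKer n hr j (c + regScale j • (x - c) - y) • v y := by
  unfold reg
  rw [convolution_eq_swap]
  rfl

lemma reg_eq' (v : Sp n → F) (x : Sp n) :
    reg c hr j v x = ∫ y, regKer n hr j y • v (c + regScale j • (x - c) - y) := rfl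

lemma integrable_regKer_smul {v : Sp n → F} (hv : LocallyIntegrable v volume) (X : Sp n) :
    Integrable fun y => regKer n hr j y • v (X - y) := by
  have := (hasCompactSupport_regKer (n := n) hr j).convolutionExists_left
    (ContinuousLinearMap.lsmul ℝ ℝ : ℝ →L[ℝ] F →L[ℝ] F) (contDiff_regKer hr j).continuous hv X
  exact this

lemma reg_sub {v w : Sp n → F} (hv : LocallyIntegrable v volume) (hw : LocallyIntegrable w volume)
    (x : Sp n) : reg c hr j (v - w) x = reg c hr j v x - reg c hr j w x := by
  rw [reg_eq', reg_eq', reg_eq', ← integral_sub (integrable_regKer_smul hr j hv _)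
    (integrable_regKer_smul hr j hw _)]
  simp [smul_sub]

lemma reg_coord {v : Sp n → Sp n} (hv : LocallyIntegrable v volume) (x : Sp n) (i : Fin n) :
    reg c hr j v x i = reg c hr j (fun y => v y i) x := by
  rw [reg_eq', reg_eq', integral_apply_coord (integrable_regKer_smul hr j hv _)]
  rfl

end reg

/-- Cauchy–Schwarz against the constant 1, which has norm one on a probability space. -/
lemma sq_lintegral_le {α : Type*} [MeasurableSpace α] {μ : Measure α} [IsProbabilityMeasure μ]
    {f : α → ENNReal} (hf : AEMeasurable f μ) : (∫⁻ x, f x ∂μ) ^ 2 ≤ ∫⁻ x, f x ^ 2 ∂μ := by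
  have h := ENNReal.lintegral_mul_le_Lp_mul_Lq μ Real.HolderConjugate.two_two hf
    (aemeasurable_const (b := (1 : ENNReal)))
  simp only [Pi.mul_apply, mul_one, ENNReal.one_rpow, lintegral_const, measure_univ] at h
  calc (∫⁻ x, f x ∂μ) ^ 2 ≤ ((∫⁻ x, f x ^ (2 : ℝ) ∂μ) ^ (1 / 2 : ℝ)) ^ 2 := by gcongr
    _ = ∫⁻ x, f x ^ 2 ∂μ := by
      rw [← ENNReal.rpow_natCast, ← ENNReal.rpow_mul]
      norm_num

lemma lintegral_comp_add_smul (G : Sp n → ENNReal) (hG : Measurable G) (a : Sp n) {t : ℝ}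
    (ht : t ≠ 0) : ∫⁻ x, G (a + t • x) = ENNReal.ofReal |(t ^ n)⁻¹| * ∫⁻ x, G x := by
  have h1 : ∫⁻ x, G (a + t • x) = ∫⁻ x, (fun z => G (a + z)) x ∂(Measure.map (fun x => t • x) volume) := by
    exact (lintegral_map (hG.comp (measurable_const_add a)) (measurable_const_smul t)).symm
  rw [h1, Measure.map_addHaar_smul volume ht, lintegral_smul_measure, lintegral_add_left_eq_self,
    finrank_euclideanSpace_fin]
  rfl

lemma eLpNorm_two_sq {α F : Type*} [MeasurableSpace α] [NormedAddCommGroup F] (μ : Measure α)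
    (f : α → F) : eLpNorm f 2 μ ^ 2 = ∫⁻ x, ‖f x‖ₑ ^ 2 ∂μ := by
  have := eLpNorm_nnreal_pow_eq_lintegral (f := f) (μ := μ) (p := 2) (by norm_num)
  simpa using this

lemma memLp_two_locallyIntegrable {F : Type*} [NormedAddCommGroup F] {v : Sp n → F}
    (hv : MemLp v 2 volume) : LocallyIntegrable v volume := hv.locallyIntegrable (by norm_num)

/-- The mollifier is a probability density, so |reg v|² is at most the average of the translates of
|v|² at the contracted point. Tonelli's theorem and the change of variables x ↦ λx leave the factor
λ⁻ⁿ ≤ 2ⁿ. -/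
lemma lintegral_reg_sq_le {F : Type*} [NormedAddCommGroup F] [NormedSpace ℝ F] (hr : 0 < r) (j : ℕ)
    {v : Sp n → F} (hv : MemLp v 2 volume) :
    ∫⁻ x, ‖reg c hr j v x‖ₑ ^ 2 ≤ 2 ^ n * ∫⁻ x, ‖v x‖ₑ ^ 2 := by
  have hlam : regScale j ≠ 0 := by have := half_le_regScale j; positivity
  -- A strongly measurable representative is needed for Tonelli's theorem; the regularization does
  -- not see the change on a null set.
  obtain ⟨v', hv'm, hvv'⟩ := hv.1
  have hreg : ∀ x, reg c hr j v x = reg c hr j v' x := by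
    intro x
    rw [reg_eq, reg_eq]
    refine integral_congr_ae (hvv'.mono fun y hy => ?_)
    simp [hy]
  have hintg : ∫⁻ x, ‖v x‖ₑ ^ 2 = ∫⁻ x, ‖v' x‖ₑ ^ 2 :=
    lintegral_congr_ae (hvv'.mono fun y hy => by simp [hy])
  have hN : Measurable fun x => ‖v' x‖ₑ ^ 2 := hv'm.enorm.pow_const 2
  simp_rw [hreg]
  rw [hintg]
  let ν : Measure (Sp n) := volume.withDensity fun y => ENNReal.ofReal (regKer n hr j y)
  have hker : Measurable fun y : Sp n => ENNReal.ofReal (regKer n hr j y) :=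
    (contDiff_regKer hr j).continuous.measurable.ennreal_ofReal
  have hν : IsProbabilityMeasure ν := ⟨by
    rw [withDensity_apply _ MeasurableSet.univ, Measure.restrict_univ, lintegral_regKer]⟩
  have key : ∀ x, ‖reg c hr j v' x‖ₑ ^ 2
      ≤ ∫⁻ y, ‖v' (c + regScale j • (x - c) - y)‖ₑ ^ 2 ∂ν := by
    intro x
    have hm : Measurable fun y => ‖v' (c + regScale j • (x - c) - y)‖ₑ :=
      (hv'm.enorm).comp (measurable_const.sub measurable_id)
    refine le_trans ?_ (sq_lintegral_le hm.aemeasurable)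
    gcongr
    rw [lintegral_withDensity_eq_lintegral_mul _ hker hm, reg_eq']
    refine (enorm_integral_le_lintegral_enorm _).trans (le_of_eq ?_)
    refine lintegral_congr fun y => ?_
    rw [enorm_smul, Pi.mul_apply, Real.enorm_of_nonneg (regKer_nonneg hr j y)]
  calc ∫⁻ x, ‖reg c hr j v' x‖ₑ ^ 2
      ≤ ∫⁻ x, ∫⁻ y, ‖v' (c + regScale j • (x - c) - y)‖ₑ ^ 2 ∂ν := lintegral_mono key
    _ = ∫⁻ y, (∫⁻ x, ‖v' (c + regScale j • (x - c) - y)‖ₑ ^ 2) ∂ν := by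
      refine lintegral_lintegral_swap (f := fun x y => ‖v' (c + regScale j • (x - c) - y)‖ₑ ^ 2) ?_
      refine Measurable.aemeasurable ?_
      have : Measurable fun z : Sp n × Sp n => c + regScale j • (z.1 - c) - z.2 := by fun_prop
      exact hN.comp this
    _ ≤ ∫⁻ _, (2 ^ n * ∫⁻ x, ‖v' x‖ₑ ^ 2) ∂ν := by
      refine lintegral_mono fun y => ?_
      have e : ∀ x, c + regScale j • (x - c) - y = (c - regScale j • c - y) + regScale j • x := by
        intro x; rw [smul_sub]; abel
      simp_rw [e]
      rw [lintegral_comp_add_smul _ hN _ hlam]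
      gcongr
      rw [abs_inv, abs_pow, ENNReal.ofReal_inv_of_pos (by positivity)]
      rw [ENNReal.inv_le_iff_inv_le, ENNReal.inv_pow, ENNReal.ofReal_pow (abs_nonneg _)]
      gcongr
      have h2 : (2 : ENNReal)⁻¹ = ENNReal.ofReal (1 / 2) := by
        rw [one_div, ENNReal.ofReal_inv_of_pos two_pos]; norm_num
      rw [h2]
      exact ENNReal.ofReal_le_ofReal ((half_le_regScale j).trans (le_abs_self _))
    _ = 2 ^ n * ∫⁻ x, ‖v' x‖ₑ ^ 2 := by simp

lemma eLpNorm_reg_le {F : Type*} [NormedAddCommGroup F] [NormedSpace ℝ F] (hr : 0 < r) (j : ℕ)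
    {v : Sp n → F} (hv : MemLp v 2 volume) :
    eLpNorm (reg c hr j v) 2 volume ≤ 2 ^ n * eLpNorm v 2 volume := by
  have h := lintegral_reg_sq_le (c := c) hr j hv
  rw [← eLpNorm_two_sq, ← eLpNorm_two_sq] at h
  refine (ENNReal.pow_le_pow_left_iff two_ne_zero).1 (h.trans ?_)
  rw [mul_pow]
  exact mul_le_mul' (le_self_pow₀ (one_le_pow₀ (by norm_num)) two_ne_zero) le_rfl

/-- A density argument: v is approximated by a continuous compactly supported g. The error v - g is
controlled by the uniform bound `eLpNorm_reg_le`, and g itself by uniform continuity on the bounded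
set `D`. -/
lemma tendsto_reg {F : Type*} [NormedAddCommGroup F] [NormedSpace ℝ F] [CompleteSpace F]
    (h : StarDom D c r) {v : Sp n → F} (hv : MemLp v 2 volume) :
    Tendsto (fun j => eLpNorm (fun x => reg c h.pos j v x - v x) 2 (volume.restrict D))
      atTop (𝓝 0) := by
  have := h.isFiniteMeasure
  rw [ENNReal.tendsto_nhds_zero]
  intro ε hε
  rcases eq_or_ne ε ⊤ with rfl | hεt
  · simp
  -- The approximation error δ counts twice: once as it is and once after regularization, which
  -- multiplies it by at most 2ⁿ.
  obtain ⟨δ, hδ, hδε⟩ : ∃ δ : ENNReal, δ ≠ 0 ∧ 2 ^ n * δ + δ ≤ ε / 2 := by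
    refine ⟨ε / 2 / (2 ^ n + 1), ?_, ?_⟩
    · simp [hε.ne', ENNReal.div_eq_zero_iff]
    · rw [← add_one_mul]
      exact ENNReal.mul_div_le
  obtain ⟨g, hgs, hvg, hgc, hgm⟩ := hv.exists_hasCompactSupport_eLpNorm_sub_le (by norm_num) hδ
  obtain ⟨η, hη, hηε⟩ : ∃ η : ℝ, 0 < η ∧
      (volume.restrict D) Set.univ ^ (2 : ENNReal).toReal⁻¹ * ENNReal.ofReal η ≤ ε / 2 := by
    have hA : (volume.restrict D) Set.univ ^ (2 : ENNReal).toReal⁻¹ ≠ ⊤ := by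
      refine ENNReal.rpow_ne_top_of_nonneg (by positivity) (measure_ne_top _ _)
    have hcont : Tendsto (fun η : ℝ => (volume.restrict D) Set.univ ^ (2 : ENNReal).toReal⁻¹
        * ENNReal.ofReal η) (𝓝[>] 0) (𝓝 0) := by
      have h0 : Tendsto (fun η : ℝ => ENNReal.ofReal η) (𝓝 0) (𝓝 0) := by
        simpa using (ENNReal.continuous_ofReal.tendsto 0)
      simpa using (ENNReal.Tendsto.const_mul h0 (Or.inr hA)).mono_left nhdsWithin_le_nhds
    have hev := (ENNReal.tendsto_nhds_zero.1 hcont (ε / 2) (by simp [hε.ne'])).and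
      self_mem_nhdsWithin
    obtain ⟨η, h1, h2⟩ := hev.exists
    exact ⟨η, h2, h1⟩
  have hunif := hgs.uniformContinuous_of_continuous hgc
  obtain ⟨d, hd, hdg⟩ := Metric.uniformContinuous_iff.1 hunif (η / 2) (by positivity)
  obtain ⟨R, hR⟩ := h.isBounded.subset_closedBall c
  -- The contraction moves a point of `D` by at most (1-λ)|R| and the mollifier looks (1-λ)r/2
  -- further; this one quantity bounds both displacements.
  have hsc : ∀ᶠ j in atTop, (1 - regScale j) * (r + |R| + 1) < d := by
    have : Tendsto (fun j => (1 - regScale j) * (r + |R| + 1)) atTop (𝓝 0) := by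
      have := (tendsto_regScale.const_sub 1).mul_const (r + |R| + 1)
      simpa using this
    exact this.eventually_lt_const hd
  filter_upwards [hsc] with j hj
  have hl := regScale_lt_one j
  have hl0 : 0 < 1 - regScale j := by linarith
  have hr := h.pos
  have hclose : ∀ x ∈ D, ‖reg c h.pos j g x - g x‖ ≤ η := by
    intro x hx
    have hxR : dist x c ≤ |R| := (Metric.mem_closedBall.1 (hR hx)).trans (le_abs_self R)
    have hX : dist (c + regScale j • (x - c)) x < d := by
      have e : c + regScale j • (x - c) - x = -((1 - regScale j) • (x - c)) := by
        rw [sub_smul, one_smul]; abel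
      rw [dist_eq_norm, e, norm_neg, norm_smul, Real.norm_of_nonneg hl0.le, ← dist_eq_norm]
      refine lt_of_le_of_lt ?_ hj
      gcongr
      linarith
    have h1 : dist (reg c h.pos j g x) (g (c + regScale j • (x - c))) ≤ η / 2 := by
      refine ContDiffBump.dist_normed_convolution_le hgc.aestronglyMeasurable fun y hy => ?_
      refine (hdg ?_).le
      have : (regBump n h.pos j).rOut = (1 - regScale j) * r / 2 := rfl
      rw [Metric.mem_ball, this] at hy
      refine hy.trans (lt_of_le_of_lt ?_ hj)
      have : 0 ≤ (1 - regScale j) * (|R| + 1) := by positivity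
      have : 0 ≤ (1 - regScale j) * r := by positivity
      nlinarith
    have h2 : dist (g (c + regScale j • (x - c))) (g x) ≤ η / 2 := (hdg hX).le
    rw [← dist_eq_norm]
    exact (dist_triangle _ _ _).trans (by linarith)
  have hvl := memLp_two_locallyIntegrable hv
  have hgl := memLp_two_locallyIntegrable hgm
  have e : (fun x => reg c h.pos j v x - v x)
      = (fun x => reg c h.pos j (v - g) x - (v - g) x) + fun x => reg c h.pos j g x - g x := by
    ext x
    simp only [Pi.add_apply, Pi.sub_apply]
    rw [reg_sub h.pos j hvl hgl]; abel
  have mreg : ∀ {w : Sp n → F}, LocallyIntegrable w volume →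
      AEStronglyMeasurable (reg c h.pos j w) volume :=
    fun hw => (contDiff_reg h.pos j hw).continuous.aestronglyMeasurable
  rw [e]
  refine (eLpNorm_add_le ?_ ?_ (by norm_num)).trans ?_
  · exact ((mreg (hvl.sub hgl)).sub (hv.1.sub hgm.1)).restrict
  · exact ((mreg hgl).sub hgm.1).restrict
  rw [← ENNReal.add_halves ε]
  refine add_le_add ?_ ?_
  · refine (eLpNorm_mono_measure _ Measure.restrict_le_self).trans ?_
    refine le_trans (eLpNorm_sub_le (mreg (hvl.sub hgl)) (hv.1.sub hgm.1) (by norm_num)) ?_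
    refine le_trans ?_ hδε
    refine add_le_add ((eLpNorm_reg_le h.pos j (hv.sub hgm)).trans ?_) hvg
    gcongr
  · refine (eLpNorm_le_of_ae_bound (C := η) ?_).trans hηε
    filter_upwards [ae_restrict_mem h.isOpen.measurableSet] with x hx
    exact hclose x hx

end

/-! ### Density of smooth functions in H¹ and Poincaré's inequality -/

section

variable {n : ℕ} {D : Set (Sp n)} {c : Sp n} {r : ℝ}

lemma exists_cutoff (hb : Bornology.IsBounded D) : ∃ χ : Sp n → ℝ, IsTest Set.univ χ ∧
    ∃ U, IsOpen U ∧ D ⊆ U ∧ ∀ x ∈ U, χ x = 1 := by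
  obtain ⟨R, hR⟩ := hb.subset_ball 0
  let f : ContDiffBump (0 : Sp n) := ⟨|R| + 1, |R| + 2, by positivity, by linarith⟩
  refine ⟨f, ⟨f.contDiff, f.hasCompactSupport, Set.subset_univ _⟩, Metric.ball 0 R,
    Metric.isOpen_ball, hR, fun x hx => f.one_of_mem_closedBall ?_⟩
  rw [Metric.mem_closedBall]
  have := Metric.mem_ball.1 hx
  have := le_abs_self R
  linarith

lemma gradient_congr {u v : Sp n → ℝ} {U : Set (Sp n)} (hU : IsOpen U) (h : Set.EqOn u v U)
    {x : Sp n} (hx : x ∈ U) : gradient u x = gradient v x := by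
  unfold gradient
  rw [Filter.EventuallyEq.fderiv_eq (h.eventuallyEq_of_mem (hU.mem_nhds hx))]

/-- Every smooth function coincides on a bounded set with a test function. -/
lemma exists_test_eqOn (hb : Bornology.IsBounded D) {u : Sp n → ℝ}
    (hu : ContDiff ℝ ∞ u) : ∃ φ, IsTest Set.univ φ ∧ (∃ U, IsOpen U ∧ closure D ⊆ U ∧
      Set.EqOn φ u U) ∧ Set.EqOn (gradient φ) (gradient u) D := by
  obtain ⟨χ, hχ, U, hU, hDU, h1⟩ := exists_cutoff hb.closure
  have he : Set.EqOn (fun x => χ x * u x) u U := fun x hx => by simp [h1 x hx]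
  exact ⟨fun x => χ x * u x, ⟨hχ.1.mul hu, hχ.2.1.mul_right, Set.subset_univ _⟩, ⟨U, hU, hDU, he⟩,
    fun x hx => gradient_congr hU he (hDU (subset_closure hx))⟩

/-! ### Derivatives of the regularization -/

/-- The points at which the regularization only sees the values in `D`. -/
def regSet (D : Set (Sp n)) (c : Sp n) (r : ℝ) (j : ℕ) : Set (Sp n) :=
  {x | Metric.closedBall (c + regScale j • (x - c)) ((1 - regScale j) * r / 2) ⊆ D}

/-- A point y of the small ball about the contraction X of x is the convex combination, with weights
1-λ and λ, of c + (y - X)/(1-λ) and x. The former is a star centre by the choice of the radius, so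
`mem_of_mem_closure` applies. -/
lemma StarDom.closure_subset_regSet (h : StarDom D c r) (j : ℕ) :
    closure D ⊆ regSet D c r j := by
  intro x hx y hy
  have hl := regScale_lt_one j
  have hl0 : 0 < 1 - regScale j := by linarith
  have hr := h.pos
  have hl2 := half_le_regScale j
  set X := c + regScale j • (x - c) with hX
  have hy' : c + (1 - regScale j)⁻¹ • (y - X) ∈ Metric.ball c r := by
    rw [Metric.mem_ball, dist_eq_norm, add_sub_cancel_left, norm_smul, norm_inv,
      Real.norm_of_nonneg hl0.le]
    have := Metric.mem_closedBall.1 hy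
    rw [dist_eq_norm] at this
    have h2 : (1 - regScale j)⁻¹ * ‖y - X‖ ≤ (1 - regScale j)⁻¹ * ((1 - regScale j) * r / 2) := by
      gcongr
    have h3 : (1 - regScale j)⁻¹ * ((1 - regScale j) * r / 2) = r / 2 := by field_simp
    linarith
  have := h.mem_of_mem_closure hy' hx (by linarith) hl
  convert this using 1
  have e : ∀ z : Sp n, z + regScale j • (x - z) = (1 - regScale j) • z + regScale j • x := by
    intro z; rw [sub_smul, one_smul, smul_sub]; abel
  rw [e, smul_add, smul_inv_smul₀ hl0.ne', hX, sub_smul, one_smul, smul_sub]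
  abel

lemma isOpen_regSet (hD : IsOpen D) (j : ℕ) : IsOpen (regSet D c r j) := by
  have h1 : IsOpen {X : Sp n | Metric.closedBall X ((1 - regScale j) * r / 2) ⊆ D} := by
    rw [Metric.isOpen_iff]
    intro X hX
    obtain ⟨δ, hδ, hsub⟩ := (isCompact_closedBall X ((1 - regScale j) * r / 2)).exists_thickening_subset_open
      hD hX
    refine ⟨δ, hδ, fun X' hX' y hy => hsub ?_⟩
    rw [Metric.mem_thickening_iff]
    refine ⟨y - (X' - X), ?_, ?_⟩
    · rw [Metric.mem_closedBall, dist_eq_norm] at hy ⊢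
      convert hy using 2; abel
    · rw [Metric.mem_ball, dist_eq_norm] at hX'
      rw [dist_eq_norm]
      convert hX' using 2; abel
  have h2 : Continuous fun x : Sp n => c + regScale j • (x - c) := by fun_prop
  exact h1.preimage h2

/-- Moving x towards c moves the small ball with it: a point of the new ball with offset z from its
centre is a convex combination of the star centre c + z and the point X + z of the old ball. The
radial potential of a regularized field is built on this set. -/
lemma StarDom.starConvex_regSet (h : StarDom D c r) (j : ℕ) :
    StarConvex ℝ c (regSet D c r j) := by
  intro x hx a b ha hb hab y hy
  have hl := regScale_lt_one j
  have hl2 := half_le_regScale j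
  have hr := h.pos
  set X := c + regScale j • (x - c) with hX
  set z := y - (c + regScale j • (a • c + b • x - c)) with hz
  have hzn : ‖z‖ ≤ (1 - regScale j) * r / 2 := by
    have := Metric.mem_closedBall.1 hy
    rwa [dist_eq_norm] at this
  have h1 : X + z ∈ D := hx (by rw [Metric.mem_closedBall, dist_eq_norm, add_sub_cancel_left]; exact hzn)
  have h2 : c + z ∈ Metric.ball c r := by
    rw [Metric.mem_ball, dist_eq_norm, add_sub_cancel_left]
    nlinarith
  have := h.star _ h2 h1 ha hb hab
  convert this using 1
  have ha' : a = 1 - b := by linarith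
  have : y = z + (c + regScale j • (a • c + b • x - c)) := by rw [hz]; abel
  rw [this, hX, ha']
  simp only [smul_add, smul_sub, sub_smul, one_smul]
  rw [smul_comm b (regScale j) x, smul_comm b (regScale j) c]
  abel

lemma gradient_comp_const_sub {f : Sp n → ℝ} (hf : ContDiff ℝ ∞ f) (X y : Sp n) :
    gradient (fun y => f (X - y)) y = - gradient f (X - y) := by
  unfold gradient
  have h1 : HasFDerivAt (fun y : Sp n => X - y) (-ContinuousLinearMap.id ℝ (Sp n)) y :=
    (hasFDerivAt_id y).const_sub X
  have h2 := ((hf.differentiable (by simp) (X - y)).hasFDerivAt).comp y h1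
  have h3 : (fun y => f (X - y)) = f ∘ fun y => X - y := rfl
  rw [h3, h2.fderiv, ContinuousLinearMap.comp_neg, ContinuousLinearMap.comp_id, map_neg]

/-- At such points the translated kernel is an admissible test function on `D`, so that weak
identities on `D` become pointwise identities for the derivatives of the regularization. -/
lemma isTest_regKer (hr : 0 < r) (j : ℕ) {x : Sp n} (hx : x ∈ regSet D c r j) :
    IsTest D fun y => regKer n hr j (c + regScale j • (x - c) - y) := by
  set X := c + regScale j • (x - c) with hX
  refine ⟨(contDiff_regKer hr j).comp (by fun_prop), ?_, ?_⟩
  · exact (hasCompactSupport_regKer hr j).comp_homeomorph (Homeomorph.subLeft X)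
  · refine subset_trans ?_ hx
    have : tsupport (fun y => regKer n hr j (X - y)) ⊆ (fun y => X - y) ⁻¹' tsupport (regKer n hr j) :=
      tsupport_comp_subset_preimage (regKer n hr j) (f := fun y => X - y) (by fun_prop)
    refine this.trans fun y hy => ?_
    rw [Set.mem_preimage, tsupport_regKer, mem_closedBall_zero_iff] at hy
    rwa [Metric.mem_closedBall, dist_comm, dist_eq_norm]

lemma gradient_reg (hr : 0 < r) (j : ℕ) {q : Sp n → ℝ} (hq : LocallyIntegrable q volume) (x : Sp n)
    (i : Fin n) : gradient (reg c hr j q) x i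
      = regScale j * ∫ y, gradient (regKer n hr j) (c + regScale j • (x - c) - y) i * q y := by
  rw [gradient_apply]
  set X := c + regScale j • (x - c) with hX
  have hk1 := (contDiff_regKer (n := n) hr j)
  have h1 := (hasCompactSupport_regKer (n := n) hr j).hasFDerivAt_convolution_left
    (ContinuousLinearMap.lsmul ℝ ℝ : ℝ →L[ℝ] ℝ →L[ℝ] ℝ) (hk1.of_le (by simp)) hq X
  have h2 : HasFDerivAt (fun x : Sp n => c + regScale j • (x - c))
      (regScale j • ContinuousLinearMap.id ℝ (Sp n)) x :=
    (((hasFDerivAt_id x).sub_const c).const_smul (regScale j)).const_add c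
  have h3 := h1.comp x h2
  have e : reg c hr j q = convolution (regKer n hr j) q (ContinuousLinearMap.lsmul ℝ ℝ) volume
      ∘ fun x => c + regScale j • (x - c) := rfl
  rw [e, h3.fderiv, ContinuousLinearMap.comp_apply]
  simp only [_root_.smul_apply, ContinuousLinearMap.id_apply, map_smul, smul_eq_mul]
  congr 1
  have hex := ((hasCompactSupport_regKer (n := n) hr j).fderiv (𝕜 := ℝ)).convolutionExists_left
    ((ContinuousLinearMap.lsmul ℝ ℝ : ℝ →L[ℝ] ℝ →L[ℝ] ℝ).precompL (Sp n))
    (hk1.continuous_fderiv (by simp)) hq X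
  rw [convolution_eq_swap, ContinuousLinearMap.integral_apply hex.integrable_swap]
  refine integral_congr_ae (Filter.Eventually.of_forall fun y => ?_)
  simp only [ContinuousLinearMap.precompL_apply, ContinuousLinearMap.lsmul_apply, smul_eq_mul,
    gradient_apply]

lemma memLp_indicator {F : Type*} [NormedAddCommGroup F] (hD : MeasurableSet D)
    (v : Lp F 2 (volume.restrict D)) : MemLp (D.indicator v) 2 volume :=
  (memLp_indicator_iff_restrict hD).2 (Lp.memLp v)

lemma integral_mul_indicator (hD : MeasurableSet D) (u q : Sp n → ℝ) :
    ∫ y, u y * D.indicator q y = ∫ y in D, u y * q y := by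
  rw [← integral_indicator hD]
  congr 1; ext y
  by_cases hy : y ∈ D <;> simp [hy]

/-- Testing the weak gradient with the translated kernel moves the derivative from the kernel to
`q`; the factor `regScale j` comes from the chain rule for the contraction. -/
lemma gradient_reg_of_isWeakGrad (hD : IsOpen D) (hr : 0 < r) (j : ℕ) {q : L2 D} {g : L2V D}
    (h : IsWeakGrad D q g) {x : Sp n} (hx : x ∈ regSet D c r j) :
    gradient (reg c hr j (D.indicator q)) x = regScale j • reg c hr j (D.indicator g) x := by
  have hm := hD.measurableSet
  refine PiLp.ext fun i => ?_
  rw [gradient_reg hr j (memLp_two_locallyIntegrable (memLp_indicator hm q)), PiLp.smul_apply,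
    reg_coord hr j (memLp_two_locallyIntegrable (memLp_indicator hm g)), smul_eq_mul, reg_eq]
  congr 1
  have e : ∀ y, D.indicator g y i = D.indicator (fun y => g y i) y := by
    intro y
    by_cases hy : y ∈ D <;> simp [hy]
  simp_rw [e, smul_eq_mul]
  rw [integral_mul_indicator hm, integral_mul_indicator hm]
  have := isWeakGrad_iff.1 h i _ (isTest_regKer hr j hx)
  simp_rw [gradient_comp_const_sub (contDiff_regKer hr j)] at this
  rw [eq_neg_iff_add_eq_zero, ← sub_neg_eq_add, sub_eq_zero, ← integral_neg] at this
  rw [← neg_inj, ← integral_neg, ← integral_neg, ← this]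
  refine integral_congr_ae (Filter.Eventually.of_forall fun y => ?_)
  simp [mul_comm]

/-- Test functions are dense in `H¹` of a star-shaped domain. -/
theorem StarDom.exists_test_tendsto (h : StarDom D c r) {q : L2 D} {g : L2V D}
    (hq : IsWeakGrad D q g) : ∃ φ : ℕ → Sp n → ℝ, (∀ j, IsTest Set.univ (φ j)) ∧
      Tendsto (fun j => eLpNorm (fun x => φ j x - q x) 2 (volume.restrict D)) atTop (𝓝 0) ∧
      Tendsto (fun j => eLpNorm (fun x => gradient (φ j) x - g x) 2 (volume.restrict D))
        atTop (𝓝 0) := by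
  have hm := h.isOpen.measurableSet
  have hqi := memLp_indicator hm q
  have hgi := memLp_indicator hm g
  have hex := fun j => exists_test_eqOn h.isBounded
    (contDiff_reg (c := c) h.pos j (memLp_two_locallyIntegrable hqi))
  choose φ hφ hU hgrad using hex
  refine ⟨φ, hφ, ?_, ?_⟩
  · refine (tendsto_reg h hqi).congr fun j => eLpNorm_congr_ae ?_
    filter_upwards [ae_restrict_mem hm] with x hx
    obtain ⟨U, _, hDU, he⟩ := hU j
    rw [he (hDU (subset_closure hx)), Set.indicator_of_mem hx]
  · have h1 := tendsto_reg h hgi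
    -- The gradient of the regularization is λ · reg g, so its error splits into λ (reg g - g) and
    -- (λ - 1) g, and both tend to zero.
    have h2 : Tendsto (fun j => eLpNorm (fun x => (regScale j - 1) • g x) 2 (volume.restrict D))
        atTop (𝓝 0) := by
      have e : ∀ j, eLpNorm (fun x => (regScale j - 1) • g x) 2 (volume.restrict D)
          = ‖regScale j - 1‖ₑ * eLpNorm g 2 (volume.restrict D) := fun j => by
        rw [← eLpNorm_const_smul]; rfl
      simp_rw [e]
      have h3 : Tendsto (fun j => ‖regScale j - 1‖ₑ) atTop (𝓝 0) := by
        have := (tendsto_regScale.sub_const 1).enorm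
        simpa using this
      simpa using ENNReal.Tendsto.mul_const h3 (Or.inr (Lp.eLpNorm_ne_top g))
    have h3 := h1.add h2
    rw [add_zero] at h3
    refine tendsto_of_tendsto_of_tendsto_of_le_of_le tendsto_const_nhds h3 (fun _ => bot_le) ?_
    intro j
    have hl := regScale_lt_one j
    have hl2 := half_le_regScale j
    have mreg := (contDiff_reg (c := c) h.pos j
      (memLp_two_locallyIntegrable hgi)).continuous.aestronglyMeasurable (μ := volume)
    have e : eLpNorm (fun x => gradient (φ j) x - g x) 2 (volume.restrict D)
        = eLpNorm ((fun x => regScale j • (reg c h.pos j (D.indicator g) x - D.indicator g x))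
          + fun x => (regScale j - 1) • g x) 2 (volume.restrict D) := by
      refine eLpNorm_congr_ae ?_
      filter_upwards [ae_restrict_mem hm] with x hx
      rw [hgrad j hx, gradient_reg_of_isWeakGrad h.isOpen h.pos j hq
        (h.closure_subset_regSet j (subset_closure hx)), Pi.add_apply, Set.indicator_of_mem hx,
        smul_sub, sub_smul, one_smul]
      abel
    change eLpNorm (fun x => gradient (φ j) x - g x) 2 (volume.restrict D) ≤ _
    rw [e]
    refine (eLpNorm_add_le ?_ ?_ (by norm_num)).trans (add_le_add ?_ le_rfl)
    · exact ((mreg.sub hgi.1).const_smul (regScale j)).restrict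
    · exact (Lp.aestronglyMeasurable g).const_smul (regScale j - 1)
    · refine eLpNorm_mono fun x => ?_
      rw [norm_smul, Real.norm_of_nonneg (by linarith)]
      exact mul_le_of_le_one_left (norm_nonneg _) hl.le

/-! ### Poincaré's inequality -/

lemma norm_gradient (φ : Sp n → ℝ) (x : Sp n) : ‖gradient φ x‖ = ‖fderiv ℝ φ x‖ := by
  unfold gradient; exact LinearIsometryEquiv.norm_map _ _

/-- The fundamental theorem of calculus along the segment from y to x, followed by the inequality of
Cauchy–Schwarz on [0, 1]. -/
lemma enorm_sub_sq_le {φ : Sp n → ℝ} (hφ : ContDiff ℝ ∞ φ) (x y : Sp n) {L : ℝ}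
    (hL : ‖x - y‖ ≤ L) : ‖φ x - φ y‖ₑ ^ 2 ≤
      ENNReal.ofReal L ^ 2 * ∫⁻ t in Set.Ioc (0 : ℝ) 1, ‖gradient φ (y + t • (x - y))‖ₑ ^ 2 := by
  have hder : ∀ t : ℝ, HasDerivAt (fun t : ℝ => φ (y + t • (x - y)))
      (fderiv ℝ φ (y + t • (x - y)) (x - y)) t := by
    intro t
    have h1 : HasDerivAt (fun t : ℝ => y + t • (x - y)) (x - y) t := by
      have := ((hasDerivAt_id t).smul_const (x - y)).const_add y
      simpa using this
    exact ((hφ.differentiable (by simp) _).hasFDerivAt).comp_hasDerivAt t h1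
  have hc : Continuous fun t : ℝ => fderiv ℝ φ (y + t • (x - y)) :=
    (hφ.continuous_fderiv (by simp)).comp (by fun_prop)
  have hc' : Continuous fun t : ℝ => fderiv ℝ φ (y + t • (x - y)) (x - y) := by fun_prop
  have hintg := intervalIntegral.integral_eq_sub_of_hasDerivAt (a := 0) (b := 1)
    (fun t _ => hder t) (hc'.intervalIntegrable 0 1)
  simp only [one_smul, zero_smul, add_zero, add_sub_cancel] at hintg
  have hprob : IsProbabilityMeasure (volume.restrict (Set.Ioc (0 : ℝ) 1)) :=
    ⟨by simp⟩
  have hg : Continuous fun t : ℝ => gradient φ (y + t • (x - y)) :=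
    (cont_gradient hφ).comp (by fun_prop)
  have hmeas : AEMeasurable (fun t : ℝ => ‖gradient φ (y + t • (x - y))‖ₑ)
      (volume.restrict (Set.Ioc (0 : ℝ) 1)) := hg.enorm.measurable.aemeasurable
  calc ‖φ x - φ y‖ₑ ^ 2
      ≤ (ENNReal.ofReal L * ∫⁻ t in Set.Ioc (0 : ℝ) 1, ‖gradient φ (y + t • (x - y))‖ₑ) ^ 2 := by
        gcongr
        rw [← hintg, intervalIntegral.integral_of_le zero_le_one,
          ← lintegral_const_mul' _ _ ENNReal.ofReal_ne_top]
        refine (enorm_integral_le_lintegral_enorm _).trans (lintegral_mono fun t => ?_)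
        rw [← ofReal_norm, ← ofReal_norm, ← ENNReal.ofReal_mul ((norm_nonneg _).trans hL)]
        refine ENNReal.ofReal_le_ofReal ?_
        rw [norm_gradient, mul_comm]
        exact (ContinuousLinearMap.le_opNorm _ _).trans (by gcongr)
    _ ≤ _ := by
        rw [mul_pow]
        gcongr
        exact sq_lintegral_le hmeas

lemma ofReal_abs_inv_pow_le {t : ℝ} (ht : 1 / 2 ≤ t) : ENNReal.ofReal |(t ^ n)⁻¹| ≤ 2 ^ n := by
  have h0 : 0 < t := by linarith
  have h : |(t ^ n)⁻¹| ≤ 2 ^ n := by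
    rw [abs_of_pos (by positivity), ← inv_pow]
    gcongr
    rw [inv_le_comm₀ h0 two_pos]
    linarith
  refine (ENNReal.ofReal_le_ofReal h).trans (le_of_eq ?_)
  rw [ENNReal.ofReal_pow zero_le_two]; norm_num

/-- The map (y, x) ↦ y + t (x - y) degenerates in x at t = 0 and in y at t = 1. For t ≥ 1/2 the
variable x is integrated first, otherwise y; in both cases the Jacobian costs at most 2ⁿ. -/
lemma lintegral_segment_le {A B : Set (Sp n)} {G : Sp n → ENNReal} (hG : Measurable G) {t : ℝ} :
    ∫⁻ z, G (z.1 + t • (z.2 - z.1)) ∂((volume.restrict A).prod (volume.restrict B))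
      ≤ 2 ^ n * (volume A + volume B) * ∫⁻ x, G x := by
  have hmeas : AEMeasurable (fun z : Sp n × Sp n => G (z.1 + t • (z.2 - z.1)))
      ((volume.restrict A).prod (volume.restrict B)) := by
    have : Measurable fun z : Sp n × Sp n => z.1 + t • (z.2 - z.1) := by fun_prop
    exact (hG.comp this).aemeasurable
  rcases le_total (1 / 2) t with ht | ht
  · have ht0 : t ≠ 0 := by intro h; subst h; norm_num at ht
    rw [lintegral_prod _ hmeas]
    calc ∫⁻ y in A, ∫⁻ x in B, G (y + t • (x - y)) ≤ ∫⁻ y in A, 2 ^ n * ∫⁻ x, G x := by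
          refine lintegral_mono fun y => ?_
          refine (lintegral_mono' Measure.restrict_le_self le_rfl).trans ?_
          have e : ∀ x, y + t • (x - y) = (y - t • y) + t • x := by
            intro x; rw [smul_sub]; abel
          simp_rw [e]
          rw [lintegral_comp_add_smul _ hG _ ht0]
          gcongr
          exact ofReal_abs_inv_pow_le ht
      _ = 2 ^ n * volume A * ∫⁻ x, G x := by
          rw [lintegral_const, Measure.restrict_apply_univ]; ring
      _ ≤ _ := by gcongr; exact le_self_add
  · have ht0 : 1 - t ≠ 0 := by linarith
    rw [lintegral_prod_symm _ hmeas]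
    calc ∫⁻ x in B, ∫⁻ y in A, G (y + t • (x - y)) ≤ ∫⁻ x in B, 2 ^ n * ∫⁻ x, G x := by
          refine lintegral_mono fun x => ?_
          refine (lintegral_mono' Measure.restrict_le_self le_rfl).trans ?_
          have e : ∀ y, y + t • (x - y) = t • x + (1 - t) • y := by
            intro y; rw [smul_sub, sub_smul, one_smul]; abel
          simp_rw [e]
          rw [lintegral_comp_add_smul _ hG _ ht0]
          gcongr
          exact ofReal_abs_inv_pow_le (by linarith)
      _ = 2 ^ n * volume B * ∫⁻ x, G x := by
          rw [lintegral_const, Measure.restrict_apply_univ]; ring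
      _ ≤ _ := by gcongr; exact le_add_self

/-- Segments from the ball of star centres to points of `D` stay in `D`. Averaging |φ x - φ y|² over
y in the ball and x in `D` is therefore bounded by the energy of the gradient on `D`, and some y
does no worse than the average. -/
theorem StarDom.poincare (h : StarDom D c r) : ∃ C : NNReal, ∀ φ : Sp n → ℝ, ContDiff ℝ ∞ φ →
    ∃ a : ℝ, eLpNorm (fun x => φ x - a) 2 (volume.restrict D)
      ≤ C * eLpNorm (gradient φ) 2 (volume.restrict D) := by
  obtain ⟨R, hR⟩ := h.isBounded.subset_closedBall c
  set B := Metric.ball c r with hB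
  have hBD : B ⊆ D := h.ball_subset
  have hm := h.isOpen.measurableSet
  have hB0 : volume B ≠ 0 := (Metric.measure_ball_pos volume c h.pos).ne'
  have hBt : volume B ≠ ⊤ := measure_ball_lt_top.ne
  have hDt : volume D ≠ ⊤ := h.isBounded.measure_lt_top.ne
  let Λ : ENNReal := ENNReal.ofReal (R + r) ^ 2 * (2 ^ n * (volume B + volume D)) / volume B
  have hΛ : Λ ≠ ⊤ := by
    refine ENNReal.div_ne_top ?_ hB0
    refine ENNReal.mul_ne_top (by simp) (ENNReal.mul_ne_top (by simp) (ENNReal.add_ne_top.2 ⟨hBt, hDt⟩))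
  -- The squared inequality holds with constant Λ, and Λ ≤ (Λ + 1)² avoids a square root.
  refine ⟨Λ.toNNReal + 1, fun φ hφ => ?_⟩
  let G : Sp n → ENNReal := D.indicator fun x => ‖gradient φ x‖ₑ ^ 2
  have hG : Measurable G := ((cont_gradient hφ).enorm.measurable.pow_const 2).indicator hm
  have hGint : ∫⁻ x, G x = eLpNorm (gradient φ) 2 (volume.restrict D) ^ 2 := by
    rw [eLpNorm_two_sq, lintegral_indicator hm]
  have key : ∀ y ∈ B, ∀ x ∈ D, ‖φ x - φ y‖ₑ ^ 2
      ≤ ENNReal.ofReal (R + r) ^ 2 * ∫⁻ t in Set.Ioc (0 : ℝ) 1, G (y + t • (x - y)) := by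
    intro y hy x hx
    have hxy : ‖x - y‖ ≤ R + r := by
      rw [← dist_eq_norm]
      have h1 := Metric.mem_closedBall.1 (hR hx)
      have h2 := Metric.mem_ball'.1 hy
      exact (dist_triangle x c y).trans (by linarith)
    refine (enorm_sub_sq_le hφ x y hxy).trans ?_
    refine mul_le_mul' le_rfl ?_
    refine setLIntegral_mono_ae' measurableSet_Ioc (Filter.Eventually.of_forall fun t ht => ?_)
    have : y + t • (x - y) ∈ D := by
      have := h.star y hy hx (sub_nonneg.2 ht.2) ht.1.le (by ring)
      convert this using 1
      rw [smul_sub, sub_smul, one_smul]; abel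
    simp only [G, Set.indicator_of_mem this]
    exact le_rfl
  let f : Sp n → ENNReal := fun y => ∫⁻ x in D, ‖φ x - φ y‖ₑ ^ 2
  have hfm : Measurable f := by
    refine Measurable.lintegral_prod_right' (f := fun z : Sp n × Sp n => ‖φ z.2 - φ z.1‖ₑ ^ 2) ?_
    have := hφ.continuous
    fun_prop
  have hmG : Measurable fun z : (Sp n × Sp n) × ℝ => G (z.1.1 + z.2 • (z.1.2 - z.1.1)) := by
    have : Measurable fun z : (Sp n × Sp n) × ℝ => z.1.1 + z.2 • (z.1.2 - z.1.1) := by fun_prop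
    exact hG.comp this
  have hf : ∫⁻ y in B, f y ≤ ENNReal.ofReal (R + r) ^ 2 * (2 ^ n * (volume B + volume D))
      * ∫⁻ x, G x := by
    calc ∫⁻ y in B, f y ≤ ∫⁻ y in B, ∫⁻ x in D, ENNReal.ofReal (R + r) ^ 2
          * ∫⁻ t in Set.Ioc (0 : ℝ) 1, G (y + t • (x - y)) := by
          refine setLIntegral_mono_ae' measurableSet_ball (Filter.Eventually.of_forall fun y hy => ?_)
          exact setLIntegral_mono_ae' hm (Filter.Eventually.of_forall fun x hx => key y hy x hx)
      _ = ∫⁻ z : Sp n × Sp n, (ENNReal.ofReal (R + r) ^ 2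
          * ∫⁻ t in Set.Ioc (0 : ℝ) 1, G (z.1 + t • (z.2 - z.1)))
            ∂((volume.restrict B).prod (volume.restrict D)) := by
          refine (lintegral_prod (fun z : Sp n × Sp n => ENNReal.ofReal (R + r) ^ 2
            * ∫⁻ t in Set.Ioc (0 : ℝ) 1, G (z.1 + t • (z.2 - z.1))) ?_).symm
          exact (hmG.lintegral_prod_right'.const_mul _).aemeasurable
      _ = ENNReal.ofReal (R + r) ^ 2 * ∫⁻ t in Set.Ioc (0 : ℝ) 1,
          (∫⁻ z, G (z.1 + t • (z.2 - z.1)) ∂((volume.restrict B).prod (volume.restrict D))) := by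
          rw [lintegral_const_mul' _ _ (by simp)]
          congr 1
          exact lintegral_lintegral_swap
            (f := fun (z : Sp n × Sp n) (t : ℝ) => G (z.1 + t • (z.2 - z.1))) hmG.aemeasurable
      _ ≤ ENNReal.ofReal (R + r) ^ 2 * ∫⁻ t in Set.Ioc (0 : ℝ) 1,
          (2 ^ n * (volume B + volume D) * ∫⁻ x, G x) := by
          gcongr with t
          exact lintegral_segment_le hG
      _ = _ := by simp [mul_assoc]
  -- The constant subtracted is the value of φ at a good star centre instead of the mean of φ.
  obtain ⟨y, hy, hyf⟩ := exists_le_setLAverage hB0 hBt hfm.aemeasurable.restrict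
  refine ⟨φ y, ?_⟩
  refine (ENNReal.pow_le_pow_left_iff two_ne_zero).1 ?_
  rw [eLpNorm_two_sq, mul_pow, ← hGint]
  calc ∫⁻ x in D, ‖φ x - φ y‖ₑ ^ 2 ≤ (∫⁻ y in B, f y) / volume B := by
        rw [← setLAverage_eq]; exact hyf
    _ ≤ Λ * ∫⁻ x, G x := by
        refine (ENNReal.div_le_div_right hf _).trans (le_of_eq ?_)
        simp only [Λ, div_eq_mul_inv]; ring
    _ ≤ _ := by
        gcongr
        rw [ENNReal.coe_add, ENNReal.coe_toNNReal hΛ, ENNReal.coe_one]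
        calc Λ ≤ Λ + 1 := le_self_add
          _ ≤ (Λ + 1) ^ 2 := le_self_pow₀ le_add_self two_ne_zero

end

section

variable {n : ℕ} {D : Set (Sp n)} {c : Sp n} {r : ℝ}

/-! ### The closure of the gradients of test functions -/

lemma memLp_gradient {φ : Sp n → ℝ} (hφ : IsTest Set.univ φ) :
    MemLp (gradient φ) 2 (volume.restrict D) :=
  memLp_test (cont_gradient hφ.1) (supp_gradient hφ.2.1)

lemma IsTest.memLp {D' : Set (Sp n)} {φ : Sp n → ℝ} (hφ : IsTest D' φ) :
    MemLp φ 2 (volume.restrict D) :=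
  memLp_test hφ.1.continuous hφ.2.1

/-- The gradients of test functions on the whole space, restricted to `D`. -/
def testGrad (D : Set (Sp n)) : Submodule ℝ (L2V D) where
  carrier := {v | ∃ φ, IsTest Set.univ φ ∧ v =ᵐ[volume.restrict D] gradient φ}
  zero_mem' := by
    refine ⟨fun _ => 0, ⟨contDiff_const, HasCompactSupport.zero, Set.subset_univ _⟩, ?_⟩
    filter_upwards [Lp.coeFn_zero (Sp n) 2 (volume.restrict D)] with x hx
    rw [hx]; simp
  add_mem' := by
    rintro v w ⟨φ, hφ, hv⟩ ⟨ψ, hψ, hw⟩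
    refine ⟨_, PolyMesh.IsTest.add hφ hψ, ?_⟩
    filter_upwards [Lp.coeFn_add v w, hv, hw] with x h1 h2 h3
    rw [h1, Pi.add_apply, h2, h3, gradient_add' hφ.1 hψ.1]
  smul_mem' := by
    rintro a v ⟨φ, hφ, hv⟩
    refine ⟨_, PolyMesh.IsTest.smul a hφ, ?_⟩
    filter_upwards [Lp.coeFn_smul a v, hv] with x h1 h2
    rw [h1, Pi.smul_apply, h2, gradient_smul' hφ.1]

/-- The class of the gradient of a test function. -/
def tgrad (D : Set (Sp n)) {φ : Sp n → ℝ} (hφ : IsTest Set.univ φ) : L2V D :=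
  (memLp_gradient hφ).toLp

lemma coeFn_tgrad {φ : Sp n → ℝ} (hφ : IsTest Set.univ φ) :
    tgrad D hφ =ᵐ[volume.restrict D] gradient φ := MemLp.coeFn_toLp (memLp_gradient hφ)

lemma tgrad_mem {φ : Sp n → ℝ} (hφ : IsTest Set.univ φ) : tgrad D hφ ∈ testGrad D :=
  ⟨φ, hφ, coeFn_tgrad hφ⟩

/-- The `L²`-closure of the gradients of test functions. -/
def gradClosure (D : Set (Sp n)) : Submodule ℝ (L2V D) := (testGrad D).topologicalClosure

lemma isClosed_gradClosure : IsClosed (gradClosure D : Set (L2V D)) :=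
  Submodule.isClosed_topologicalClosure _

instance : CompleteSpace (gradClosure D) := isClosed_gradClosure.completeSpace_coe

lemma testGrad_le_gradClosure : testGrad D ≤ gradClosure D := Submodule.le_topologicalClosure _

lemma inner_tgrad (v : L2V D) {φ : Sp n → ℝ} (hφ : IsTest Set.univ φ) :
    ⟪v, tgrad D hφ⟫ = ∫ x in D, ⟪v x, gradient φ x⟫ := by
  rw [L2.inner_def]
  refine integral_congr_ae ?_
  filter_upwards [coeFn_tgrad hφ] with x hx
  rw [hx]

lemma mem_orthogonal_gradClosure {v : L2V D}
    (h : ∀ φ, IsTest Set.univ φ → ∫ x in D, ⟪v x, gradient φ x⟫ = 0) :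
    v ∈ (gradClosure D)ᗮ := by
  unfold gradClosure
  rw [Submodule.orthogonal_closure, Submodule.mem_orthogonal']
  rintro w ⟨φ, hφ, hw⟩
  rw [← h φ hφ, L2.inner_def]
  refine integral_congr_ae ?_
  filter_upwards [hw] with x hx
  rw [hx]

/-- Functionals that are bounded by the gradient norm are represented by a limit of gradients. -/
lemma exists_mem_gradClosure (l : (Sp n → ℝ) → ℝ)
    (hadd : ∀ φ ψ, IsTest Set.univ φ → IsTest Set.univ ψ → l (fun x => φ x + ψ x) = l φ + l ψ)
    (hsmul : ∀ (a : ℝ) φ, IsTest Set.univ φ → l (fun x => a * φ x) = a * l φ)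
    {C : ℝ} (hC : ∀ φ (hφ : IsTest Set.univ φ), |l φ| ≤ C * ‖tgrad D hφ‖) :
    ∃ v ∈ gradClosure D, ∀ φ, IsTest Set.univ φ → ∫ x in D, ⟪v x, gradient φ x⟫ = l φ := by
  -- The bound forces `l` to depend on the gradient on `D` only, so it descends to a linear
  -- functional on `testGrad D`.
  have hsub : ∀ φ ψ, IsTest Set.univ φ → IsTest Set.univ ψ →
      gradient φ =ᵐ[volume.restrict D] gradient ψ → l φ = l ψ := by
    intro φ ψ hφ hψ h
    have hd := PolyMesh.IsTest.add hφ (PolyMesh.IsTest.smul (-1) hψ)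
    have h0 : tgrad D hd = 0 := by
      apply Lp.ext
      filter_upwards [coeFn_tgrad hd, Lp.coeFn_zero (Sp n) 2 (volume.restrict D), h] with x h1 h2 h3
      rw [h1, h2, gradient_add' hφ.1 (contDiff_const.mul hψ.1), gradient_smul' hψ.1, h3]
      simp
    have h1 := hC _ hd
    rw [h0, norm_zero, mul_zero, hadd _ _ hφ (PolyMesh.IsTest.smul (-1) hψ), hsmul _ _ hψ] at h1
    have := abs_nonpos_iff.1 h1
    linarith
  choose rep hrep hrep' using fun v : testGrad D => v.2
  have hl : ∀ (v : testGrad D) φ, IsTest Set.univ φ → (v : L2V D) =ᵐ[volume.restrict D] gradient φ →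
      l (rep v) = l φ := fun v φ hφ h => hsub _ _ (hrep v) hφ ((hrep' v).symm.trans h)
  let L : testGrad D →ₗ[ℝ] ℝ :=
    { toFun := fun v => l (rep v)
      map_add' := fun v w => by
        rw [← hadd _ _ (hrep v) (hrep w)]
        refine hl _ _ (PolyMesh.IsTest.add (hrep v) (hrep w)) ?_
        filter_upwards [Lp.coeFn_add (v : L2V D) w, hrep' v, hrep' w] with x h1 h2 h3
        rw [Submodule.coe_add, h1, Pi.add_apply, h2, h3, gradient_add' (hrep v).1 (hrep w).1]
      map_smul' := fun a v => by
        rw [RingHom.id_apply, smul_eq_mul, ← hsmul _ _ (hrep v)]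
        refine hl _ _ (PolyMesh.IsTest.smul a (hrep v)) ?_
        filter_upwards [Lp.coeFn_smul a (v : L2V D), hrep' v] with x h1 h2
        rw [Submodule.coe_smul, h1, Pi.smul_apply, h2, gradient_smul' (hrep v).1] }
  have hbound : ∀ v, ‖L v‖ ≤ C * ‖v‖ := by
    intro v
    have h1 := hC _ (hrep v)
    have h2 : tgrad D (hrep v) = v := Lp.ext ((coeFn_tgrad (hrep v)).trans (hrep' v).symm)
    rw [h2] at h1
    exact h1
  -- Hahn–Banach and Riesz give a representing field in L². Projecting it onto the closure of the
  -- gradients changes none of its pairings with gradients.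
  obtain ⟨g, hg, -⟩ := exists_extension_norm_eq (testGrad D) (L.mkContinuous C hbound)
  let w := (InnerProductSpace.toDual ℝ (L2V D)).symm g
  refine ⟨(gradClosure D).starProjection w, Submodule.starProjection_apply_mem _ _,
    fun φ hφ => ?_⟩
  have h1 : ⟪(gradClosure D).starProjection w, tgrad D hφ⟫ = ⟪w, tgrad D hφ⟫ := by
    have := Submodule.sub_starProjection_mem_orthogonal (K := gradClosure D) w
    have := (Submodule.mem_orthogonal' _ _).1 this _ (testGrad_le_gradClosure (tgrad_mem hφ))
    rw [inner_sub_left] at this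
    linarith
  rw [← inner_tgrad _ hφ, h1, InnerProductSpace.toDual_symm_apply,
    hg ⟨tgrad D hφ, tgrad_mem hφ⟩]
  exact hl _ _ hφ (coeFn_tgrad hφ)

/-- Each side of the defining identity is an inner product with a fixed class in L², so it passes to
the limit. -/
lemma isWeakGrad_of_tendsto {φ : ℕ → Sp n → ℝ} (hφ : ∀ j, ContDiff ℝ ∞ (φ j)) {q : L2 D} {g : L2V D}
    (q' : ℕ → L2 D) (g' : ℕ → L2V D) (hq' : ∀ j, q' j =ᵐ[volume.restrict D] φ j)
    (hg' : ∀ j, g' j =ᵐ[volume.restrict D] gradient (φ j))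
    (hq : Tendsto q' atTop (𝓝 q)) (hg : Tendsto g' atTop (𝓝 g)) : IsWeakGrad D q g := by
  refine isWeakGrad_iff.2 fun i ψ hψ => ?_
  have hw := fun j => isWeakGrad_iff.1 (isWeakGrad_of_contDiff (hφ j) (hq' j) (hg' j)) i ψ hψ
  have m1 : MemLp (fun x => gradient ψ x i) 2 (volume.restrict D) :=
    memLp_coord (memLp_gradient (hψ.mono (Set.subset_univ _))) i
  have m2 : MemLp (fun x => EuclideanSpace.single i (ψ x)) 2 (volume.restrict D) := by
    have : (fun x => EuclideanSpace.single i (ψ x)) = fun x => ψ x • EuclideanSpace.single i (1 : ℝ) := by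
      ext x k; simp
    rw [this]
    refine memLp_test (hψ.1.continuous.smul continuous_const) hψ.2.1.smul_right
  have e1 : ∀ q : L2 D, ∫ x in D, q x * gradient ψ x i = ⟪q, m1.toLp⟫ := by
    intro q
    rw [l2_inner_eq]
    refine integral_congr_ae ?_
    filter_upwards [m1.coeFn_toLp] with x hx
    rw [hx]
  have e2 : ∀ g : L2V D, ∫ x in D, ψ x * g x i = ⟪m2.toLp, g⟫ := by
    intro g
    rw [L2.inner_def]
    refine integral_congr_ae ?_
    filter_upwards [m2.coeFn_toLp] with x hx
    rw [hx, EuclideanSpace.inner_single_left]; simp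
  simp_rw [e1, e2] at hw
  rw [e1, e2]
  have t1 : Tendsto (fun j => ⟪q' j, m1.toLp⟫) atTop (𝓝 ⟪q, m1.toLp⟫) :=
    hq.inner tendsto_const_nhds
  have t2 : Tendsto (fun j => ⟪m2.toLp, g' j⟫) atTop (𝓝 ⟪m2.toLp, g⟫) :=
    tendsto_const_nhds.inner hg
  simp_rw [hw] at t1
  exact tendsto_nhds_unique t1 t2.neg

/-- Limits of gradients are weak gradients. -/
theorem StarDom.exists_isWeakGrad (h : StarDom D c r) {v : L2V D} (hv : v ∈ gradClosure D) :
    ∃ q : L2 D, IsWeakGrad D q v := by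
  obtain ⟨C, hC⟩ := h.poincare
  obtain ⟨g', hg'mem, hg'⟩ := mem_closure_iff_seq_limit.1 hv
  choose φ hφ hgφ using hg'mem
  have hfin := h.isFiniteMeasure
  have hone : MemLp (fun _ : Sp n => (1 : ℝ)) 2 (volume.restrict D) := memLp_const 1
  -- the primitives, normalized to be orthogonal to the constants
  let one : L2 D := hone.toLp
  let K : Submodule ℝ (L2 D) := ℝ ∙ one
  let q' : ℕ → L2 D := fun j => Kᗮ.starProjection (hφ j).memLp.toLp
  have hq'c : ∀ j, ∃ b : ℝ, q' j =ᵐ[volume.restrict D] fun x => φ j x - b := by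
    intro j
    have h1 : (hφ j).memLp.toLp - q' j ∈ K := by
      have := Submodule.sub_starProjection_mem_orthogonal (K := Kᗮ) ((hφ j).memLp (D := D)).toLp
      rwa [Submodule.orthogonal_orthogonal] at this
    obtain ⟨b, hb⟩ := Submodule.mem_span_singleton.1 h1
    refine ⟨b, ?_⟩
    have e : q' j = (hφ j).memLp.toLp - b • one := by rw [hb]; abel
    rw [e]
    filter_upwards [Lp.coeFn_sub ((hφ j).memLp (D := D)).toLp (b • one), Lp.coeFn_smul b one,
      hone.coeFn_toLp, ((hφ j).memLp (D := D)).coeFn_toLp] with x h1 h2 h3 h4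
    rw [h1, Pi.sub_apply, h2, Pi.smul_apply, h3, h4]; simp
  have hcauchy : ∀ i j, ‖q' i - q' j‖ ≤ C * ‖g' i - g' j‖ := by
    intro i j
    have hd : ContDiff ℝ ∞ fun x => φ i x - φ j x := (hφ i).1.sub (hφ j).1
    obtain ⟨b, hb⟩ := hC _ hd
    have hdm : MemLp (fun x => φ i x - φ j x - b) 2 (volume.restrict D) :=
      memLp_of_bounded' h.isBounded h.isOpen (hd.continuous.sub continuous_const)
    -- The projection kills constants, so the constant `b` of Poincaré's inequality may be
    -- subtracted before projecting; Cauchy gradients then give Cauchy primitives.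
    have e1 : q' i - q' j = Kᗮ.starProjection hdm.toLp := by
      have e2 : hdm.toLp = (hφ i).memLp.toLp - (hφ j).memLp.toLp - b • one := by
        apply Lp.ext
        filter_upwards [hdm.coeFn_toLp, Lp.coeFn_sub (((hφ i).memLp (D := D)).toLp - ((hφ j).memLp (D := D)).toLp) (b • one),
          Lp.coeFn_sub ((hφ i).memLp (D := D)).toLp ((hφ j).memLp (D := D)).toLp, Lp.coeFn_smul b one, hone.coeFn_toLp,
          ((hφ i).memLp (D := D)).coeFn_toLp, ((hφ j).memLp (D := D)).coeFn_toLp] with x h1 h2 h3 h4 h5 h6 h7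
        rw [h1, h2, Pi.sub_apply, h3, Pi.sub_apply, h4, Pi.smul_apply, h5, h6, h7]; simp
      have h0 : Kᗮ.starProjection one = 0 := by
        rw [Submodule.starProjection_apply_eq_zero_iff, Submodule.orthogonal_orthogonal]
        exact Submodule.mem_span_singleton_self _
      rw [e2, map_sub, map_sub, map_smul, h0, smul_zero, sub_zero]
    have e3 : ‖g' i - g' j‖ = (eLpNorm (gradient fun x => φ i x - φ j x) 2 (volume.restrict D)).toReal := by
      rw [Lp.norm_def]
      congr 1
      refine eLpNorm_congr_ae ?_
      filter_upwards [Lp.coeFn_sub (g' i) (g' j), hgφ i, hgφ j] with x h1 h2 h3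
      have e : (fun x => φ i x - φ j x) = fun x => φ i x + (-1) * φ j x := by ext; ring
      rw [h1, Pi.sub_apply, h2, h3, e, gradient_add' (hφ i).1 (contDiff_const.mul (hφ j).1),
        gradient_smul' (hφ j).1]
      simp [sub_eq_add_neg]
    rw [e1, e3]
    refine (Submodule.norm_starProjection_apply_le _ _).trans ?_
    rw [Lp.norm_toLp, ← ENNReal.coe_toReal, ← ENNReal.toReal_mul]
    refine ENNReal.toReal_mono ?_ hb
    refine ENNReal.mul_ne_top ENNReal.coe_ne_top ?_
    exact (memLp_of_bounded' h.isBounded h.isOpen (cont_gradient hd)).2.ne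
  have hq'cs : CauchySeq q' := by
    have hgc := hg'.cauchySeq
    rw [Metric.cauchySeq_iff] at hgc ⊢
    intro ε hε
    obtain ⟨N, hN⟩ := hgc (ε / (C + 1)) (by positivity)
    refine ⟨N, fun i hi j hj => ?_⟩
    rw [dist_eq_norm]
    have h1 := hN i hi j hj
    rw [dist_eq_norm, lt_div_iff₀ (by positivity)] at h1
    have h2 := hcauchy i j
    nlinarith [norm_nonneg (g' i - g' j)]
  obtain ⟨q, hq⟩ := cauchySeq_tendsto_of_complete hq'cs
  choose b hb using hq'c
  refine ⟨q, isWeakGrad_of_tendsto (φ := fun j x => φ j x - b j)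
    (fun j => (hφ j).1.sub contDiff_const) q' g' hb (fun j => ?_) hq hg'⟩
  filter_upwards [hgφ j] with x hx
  rw [hx]
  unfold gradient
  rw [fderiv_sub_const]

/-! ### The Poincaré lemma -/

lemma fderiv_coord {V : Sp n → Sp n} {x : Sp n} (hV : DifferentiableAt ℝ V x) (w : Sp n) (i : Fin n) :
    fderiv ℝ V x w i = fderiv ℝ (fun y => V y i) x w := by
  have := ((EuclideanSpace.proj i : Sp n →L[ℝ] ℝ).hasFDerivAt.comp x hV.hasFDerivAt).fderiv
  have e : (fun y => V y i) = (EuclideanSpace.proj i : Sp n →L[ℝ] ℝ) ∘ V := rfl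
  rw [e, this]; rfl

lemma inner_fderiv_symm {V : Sp n → Sp n} {x : Sp n} (hV : DifferentiableAt ℝ V x)
    (h : ∀ i j, gradient (fun y => V y j) x i = gradient (fun y => V y i) x j) (a b : Sp n) :
    ⟪fderiv ℝ V x a, b⟫ = ⟪fderiv ℝ V x b, a⟫ := by
  have hexp : ∀ a : Sp n, a = ∑ i, a i • EuclideanSpace.single i (1 : ℝ) := by
    intro a; ext k; simp [Pi.single_apply]
  have key : ∀ a b : Sp n, ⟪fderiv ℝ V x a, b⟫
      = ∑ j, ∑ i, a i * b j * gradient (fun y => V y j) x i := by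
    intro a b
    rw [inner_eq_sum]
    refine Finset.sum_congr rfl fun j _ => ?_
    rw [fderiv_coord hV]
    conv_lhs => rw [hexp a, map_sum, Finset.sum_mul]
    refine Finset.sum_congr rfl fun i _ => ?_
    rw [map_smul, ← gradient_apply, smul_eq_mul]; ring
  rw [key, key, Finset.sum_comm]
  refine Finset.sum_congr rfl fun i _ => Finset.sum_congr rfl fun j _ => ?_
  rw [h i j]; ring

/-- The derivative of `x ↦ ⟪V (c + t (x - c)), x - c⟫`. -/
def potDer (V : Sp n → Sp n) (c x : Sp n) (t : ℝ) : Sp n →L[ℝ] ℝ :=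
  innerSL ℝ (V (c + t • (x - c))) + t • (innerSL ℝ (x - c)).comp (fderiv ℝ V (c + t • (x - c)))

lemma potDer_apply (V : Sp n → Sp n) (c x : Sp n) (t : ℝ) (w : Sp n) :
    potDer V c x t w = ⟪V (c + t • (x - c)), w⟫ + t * ⟪x - c, fderiv ℝ V (c + t • (x - c)) w⟫ := rfl

lemma hasFDerivAt_potDer {V : Sp n → Sp n} (hV : ContDiff ℝ ∞ V) (x : Sp n) (t : ℝ) :
    HasFDerivAt (fun x => ⟪V (c + t • (x - c)), x - c⟫) (potDer V c x t) x := by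
  have h1 : HasFDerivAt (fun x : Sp n => c + t • (x - c)) (t • ContinuousLinearMap.id ℝ (Sp n)) x :=
    (((hasFDerivAt_id x).sub_const c).const_smul t).const_add c
  have h2 : HasFDerivAt (fun x => V (c + t • (x - c)))
      ((fderiv ℝ V (c + t • (x - c))).comp (t • ContinuousLinearMap.id ℝ (Sp n))) x :=
    ((hV.differentiable (by simp) (c + t • (x - c))).hasFDerivAt).comp x h1
  have h3 := h2.inner ℝ ((hasFDerivAt_id x).sub_const c)
  refine h3.congr_fderiv (ContinuousLinearMap.ext fun w => ?_)
  rw [potDer_apply, ContinuousLinearMap.comp_apply, ContinuousLinearMap.prod_apply,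
    fderivInnerCLM_apply, ContinuousLinearMap.comp_apply, _root_.smul_apply,
    ContinuousLinearMap.id_apply, map_smul, real_inner_smul_left, real_inner_comm (id x - c)]
  rfl

lemma continuous_potDer {V : Sp n → Sp n} (hV : ContDiff ℝ ∞ V) :
    Continuous fun z : Sp n × ℝ => potDer V c z.1 z.2 := by
  have hp : Continuous fun z : Sp n × ℝ => c + z.2 • (z.1 - c) := by fun_prop
  have h1 := hV.continuous.comp hp
  have h2 := (hV.continuous_fderiv (by simp)).comp hp
  refine ((innerSL ℝ).continuous.comp h1).add (continuous_snd.smul ?_)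
  exact ((innerSL ℝ).continuous.comp (continuous_fst.sub continuous_const)).clm_comp h2

lemma continuous_potDer_right {V : Sp n → Sp n} (hV : ContDiff ℝ ∞ V) (x : Sp n) :
    Continuous fun t : ℝ => potDer V c x t := by
  have hp : Continuous fun t : ℝ => c + t • (x - c) := by fun_prop
  have h1 := hV.continuous.comp hp
  have h2 := (hV.continuous_fderiv (by simp)).comp hp
  refine ((innerSL ℝ).continuous.comp h1).add (continuous_id.smul ?_)
  exact continuous_const.clm_comp h2

/-- When the derivative of V is symmetric, `potDer` is the exact t-derivative of t ⟨V(c + t (x -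
c)), w⟩. Its integral over [0, 1] is therefore ⟨V x, w⟩, which identifies the gradient of the radial
potential. -/
lemma hasDerivAt_mul_inner {V : Sp n → Sp n} (hV : ContDiff ℝ ∞ V) {x w : Sp n} {t : ℝ}
    (hs : ⟪fderiv ℝ V (c + t • (x - c)) (x - c), w⟫ = ⟪fderiv ℝ V (c + t • (x - c)) w, x - c⟫) :
    HasDerivAt (fun t : ℝ => t * ⟪V (c + t • (x - c)), w⟫) (potDer V c x t w) t := by
  have h1 : HasDerivAt (fun t : ℝ => c + t • (x - c)) (x - c) t := by
    have := ((hasDerivAt_id t).smul_const (x - c)).const_add c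
    simpa using this
  have h2 : HasDerivAt (fun t : ℝ => V (c + t • (x - c))) (fderiv ℝ V (c + t • (x - c)) (x - c)) t :=
    ((hV.differentiable (by simp) (c + t • (x - c))).hasFDerivAt).comp_hasDerivAt t h1
  have h4 : HasDerivAt (fun t : ℝ => ⟪V (c + t • (x - c)), w⟫)
      ⟪x - c, fderiv ℝ V (c + t • (x - c)) w⟫ t := by
    have := h2.inner ℝ (hasDerivAt_const t w)
    rwa [inner_zero_right, zero_add, hs, real_inner_comm] at this
  have h3 := (hasDerivAt_id' t).mul h4
  rwa [one_mul] at h3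

/-- The classical Poincaré lemma on a star-shaped set. -/
lemma hasFDerivAt_potential {V : Sp n → Sp n} (hV : ContDiff ℝ ∞ V) {G : Set (Sp n)}
    (hG : StarConvex ℝ c G) (hsymm : ∀ x ∈ G, ∀ a b, ⟪fderiv ℝ V x a, b⟫ = ⟪fderiv ℝ V x b, a⟫)
    {x : Sp n} (hx : x ∈ G) :
    HasFDerivAt (fun x => ∫ t in (0 : ℝ)..1, ⟪V (c + t • (x - c)), x - c⟫)
      (InnerProductSpace.toDual ℝ (Sp n) (V x)) x := by
  have hF'c := continuous_potDer (c := c) hV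
  have hF'x := continuous_potDer_right (c := c) hV x
  have hFc : ∀ x, Continuous fun t : ℝ => ⟪V (c + t • (x - c)), x - c⟫ := by
    intro x
    have hp : Continuous fun t : ℝ => c + t • (x - c) := by fun_prop
    exact (hV.continuous.comp hp).inner continuous_const
  obtain ⟨B, hB⟩ := ((isCompact_closedBall x 1).prod
    (isCompact_Icc (a := (0 : ℝ)) (b := 1))).exists_bound_of_continuousOn hF'c.continuousOn
  have hmain := intervalIntegral.hasFDerivAt_integral_of_dominated_of_fderiv_le (μ := volume)
    (a := 0) (b := 1) (F := fun x t => ⟪V (c + t • (x - c)), x - c⟫) (F' := potDer V c) (x₀ := x)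
    (bound := fun _ => B) (Metric.ball_mem_nhds x one_pos)
    (Filter.Eventually.of_forall fun y => (hFc y).aestronglyMeasurable)
    ((hFc x).intervalIntegrable 0 1) hF'x.aestronglyMeasurable
    (Filter.Eventually.of_forall fun t ht y hy => by
      rw [Set.uIoc_of_le zero_le_one] at ht
      exact hB (y, t) ⟨Metric.ball_subset_closedBall hy, ht.1.le, ht.2⟩)
    (continuous_const.intervalIntegrable 0 1)
    (Filter.Eventually.of_forall fun t _ y _ => hasFDerivAt_potDer hV y t)
  refine hmain.congr_fderiv (ContinuousLinearMap.ext fun w => ?_)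
  rw [ContinuousLinearMap.intervalIntegral_apply (hF'x.intervalIntegrable 0 1)]
  have hder : ∀ t ∈ Set.uIcc (0 : ℝ) 1, HasDerivAt (fun t : ℝ => t * ⟪V (c + t • (x - c)), w⟫)
      (potDer V c x t w) t := by
    intro t ht
    rw [Set.uIcc_of_le zero_le_one] at ht
    refine hasDerivAt_mul_inner hV (hsymm _ ?_ (x - c) w)
    have := hG hx (sub_nonneg.2 ht.2) ht.1 (by ring)
    convert this using 1
    rw [smul_sub, sub_smul, one_smul]; abel
  have hcont : Continuous fun t => potDer V c x t w := hF'x.clm_apply continuous_const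
  rw [intervalIntegral.integral_eq_sub_of_hasDerivAt hder (hcont.intervalIntegrable 0 1)]
  simp

/-- Here u is smooth on a neighbourhood of the closure of U only, so the cutoff must have its
support inside that neighbourhood for the product to be smooth everywhere. -/
lemma exists_test_of_isOpen {G U : Set (Sp n)} (hU : Bornology.IsBounded U)
    (hG : IsOpen G) (hUG : closure U ⊆ G) {u : Sp n → ℝ} (hu : ContDiffOn ℝ ∞ u G) :
    ∃ φ, IsTest Set.univ φ ∧ Set.EqOn φ u U := by
  obtain ⟨s, hs, hKs, hsG, hsc⟩ := exists_open_between_and_isCompact_closure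
    hU.isCompact_closure hG hUG
  obtain ⟨χ, hχ, -, hsupp, hone⟩ := exists_contMDiff_support_eq_eq_one_iff
    (modelWithCornersSelf ℝ (Sp n)) (n := ⊤) hs isClosed_closure hKs
  have hχ' : ContDiff ℝ ∞ χ := hχ.contDiff
  have hts : tsupport χ = closure s := by rw [tsupport, hsupp]
  refine ⟨fun x => χ x * u x, ⟨?_, ?_, Set.subset_univ _⟩, fun x hx => ?_⟩
  · rw [contDiff_iff_contDiffAt]
    intro x
    by_cases hx : x ∈ G
    · exact hχ'.contDiffAt.mul (hu.contDiffAt (hG.mem_nhds hx))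
    · have hx' : x ∉ tsupport χ := by rw [hts]; exact fun h => hx (hsG h)
      refine (contDiffAt_const (c := (0 : ℝ))).congr_of_eventuallyEq ?_
      filter_upwards [(isClosed_tsupport χ).isOpen_compl.mem_nhds hx'] with y hy
      rw [image_eq_zero_of_notMem_tsupport hy, zero_mul]
  · have : HasCompactSupport χ := by
      rw [HasCompactSupport, hts]; exact hsc
    exact this.mul_right
  · simp [(hone x).1 (subset_closure hx)]

/-- Weakly curl-free square-integrable fields on a star-shaped domain are limits of gradients. -/
theorem StarDom.mem_gradClosure_of_curl (h : StarDom D c r) {v : L2V D}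
    (hv : ∀ i j, ∀ φ, IsTest D φ →
      ∫ x in D, (v x j * gradient φ x i - v x i * gradient φ x j) = 0) : v ∈ gradClosure D := by
  have hm := h.isOpen.measurableSet
  have hvi := memLp_indicator hm v
  have hvl := memLp_two_locallyIntegrable hvi
  have e : ∀ i, (fun y => D.indicator v y i) = D.indicator (fun y => v y i) := by
    intro i; ext y
    by_cases hy : y ∈ D <;> simp [hy]
  have hcl : ∀ i, LocallyIntegrable (D.indicator fun y => v y i) volume := by
    intro i
    rw [← e i]
    exact memLp_two_locallyIntegrable ((EuclideanSpace.proj i : Sp n →L[ℝ] ℝ).comp_memLp' hvi)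
  let V : ℕ → Sp n → Sp n := fun j => reg c h.pos j (D.indicator v)
  have hV : ∀ j, ContDiff ℝ ∞ (V j) := fun j => contDiff_reg h.pos j hvl
  have hVcoord : ∀ j i, (fun y => V j y i) = reg c h.pos j (D.indicator fun y => v y i) := by
    intro j i; ext y; rw [← e i]; exact reg_coord h.pos j hvl y i
  -- Testing the vanishing weak curl with the translated kernel makes the derivative of the
  -- regularized field symmetric at every point of `regSet`.
  have hsymm : ∀ j, ∀ x ∈ regSet D c r j, ∀ a b,
      ⟪fderiv ℝ (V j) x a, b⟫ = ⟪fderiv ℝ (V j) x b, a⟫ := by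
    intro j x hx a b
    refine inner_fderiv_symm ((hV j).differentiable (by simp) x) (fun i k => ?_) a b
    have ht := isTest_regKer h.pos j hx
    rw [hVcoord, hVcoord, gradient_reg h.pos j (hcl k), gradient_reg h.pos j (hcl i),
      integral_mul_indicator hm, integral_mul_indicator hm]
    congr 1
    have h1 := hv i k _ ht
    have m1 := memLp_gradient (D := D) (ht.mono (Set.subset_univ _))
    rw [integral_sub (integrable_mul' (memLp_coord (Lp.memLp v) k) (memLp_coord m1 i))
      (integrable_mul' (memLp_coord (Lp.memLp v) i) (memLp_coord m1 k)), sub_eq_zero] at h1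
    simp_rw [gradient_comp_const_sub (contDiff_regKer h.pos j)] at h1
    rw [← neg_inj, ← integral_neg, ← integral_neg]
    simpa [mul_comm] using h1
  -- The radial potential has the smooth field `V j` as its gradient on the star-shaped open set
  -- `regSet`, hence is smooth there; as this set contains the closure of `D`, a cutoff turns it
  -- into a test function.
  have hpot : ∀ j, ∃ φ, IsTest Set.univ φ ∧ Set.EqOn (gradient φ) (V j) D := by
    intro j
    let u : Sp n → ℝ := fun x => ∫ t in (0 : ℝ)..1, ⟪V j (c + t • (x - c)), x - c⟫
    have hu : ∀ x ∈ regSet D c r j, HasFDerivAt u (InnerProductSpace.toDual ℝ (Sp n) (V j x)) x :=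
      fun x hx => hasFDerivAt_potential (hV j) (h.starConvex_regSet j) (hsymm j) hx
    have hus : ContDiffOn ℝ ∞ u (regSet D c r j) := by
      rw [contDiffOn_infty_iff_fderiv_of_isOpen (isOpen_regSet h.isOpen j)]
      refine ⟨fun x hx => (hu x hx).differentiableAt.differentiableWithinAt, ?_⟩
      have : ContDiff ℝ ∞ fun x => InnerProductSpace.toDual ℝ (Sp n) (V j x) :=
        (InnerProductSpace.toDual ℝ (Sp n)).toContinuousLinearEquiv.contDiff.comp (hV j)
      exact this.contDiffOn.congr fun x hx => (hu x hx).fderiv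
    obtain ⟨φ, hφ, he⟩ := exists_test_of_isOpen h.isBounded (isOpen_regSet h.isOpen j)
      (h.closure_subset_regSet j) hus
    refine ⟨φ, hφ, fun x hx => ?_⟩
    rw [gradient_congr h.isOpen he hx]
    unfold gradient
    rw [(hu x (h.closure_subset_regSet j (subset_closure hx))).fderiv,
      LinearIsometryEquiv.symm_apply_apply]
  choose φ hφ hφV using hpot
  refine mem_closure_of_tendsto (f := fun j => tgrad D (hφ j)) (b := atTop) ?_
    (Filter.Eventually.of_forall fun j => tgrad_mem (hφ j))
  rw [Lp.tendsto_Lp_iff_tendsto_eLpNorm']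
  refine (tendsto_reg h hvi).congr fun j => eLpNorm_congr_ae ?_
  filter_upwards [ae_restrict_mem hm, coeFn_tgrad (D := D) (hφ j)] with x hx h1
  rw [Pi.sub_apply, h1, hφV j hx, Set.indicator_of_mem hx]

end

section

variable {m : ℕ} {T E : Type*}

/-! ### Faces -/

namespace PolyFace

variable (f : PolyFace m)

lemma chart_sub (y z : Sp m) : f.chart y - f.chart z = f.chart.linear (y - z) := by
  simpa using (f.chart.linearMap_vsub y z).symm

lemma chart_eq (y z : Sp m) : f.chart y = f.chart z + f.chart.linear (y - z) := by
  rw [← f.chart_sub]; abel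

lemma continuous_chart : Continuous f.chart := f.chart.isometry.continuous

/-- `ν` is a unit vector orthogonal to the face. -/
def IsNormal (ν : Sp (m + 1)) : Prop :=
  ‖ν‖ = 1 ∧ ∀ w : Sp m, ⟪ν, f.chart.linear w⟫ = 0

variable {f}

lemma IsNormal.neg {ν : Sp (m + 1)} (h : f.IsNormal ν) : f.IsNormal (-ν) :=
  ⟨by rw [norm_neg, h.1], fun w => by rw [inner_neg_left, h.2, neg_zero]⟩

lemma IsNormal.inner_self {ν : Sp (m + 1)} (h : f.IsNormal ν) : ⟪ν, ν⟫ = 1 := by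
  rw [real_inner_self_eq_norm_sq, h.1]; norm_num

/-- The orthonormal basis consisting of the normal and the coordinate directions of the face. -/
lemma IsNormal.exists_basis {ν : Sp (m + 1)} (h : f.IsNormal ν) :
    ∃ b : OrthonormalBasis (Fin (m + 1)) ℝ (Sp (m + 1)),
      b 0 = ν ∧ ∀ i, b (Fin.succ i) = f.chart.linear (EuclideanSpace.single i 1) := by
  let v : Fin (m + 1) → Sp (m + 1) :=
    Fin.cons ν fun i => f.chart.linear (EuclideanSpace.single i 1)
  have hv : Orthonormal ℝ v := by
    rw [orthonormal_iff_ite]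
    intro i j
    refine Fin.cases ?_ (fun i => ?_) i <;> refine Fin.cases ?_ (fun j => ?_) j
    · simpa [v] using h.inner_self
    · simpa [v, (Fin.succ_ne_zero _).symm] using h.2 _
    · simp only [v, Fin.cons_succ, Fin.cons_zero, Fin.succ_ne_zero, if_false]
      rw [real_inner_comm]; exact h.2 _
    · simp only [v, Fin.cons_succ, Fin.succ_inj]
      have e := f.chart.linearIsometry.inner_map_map (EuclideanSpace.single i (1 : ℝ))
        (EuclideanSpace.single j 1)
      have e' : ⟪f.chart.linear (EuclideanSpace.single i (1 : ℝ)),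
          f.chart.linear (EuclideanSpace.single j 1)⟫ = ⟪EuclideanSpace.single i (1 : ℝ),
          (EuclideanSpace.single j 1 : Sp m)⟫ := e
      rw [e', EuclideanSpace.inner_single_left]
      simp
  have hcard : Fintype.card (Fin (m + 1)) = Module.finrank ℝ (Sp (m + 1)) := by simp
  let B := basisOfOrthonormalOfCardEqFinrank hv hcard
  have hB : ⇑B = v := coe_basisOfOrthonormalOfCardEqFinrank hv hcard
  let b := B.toOrthonormalBasis (by rw [hB]; exact hv)
  have hb : ⇑b = v := by rw [Module.Basis.coe_toOrthonormalBasis, hB]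
  exact ⟨b, by rw [hb]; rfl, fun i => by rw [hb]; rfl⟩

variable (f)

lemma exists_isNormal : ∃ ν, f.IsNormal ν := by
  let K := LinearMap.range f.chart.linear
  have h1 : Module.finrank ℝ K ≤ m := by
    have := LinearMap.finrank_range_le f.chart.linear
    simpa using this
  have h2 := K.finrank_add_finrank_orthogonal
  have h3 : 0 < Module.finrank ℝ Kᗮ := by
    rw [finrank_euclideanSpace_fin] at h2; omega
  have : Nontrivial Kᗮ := Module.finrank_pos_iff.1 h3
  obtain ⟨⟨w, hw⟩, hne⟩ := exists_ne (0 : Kᗮ)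
  have hw0 : w ≠ 0 := fun h => hne (by ext1; exact h)
  refine ⟨‖w‖⁻¹ • w, ?_, fun y => ?_⟩
  · rw [norm_smul, norm_inv, norm_norm, inv_mul_cancel₀ (norm_ne_zero_iff.2 hw0)]
  · rw [real_inner_smul_left, (Submodule.mem_orthogonal' _ _).1 hw _ (LinearMap.mem_range_self _ y),
      mul_zero]

/-- Coordinates of `ℝ^{m+1}` adapted to the face. -/
def frame (ν : Sp (m + 1)) (z : ℝ × Sp m) : Sp (m + 1) := f.chart z.2 + z.1 • ν

variable {f}

/-- The adapted coordinates preserve the volume. -/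
lemma IsNormal.exists_frameEquiv {ν : Sp (m + 1)} (h : f.IsNormal ν) :
    ∃ e : ℝ × Sp m ≃ᵐ Sp (m + 1), ⇑e = f.frame ν ∧ MeasurePreserving e := by
  obtain ⟨b, hb0, hb⟩ := h.exists_basis
  let e1 : ℝ × Sp m ≃ᵐ ℝ × (Fin m → ℝ) :=
    (MeasurableEquiv.refl ℝ).prodCongr (MeasurableEquiv.toLp 2 (Fin m → ℝ)).symm
  let e2 : (Fin (m + 1) → ℝ) ≃ᵐ ℝ × (Fin m → ℝ) :=
    MeasurableEquiv.piFinSuccAbove (fun _ => ℝ) 0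
  let e3 : (Fin (m + 1) → ℝ) ≃ᵐ Sp (m + 1) := MeasurableEquiv.toLp 2 (Fin (m + 1) → ℝ)
  let e4 : Sp (m + 1) ≃ᵐ Sp (m + 1) := b.repr.symm.toHomeomorph.toMeasurableEquiv
  let e5 : Sp (m + 1) ≃ᵐ Sp (m + 1) := MeasurableEquiv.addLeft (f.chart 0)
  refine ⟨e1.trans (e2.symm.trans (e3.trans (e4.trans e5))), ?_, ?_⟩
  · ext1 z
    obtain ⟨s, y⟩ := z
    change f.chart 0 + b.repr.symm (WithLp.toLp 2 ((MeasurableEquiv.piFinSuccAbove (fun _ => ℝ) 0).symm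
      (s, fun i => y i))) = f.chart y + s • ν
    have e : (MeasurableEquiv.piFinSuccAbove (fun _ : Fin (m + 1) => ℝ) 0).symm (s, fun i => y i)
        = (Fin.cons s (fun i => y i) : Fin (m + 1) → ℝ) := by
      funext i
      exact congrFun (Fin.insertNth_zero' (β := ℝ) s _) i
    have e2 : y = ∑ j, y j • EuclideanSpace.single j (1 : ℝ) := by
      ext i; simp [Pi.single_apply]
    rw [e, ← OrthonormalBasis.sum_repr_symm, Fin.sum_univ_succ, f.chart_eq y 0, sub_zero]
    conv_rhs => rw [e2]
    simp only [Fin.cons_zero, Fin.cons_succ, hb0, hb, map_sum, map_smul]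
    abel
  · have m1 : MeasurePreserving e1 volume volume :=
      (MeasurePreserving.id volume).prod
        (EuclideanSpace.volume_preserving_symm_measurableEquiv_toLp (Fin m))
    have m2 : MeasurePreserving e2.symm volume volume :=
      (volume_preserving_piFinSuccAbove (fun _ : Fin (m + 1) => ℝ) 0).symm
    have m3 : MeasurePreserving e3 volume volume :=
      ((EuclideanSpace.volume_preserving_symm_measurableEquiv_toLp (Fin (m + 1))).symm)
    have m4 : MeasurePreserving e4 volume volume := b.repr.symm.measurePreserving
    have m5 : MeasurePreserving e5 volume volume := measurePreserving_add_left volume (f.chart 0)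
    exact m5.comp (m4.comp (m3.comp (m2.comp m1)))

lemma IsNormal.frame_injective {ν : Sp (m + 1)} (h : f.IsNormal ν) :
    Function.Injective (f.frame ν) := by
  obtain ⟨e, he, -⟩ := h.exists_frameEquiv
  rw [← he]; exact e.injective

lemma IsNormal.exists_frame_eq {ν : Sp (m + 1)} (h : f.IsNormal ν) (x : Sp (m + 1)) :
    ∃ z, f.frame ν z = x := by
  obtain ⟨e, he, -⟩ := h.exists_frameEquiv
  rw [← he]; exact e.surjective x

lemma IsNormal.eq_or_eq_neg {ν ν' : Sp (m + 1)} (h : f.IsNormal ν) (h' : f.IsNormal ν') :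
    ν' = ν ∨ ν' = -ν := by
  obtain ⟨⟨s, y⟩, hz⟩ := h.exists_frame_eq (ν' + f.chart 0)
  have e : ν' = f.chart.linear y + s • ν := by
    have : f.chart y + s • ν = ν' + f.chart 0 := hz
    rw [f.chart_eq y 0, sub_zero] at this
    rw [← sub_eq_iff_eq_add] at this
    rw [← this]; abel
  have hy : f.chart.linear y = 0 := by
    have h1 := h'.2 y
    rw [e, inner_add_left, real_inner_smul_left, h.2, mul_zero, add_zero] at h1
    exact inner_self_eq_zero.1 h1
  rw [hy, zero_add] at e
  have hs : ‖s‖ = 1 := by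
    have := h'.1
    rwa [e, norm_smul, h.1, mul_one] at this
  rcases (abs_eq zero_le_one).1 hs with hs | hs
  · left; rw [e, hs, one_smul]
  · right; rw [e, hs, neg_one_smul]

lemma IsNormal.inner_chart_sub {ν : Sp (m + 1)} (h : f.IsNormal ν) (y z : Sp m) :
    ⟪ν, f.chart y - f.chart z⟫ = 0 := by
  rw [f.chart_sub, h.2]

lemma IsNormal.inner_sub_eq {ν : Sp (m + 1)} (h : f.IsNormal ν) (x : Sp (m + 1)) (y z : Sp m) :
    ⟪ν, x - f.chart y⟫ = ⟪ν, x - f.chart z⟫ := by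
  have := h.inner_chart_sub y z
  rw [← sub_add_sub_cancel x (f.chart y) (f.chart z), inner_add_right, this, add_zero]

variable (f)

lemma closure_carrier : closure f.carrier = f.chart '' closure f.dom :=
  f.chart.isometry.isClosedEmbedding.closure_image_eq f.dom

lemma map_chart_ne_top {A : AffineSubspace ℝ (Sp m)} : A.map f.chart.toAffineMap ≠ ⊤ := by
  intro h
  obtain ⟨ν, hν⟩ := f.exists_isNormal
  have h1 : f.chart 0 + ν ∈ A.map f.chart.toAffineMap := by rw [h]; trivial
  obtain ⟨y, -, hy⟩ := (AffineSubspace.mem_map).1 h1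
  have h2 : f.chart y = f.chart 0 + ν := hy
  have h3 := hν.inner_chart_sub y 0
  rw [h2, add_sub_cancel_left, hν.inner_self] at h3
  exact one_ne_zero h3

lemma volume_range_chart : volume (Set.range f.chart) = 0 := by
  have := Measure.addHaar_affineSubspace volume _ (f.map_chart_ne_top (A := ⊤))
  refine measure_mono_null ?_ this
  rintro _ ⟨y, rfl⟩
  exact ⟨y, trivial, rfl⟩

end PolyFace

namespace PolyMesh

variable (M : PolyMesh m T E)

/-- A nonempty open set in positive dimension has positive diameter, so the ball in the regularity
condition has positive radius. -/
lemma Regular.exists_starDom {M : PolyMesh m T E} {ρ : ℝ} (hρ : 0 < ρ) (hM : M.Regular ρ) (P : T) :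
    ∃ c r, StarDom (M.cell P) c r := by
  obtain ⟨c, hc⟩ := hM.cell_star P
  refine ⟨c, _, M.isOpen_cell P, M.bounded_cell P, M.nonempty_cell P, ?_, hc⟩
  refine mul_pos hρ ?_
  have hnt : (M.cell P).Nontrivial := by
    obtain ⟨x, hx⟩ := M.nonempty_cell P
    exact (infinite_of_mem_nhds x ((M.isOpen_cell P).mem_nhds hx)).nontrivial
  exact Metric.diam_pos hnt (M.bounded_cell P)

variable [Fintype E]

lemma mem_faces {P : T} {f : E} : f ∈ M.faces P ↔ (M.face f).carrier ⊆ frontier (M.cell P) := by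
  simp [faces]

lemma mem_intFaces {f : E} : f ∈ M.intFaces ↔ (M.face f).carrier ⊆ M.domain := by
  simp [intFaces]

lemma mem_bdFaces {f : E} : f ∈ M.bdFaces ↔ (M.face f).carrier ⊆ frontier M.domain := by
  simp [bdFaces]

lemma frontier_eq (P : T) :
    frontier (M.cell P) = ⋃ f ∈ M.faces P, closure (M.face f).carrier := by
  rw [M.frontier_cell P]
  simp [mem_faces]

lemma frontier_subset_range (P : T) :
    frontier (M.cell P) ⊆ ⋃ f : E, Set.range (M.face f).chart := by
  rw [M.frontier_eq]
  refine Set.iUnion_mono fun f => Set.iUnion_subset fun _ => ?_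
  rw [PolyFace.closure_carrier]
  exact Set.image_subset_range _ _

lemma volume_frontier (P : T) : volume (frontier (M.cell P)) = 0 :=
  measure_mono_null (M.frontier_subset_range P)
    (measure_iUnion_null fun f => (M.face f).volume_range_chart)

/-- The frontier is a union of closed faces of the element, and a face does not meet the closure of
another one. So one common point already makes the face a face of the element, which is the
conformity of the mesh. -/
lemma mem_faces_of_mem_frontier {P : T} {f : E} {x : Sp (m + 1)} (hx : x ∈ (M.face f).carrier)
    (hP : x ∈ frontier (M.cell P)) : f ∈ M.faces P := by
  rw [M.frontier_eq] at hP
  obtain ⟨e, he, hxe⟩ := Set.mem_iUnion₂.1 hP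
  by_cases h : f = e
  · rwa [h]
  · exact absurd hxe (Set.disjoint_left.1 (M.disjoint_face f e h) hx)

/-- Near a point of a face there is no other face. -/
lemma exists_ball_inter (f : E) {x : Sp (m + 1)} (hx : x ∈ (M.face f).carrier) :
    ∃ ε > 0, ∀ e, e ≠ f → Disjoint (Metric.ball x ε) (closure (M.face e).carrier) := by
  have hcl : IsClosed (⋃ e ∈ {e : E | e ≠ f}, closure (M.face e).carrier) :=
    (Set.toFinite _).isClosed_biUnion fun _ _ => isClosed_closure
  have hx' : x ∈ (⋃ e ∈ {e : E | e ≠ f}, closure (M.face e).carrier)ᶜ := by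
    rw [Set.mem_compl_iff, Set.mem_iUnion₂]
    rintro ⟨e, he, hxe⟩
    exact Set.disjoint_left.1 (M.disjoint_face f e (Ne.symm he)) hx hxe
  obtain ⟨ε, hε, hsub⟩ := Metric.isOpen_iff.1 hcl.isOpen_compl x hx'
  refine ⟨ε, hε, fun e he => Set.disjoint_left.2 fun z hz hze => hsub hz ?_⟩
  exact Set.mem_iUnion₂.2 ⟨e, he, hze⟩

/-- The part of a ball on the negative side of a hyperplane. -/
def halfBall (x : Sp (m + 1)) (ε : ℝ) (ν : Sp (m + 1)) : Set (Sp (m + 1)) :=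
  {z | z ∈ Metric.ball x ε ∧ ⟪ν, z - x⟫ < 0}

lemma convex_halfBall (x : Sp (m + 1)) (ε : ℝ) (ν : Sp (m + 1)) : Convex ℝ (halfBall x ε ν) := by
  have h1 : Convex ℝ {z : Sp (m + 1) | ⟪ν, z⟫ < ⟪ν, x⟫} :=
    convex_halfSpace_lt (innerSL ℝ ν).isLinear _
  have h2 : halfBall x ε ν = Metric.ball x ε ∩ {z : Sp (m + 1) | ⟪ν, z⟫ < ⟪ν, x⟫} := by
    ext z; simp [halfBall, inner_sub_right]
  rw [h2]
  exact (convex_ball x ε).inter h1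

lemma isOpen_halfBall (x : Sp (m + 1)) (ε : ℝ) (ν : Sp (m + 1)) : IsOpen (halfBall x ε ν) := by
  have : Continuous fun z : Sp (m + 1) => ⟪ν, z - x⟫ := by fun_prop
  exact Metric.isOpen_ball.inter (isOpen_lt this continuous_const)

variable {M}

lemma sub_smul_mem_halfBall {x ν : Sp (m + 1)} (hν : ‖ν‖ = 1) {t ε : ℝ} (ht : 0 < t) (hε : t < ε) :
    x - t • ν ∈ halfBall x ε ν := by
  have h1 : ⟪ν, ν⟫ = 1 := by rw [real_inner_self_eq_norm_sq, hν]; norm_num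
  constructor
  · rw [Metric.mem_ball, dist_eq_norm, sub_sub_cancel_left, norm_neg, norm_smul, hν,
      Real.norm_of_nonneg ht.le]
    linarith
  · rw [sub_sub_cancel_left, inner_neg_right, real_inner_smul_right, h1]
    linarith

/-- In the ball the only nearby face is `f`, and it lies in the hyperplane that the open half ball
avoids. -/
lemma halfBall_disjoint_frontier {f : E} {y : Sp m} {ε : ℝ}
    (hball : ∀ e, e ≠ f → Disjoint (Metric.ball ((M.face f).chart y) ε) (closure (M.face e).carrier))
    {ν : Sp (m + 1)} (hν : (M.face f).IsNormal ν) (P : T) :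
    Disjoint (halfBall ((M.face f).chart y) ε ν) (frontier (M.cell P)) := by
  rw [Set.disjoint_left]
  intro z hz hzP
  rw [M.frontier_eq] at hzP
  obtain ⟨e, he, hze⟩ := Set.mem_iUnion₂.1 hzP
  by_cases h : e = f
  · subst h
    rw [PolyFace.closure_carrier] at hze
    obtain ⟨w, -, rfl⟩ := hze
    have := hz.2
    rw [hν.inner_chart_sub] at this
    exact lt_irrefl _ this
  · exact Set.disjoint_left.1 (hball e h) hz.1 hze

/-- The half ball is convex, hence connected, and avoids the frontier, so it cannot lie partly in
the cell. -/
lemma halfBall_subset_or {f : E} {y : Sp m} {ε : ℝ}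
    (hball : ∀ e, e ≠ f → Disjoint (Metric.ball ((M.face f).chart y) ε) (closure (M.face e).carrier))
    {ν : Sp (m + 1)} (hν : (M.face f).IsNormal ν) {P : T}
    (hP : (halfBall ((M.face f).chart y) ε ν ∩ M.cell P).Nonempty) :
    halfBall ((M.face f).chart y) ε ν ⊆ M.cell P := by
  have hd := Set.disjoint_left.1 (halfBall_disjoint_frontier hball hν P)
  refine (convex_halfBall _ ε ν).isPreconnected.subset_left_of_subset_union (M.isOpen_cell P)
    (isClosed_closure (s := M.cell P)).isOpen_compl
    (Set.disjoint_compl_right_iff_subset.2 subset_closure) (fun z hz => ?_) hP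
  by_cases hzP : z ∈ M.cell P
  · exact Or.inl hzP
  · refine Or.inr fun hcl => hd hz ?_
    rw [(M.isOpen_cell P).frontier_eq]
    exact ⟨hcl, hzP⟩

/-- The star centres of an element that contains a half ball at a face lie on the same side. -/
lemma inner_lt_zero_of_halfBall_subset {P : T} {f : E} (hf : f ∈ M.faces P) {c : Sp (m + 1)} {r : ℝ}
    (hS : StarDom (M.cell P) c r) {ν : Sp (m + 1)} (hν : (M.face f).IsNormal ν) {y : Sp m}
    (hy : y ∈ (M.face f).dom) {ε : ℝ} (hε : 0 < ε)
    (hsub : halfBall ((M.face f).chart y) ε ν ⊆ M.cell P) {a : Sp (m + 1)}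
    (ha : a ∈ Metric.ball c r) : ⟪ν, a - (M.face f).chart y⟫ < 0 := by
  set x := (M.face f).chart y with hx
  have hxP : x ∉ M.cell P := by
    have := M.mem_faces.1 hf ⟨y, hy, rfl⟩
    rw [(M.isOpen_cell P).frontier_eq] at this
    exact this.2
  -- If a star centre lay strictly beyond the face, the point x - t (a - x) would be in the half
  -- ball and hence in the cell for small t. Then x, which lies between this point and a, would be
  -- in the open cell instead of on its frontier.
  have key : ∀ a ∈ Metric.ball c r, ¬ 0 < ⟪ν, a - x⟫ := by
    intro a ha hpos
    obtain ⟨t, ht, ht2⟩ : ∃ t : ℝ, 0 < t ∧ t * ‖a - x‖ < ε := by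
      refine ⟨ε / (‖a - x‖ + 1), by positivity, ?_⟩
      rw [div_mul_eq_mul_div, div_lt_iff₀ (by positivity)]
      nlinarith [norm_nonneg (a - x)]
    have hz : x - t • (a - x) ∈ M.cell P := by
      refine hsub ⟨?_, ?_⟩
      · rw [Metric.mem_ball, dist_eq_norm, sub_sub_cancel_left, norm_neg, norm_smul,
          Real.norm_of_nonneg ht.le]
        exact ht2
      · rw [sub_sub_cancel_left, inner_neg_right, real_inner_smul_right]
        have := mul_pos ht hpos
        linarith
    have h1 : (0 : ℝ) < 1 + t := by linarith
    have := hS.star a ha hz (a := t / (1 + t)) (b := 1 / (1 + t)) (by positivity) (by positivity)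
      (by field_simp; ring)
    apply hxP
    convert this using 1
    have e : t / (1 + t) = (1 / (1 + t)) * t := by ring
    rw [e, mul_smul, ← smul_add, smul_sub]
    have e2 : t • a + (x - (t • a - t • x)) = (1 + t) • x := by rw [add_smul, one_smul]; abel
    rw [e2, smul_smul, one_div, inv_mul_cancel₀ h1.ne', one_smul]
  rcases lt_trichotomy ⟪ν, a - x⟫ 0 with h | h | h
  · exact h
  -- A star centre in the hyperplane itself can be pushed within the open ball to the forbidden
  -- side.
  · exfalso
    obtain ⟨δ, hδ, hδb⟩ := Metric.isOpen_iff.1 Metric.isOpen_ball a ha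
    refine key (a + (δ / 2) • ν) (hδb ?_) ?_
    · rw [Metric.mem_ball, dist_eq_norm, add_sub_cancel_left, norm_smul, hν.1,
        Real.norm_of_nonneg (by positivity)]
      linarith
    · rw [add_sub_right_comm, inner_add_right, h, real_inner_smul_right, hν.inner_self]
      linarith
  · exact absurd h (key a ha)

/-- Points of the cell accumulate at x. One that lies in the hyperplane can be moved off it, since
the cell is open, so one of the two half balls meets the cell and is then contained in it. -/
lemma exists_halfBall_subset {P : T} {f : E} (hf : f ∈ M.faces P) {ν : Sp (m + 1)}
    (hν : (M.face f).IsNormal ν) {y : Sp m} (hy : y ∈ (M.face f).dom) {ε : ℝ} (hε : 0 < ε)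
    (hball : ∀ e, e ≠ f → Disjoint (Metric.ball ((M.face f).chart y) ε) (closure (M.face e).carrier)) :
    halfBall ((M.face f).chart y) ε ν ⊆ M.cell P ∨
      halfBall ((M.face f).chart y) ε (-ν) ⊆ M.cell P := by
  set x := (M.face f).chart y with hx
  have hxP : x ∈ closure (M.cell P) := frontier_subset_closure (M.mem_faces.1 hf ⟨y, hy, rfl⟩)
  obtain ⟨z, hzB, hzP⟩ := mem_closure_iff.1 hxP _ Metric.isOpen_ball (Metric.mem_ball_self hε)
  have hopen : IsOpen (Metric.ball x ε ∩ M.cell P) := Metric.isOpen_ball.inter (M.isOpen_cell P)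
  obtain ⟨δ, hδ, hδb⟩ := Metric.isOpen_iff.1 hopen z ⟨hzB, hzP⟩
  rcases lt_trichotomy ⟪ν, z - x⟫ 0 with h | h | h
  · exact Or.inl (halfBall_subset_or hball hν ⟨z, ⟨hzB, h⟩, hzP⟩)
  · left
    have hz' : z - (δ / 2) • ν ∈ Metric.ball z δ := by
      rw [Metric.mem_ball, dist_eq_norm, sub_sub_cancel_left, norm_neg, norm_smul, hν.1,
        Real.norm_of_nonneg (by positivity)]
      linarith
    refine halfBall_subset_or hball hν ⟨_, ⟨(hδb hz').1, ?_⟩, (hδb hz').2⟩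
    rw [sub_right_comm, inner_sub_right, h, real_inner_smul_right, hν.inner_self]
    linarith
  · right
    refine halfBall_subset_or hball hν.neg ⟨z, ⟨hzB, ?_⟩, hzP⟩
    rw [inner_neg_left]; linarith

/-- The outward normal separates the element from its face. -/
lemma exists_outer {P : T} {f : E} (hf : f ∈ M.faces P) {c : Sp (m + 1)} {r : ℝ}
    (hS : StarDom (M.cell P) c r) : ∃ ν, (M.face f).IsNormal ν ∧
      (∀ a ∈ Metric.ball c r, ∀ y, ⟪ν, a - (M.face f).chart y⟫ < 0) ∧
      ∀ y ∈ (M.face f).dom, ∃ ε₀ > 0, ∀ ε, 0 < ε → ε ≤ ε₀ →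
        halfBall ((M.face f).chart y) ε ν ⊆ M.cell P ∧
        Disjoint (halfBall ((M.face f).chart y) ε (-ν)) (M.cell P) := by
  obtain ⟨ν₀, hν₀⟩ := (M.face f).exists_isNormal
  obtain ⟨y₀, hy₀⟩ := (M.face f).nonempty_dom
  have hex : ∃ ν, (M.face f).IsNormal ν ∧ ∃ ε > 0, halfBall ((M.face f).chart y₀) ε ν ⊆ M.cell P := by
    obtain ⟨ε, hε, hball⟩ := M.exists_ball_inter f ⟨y₀, hy₀, rfl⟩
    rcases exists_halfBall_subset hf hν₀ hy₀ hε hball with h | h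
    · exact ⟨ν₀, hν₀, ε, hε, h⟩
    · exact ⟨-ν₀, hν₀.neg, ε, hε, h⟩
  obtain ⟨ν, hν, ε, hε, hsub⟩ := hex
  have hside : ∀ a ∈ Metric.ball c r, ∀ y, ⟪ν, a - (M.face f).chart y⟫ < 0 := fun a ha y => by
    rw [hν.inner_sub_eq a y y₀]
    exact inner_lt_zero_of_halfBall_subset hf hS hν hy₀ hε hsub ha
  have hc : c ∈ Metric.ball c r := Metric.mem_ball_self hS.pos
  refine ⟨ν, hν, hside, fun y hy => ?_⟩
  obtain ⟨ε₀, hε₀, hball₀⟩ := M.exists_ball_inter f ⟨y, hy, rfl⟩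
  refine ⟨ε₀, hε₀, fun ε hε hle => ?_⟩
  have hball : ∀ e, e ≠ f → Disjoint (Metric.ball ((M.face f).chart y) ε)
      (closure (M.face e).carrier) := fun e he =>
    (hball₀ e he).mono_left (Metric.ball_subset_ball hle)
  -- If the opposite half ball were in the cell as well, the star centre c would lie strictly on
  -- both sides of the hyperplane.
  have hno : ¬ halfBall ((M.face f).chart y) ε (-ν) ⊆ M.cell P := by
    intro h
    have := inner_lt_zero_of_halfBall_subset hf hS hν.neg hy hε h hc
    rw [inner_neg_left] at this
    have := hside c hc y
    linarith
  refine ⟨(exists_halfBall_subset hf hν hy hε hball).resolve_right hno, ?_⟩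
  rw [Set.disjoint_iff_inter_eq_empty, ← Set.not_nonempty_iff_eq_empty]
  exact fun h => hno (halfBall_subset_or hball hν.neg h)

lemma isOuterNormal_of {P : T} {f : E} {ν : Sp (m + 1)} (hν : (M.face f).IsNormal ν)
    (h : ∀ y ∈ (M.face f).dom, ∃ ε₀ > 0, ∀ ε, 0 < ε → ε ≤ ε₀ →
        halfBall ((M.face f).chart y) ε ν ⊆ M.cell P ∧
        Disjoint (halfBall ((M.face f).chart y) ε (-ν)) (M.cell P)) :
    M.IsOuterNormal P f ν := by
  refine ⟨hν.1, hν.2, fun y hy => ?_⟩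
  obtain ⟨ε, hε, hεh⟩ := h y hy
  obtain ⟨h1, h2⟩ := hεh ε hε le_rfl
  have : Set.Ioo 0 ε ∈ 𝓝[>] (0 : ℝ) := Ioo_mem_nhdsGT hε
  filter_upwards [this] with t ht
  refine ⟨h1 (sub_smul_mem_halfBall hν.1 ht.1 ht.2), fun hP => ?_⟩
  have := sub_smul_mem_halfBall (x := (M.face f).chart y) hν.neg.1 ht.1 ht.2
  rw [smul_neg, sub_neg_eq_add] at this
  exact Set.disjoint_left.1 h2 this hP

lemma IsOuterNormal.unique {P : T} {f : E} {ν ν' : Sp (m + 1)} (h : M.IsOuterNormal P f ν)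
    (h' : M.IsOuterNormal P f ν') : ν = ν' := by
  have hn : (M.face f).IsNormal ν := ⟨h.1, h.2.1⟩
  rcases hn.eq_or_eq_neg ⟨h'.1, h'.2.1⟩ with e | e
  · exact e.symm
  · exfalso
    obtain ⟨y, hy⟩ := (M.face f).nonempty_dom
    obtain ⟨t, ht, ht'⟩ := ((h.2.2 y hy).and (h'.2.2 y hy)).exists
    have := ht'.1
    rw [e, smul_neg, sub_neg_eq_add] at this
    exact ht.2 this

/-- The properties of the outward normal. -/
lemma outerNormal_spec {P : T} {f : E} (hf : f ∈ M.faces P) {c : Sp (m + 1)} {r : ℝ}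
    (hS : StarDom (M.cell P) c r) : (M.face f).IsNormal (M.outerNormal P f) ∧
      (∀ a ∈ Metric.ball c r, ∀ y, ⟪M.outerNormal P f, a - (M.face f).chart y⟫ < 0) ∧
      ∀ y ∈ (M.face f).dom, ∃ ε₀ > 0, ∀ ε, 0 < ε → ε ≤ ε₀ →
        halfBall ((M.face f).chart y) ε (M.outerNormal P f) ⊆ M.cell P ∧
        Disjoint (halfBall ((M.face f).chart y) ε (-(M.outerNormal P f))) (M.cell P) := by
  obtain ⟨ν, hν, h1, h2⟩ := exists_outer hf hS
  have ho := isOuterNormal_of hν h2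
  have hex : ∃ ν, M.IsOuterNormal P f ν := ⟨ν, ho⟩
  have e : M.outerNormal P f = ν := by
    unfold outerNormal
    rw [dif_pos hex]
    exact hex.choose_spec.unique ho
  rw [e]
  exact ⟨hν, h1, h2⟩

end PolyMesh

end

/-! ### Incidence of faces and elements; Euler's formula -/

section

variable {m : ℕ} {T E : Type*}

namespace PolyMesh

variable (M : PolyMesh m T E)

/-- Every element is star-shaped with respect to a ball. -/
def StarCells : Prop := ∀ P, ∃ c r, StarDom (M.cell P) c r

lemma Regular.starCells {M : PolyMesh m T E} {ρ : ℝ} (hρ : 0 < ρ) (hM : M.Regular ρ) :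
    M.StarCells := fun P => hM.exists_starDom hρ P

/-- The face lies in the frontier of some Q. An open cell containing a point of it would meet Q, so
it would be Q, which does not meet its own frontier. -/
lemma not_mem_cell_of_mem_carrier {f : E} {x : Sp (m + 1)} (hx : x ∈ (M.face f).carrier) (P : T) :
    x ∉ M.cell P := by
  intro hP
  obtain ⟨Q, hQ⟩ := M.face_used f
  have hxQ := hQ hx
  rw [(M.isOpen_cell Q).frontier_eq] at hxQ
  obtain ⟨z, hzP, hzQ⟩ := mem_closure_iff.1 hxQ.1 _ (M.isOpen_cell P) hP
  by_cases h : P = Q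
  · exact hxQ.2 (h ▸ hP)
  · exact Set.disjoint_left.1 (M.disjoint_cell P Q h) hzP hzQ

lemma carrier_subset_closure_domain (f : E) : (M.face f).carrier ⊆ closure M.domain := by
  obtain ⟨Q, hQ⟩ := M.face_used f
  exact hQ.trans (frontier_subset_closure.trans (closure_mono (M.cell_subset Q)))

lemma mem_closure_halfBall {x ν : Sp (m + 1)} (hν : ‖ν‖ = 1) {ε : ℝ} {z : Sp (m + 1)}
    (hz : z ∈ Metric.ball x ε) (h : ⟪ν, z - x⟫ ≤ 0) : z ∈ closure (halfBall x ε ν) := by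
  have h1 : ⟪ν, ν⟫ = 1 := by rw [real_inner_self_eq_norm_sq, hν]; norm_num
  obtain ⟨δ, hδ, hδb⟩ := Metric.isOpen_iff.1 Metric.isOpen_ball z hz
  rw [Metric.mem_closure_iff]
  intro η hη
  have hmin : 0 < min η δ / 2 := by positivity
  have e : dist (z - (min η δ / 2) • ν) z = min η δ / 2 := by
    rw [dist_eq_norm, sub_sub_cancel_left, norm_neg, norm_smul, hν, mul_one,
      Real.norm_of_nonneg hmin.le]
  refine ⟨z - (min η δ / 2) • ν, ⟨hδb ?_, ?_⟩, ?_⟩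
  · rw [Metric.mem_ball, e]
    linarith [min_le_right η δ]
  · rw [sub_right_comm, inner_sub_right, real_inner_smul_right, h1]
    linarith
  · rw [dist_comm, e]
    linarith [min_le_left η δ]

variable [Fintype E]

variable {M}

/-- An element is determined by one of its faces and the outward normal there. -/
lemma eq_of_outerNormal_eq (hM : M.StarCells) {f : E} {P Q : T} (hP : f ∈ M.faces P)
    (hQ : f ∈ M.faces Q) (h : M.outerNormal P f = M.outerNormal Q f) : P = Q := by
  by_contra hne
  obtain ⟨c, r, hc⟩ := hM P
  obtain ⟨c', r', hc'⟩ := hM Q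
  obtain ⟨hn, -, h1⟩ := outerNormal_spec hP hc
  obtain ⟨-, -, h2⟩ := outerNormal_spec hQ hc'
  obtain ⟨y, hy⟩ := (M.face f).nonempty_dom
  obtain ⟨ε, hε, h1⟩ := h1 y hy
  obtain ⟨ε', hε', h2⟩ := h2 y hy
  have hmin : 0 < min ε ε' := lt_min hε hε'
  have hz := sub_smul_mem_halfBall (x := (M.face f).chart y) hn.1 (half_pos hmin) (half_lt_self hmin)
  refine Set.disjoint_left.1 (M.disjoint_cell P Q hne) ((h1 _ hmin (min_le_left _ _)).1 hz)
    ((h2 _ hmin (min_le_right _ _)).1 (h ▸ hz))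

lemma outerNormal_eq_neg (hM : M.StarCells) {f : E} {P Q : T} (hP : f ∈ M.faces P)
    (hQ : f ∈ M.faces Q) (hne : P ≠ Q) : M.outerNormal Q f = -M.outerNormal P f := by
  obtain ⟨c, r, hc⟩ := hM P
  obtain ⟨c', r', hc'⟩ := hM Q
  obtain ⟨hn, -⟩ := outerNormal_spec hP hc
  obtain ⟨hn', -⟩ := outerNormal_spec hQ hc'
  exact (hn.eq_or_eq_neg hn').resolve_left fun h => hne (eq_of_outerNormal_eq hM hP hQ h.symm)

/-- Both sides of a face that meets the domain are occupied by an element. -/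
lemma exists_cell_of_normal (hM : M.StarCells) {f : E} {y : Sp m} (hy : y ∈ (M.face f).dom)
    (hdom : (M.face f).chart y ∈ M.domain) {ν : Sp (m + 1)} (hν : (M.face f).IsNormal ν) :
    ∃ P, f ∈ M.faces P ∧ M.outerNormal P f = ν := by
  set x := (M.face f).chart y with hx
  have hxf : x ∈ (M.face f).carrier := ⟨y, hy, rfl⟩
  obtain ⟨ε₀, hε₀, hball₀⟩ := M.exists_ball_inter f hxf
  obtain ⟨δ, hδ, hδb⟩ := Metric.isOpen_iff.1 M.isOpen_domain x hdom
  have hε : 0 < min ε₀ δ := lt_min hε₀ hδ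
  set ε := min ε₀ δ
  have hball : ∀ e, e ≠ f → Disjoint (Metric.ball x ε) (closure (M.face e).carrier) := fun e he =>
    (hball₀ e he).mono_left (Metric.ball_subset_ball (min_le_left _ _))
  have hz := sub_smul_mem_halfBall (x := x) hν.1 (half_pos hε) (half_lt_self hε)
  have hzd := subset_closure (hδb (Metric.ball_subset_ball (min_le_right _ _) hz.1))
  -- A point of the open half ball lies in the closure of some cell, so that cell meets the half
  -- ball and therefore contains it.
  rw [M.cover] at hzd
  obtain ⟨P, hzP⟩ := Set.mem_iUnion.1 hzd
  obtain ⟨w, hw⟩ := mem_closure_iff.1 hzP _ (isOpen_halfBall x ε ν) hz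
  have hsub := halfBall_subset_or hball hν ⟨w, hw⟩
  have hxcl : x ∈ closure (M.cell P) := by
    refine closure_mono hsub (mem_closure_halfBall hν.1 (Metric.mem_ball_self hε) ?_)
    rw [sub_self, inner_zero_right]
  have hfP : f ∈ M.faces P := by
    refine M.mem_faces_of_mem_frontier hxf ?_
    rw [(M.isOpen_cell P).frontier_eq]
    exact ⟨hxcl, M.not_mem_cell_of_mem_carrier hxf P⟩
  refine ⟨P, hfP, ?_⟩
  obtain ⟨c, r, hc⟩ := hM P
  obtain ⟨hn, -, h1⟩ := outerNormal_spec hfP hc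
  rcases hν.eq_or_eq_neg hn with h | h
  · exact h
  · exfalso
    obtain ⟨ε', hε', h1⟩ := h1 y hy
    have hm := lt_min hε hε'
    have h2 := (h1 _ hm (min_le_right _ _)).2
    rw [h, neg_neg] at h2
    have hz := sub_smul_mem_halfBall (x := x) hν.1 (half_pos hm) (half_lt_self hm)
    exact Set.disjoint_left.1 h2 hz
      (hsub ⟨Metric.ball_subset_ball (min_le_left _ _) hz.1, hz.2⟩)

/-- Two elements on a common face have opposite normals, so the closures of their half balls fill a
ball about each point of the face. The ball lies in the closure of the domain, and `domain_regular`,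
the absence of cracks, puts the point in the domain itself. -/
lemma mem_intFaces_of_ne (hM : M.StarCells) {f : E} {P Q : T} (hP : f ∈ M.faces P)
    (hQ : f ∈ M.faces Q) (hne : P ≠ Q) : f ∈ M.intFaces := by
  rw [M.mem_intFaces]
  rintro _ ⟨y, hy, rfl⟩
  have hneg := outerNormal_eq_neg hM hP hQ hne
  obtain ⟨c, r, hc⟩ := hM P
  obtain ⟨c', r', hc'⟩ := hM Q
  obtain ⟨hn, -, h1⟩ := outerNormal_spec hP hc
  obtain ⟨hn', -, h2⟩ := outerNormal_spec hQ hc'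
  obtain ⟨ε, hε, h1⟩ := h1 y hy
  obtain ⟨ε', hε', h2⟩ := h2 y hy
  have hm := lt_min hε hε'
  rw [← M.domain_regular, mem_interior]
  refine ⟨Metric.ball ((M.face f).chart y) (min ε ε'), fun z hz => ?_, Metric.isOpen_ball,
    Metric.mem_ball_self hm⟩
  rcases le_total ⟪M.outerNormal P f, z - (M.face f).chart y⟫ 0 with h | h
  · exact closure_mono (((h1 _ hm (min_le_left _ _)).1).trans (M.cell_subset P))
      (mem_closure_halfBall hn.1 hz h)
  · refine closure_mono (((h2 _ hm (min_le_right _ _)).1).trans (M.cell_subset Q))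
      (mem_closure_halfBall hn'.1 hz ?_)
    rw [hneg, inner_neg_left]; linarith

/-- Both unit normals ν and -ν are outward normals of elements at the face; the elements differ
because ν ≠ -ν. -/
lemma exists_ne_of_mem_domain (hM : M.StarCells) {f : E} {x : Sp (m + 1)}
    (hx : x ∈ (M.face f).carrier) (hd : x ∈ M.domain) :
    ∃ P Q, P ≠ Q ∧ f ∈ M.faces P ∧ f ∈ M.faces Q := by
  obtain ⟨y, hy, rfl⟩ := hx
  obtain ⟨ν, hν⟩ := (M.face f).exists_isNormal
  obtain ⟨P, hP, hP'⟩ := exists_cell_of_normal hM hy hd hν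
  obtain ⟨Q, hQ, hQ'⟩ := exists_cell_of_normal hM hy hd hν.neg
  refine ⟨P, Q, ?_, hP, hQ⟩
  rintro rfl
  have h : ν = -ν := hP'.symm.trans hQ'
  have h2 := congrArg (fun z => ⟪ν, z⟫) h
  simp only [inner_neg_right, hν.inner_self] at h2
  norm_num at h2

/-- An interior face belongs to exactly two elements. -/
lemma exists_pair_of_mem_intFaces (hM : M.StarCells) {f : E} (hf : f ∈ M.intFaces) :
    ∃ P Q, P ≠ Q ∧ ∀ R, f ∈ M.faces R ↔ R = P ∨ R = Q := by
  obtain ⟨y, hy⟩ := (M.face f).nonempty_dom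
  obtain ⟨P, Q, hne, hP, hQ⟩ := exists_ne_of_mem_domain hM ⟨y, hy, rfl⟩
    (M.mem_intFaces.1 hf ⟨y, hy, rfl⟩)
  refine ⟨P, Q, hne, fun R => ⟨fun hR => ?_, ?_⟩⟩
  · by_contra h
    push Not at h
    have h1 := outerNormal_eq_neg hM hP hR h.1.symm
    have h2 := outerNormal_eq_neg hM hP hQ hne
    exact h.2 (eq_of_outerNormal_eq hM hR hQ (h1.trans h2.symm))
  · rintro (rfl | rfl) <;> assumption

/-- A face that meets the domain in one point has elements on both sides and is then interior as a
whole, so no face is partly interior. -/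
lemma mem_bdFaces_of_not_mem_intFaces (hM : M.StarCells) {f : E} (hf : f ∉ M.intFaces) :
    f ∈ M.bdFaces := by
  rw [M.mem_bdFaces, M.isOpen_domain.frontier_eq]
  refine fun x hx => ⟨M.carrier_subset_closure_domain f hx, fun hd => hf ?_⟩
  obtain ⟨P, Q, hne, hP, hQ⟩ := exists_ne_of_mem_domain hM hx hd
  exact mem_intFaces_of_ne hM hP hQ hne

lemma not_mem_bdFaces_of_mem_intFaces {f : E} (hf : f ∈ M.intFaces) : f ∉ M.bdFaces := by
  intro hb
  obtain ⟨y, hy⟩ := (M.face f).nonempty_dom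
  have h := M.mem_bdFaces.1 hb ⟨y, hy, rfl⟩
  rw [M.isOpen_domain.frontier_eq] at h
  exact h.2 (M.mem_intFaces.1 hf ⟨y, hy, rfl⟩)

/-- A boundary face belongs to exactly one element. -/
lemma exists_unique_of_mem_bdFaces (hM : M.StarCells) {f : E} (hf : f ∈ M.bdFaces) :
    ∃ P, ∀ R, f ∈ M.faces R ↔ R = P := by
  obtain ⟨P, hP⟩ := M.face_used f
  have hP := M.mem_faces.2 hP
  refine ⟨P, fun R => ⟨fun hR => ?_, fun h => h ▸ hP⟩⟩
  by_contra hne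
  exact not_mem_bdFaces_of_mem_intFaces (mem_intFaces_of_ne hM hR hP hne) hf

lemma card_intFaces_add_card_bdFaces (hM : M.StarCells) :
    M.intFaces.card + M.bdFaces.card = Fintype.card E := by
  classical
  rw [← Finset.card_union_of_disjoint, ← Finset.card_univ]
  · congr 1
    ext f
    simp only [Finset.mem_union, Finset.mem_univ, iff_true]
    by_cases h : f ∈ M.intFaces
    · exact Or.inl h
    · exact Or.inr (mem_bdFaces_of_not_mem_intFaces hM h)
  · exact Finset.disjoint_left.2 fun f hf => not_mem_bdFaces_of_mem_intFaces hf

/-- Euler's formula. -/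
lemma sum_card_faces [Fintype T] (hM : M.StarCells) :
    ∑ P, (M.faces P).card = 2 * M.intFaces.card + M.bdFaces.card := by
  classical
  have h1 : ∑ P, (M.faces P).card = ∑ f : E, (Finset.univ.filter fun P => f ∈ M.faces P).card := by
    have := Finset.sum_card_bipartiteAbove_eq_sum_card_bipartiteBelow (s := (Finset.univ : Finset T))
      (t := (Finset.univ : Finset E)) (fun P f => f ∈ M.faces P)
    simpa [Finset.bipartiteAbove, Finset.bipartiteBelow] using this
  have h2 : ∀ f ∈ M.intFaces, (Finset.univ.filter fun P => f ∈ M.faces P).card = 2 := by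
    intro f hf
    obtain ⟨P, Q, hne, h⟩ := exists_pair_of_mem_intFaces hM hf
    rw [← Finset.card_pair hne]
    congr 1
    ext R; simp [h]
  have h3 : ∀ f ∈ M.intFacesᶜ, (Finset.univ.filter fun P => f ∈ M.faces P).card = 1 := by
    intro f hf
    obtain ⟨P, h⟩ := exists_unique_of_mem_bdFaces hM
      (mem_bdFaces_of_not_mem_intFaces hM (Finset.mem_compl.1 hf))
    rw [← Finset.card_singleton P]
    congr 1
    ext R; simp [h]
  have h4 := card_intFaces_add_card_bdFaces hM
  rw [h1, ← Finset.sum_add_sum_compl M.intFaces, Finset.sum_congr rfl h2, Finset.sum_congr rfl h3,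
    Finset.sum_const, Finset.sum_const, Finset.card_compl, smul_eq_mul, smul_eq_mul]
  omega

lemma volume_domain_diff [Finite T] : volume (M.domain \ ⋃ P, M.cell P) = 0 := by
  have : M.domain \ ⋃ P, M.cell P ⊆ ⋃ P, frontier (M.cell P) := by
    rintro x ⟨hx, hn⟩
    have hx' := subset_closure hx
    rw [M.cover] at hx'
    obtain ⟨P, hP⟩ := Set.mem_iUnion.1 hx'
    refine Set.mem_iUnion.2 ⟨P, ?_⟩
    rw [(M.isOpen_cell P).frontier_eq]
    exact ⟨hP, fun h => hn (Set.mem_iUnion.2 ⟨P, h⟩)⟩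
  exact measure_mono_null this (measure_iUnion_null fun P => M.volume_frontier P)

end PolyMesh

end

section

variable {m : ℕ} {T E : Type*}

/-! ### Cones over a face -/

namespace PolyFace

variable (f : PolyFace m)

/-- The open cone with apex `a` over the part `B` of the hyperplane of a face. -/
def cone (a : Sp (m + 1)) (B : Set (Sp m)) : Set (Sp (m + 1)) :=
  {x | ∃ t ∈ Set.Ioo (0 : ℝ) 1, ∃ y ∈ B, x = a + t • (f.chart y - a)}

lemma chart_homothety (y z : Sp m) (t : ℝ) :
    f.chart (z + t • (y - z)) = f.chart z + t • (f.chart y - f.chart z) := by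
  rw [f.chart_eq (z + t • (y - z)) z, add_sub_cancel_left, map_smul, f.chart_sub]

variable {f}

lemma frame_eq_cone {ν : Sp (m + 1)} {s : ℝ} {y₀ y : Sp m} {t : ℝ} :
    f.frame ν ((1 - t) * s, y₀ + t • (y - y₀)) =
      f.frame ν (s, y₀) + t • (f.chart y - f.frame ν (s, y₀)) := by
  simp only [frame]
  rw [f.chart_homothety]
  module

lemma frame_mem_cone_iff {ν : Sp (m + 1)} (hν : f.IsNormal ν) {s : ℝ} (hs : s ≠ 0) {y₀ : Sp m}
    {B : Set (Sp m)} {t : ℝ} (ht : t ≠ 0) {y : Sp m} :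
    f.frame ν ((1 - t) * s, y₀ + t • (y - y₀)) ∈ f.cone (f.frame ν (s, y₀)) B ↔
      t ∈ Set.Ioo (0 : ℝ) 1 ∧ y ∈ B := by
  constructor
  · rintro ⟨t', ht', y', hy', h⟩
    rw [← frame_eq_cone] at h
    have h' := hν.frame_injective h
    rw [Prod.mk.injEq] at h'
    have htt : t = t' := by
      have := mul_right_cancel₀ hs h'.1
      linarith
    subst htt
    have hyy : y = y' := by
      have h2 := smul_right_injective (Sp m) ht (add_left_cancel h'.2)
      exact sub_left_injective h2
    subst hyy
    exact ⟨ht', hy'⟩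
  · rintro ⟨ht', hy⟩
    exact ⟨t, ht', y, hy, frame_eq_cone⟩

/-- For a base that is only measurable the cone is described in adapted coordinates by solving for
its parameters: t = 1 - σ/s and y = y₀ + t⁻¹ (z - y₀). -/
lemma measurableSet_cone {ν : Sp (m + 1)} (hν : f.IsNormal ν) {s : ℝ} (hs : s ≠ 0) (y₀ : Sp m)
    {B : Set (Sp m)} (hB : MeasurableSet B) : MeasurableSet (f.cone (f.frame ν (s, y₀)) B) := by
  obtain ⟨e, he, -⟩ := hν.exists_frameEquiv
  rw [← e.measurableSet_preimage]
  have : e ⁻¹' f.cone (f.frame ν (s, y₀)) B =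
      {z : ℝ × Sp m | 1 - z.1 / s ∈ Set.Ioo (0 : ℝ) 1 ∧
        y₀ + (1 - z.1 / s)⁻¹ • (z.2 - y₀) ∈ B} := by
    ext ⟨σ, z⟩
    rw [Set.mem_preimage, he]
    set t := 1 - σ / s with ht
    have hσ : σ = (1 - t) * s := by rw [ht]; field_simp; ring
    -- The case t = 0 is the plane through the apex parallel to the face; both descriptions exclude
    -- it, so the default value of t⁻¹ does not matter.
    by_cases h0 : t = 0
    · constructor
      · rintro ⟨t', ht', y', hy', h⟩
        rw [← frame_eq_cone] at h
        have h' := congrArg Prod.fst (hν.frame_injective h)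
        have h'' : σ = (1 - t') * s := h'
        rw [hσ] at h''
        have := mul_right_cancel₀ hs h''
        have := ht'.1
        linarith
      · rintro ⟨h1, -⟩
        have h1' : t ∈ Set.Ioo (0 : ℝ) 1 := h1
        rw [h0] at h1'
        exact absurd h1'.1 (lt_irrefl _)
    · have hz : z = y₀ + t • ((y₀ + t⁻¹ • (z - y₀)) - y₀) := by
        rw [add_sub_cancel_left, smul_smul, mul_inv_cancel₀ h0, one_smul, add_sub_cancel]
      have key := frame_mem_cone_iff hν hs (y₀ := y₀) (B := B) h0 (y := y₀ + t⁻¹ • (z - y₀))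
      rw [← hz, ← hσ] at key
      exact key
  rw [this]
  have h1 : Measurable fun z : ℝ × Sp m => 1 - z.1 / s := by fun_prop
  have h2 : Measurable fun z : ℝ × Sp m => y₀ + (1 - z.1 / s)⁻¹ • (z.2 - y₀) := by fun_prop
  exact (h1 measurableSet_Ioo).inter (h2 hB)

lemma isBounded_cone (a : Sp (m + 1)) {B : Set (Sp m)} (hB : Bornology.IsBounded B) :
    Bornology.IsBounded (f.cone a B) := by
  have h1 : Bornology.IsBounded (f.chart '' B) := f.chart.lipschitz.isBounded_image hB
  obtain ⟨R, hR⟩ := h1.subset_closedBall a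
  refine (Metric.isBounded_closedBall (x := a) (r := R)).subset ?_
  rintro _ ⟨t, ht, y, hy, rfl⟩
  have h2 := hR ⟨y, hy, rfl⟩
  rw [Metric.mem_closedBall, dist_eq_norm] at h2 ⊢
  rw [add_sub_cancel_left, norm_smul, Real.norm_of_nonneg ht.1.le]
  nlinarith [ht.2, norm_nonneg (f.chart y - a)]

/-- Integration over a cone in polar form. -/
lemma integral_cone {ν : Sp (m + 1)} (hν : f.IsNormal ν) {s : ℝ} (hs : s < 0) (y₀ : Sp m)
    {B : Set (Sp m)} (hB : MeasurableSet B) (hBb : Bornology.IsBounded B) {G : Sp (m + 1) → ℝ}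
    (hG : Continuous G) :
    ∫ x in f.cone (f.frame ν (s, y₀)) B, G x =
      -s * ∫ t in Set.Ioo (0 : ℝ) 1, t ^ m * ∫ y in B,
        G (f.frame ν (s, y₀) + t • (f.chart y - f.frame ν (s, y₀))) := by
  set a := f.frame ν (s, y₀) with ha
  set C := f.cone a B with hC
  have hCm : MeasurableSet C := measurableSet_cone hν hs.ne y₀ hB
  obtain ⟨e, he, hmp⟩ := hν.exists_frameEquiv
  have hintg : Integrable (C.indicator G) := by
    rw [integrable_indicator_iff hCm]
    exact (hG.continuousOn.integrableOn_compact
      (isBounded_cone a hBb).isCompact_closure).mono_set subset_closure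
  have hintg' : Integrable (fun z => C.indicator G (e z)) :=
    (hmp.integrable_comp_emb e.measurableEmbedding).2 hintg
  have h1 : ∫ x in C, G x = ∫ σ, ∫ z, C.indicator G (e (σ, z)) := by
    rw [← integral_indicator hCm, ← hmp.integral_comp' (C.indicator G)]
    exact integral_prod _ hintg'
  -- The substitution σ = (1 - t) s replaces the height by the cone parameter; -s is the distance
  -- from the apex to the hyperplane.
  have h2 : ∀ H : ℝ → ℝ, ∫ σ, H σ = -s * ∫ t, H ((1 - t) * s) := by
    intro H
    have e1 := Measure.integral_comp_mul_right H s
    have e2 := integral_sub_left_eq_self (fun t : ℝ => H (t * s)) volume 1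
    rw [e2, e1, abs_inv, abs_of_neg hs, smul_eq_mul, ← mul_assoc,
      mul_inv_cancel₀ (by linarith), one_mul]
  -- Each slice of the cone is a dilation of the base about y₀, with Jacobian |t|ᵐ.
  have h3 : ∀ (K : Sp m → ℝ) (t : ℝ), t ≠ 0 →
      ∫ z, K z = |t| ^ m * ∫ y, K (y₀ + t • (y - y₀)) := by
    intro K t ht
    have e1 := Measure.integral_comp_smul volume (fun z => K (y₀ + z)) t
    have e2 := integral_sub_right_eq_self (fun y : Sp m => K (y₀ + t • y)) y₀ (μ := volume)
    have e3 := integral_add_left_eq_self K y₀ (μ := volume)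
    rw [e2, e1, e3, finrank_euclideanSpace_fin, smul_eq_mul, abs_inv, abs_pow, ← mul_assoc,
      mul_inv_cancel₀ (by positivity), one_mul]
  rw [h1, h2, ← integral_indicator measurableSet_Ioo]
  congr 1
  apply integral_congr_ae
  have h0 : ∀ᵐ t : ℝ, t ≠ 0 := by
    rw [ae_iff]
    simp
  filter_upwards [h0] with t ht
  rw [h3 _ t ht]
  by_cases ht' : t ∈ Set.Ioo (0 : ℝ) 1
  · rw [Set.indicator_of_mem ht', abs_of_pos ht'.1, ← integral_indicator hB]
    congr 1
    congr 1
    ext y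
    rw [he]
    by_cases hy : y ∈ B
    · rw [Set.indicator_of_mem ((frame_mem_cone_iff hν hs.ne ht).2 ⟨ht', hy⟩),
        Set.indicator_of_mem hy, frame_eq_cone]
    · rw [Set.indicator_of_notMem (fun h => hy ((frame_mem_cone_iff hν hs.ne ht).1 h).2),
        Set.indicator_of_notMem hy]
  · rw [Set.indicator_of_notMem ht']
    have : ∀ y, C.indicator G (e ((1 - t) * s, y₀ + t • (y - y₀))) = 0 := by
      intro y
      rw [he]
      exact Set.indicator_of_notMem (fun h => ht' ((frame_mem_cone_iff hν hs.ne ht).1 h).1) _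
    simp [this]

/-- The cone over a null set is a null set. -/
lemma volume_cone_eq_zero {ν : Sp (m + 1)} (hν : f.IsNormal ν) {s : ℝ} (hs : s < 0) (y₀ : Sp m)
    {B : Set (Sp m)} (hB : MeasurableSet B) (hBb : Bornology.IsBounded B) (h0 : volume B = 0) :
    volume (f.cone (f.frame ν (s, y₀)) B) = 0 := by
  have h := integral_cone hν hs y₀ hB hBb (G := fun _ => 1) continuous_const
  have hr : volume.restrict B = 0 := Measure.restrict_eq_zero.2 h0
  rw [hr] at h
  simp only [integral_zero_measure, mul_zero, setIntegral_const, smul_eq_mul, mul_one,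
    integral_zero] at h
  exact (measureReal_eq_zero_iff (isBounded_cone _ hBb).measure_lt_top.ne).1 h

lemma volume_frontier_dom (f : PolyFace m) : volume (frontier f.dom) = 0 := by
  obtain ⟨S, hS, hsub⟩ := f.flat_frontier
  refine measure_mono_null hsub ((measure_biUnion_null_iff S.countable_toSet).2 fun A hA => ?_)
  exact Measure.addHaar_affineSubspace volume A (hS A hA)

/-- The radial integration formula over a cone. -/
lemma integral_cone_radial {ν : Sp (m + 1)} (hν : f.IsNormal ν) {s : ℝ} (hs : s < 0) (y₀ : Sp m)
    {φ : Sp (m + 1) → ℝ} (hφ : ContDiff ℝ ∞ φ) :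
    ∫ x in f.cone (f.frame ν (s, y₀)) f.dom,
        ((m + 1) * φ x + ⟪gradient φ x, x - f.frame ν (s, y₀)⟫) =
      -s * ∫ y in f.dom, φ (f.chart y) := by
  set a := f.frame ν (s, y₀) with ha
  have hgc := cont_gradient hφ
  have hφc := hφ.continuous
  have hcc := f.continuous_chart
  rw [integral_cone hν hs y₀ f.isOpen_dom.measurableSet f.bounded_dom
    (G := fun x => (m + 1) * φ x + ⟪gradient φ x, x - a⟫) (by fun_prop)]
  congr 1
  set H : ℝ → Sp m → ℝ := fun t y => t ^ m * ((m + 1) * φ (a + t • (f.chart y - a))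
    + ⟪gradient φ (a + t • (f.chart y - a)), t • (f.chart y - a)⟫) with hH
  have hHc : Continuous (Function.uncurry H) := by
    simp only [hH, Function.uncurry_def]
    fun_prop
  have e1 : ∀ t, t ^ m * ∫ y in f.dom, ((m + 1) * φ (a + t • (f.chart y - a))
      + ⟪gradient φ (a + t • (f.chart y - a)), (a + t • (f.chart y - a)) - a⟫)
      = ∫ y in f.dom, H t y := by
    intro t
    rw [← integral_const_mul]
    simp only [hH, add_sub_cancel_left]
  have hfin : IsFiniteMeasure (volume.restrict f.dom) :=
    ⟨by rw [Measure.restrict_apply_univ]; exact f.bounded_dom.measure_lt_top⟩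
  have hI : Integrable (Function.uncurry H)
      ((volume.restrict (Set.Ioo (0 : ℝ) 1)).prod (volume.restrict f.dom)) := by
    rw [Measure.prod_restrict]
    have hK : IsCompact (Set.Icc (0 : ℝ) 1 ×ˢ closure f.dom) :=
      isCompact_Icc.prod f.bounded_dom.isCompact_closure
    exact (hHc.continuousOn.integrableOn_compact hK).mono_set
      (Set.prod_mono Set.Ioo_subset_Icc_self subset_closure)
  refine (integral_congr_ae (Eventually.of_forall fun t => e1 t)).trans ?_
  rw [integral_integral_swap hI]
  refine setIntegral_congr_fun f.isOpen_dom.measurableSet fun y _ => ?_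
  -- The weight m + 1 makes the integrand the derivative of tᵐ⁺¹ φ(a + t (y - a)), so the integral
  -- in t collapses to the value on the face; the end t = 0 contributes nothing.
  have hd : ∀ t : ℝ, HasDerivAt (fun t : ℝ => t ^ (m + 1) * φ (a + t • (f.chart y - a))) (H t y) t := by
    intro t
    have d1 : HasDerivAt (fun t : ℝ => a + t • (f.chart y - a)) (f.chart y - a) t := by
      simpa using ((hasDerivAt_id t).smul_const (f.chart y - a)).const_add a
    have d2 := (hφ.differentiable (by simp) (a + t • (f.chart y - a))).hasGradientAt
    have d3 := d2.hasFDerivAt.comp_hasDerivAt t d1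
    have d4 := (hasDerivAt_pow (m + 1) t).mul d3
    refine d4.congr_deriv ?_
    simp only [hH, InnerProductSpace.toDual_apply_apply, real_inner_smul_right,
      add_tsub_cancel_right, Function.comp_apply]
    push_cast
    ring
  have hFTC := intervalIntegral.integral_eq_sub_of_hasDerivAt (a := 0) (b := 1)
    (fun t _ => hd t) ((hHc.comp (by fun_prop : Continuous fun t : ℝ => (t, y))).intervalIntegrable _ _)
  rw [intervalIntegral.integral_of_le zero_le_one, integral_Ioc_eq_integral_Ioo] at hFTC
  rw [hFTC]
  simp

end PolyFace

end

/-! ### The radial identity and the divergence theorem on an element -/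

section

variable {m : ℕ} {T E : Type*}

lemma exists_mem_frontier_of_isPreconnected {X : Type*} [TopologicalSpace X] {S D : Set X}
    (hS : IsPreconnected S) (hD : IsOpen D) (h1 : (S ∩ D).Nonempty) (h2 : ¬ S ⊆ D) :
    ∃ w ∈ S, w ∈ frontier D := by
  by_contra! h
  refine h2 (hS.subset_left_of_subset_union hD (isClosed_closure (s := D)).isOpen_compl
    (Set.disjoint_compl_right_iff_subset.2 subset_closure) (fun z hz => ?_) h1)
  by_cases hzD : z ∈ D
  · exact Or.inl hzD
  · refine Or.inr fun hcl => h z hz ?_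
    rw [hD.frontier_eq]
    exact ⟨hcl, hzD⟩

/-- A ray that starts in a bounded open set leaves it through the boundary. -/
lemma exists_exit_point {n : ℕ} {D : Set (Sp n)} (hD : IsOpen D) (hb : Bornology.IsBounded D)
    {a x : Sp n} (hx : x ∈ D) (hne : x ≠ a) :
    ∃ t ∈ Set.Ioo (0 : ℝ) 1, ∃ z ∈ frontier D, x = a + t • (z - a) := by
  obtain ⟨R, hR⟩ := hb.subset_closedBall a
  have hpos : 0 < ‖x - a‖ := norm_pos_iff.2 (sub_ne_zero.2 hne)
  obtain ⟨N, hN⟩ := exists_gt (max 1 (R / ‖x - a‖))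
  have hN1 : 1 < N := lt_of_le_of_lt (le_max_left _ _) hN
  have hN2 : R < N * ‖x - a‖ := by
    rw [← div_lt_iff₀ hpos]; exact lt_of_le_of_lt (le_max_right _ _) hN
  obtain ⟨w, ⟨τ, hτ, rfl⟩, hw⟩ := exists_mem_frontier_of_isPreconnected
    (S := (fun τ : ℝ => a + τ • (x - a)) '' Set.Icc 1 N)
    (isPreconnected_Icc.image _ (by fun_prop)) hD
    ⟨x, ⟨1, ⟨le_rfl, hN1.le⟩, by simp⟩, hx⟩ (fun hsub => by
      have h1 := hR (hsub ⟨N, ⟨hN1.le, le_rfl⟩, rfl⟩)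
      rw [Metric.mem_closedBall, dist_eq_norm, add_sub_cancel_left, norm_smul,
        Real.norm_of_nonneg (by linarith)] at h1
      linarith)
  have hτ1 : 1 < τ := by
    refine lt_of_le_of_ne hτ.1 fun h => ?_
    rw [← h, hD.frontier_eq] at hw
    apply hw.2
    simpa using hx
  have hτ0 : (0 : ℝ) < τ := by linarith
  refine ⟨τ⁻¹, ⟨inv_pos.2 hτ0, inv_lt_one_of_one_lt₀ hτ1⟩, _, hw, ?_⟩
  rw [add_sub_cancel_left, smul_smul, inv_mul_cancel₀ hτ0.ne', one_smul, add_sub_cancel]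

namespace PolyMesh

variable {M : PolyMesh m T E} [Fintype E]

/-- The apex in coordinates adapted to a face. -/
lemma exists_apex {P : T} {f : E} (hf : f ∈ M.faces P) {c : Sp (m + 1)} {r : ℝ}
    (hS : StarDom (M.cell P) c r) {a : Sp (m + 1)} (ha : a ∈ Metric.ball c r) :
    ∃ s < 0, ∃ y₀, (M.face f).frame (M.outerNormal P f) (s, y₀) = a ∧
      s = ⟪M.outerNormal P f, a - (M.face f).chart 0⟫ := by
  obtain ⟨hn, h1, -⟩ := outerNormal_spec hf hS
  obtain ⟨⟨s, y₀⟩, hz⟩ := hn.exists_frame_eq a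
  have hs : s = ⟪M.outerNormal P f, a - (M.face f).chart 0⟫ := by
    rw [hn.inner_sub_eq a 0 y₀, ← hz, PolyFace.frame, add_sub_cancel_left, real_inner_smul_right,
      hn.inner_self, mul_one]
  exact ⟨s, hs ▸ h1 a ha 0, y₀, hz, hs⟩

lemma cone_subset {P : T} {f : E} (hf : f ∈ M.faces P) {c : Sp (m + 1)} {r : ℝ}
    (hS : StarDom (M.cell P) c r) {a : Sp (m + 1)} (ha : a ∈ Metric.ball c r) :
    (M.face f).cone a (M.face f).dom ⊆ M.cell P := by
  rintro _ ⟨t, ht, y, hy, rfl⟩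
  exact hS.mem_of_mem_closure ha
    (frontier_subset_closure (M.mem_faces.1 hf ⟨y, hy, rfl⟩)) ht.1.le ht.2

/-- A ray from a star centre meets the frontier only once, since the nearer of two such points would
be in the open cell. A common point of two cones would thus give a common point of two faces. -/
lemma cone_disjoint {P : T} {f e : E} (hf : f ∈ M.faces P) (he : e ∈ M.faces P) (hne : f ≠ e)
    {c : Sp (m + 1)} {r : ℝ} (hS : StarDom (M.cell P) c r) {a : Sp (m + 1)}
    (ha : a ∈ Metric.ball c r) :
    Disjoint ((M.face f).cone a (M.face f).dom) ((M.face e).cone a (M.face e).dom) := by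
  have key : ∀ {z z' : Sp (m + 1)} {t t' : ℝ}, z ∈ frontier (M.cell P) → z' ∈ frontier (M.cell P) →
      0 < t → 0 < t' → a + t • (z - a) = a + t' • (z' - a) → ¬ t < t' := by
    intro z z' t t' hz hz' ht ht' h hlt
    have h1 : z' = a + (t / t') • (z - a) := by
      have h2 : t • (z - a) = t' • (z' - a) := add_left_cancel h
      rw [div_eq_inv_mul, mul_smul, h2, smul_smul, inv_mul_cancel₀ ht'.ne', one_smul,
        add_sub_cancel]
    have h3 := hS.mem_of_mem_closure ha (frontier_subset_closure hz) (div_pos ht ht').le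
      ((div_lt_one ht').2 hlt)
    rw [← h1] at h3
    rw [(M.isOpen_cell P).frontier_eq] at hz'
    exact hz'.2 h3
  rw [Set.disjoint_left]
  rintro _ ⟨t, ht, y, hy, rfl⟩ ⟨t', ht', y', hy', h⟩
  have hz := M.mem_faces.1 hf ⟨y, hy, rfl⟩
  have hz' := M.mem_faces.1 he ⟨y', hy', rfl⟩
  rcases lt_trichotomy t t' with h' | h' | h'
  · exact key hz hz' ht.1 ht'.1 h h'
  · subst h'
    have h2 := smul_right_injective _ ht.1.ne' (add_left_cancel h)
    have h3 : (M.face f).chart y = (M.face e).chart y' := sub_left_injective h2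
    refine Set.disjoint_left.1 (M.disjoint_face f e hne) ⟨y, hy, rfl⟩ ?_
    rw [h3]
    exact subset_closure ⟨y', hy', rfl⟩
  · exact key hz' hz ht'.1 ht.1 h.symm h'

/-- Every point other than the apex lies on a ray that leaves the cell through a closed face. What
the open cones miss is the apex and the cones over the relative boundaries of the faces, which are
null because those boundaries lie in finitely many proper affine subspaces. -/
lemma volume_cell_diff_cones {P : T} {c : Sp (m + 1)} {r : ℝ} (hS : StarDom (M.cell P) c r)
    {a : Sp (m + 1)} (ha : a ∈ Metric.ball c r) :
    volume (M.cell P \ ⋃ f ∈ M.faces P, (M.face f).cone a (M.face f).dom) = 0 := by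
  have hsub : M.cell P \ ⋃ f ∈ M.faces P, (M.face f).cone a (M.face f).dom ⊆
      {a} ∪ ⋃ f ∈ M.faces P, (M.face f).cone a (frontier (M.face f).dom) := by
    rintro x ⟨hx, hn⟩
    by_cases hxa : x = a
    · exact Or.inl hxa
    · right
      obtain ⟨t, ht, z, hz, rfl⟩ := exists_exit_point (M.isOpen_cell P) (M.bounded_cell P) hx hxa
      rw [M.frontier_eq] at hz
      obtain ⟨f, hf, hzf⟩ := Set.mem_iUnion₂.1 hz
      rw [PolyFace.closure_carrier] at hzf
      obtain ⟨y, hy, rfl⟩ := hzf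
      refine Set.mem_iUnion₂.2 ⟨f, hf, t, ht, y, ?_, rfl⟩
      rw [(M.face f).isOpen_dom.frontier_eq]
      exact ⟨hy, fun hyd => hn (Set.mem_iUnion₂.2 ⟨f, hf, t, ht, y, hyd, rfl⟩)⟩
  refine measure_mono_null hsub (measure_union_null (measure_singleton a) ?_)
  refine (measure_biUnion_null_iff (M.faces P).countable_toSet).2 fun f hf => ?_
  obtain ⟨s, hs, y₀, hfr, -⟩ := exists_apex hf hS ha
  rw [← hfr]
  exact PolyFace.volume_cone_eq_zero (outerNormal_spec hf hS).1 hs y₀ isClosed_frontier.measurableSet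
    ((M.face f).bounded_dom.closure.subset frontier_subset_closure) (M.face f).volume_frontier_dom

lemma setIntegral_cell_eq_sum {P : T} {c : Sp (m + 1)} {r : ℝ} (hS : StarDom (M.cell P) c r)
    {a : Sp (m + 1)} (ha : a ∈ Metric.ball c r) {G : Sp (m + 1) → ℝ} (hG : Continuous G) :
    ∫ x in M.cell P, G x = ∑ f ∈ M.faces P, ∫ x in (M.face f).cone a (M.face f).dom, G x := by
  have hm : ∀ f ∈ M.faces P, MeasurableSet ((M.face f).cone a (M.face f).dom) := by
    intro f hf
    obtain ⟨s, hs, y₀, hfr, -⟩ := exists_apex hf hS ha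
    rw [← hfr]
    exact PolyFace.measurableSet_cone (outerNormal_spec hf hS).1 hs.ne y₀
      (M.face f).isOpen_dom.measurableSet
  have hae : M.cell P =ᵐ[volume] ⋃ f ∈ M.faces P, (M.face f).cone a (M.face f).dom := by
    refine EventuallyLE.antisymm (ae_le_set.2 (volume_cell_diff_cones hS ha)) (ae_le_set.2 ?_)
    rw [Set.sdiff_eq_empty.2 (Set.iUnion₂_subset fun f hf => cone_subset hf hS ha), measure_empty]
  rw [setIntegral_congr_set hae]
  refine integral_biUnion_finset (M.faces P) hm ?_ fun f hf => ?_
  · intro f hf e he hne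
    exact cone_disjoint hf he hne hS ha
  · exact (hG.continuousOn.integrableOn_compact (PolyFace.isBounded_cone a
      (M.face f).bounded_dom).isCompact_closure).mono_set subset_closure

/-- The weights on the faces are the positive distances of the apex from their hyperplanes. The
identity serves twice: applied to φ² it gives the trace inequality, and by varying the apex it gives
the divergence theorem. -/
lemma integral_radial {P : T} {c : Sp (m + 1)} {r : ℝ} (hS : StarDom (M.cell P) c r)
    {a : Sp (m + 1)} (ha : a ∈ Metric.ball c r) {φ : Sp (m + 1) → ℝ} (hφ : ContDiff ℝ ∞ φ) :
    ∫ x in M.cell P, ((m + 1) * φ x + ⟪gradient φ x, x - a⟫) =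
      ∑ f ∈ M.faces P, -⟪M.outerNormal P f, a - (M.face f).chart 0⟫
        * ∫ y in (M.face f).dom, φ ((M.face f).chart y) := by
  have hgc := cont_gradient hφ
  have hφc := hφ.continuous
  rw [setIntegral_cell_eq_sum hS ha (by fun_prop)]
  refine Finset.sum_congr rfl fun f hf => ?_
  obtain ⟨s, hs, y₀, hfr, hs'⟩ := exists_apex hf hS ha
  rw [← hs', ← hfr]
  exact PolyFace.integral_cone_radial (outerNormal_spec hf hS).1 hs y₀ hφ

/-- The divergence theorem on an element. -/
theorem integral_inner_gradient {P : T} {c : Sp (m + 1)} {r : ℝ} (hS : StarDom (M.cell P) c r)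
    {φ : Sp (m + 1) → ℝ} (hφ : ContDiff ℝ ∞ φ) (w : Sp (m + 1)) :
    ∫ x in M.cell P, ⟪gradient φ x, w⟫ =
      ∑ f ∈ M.faces P, ⟪M.outerNormal P f, w⟫ * ∫ y in (M.face f).dom, φ ((M.face f).chart y) := by
  have hgc := cont_gradient hφ
  have hφc := hφ.continuous
  have hfin := hS.isFiniteMeasure
  have hI : ∀ G : Sp (m + 1) → ℝ, Continuous G → Integrable G (volume.restrict (M.cell P)) :=
    fun G hG => (hG.continuousOn.integrableOn_compact
      (M.bounded_cell P).isCompact_closure).mono_set subset_closure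
  -- The radial identity is affine in the apex. Its values at the apexes c and c - δw, with δ so
  -- small that the second is still a star centre, differ by δ times the divergence theorem in
  -- direction w.
  obtain ⟨δ, hδ, hδw⟩ : ∃ δ : ℝ, 0 < δ ∧ δ * ‖w‖ < r := by
    refine ⟨r / (‖w‖ + 1), div_pos hS.pos (by positivity), ?_⟩
    rw [div_mul_eq_mul_div, div_lt_iff₀ (by positivity)]
    nlinarith [hS.pos, norm_nonneg w]
  have ha : c - δ • w ∈ Metric.ball c r := by
    rw [Metric.mem_ball, dist_eq_norm, sub_sub_cancel_left, norm_neg, norm_smul,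
      Real.norm_of_nonneg hδ.le]
    exact hδw
  have h1 := integral_radial hS (Metric.mem_ball_self hS.pos) hφ
  have h2 := integral_radial hS ha hφ
  have h3 : ∫ x in M.cell P, ((m + 1) * φ x + ⟪gradient φ x, x - (c - δ • w)⟫)
      = (∫ x in M.cell P, ((m + 1) * φ x + ⟪gradient φ x, x - c⟫))
        + δ * ∫ x in M.cell P, ⟪gradient φ x, w⟫ := by
    rw [← integral_const_mul, ← integral_add (hI _ (by fun_prop)) (hI _ (by fun_prop))]
    congr 1
    ext x
    rw [sub_sub_eq_add_sub, add_sub_right_comm, inner_add_right, real_inner_smul_right]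
    ring
  have h4 : ∑ f ∈ M.faces P, -⟪M.outerNormal P f, c - δ • w - (M.face f).chart 0⟫
        * ∫ y in (M.face f).dom, φ ((M.face f).chart y)
      = (∑ f ∈ M.faces P, -⟪M.outerNormal P f, c - (M.face f).chart 0⟫
        * ∫ y in (M.face f).dom, φ ((M.face f).chart y))
        + δ * ∑ f ∈ M.faces P, ⟪M.outerNormal P f, w⟫
          * ∫ y in (M.face f).dom, φ ((M.face f).chart y) := by
    rw [Finset.mul_sum, ← Finset.sum_add_distrib]
    refine Finset.sum_congr rfl fun f _ => ?_
    rw [sub_right_comm, inner_sub_right, real_inner_smul_right]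
    ring
  rw [h3, h4, h1] at h2
  exact mul_left_cancel₀ hδ.ne' (add_left_cancel h2)

end PolyMesh

end

/-! ### Traces and Green's formula in H¹ -/

section

variable {m : ℕ} {T E : Type*}

section

variable {n : ℕ} {D : Set (Sp n)}

lemma eLpNorm_two_sq_eq_ofReal {α F : Type*} [MeasurableSpace α] [NormedAddCommGroup F]
    {μ : Measure α} {u : α → F} (hu : MemLp u 2 μ) :
    eLpNorm u 2 μ ^ 2 = ENNReal.ofReal (∫ x, ‖u x‖ ^ 2 ∂μ) := by
  rw [eLpNorm_two_sq, ofReal_integral_eq_lintegral_ofReal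
    ((memLp_two_iff_integrable_sq_norm hu.1).1 hu) (Eventually.of_forall fun x => by positivity)]
  congr 1
  ext x
  rw [ENNReal.ofReal_pow (norm_nonneg _), ofReal_norm]

lemma norm_toLp_sq {α F : Type*} [MeasurableSpace α] [NormedAddCommGroup F]
    {μ : Measure α} {u : α → F} (hu : MemLp u 2 μ) : ‖hu.toLp‖ ^ 2 = ∫ x, ‖u x‖ ^ 2 ∂μ := by
  rw [Lp.norm_toLp, ← ENNReal.toReal_pow, eLpNorm_two_sq_eq_ofReal hu,
    ENNReal.toReal_ofReal (integral_nonneg fun x => by positivity)]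

lemma gradient_sq {φ : Sp n → ℝ} (hφ : ContDiff ℝ ∞ φ) (x : Sp n) :
    gradient (fun x => φ x ^ 2) x = (2 * φ x) • gradient φ x := by
  unfold gradient
  rw [fderiv_fun_pow 2 (hφ.differentiable (by simp) x)]
  simp [mul_comm]

lemma tendsto_toLp_iff {α F : Type*} [MeasurableSpace α] [NormedAddCommGroup F]
    {μ : Measure α} {a : ℕ → α → F} (h : ∀ j, MemLp (a j) 2 μ) (q : Lp F 2 μ) :
    Tendsto (fun j => (h j).toLp) atTop (𝓝 q) ↔
      Tendsto (fun j => eLpNorm (fun x => a j x - q x) 2 μ) atTop (𝓝 0) := by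
  rw [Lp.tendsto_Lp_iff_tendsto_eLpNorm']
  have : ∀ j, eLpNorm (⇑((h j).toLp) - ⇑q) 2 μ = eLpNorm (fun x => a j x - q x) 2 μ := by
    intro j
    apply eLpNorm_congr_ae
    filter_upwards [(h j).coeFn_toLp] with x hx
    rw [Pi.sub_apply, hx]
  simp_rw [this]

/-- The class of a test function in `L²(D)`. -/
def tval (D : Set (Sp n)) {φ : Sp n → ℝ} (hφ : IsTest Set.univ φ) : L2 D :=
  (hφ.memLp (D := D)).toLp φ

lemma coeFn_tval {φ : Sp n → ℝ} (hφ : IsTest Set.univ φ) : tval D hφ =ᵐ[volume.restrict D] φ :=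
  MemLp.coeFn_toLp _

lemma inner_tval (s : L2 D) {φ : Sp n → ℝ} (hφ : IsTest Set.univ φ) :
    ⟪s, tval D hφ⟫ = ∫ x in D, s x * φ x := by
  rw [l2_inner_eq]
  apply integral_congr_ae
  filter_upwards [coeFn_tval (D := D) hφ] with x hx
  rw [hx]

lemma l2v_inner_eq (v w : L2V D) : ⟪v, w⟫ = ∫ x in D, ⟪v x, w x⟫ := L2.inner_def v w

lemma IsTest.sub {φ ψ : Sp n → ℝ} (h : IsTest Set.univ φ) (h' : IsTest Set.univ ψ) :
    IsTest Set.univ (fun x => φ x - ψ x) :=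
  ⟨h.1.sub h'.1, h.2.1.sub h'.2.1, Set.subset_univ _⟩

lemma tval_sub {φ ψ : Sp n → ℝ} (h : IsTest Set.univ φ) (h' : IsTest Set.univ ψ) :
    tval D (h.sub h') = tval D h - tval D h' := MemLp.toLp_sub _ _

lemma gradient_sub' {φ ψ : Sp n → ℝ} (h : ContDiff ℝ ∞ φ) (h' : ContDiff ℝ ∞ ψ) (x : Sp n) :
    gradient (fun x => φ x - ψ x) x = gradient φ x - gradient ψ x := by
  unfold gradient
  rw [fderiv_fun_sub (h.differentiable (by simp) x) (h'.differentiable (by simp) x), map_sub]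

lemma tgrad_sub {φ ψ : Sp n → ℝ} (h : IsTest Set.univ φ) (h' : IsTest Set.univ ψ) :
    tgrad D (h.sub h') = tgrad D h - tgrad D h' := by
  apply Lp.ext
  filter_upwards [coeFn_tgrad (D := D) (h.sub h'), coeFn_tgrad (D := D) h, coeFn_tgrad (D := D) h',
    Lp.coeFn_sub (tgrad D h) (tgrad D h')] with x h1 h2 h3 h4
  rw [h1, h4, Pi.sub_apply, h2, h3, gradient_sub' h.1 h'.1]

end

namespace PolyMesh

variable (M : PolyMesh m T E)

lemma memLp_face (f : E) {φ : Sp (m + 1) → ℝ} (hφ : Continuous φ) :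
    MemLp (fun y => φ ((M.face f).chart y)) 2 (volume.restrict (M.face f).dom) :=
  memLp_of_bounded' (M.face f).bounded_dom (M.face f).isOpen_dom
    (hφ.comp (M.face f).continuous_chart)

/-- The class of the restriction of a test function to a face. -/
def ttrace (f : E) {φ : Sp (m + 1) → ℝ} (hφ : IsTest Set.univ φ) : M.L2F f :=
  (M.memLp_face f hφ.1.continuous).toLp

lemma coeFn_ttrace (f : E) {φ : Sp (m + 1) → ℝ} (hφ : IsTest Set.univ φ) :
    M.ttrace f hφ =ᵐ[volume.restrict (M.face f).dom] fun y => φ ((M.face f).chart y) :=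
  MemLp.coeFn_toLp _

lemma ttrace_sub (f : E) {φ ψ : Sp (m + 1) → ℝ} (h : IsTest Set.univ φ) (h' : IsTest Set.univ ψ) :
    M.ttrace f (h.sub h') = M.ttrace f h - M.ttrace f h' :=
  MemLp.toLp_sub (M.memLp_face f h.1.continuous) (M.memLp_face f h'.1.continuous)

/-- The class of a polynomial in `L²(f)`. -/
def fcls (f : E) : MvPolynomial (Fin m) ℝ →ₗ[ℝ] M.L2F f :=
  pcls (M.face f).isOpen_dom (M.face f).bounded_dom

lemma coeFn_fcls (f : E) (μ : MvPolynomial (Fin m) ℝ) :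
    M.fcls f μ =ᵐ[volume.restrict (M.face f).dom] pval μ := coeFn_pcls _ _ μ

lemma faceMoment_eq_inner (f : E) (t : M.L2F f) (μ : MvPolynomial (Fin m) ℝ) :
    M.faceMoment f t μ = ⟪M.fcls f μ, t⟫ := by
  rw [l2_inner_eq, faceMoment]
  apply integral_congr_ae
  filter_upwards [M.coeFn_fcls f μ] with y hy
  rw [hy, mul_comm]

lemma inner_fcls_ttrace (f : E) (μ : MvPolynomial (Fin m) ℝ) {φ : Sp (m + 1) → ℝ}
    (hφ : IsTest Set.univ φ) :
    ⟪M.fcls f μ, M.ttrace f hφ⟫ = ∫ y in (M.face f).dom, pval μ y * φ ((M.face f).chart y) := by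
  rw [l2_inner_eq]
  apply integral_congr_ae
  filter_upwards [M.coeFn_fcls f μ, M.coeFn_ttrace f hφ] with y hy hy'
  rw [hy, hy']

/-- Convergence of seminorms is recast as convergence of classes in Hilbert spaces, so that
continuity of inner products can be used in limits. -/
lemma isTrace_iff {P : T} {f : E} {q : L2 (M.cell P)} {t : M.L2F f} : M.IsTrace P f q t ↔
    ∃ (g : L2V (M.cell P)) (φ : ℕ → Sp (m + 1) → ℝ) (hφ : ∀ j, IsTest Set.univ (φ j)),
      IsWeakGrad (M.cell P) q g ∧ Tendsto (fun j => tval (M.cell P) (hφ j)) atTop (𝓝 q) ∧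
      Tendsto (fun j => tgrad (M.cell P) (hφ j)) atTop (𝓝 g) ∧
      Tendsto (fun j => M.ttrace f (hφ j)) atTop (𝓝 t) := by
  constructor
  · rintro ⟨g, φ, hg, hφ, h1, h2, h3⟩
    exact ⟨g, φ, hφ, hg, (tendsto_toLp_iff _ _).2 h1, (tendsto_toLp_iff _ _).2 h2,
      (tendsto_toLp_iff _ _).2 h3⟩
  · rintro ⟨g, φ, hφ, hg, h1, h2, h3⟩
    exact ⟨g, φ, hg, hφ, (tendsto_toLp_iff _ _).1 h1, (tendsto_toLp_iff _ _).1 h2,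
      (tendsto_toLp_iff _ _).1 h3⟩

variable [Fintype E]

lemma hasNormalTrace_iff {P : T} {v : L2V (M.cell P)} {s : L2 (M.cell P)}
    {g : E → MvPolynomial (Fin m) ℝ} : M.HasNormalTrace P v s g ↔
      ∀ φ (hφ : IsTest Set.univ φ), ⟪v, tgrad (M.cell P) hφ⟫ + ⟪s, tval (M.cell P) hφ⟫ =
        ∑ f ∈ M.faces P, ⟪M.fcls f (g f), M.ttrace f hφ⟫ := by
  refine forall₂_congr fun φ hφ => ?_
  have m1 := memLp_test (D := M.cell P) (cont_gradient hφ.1) (supp_gradient hφ.2.1)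
  have m2 := memLp_test (D := M.cell P) hφ.1.continuous hφ.2.1
  rw [inner_tgrad, inner_tval, integral_add (integrable_inner' (Lp.memLp v) m1)
    (integrable_mul' (Lp.memLp s) m2)]
  simp_rw [M.inner_fcls_ttrace]

variable {M}

/-- The trace inequality for smooth functions. -/
lemma exists_trace_bound {P : T} {c : Sp (m + 1)} {r : ℝ} (hS : StarDom (M.cell P) c r) {f : E}
    (hf : f ∈ M.faces P) : ∃ C : ℝ, 0 ≤ C ∧ ∀ φ (hφ : IsTest Set.univ φ),
      ‖M.ttrace f hφ‖ ≤ C * (‖tval (M.cell P) hφ‖ + ‖tgrad (M.cell P) hφ‖) := by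
  obtain ⟨R, hR⟩ := (M.bounded_cell P).subset_closedBall c
  have hR0 : 0 ≤ R := by
    have := hR (hS.ball_subset (Metric.mem_ball_self hS.pos))
    simpa using this
  have hcc := Metric.mem_ball_self (x := c) hS.pos
  have hneg : ∀ e ∈ M.faces P, 0 < -⟪M.outerNormal P e, c - (M.face e).chart 0⟫ := fun e he => by
    have := (outerNormal_spec he hS).2.1 c hcc 0
    linarith
  set h := -⟪M.outerNormal P f, c - (M.face f).chart 0⟫ with hh
  have hpos : 0 < h := hneg f hf
  set A : ℝ := (m + 1 + R) / h with hA
  have hA0 : 0 ≤ A := by positivity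
  -- In `A`, R bounds |x - c| on the cell and h is the distance of c from the hyperplane of the
  -- face. The squared inequality holds with constant A, and A ≤ (A + 1)² saves the square root.
  refine ⟨A + 1, by positivity, fun φ hφ => ?_⟩
  have hφc := hφ.1.continuous
  have hgc := cont_gradient hφ.1
  have hI : ∀ G : Sp (m + 1) → ℝ, Continuous G → Integrable G (volume.restrict (M.cell P)) :=
    fun G hG => (hG.continuousOn.integrableOn_compact
      (M.bounded_cell P).isCompact_closure).mono_set subset_closure
  -- For φ² all boundary terms are nonnegative, so those of the other faces may be dropped.
  have h1 := integral_radial hS hcc (φ := fun x => φ x ^ 2) (hφ.1.pow 2)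
  have h2 : h * ∫ y in (M.face f).dom, φ ((M.face f).chart y) ^ 2 ≤
      ∫ x in M.cell P, ((m + 1) * φ x ^ 2 + ⟪gradient (fun x => φ x ^ 2) x, x - c⟫) := by
    rw [h1]
    refine Finset.single_le_sum (f := fun e => -⟪M.outerNormal P e, c - (M.face e).chart 0⟫
        * ∫ y in (M.face e).dom, φ ((M.face e).chart y) ^ 2) (fun e he => ?_) hf
    exact mul_nonneg (hneg e he).le (integral_nonneg fun y => by positivity)
  have h3 : ∫ x in M.cell P, ((m + 1) * φ x ^ 2 + ⟪gradient (fun x => φ x ^ 2) x, x - c⟫) ≤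
      ∫ x in M.cell P, (m + 1 + R) * (‖φ x‖ ^ 2 + ‖gradient φ x‖ ^ 2) := by
    have hgc2 := cont_gradient (hφ.1.pow 2)
    refine setIntegral_mono_on (hI _ (by fun_prop)) (hI _ (by fun_prop))
      (M.isOpen_cell P).measurableSet fun x hx => ?_
    rw [gradient_sq hφ.1, real_inner_smul_left]
    have hx' : ‖x - c‖ ≤ R := by simpa [dist_eq_norm] using hR hx
    have h4 : |⟪gradient φ x, x - c⟫| ≤ ‖gradient φ x‖ * R :=
      (abs_real_inner_le_norm _ _).trans (by gcongr)
    have h5 : 2 * φ x * ⟪gradient φ x, x - c⟫ ≤ 2 * |φ x| * (‖gradient φ x‖ * R) := by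
      refine (le_abs_self _).trans ?_
      rw [abs_mul, abs_mul, abs_two]
      gcongr
    have h6 : 2 * |φ x| * ‖gradient φ x‖ ≤ |φ x| ^ 2 + ‖gradient φ x‖ ^ 2 := two_mul_le_add_sq _ _
    rw [Real.norm_eq_abs]
    have h7 := mul_le_mul_of_nonneg_right h6 hR0
    have h8 : φ x ^ 2 = |φ x| ^ 2 := (sq_abs _).symm
    have h9 : (0 : ℝ) ≤ (m + 1) * ‖gradient φ x‖ ^ 2 := by positivity
    rw [h8]
    nlinarith
  have h10 : ‖M.ttrace f hφ‖ ^ 2 ≤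
      A * (‖tval (M.cell P) hφ‖ ^ 2 + ‖tgrad (M.cell P) hφ‖ ^ 2) := by
    have e1 := norm_toLp_sq (M.memLp_face f hφ.1.continuous)
    have e2 := norm_toLp_sq (hφ.memLp (D := M.cell P))
    have e3 := norm_toLp_sq (memLp_gradient (D := M.cell P) hφ)
    simp only [ttrace, tval, tgrad]
    rw [e1, e2, e3, ← integral_add (hI _ (by fun_prop)) (hI _ (by fun_prop)), hA,
      div_mul_eq_mul_div, le_div_iff₀ hpos, ← integral_const_mul, mul_comm]
    refine le_trans ?_ (h2.trans h3)
    simp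
  have h11 : 0 ≤ ‖tval (M.cell P) hφ‖ := norm_nonneg _
  have h12 : 0 ≤ ‖tgrad (M.cell P) hφ‖ := norm_nonneg _
  refine abs_le_of_sq_le_sq' ?_ (by positivity) |>.2
  refine h10.trans ?_
  rw [mul_pow]
  refine mul_le_mul (by nlinarith) (by nlinarith) (by positivity) (by positivity)

/-- Traces exist, along one approximating sequence for all faces. -/
lemma exists_seq_traces {P : T} {c : Sp (m + 1)} {r : ℝ} (hS : StarDom (M.cell P) c r)
    {q : L2 (M.cell P)} {g : L2V (M.cell P)} (hg : IsWeakGrad (M.cell P) q g) :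
    ∃ (φ : ℕ → Sp (m + 1) → ℝ) (hφ : ∀ j, IsTest Set.univ (φ j)) (t : ∀ f, M.L2F f),
      Tendsto (fun j => tval (M.cell P) (hφ j)) atTop (𝓝 q) ∧
      Tendsto (fun j => tgrad (M.cell P) (hφ j)) atTop (𝓝 g) ∧
      ∀ f ∈ M.faces P, Tendsto (fun j => M.ttrace f (hφ j)) atTop (𝓝 (t f)) := by
  obtain ⟨φ, hφ, h1, h2⟩ := hS.exists_test_tendsto hg
  have h1' : Tendsto (fun j => tval (M.cell P) (hφ j)) atTop (𝓝 q) := (tendsto_toLp_iff _ _).2 h1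
  have h2' : Tendsto (fun j => tgrad (M.cell P) (hφ j)) atTop (𝓝 g) := (tendsto_toLp_iff _ _).2 h2
  -- The restrictions to a face are Cauchy by the trace inequality for differences. Off the faces of
  -- P nothing is required and the value is 0.
  have key : ∀ f, ∃ t : M.L2F f, f ∈ M.faces P →
      Tendsto (fun j => M.ttrace f (hφ j)) atTop (𝓝 t) := by
    intro f
    by_cases hf : f ∈ M.faces P
    · obtain ⟨C, hC, hbd⟩ := exists_trace_bound hS hf
      have hc1 := h1'.cauchySeq
      have hc2 := h2'.cauchySeq
      have : CauchySeq fun j => M.ttrace f (hφ j) := by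
        rw [Metric.cauchySeq_iff] at hc1 hc2 ⊢
        intro ε hε
        obtain ⟨N1, hN1⟩ := hc1 (ε / (2 * (C + 1))) (by positivity)
        obtain ⟨N2, hN2⟩ := hc2 (ε / (2 * (C + 1))) (by positivity)
        refine ⟨max N1 N2, fun i hi j hj => ?_⟩
        have a1 := hN1 i (le_trans (le_max_left _ _) hi) j (le_trans (le_max_left _ _) hj)
        have a2 := hN2 i (le_trans (le_max_right _ _) hi) j (le_trans (le_max_right _ _) hj)
        have a3 := hbd _ ((hφ i).sub (hφ j))
        rw [M.ttrace_sub f (hφ i) (hφ j), tval_sub (hφ i) (hφ j), tgrad_sub (hφ i) (hφ j)] at a3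
        rw [dist_eq_norm] at a1 a2 ⊢
        refine a3.trans_lt ?_
        have a4 : ‖tval (M.cell P) (hφ i) - tval (M.cell P) (hφ j)‖
            + ‖tgrad (M.cell P) (hφ i) - tgrad (M.cell P) (hφ j)‖ < ε / (C + 1) := by
          have : ε / (C + 1) = ε / (2 * (C + 1)) + ε / (2 * (C + 1)) := by field_simp; ring
          rw [this]
          exact add_lt_add a1 a2
        rw [lt_div_iff₀ (by positivity)] at a4
        refine lt_of_le_of_lt ?_ a4
        rw [mul_comm]
        gcongr
        linarith
      obtain ⟨t, ht⟩ := cauchySeq_tendsto_of_complete this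
      exact ⟨t, fun _ => ht⟩
    · exact ⟨0, fun h => absurd h hf⟩
  choose t ht using key
  exact ⟨φ, hφ, t, h1', h2', fun f hf => ht f hf⟩

/-- Two approximating sequences have the same limit in H¹, the weak gradient being unique, and the
trace inequality applied to their difference lets the traces coincide in the limit. -/
lemma IsTrace.unique {P : T} {c : Sp (m + 1)} {r : ℝ} (hS : StarDom (M.cell P) c r)
    {f : E} (hf : f ∈ M.faces P) {q : L2 (M.cell P)} {t t' : M.L2F f} (ht : M.IsTrace P f q t)
    (ht' : M.IsTrace P f q t') : t = t' := by
  obtain ⟨g, φ, hφ, hg, h1, h2, h3⟩ := M.isTrace_iff.1 ht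
  obtain ⟨g', ψ, hψ, hg', h1', h2', h3'⟩ := M.isTrace_iff.1 ht'
  obtain rfl := hg.unique (M.isOpen_cell P) hg'
  obtain ⟨C, hC, hbd⟩ := exists_trace_bound hS hf
  have k1 := (h1.sub h1').norm
  have k2 := (h2.sub h2').norm
  have k3 := (h3.sub h3').norm
  rw [sub_self, norm_zero] at k1 k2
  have k4 := (k1.add k2).const_mul C
  rw [add_zero, mul_zero] at k4
  have k5 : ‖t - t'‖ ≤ 0 := by
    refine le_of_tendsto_of_tendsto' k3 k4 fun j => ?_
    have := hbd _ ((hφ j).sub (hψ j))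
    rwa [M.ttrace_sub f (hφ j) (hψ j), tval_sub (hφ j) (hψ j), tgrad_sub (hφ j) (hψ j)] at this
  exact sub_eq_zero.1 (norm_le_zero_iff.1 k5)

lemma exists_isTraceFamily {P : T} {c : Sp (m + 1)} {r : ℝ} (hS : StarDom (M.cell P) c r)
    {q : L2 (M.cell P)} {g : L2V (M.cell P)} (hg : IsWeakGrad (M.cell P) q g) :
    ∃ t, M.IsTraceFamily P q t := by
  obtain ⟨φ, hφ, t, h1, h2, h3⟩ := exists_seq_traces hS hg
  exact ⟨t, fun f hf => M.isTrace_iff.2 ⟨g, φ, hφ, hg, h1, h2, h3 f hf⟩⟩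

/-- Green's formula for functions in `H¹`. -/
theorem HasNormalTrace.green {P : T} {c : Sp (m + 1)} {r : ℝ} (hS : StarDom (M.cell P) c r)
    {v : L2V (M.cell P)} {s : L2 (M.cell P)} {γ : E → MvPolynomial (Fin m) ℝ}
    (hv : M.HasNormalTrace P v s γ) {q : L2 (M.cell P)} {g : L2V (M.cell P)}
    (hg : IsWeakGrad (M.cell P) q g) {t : ∀ f, M.L2F f} (ht : M.IsTraceFamily P q t) :
    ⟪v, g⟫ + ⟪s, q⟫ = ∑ f ∈ M.faces P, M.faceMoment f (t f) (γ f) := by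
  obtain ⟨φ, hφ, t', h1, h2, h3⟩ := exists_seq_traces hS hg
  have ht' : ∀ f ∈ M.faces P, t' f = t f := fun f hf =>
    IsTrace.unique hS hf (M.isTrace_iff.2 ⟨g, φ, hφ, hg, h1, h2, h3 f hf⟩) (ht f hf)
  have hv' := M.hasNormalTrace_iff.1 hv
  have k1 : Tendsto (fun j => ⟪v, tgrad (M.cell P) (hφ j)⟫ + ⟪s, tval (M.cell P) (hφ j)⟫) atTop
      (𝓝 (⟪v, g⟫ + ⟪s, q⟫)) :=
    (tendsto_const_nhds.inner h2).add (tendsto_const_nhds.inner h1)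
  have k2 : Tendsto (fun j => ∑ f ∈ M.faces P, ⟪M.fcls f (γ f), M.ttrace f (hφ j)⟫) atTop
      (𝓝 (∑ f ∈ M.faces P, M.faceMoment f (t f) (γ f))) := by
    refine tendsto_finsetSum _ fun f hf => ?_
    rw [M.faceMoment_eq_inner, ← ht' f hf]
    exact tendsto_const_nhds.inner (h3 f hf)
  refine tendsto_nhds_unique k1 (k2.congr fun j => ?_)
  rw [hv' _ (hφ j)]

end PolyMesh

end

/-! ### Traces and normal traces of polynomials; uniqueness of normal traces -/

section

variable {m : ℕ} {T E : Type*}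

section

variable {n : ℕ} {D : Set (Sp n)}

lemma gradient_mul_apply {φ ψ : Sp n → ℝ} (hφ : ContDiff ℝ ∞ φ) (hψ : ContDiff ℝ ∞ ψ) (x : Sp n)
    (i : Fin n) : gradient (fun x => φ x * ψ x) x i
      = φ x * gradient ψ x i + ψ x * gradient φ x i := by
  rw [gradient_apply, gradient_apply, gradient_apply,
    fderiv_fun_mul (hφ.differentiable (by simp) x) (hψ.differentiable (by simp) x)]
  simp

end

namespace PolyMesh

variable (M : PolyMesh m T E)

/-- The class in `L²(P)` of a polynomial. -/
abbrev ccls (P : T) : MvPolynomial (Fin (m + 1)) ℝ →ₗ[ℝ] L2 (M.cell P) :=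
  pcls (M.isOpen_cell P) (M.bounded_cell P)

/-- The class in `(L²(P))^d` of a vector of polynomials. -/
abbrev cclsV (P : T) : (Fin (m + 1) → MvPolynomial (Fin (m + 1)) ℝ) →ₗ[ℝ] L2V (M.cell P) :=
  pclsV (M.isOpen_cell P) (M.bounded_cell P)

lemma exists_chartPoly (f : E) :
    ∃ h : MvPolynomial (Fin (m + 1)) ℝ →ₐ[ℝ] MvPolynomial (Fin m) ℝ,
      (∀ p y, pval (h p) y = pval p ((M.face f).chart y)) ∧
      ∀ k : ℤ, ∀ p ∈ polyDeg (m + 1) k, h p ∈ polyDeg m k := by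
  obtain ⟨g, hg, h⟩ := exists_pval_comp_affine (M.face f).chart.toAffineMap
  exact ⟨MvPolynomial.bind₁ g, h, fun k p hp => bind₁_mem_polyDeg g hg hp⟩

/-- Restriction of a polynomial to the hyperplane of a face. -/
def chartPoly (f : E) : MvPolynomial (Fin (m + 1)) ℝ →ₐ[ℝ] MvPolynomial (Fin m) ℝ :=
  (M.exists_chartPoly f).choose

lemma pval_chartPoly (f : E) (p : MvPolynomial (Fin (m + 1)) ℝ) (y : Sp m) :
    pval (M.chartPoly f p) y = pval p ((M.face f).chart y) :=
  (M.exists_chartPoly f).choose_spec.1 p y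

lemma chartPoly_mem {f : E} {k : ℤ} {p : MvPolynomial (Fin (m + 1)) ℝ}
    (hp : p ∈ polyDeg (m + 1) k) : M.chartPoly f p ∈ polyDeg m k :=
  (M.exists_chartPoly f).choose_spec.2 k p hp

variable [Fintype E]

/-- On a neighbourhood of an element a polynomial agrees with a test function. -/
lemma exists_test_poly (P : T) (q : MvPolynomial (Fin (m + 1)) ℝ) :
    ∃ φ, ∃ hφ : IsTest Set.univ φ, tval (M.cell P) hφ = M.ccls P q ∧
      tgrad (M.cell P) hφ = M.cclsV P (pgrad q) ∧
      ∀ f ∈ M.faces P, M.ttrace f hφ = M.fcls f (M.chartPoly f q) := by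
  obtain ⟨φ, hφ, ⟨U, hU, hsub, hE⟩, hG⟩ := exists_test_eqOn (M.bounded_cell P) (contDiff_pval q)
  have hm := ae_restrict_mem (μ := volume) (M.isOpen_cell P).measurableSet
  refine ⟨φ, hφ, ?_, ?_, fun f hf => ?_⟩
  · rw [eq_pcls_iff]
    filter_upwards [coeFn_tval (D := M.cell P) hφ, hm] with x hx hxP
    rw [hx, hE (hsub (subset_closure hxP))]
  · rw [eq_pclsV_iff]
    filter_upwards [coeFn_tgrad (D := M.cell P) hφ, hm] with x hx hxP
    rw [hx, hG hxP, gradient_pval]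
  · refine (eq_pcls_iff (M.face f).isOpen_dom (M.face f).bounded_dom).2 ?_
    filter_upwards [M.coeFn_ttrace f hφ,
      ae_restrict_mem (μ := volume) (M.face f).isOpen_dom.measurableSet] with y hy hyf
    rw [hy, M.pval_chartPoly, hE (hsub (frontier_subset_closure (M.mem_faces.1 hf ⟨y, hyf, rfl⟩)))]

lemma isTrace_ccls {P : T} {f : E} (hf : f ∈ M.faces P) (q : MvPolynomial (Fin (m + 1)) ℝ) :
    M.IsTrace P f (M.ccls P q) (M.fcls f (M.chartPoly f q)) := by
  obtain ⟨φ, hφ, h1, h2, h3⟩ := M.exists_test_poly P q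
  refine M.isTrace_iff.2 ⟨_, fun _ => φ, fun _ => hφ, isWeakGrad_pcls _ _ q, ?_, ?_, ?_⟩
  · rw [← h1]; exact tendsto_const_nhds
  · rw [← h2]; exact tendsto_const_nhds
  · rw [← h3 f hf]; exact tendsto_const_nhds

/-- The normal component on a face of a vector of polynomials. -/
def normalPoly (P : T) (w : Fin (m + 1) → MvPolynomial (Fin (m + 1)) ℝ) (f : E) :
    MvPolynomial (Fin m) ℝ :=
  ∑ i, M.outerNormal P f i • M.chartPoly f (w i)

lemma pval_normalPoly (P : T) (w : Fin (m + 1) → MvPolynomial (Fin (m + 1)) ℝ) (f : E) (y : Sp m) :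
    pval (M.normalPoly P w f) y = ⟪pvalV w ((M.face f).chart y), M.outerNormal P f⟫ := by
  rw [normalPoly, map_sum, Finset.sum_apply, inner_eq_sum]
  refine Finset.sum_congr rfl fun i _ => ?_
  rw [map_smul, Pi.smul_apply, M.pval_chartPoly, smul_eq_mul, mul_comm, pvalV_apply]

lemma normalPoly_mem {P : T} {w : Fin (m + 1) → MvPolynomial (Fin (m + 1)) ℝ} {k : ℤ}
    (hw : ∀ i, w i ∈ polyDeg (m + 1) k) (f : E) : M.normalPoly P w f ∈ polyDeg m k :=
  Submodule.sum_mem _ fun i _ => Submodule.smul_mem _ _ (M.chartPoly_mem (hw i))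

variable {M}

/-- The divergence theorem in the coordinate direction eᵢ is applied to the product φ wᵢ and summed
over i. -/
lemma hasNormalTrace_cclsV {P : T} {c : Sp (m + 1)} {r : ℝ} (hS : StarDom (M.cell P) c r)
    (w : Fin (m + 1) → MvPolynomial (Fin (m + 1)) ℝ) :
    M.HasNormalTrace P (M.cclsV P w) (M.ccls P (pdiv w)) (M.normalPoly P w) := by
  intro φ hφ
  have hI : ∀ G : Sp (m + 1) → ℝ, Continuous G → Integrable G (volume.restrict (M.cell P)) :=
    fun G hG => (hG.continuousOn.integrableOn_compact
      (M.bounded_cell P).isCompact_closure).mono_set subset_closure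
  have hJ : ∀ (f : E) (G : Sp m → ℝ), Continuous G →
      Integrable G (volume.restrict (M.face f).dom) :=
    fun f G hG => (hG.continuousOn.integrableOn_compact
      (M.face f).bounded_dom.isCompact_closure).mono_set subset_closure
  have hcd : ∀ i, ContDiff ℝ ∞ fun x => φ x * pval (w i) x := fun i =>
    hφ.1.mul (contDiff_pval (w i))
  have e1 : ∫ x in M.cell P, (⟪(M.cclsV P w) x, gradient φ x⟫ + (M.ccls P (pdiv w)) x * φ x)
      = ∫ x in M.cell P, ∑ i, ⟪gradient (fun x => φ x * pval (w i) x) x,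
          EuclideanSpace.single i (1 : ℝ)⟫ := by
    apply integral_congr_ae
    filter_upwards [coeFn_pclsV (M.isOpen_cell P) (M.bounded_cell P) w,
      coeFn_pcls (M.isOpen_cell P) (M.bounded_cell P) (pdiv w)] with x h1 h2
    have e : pval (pdiv w) x = ∑ i, pval (MvPolynomial.pderiv i (w i)) x := by
      rw [pdiv, map_sum, Finset.sum_apply]
    rw [h1, h2, inner_eq_sum, e, Finset.sum_mul, ← Finset.sum_add_distrib]
    refine Finset.sum_congr rfl fun i _ => ?_
    rw [EuclideanSpace.inner_single_right]
    simp only [conj_trivial, one_mul]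
    rw [gradient_mul_apply hφ.1 (contDiff_pval (w i)), gradient_pval_apply, pvalV_apply]
    ring
  rw [e1, integral_finsetSum _ fun i _ => hI _ (by
    have := cont_gradient (hcd i)
    fun_prop)]
  simp_rw [fun i => integral_inner_gradient hS (hcd i)]
  rw [Finset.sum_comm]
  refine Finset.sum_congr rfl fun f _ => ?_
  have e2 : ∀ y, pval (M.normalPoly P w f) y * φ ((M.face f).chart y)
      = ∑ i, M.outerNormal P f i * (φ ((M.face f).chart y) * pval (w i) ((M.face f).chart y)) := by
    intro y
    rw [M.pval_normalPoly, inner_eq_sum, Finset.sum_mul]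
    refine Finset.sum_congr rfl fun i _ => ?_
    rw [pvalV_apply]; ring
  simp_rw [e2]
  rw [integral_finsetSum _ fun i _ => hJ f _ (by
    have h1 := (M.face f).continuous_chart
    have h2 := hφ.1.continuous
    have h3 := continuous_pval (w i)
    fun_prop)]
  refine Finset.sum_congr rfl fun i _ => ?_
  rw [integral_const_mul, EuclideanSpace.inner_single_right]
  simp

/-- A test function supported in the open cell vanishes on all faces, so the boundary terms of
Green's formula drop out. -/
lemma HasNormalTrace.isWeakDiv {P : T} {v : L2V (M.cell P)} {s : L2 (M.cell P)}
    {g : E → MvPolynomial (Fin m) ℝ} (h : M.HasNormalTrace P v s g) : IsWeakDiv (M.cell P) v s := by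
  intro φ hφ
  have h1 := h φ (hφ.mono (Set.subset_univ _))
  have m1 := memLp_test (D := M.cell P) (cont_gradient hφ.1) (supp_gradient hφ.2.1)
  have m2 := memLp_test (D := M.cell P) hφ.1.continuous hφ.2.1
  rw [integral_add (integrable_inner' (Lp.memLp v) m1) (integrable_mul' (Lp.memLp s) m2)] at h1
  have h2 : ∑ f ∈ M.faces P, ∫ y in (M.face f).dom, pval (g f) y * φ ((M.face f).chart y) = 0 := by
    refine Finset.sum_eq_zero fun f _ => ?_
    rw [setIntegral_congr_fun (g := fun _ => (0 : ℝ)) (M.face f).isOpen_dom.measurableSet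
      fun y hy => ?_]
    · simp
    · simp only
      rw [hφ.eq_zero (M.not_mem_cell_of_mem_carrier ⟨y, hy, rfl⟩ P), mul_zero]
  rw [h2] at h1
  rw [eq_neg_of_add_eq_zero_left h1]
  simp_rw [mul_comm]

/-- A polynomial on a face is determined by its integrals against test functions that are
supported near a point of the face. -/
lemma eq_zero_of_forall_test_face {f : E} {δ : MvPolynomial (Fin m) ℝ} {y₀ : Sp m}
    (hy₀ : y₀ ∈ (M.face f).dom) {U : Set (Sp (m + 1))} (hU : U ∈ 𝓝 ((M.face f).chart y₀))
    (h : ∀ φ, IsTest U φ → ∫ y in (M.face f).dom, pval δ y * φ ((M.face f).chart y) = 0) :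
    δ = 0 := by
  obtain ⟨ε, hε, hεU⟩ := Metric.mem_nhds_iff.1 hU
  obtain ⟨ε', hε', hεd⟩ := Metric.isOpen_iff.1 (M.face f).isOpen_dom y₀ hy₀
  set η := min ε ε' with hη
  have hη0 : 0 < η := lt_min hε hε'
  refine eq_zero_of_pval_eq_zero (D := Metric.ball y₀ η) Metric.isOpen_ball
    ⟨y₀, Metric.mem_ball_self hη0⟩ fun y₁ hy₁ => ?_
  by_contra hne
  have hcont : Continuous fun y => pval δ y₁ * pval δ y :=
    continuous_const.mul (continuous_pval δ)
  have hpos : 0 < pval δ y₁ * pval δ y₁ := mul_self_pos.2 hne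
  have hev : {y | 0 < pval δ y₁ * pval δ y} ∩ Metric.ball y₀ η ∈ 𝓝 y₁ :=
    Filter.inter_mem ((isOpen_lt continuous_const hcont).mem_nhds hpos)
      (Metric.isOpen_ball.mem_nhds hy₁)
  obtain ⟨κ₀, hκ₀, hκs₀⟩ := Metric.mem_nhds_iff.1 hev
  rw [Metric.mem_ball] at hy₁
  set κ := min κ₀ (η - dist y₁ y₀) with hκdef
  have hκ : 0 < κ := lt_min hκ₀ (by linarith)
  have hκs := (Metric.ball_subset_ball (x := y₁) (min_le_left κ₀ (η - dist y₁ y₀))).trans hκs₀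
  -- The bump sits at a point y₁ with δ(y₁) ≠ 0. Its radius is so small that δ keeps the sign of
  -- δ(y₁) on its support and that the support stays in U and sees only the face. The integral of
  -- δ(y₁) δ b would then be positive.
  let b : ContDiffBump ((M.face f).chart y₁) := ⟨κ / 4, κ / 2, by positivity, by linarith⟩
  have hdist : ∀ y, dist ((M.face f).chart y) ((M.face f).chart y₁) = dist y y₁ :=
    fun y => (M.face f).chart.isometry.dist_eq y y₁
  have hsupp : ∀ y, b ((M.face f).chart y) ≠ 0 → y ∈ Metric.ball y₁ κ := by
    intro y hy
    have : (M.face f).chart y ∈ Function.support b := hy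
    rw [b.support_eq, Metric.mem_ball, hdist] at this
    rw [Metric.mem_ball]
    have h2 : b.rOut = κ / 2 := rfl
    linarith
  have hκball : κ / 2 + dist y₁ y₀ < η := by
    have : κ ≤ η - dist y₁ y₀ := min_le_right _ _
    linarith
  have hbU : IsTest U b := by
    refine ⟨b.contDiff, b.hasCompactSupport, ?_⟩
    rw [b.tsupport_eq]
    intro x hx
    apply hεU
    rw [Metric.mem_closedBall] at hx
    rw [Metric.mem_ball]
    have h1 := dist_triangle x ((M.face f).chart y₁) ((M.face f).chart y₀)
    have h2 : dist ((M.face f).chart y₁) ((M.face f).chart y₀) = dist y₁ y₀ :=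
      (M.face f).chart.isometry.dist_eq y₁ y₀
    have h3 : b.rOut = κ / 2 := rfl
    have h4 : η ≤ ε := min_le_left _ _
    linarith
  have hGc : Continuous fun y => (pval δ y₁ * pval δ y) * b ((M.face f).chart y) :=
    hcont.mul (b.continuous.comp (M.face f).continuous_chart)
  have hGs : HasCompactSupport fun y => (pval δ y₁ * pval δ y) * b ((M.face f).chart y) :=
    HasCompactSupport.mul_left (b.hasCompactSupport.comp_isClosedEmbedding
      (M.face f).chart.isometry.isClosedEmbedding)
  have hG0 : 0 ≤ fun y => (pval δ y₁ * pval δ y) * b ((M.face f).chart y) := by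
    intro y
    change 0 ≤ (pval δ y₁ * pval δ y) * b ((M.face f).chart y)
    by_cases hy : b ((M.face f).chart y) = 0
    · rw [hy, mul_zero]
    · exact mul_nonneg (le_of_lt (hκs (hsupp y hy)).1) b.nonneg
  have hG1 : (pval δ y₁ * pval δ y₁) * b ((M.face f).chart y₁) ≠ 0 := by
    rw [b.one_of_mem_closedBall (Metric.mem_closedBall_self b.rIn_pos.le), mul_one]
    exact hpos.ne'
  have hintg := hGc.integral_pos_of_hasCompactSupport_nonneg_nonzero (μ := volume) hGs hG0 hG1
  have hset : ∫ y in (M.face f).dom, (pval δ y₁ * pval δ y) * b ((M.face f).chart y)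
      = ∫ y, (pval δ y₁ * pval δ y) * b ((M.face f).chart y) := by
    refine setIntegral_eq_integral_of_forall_compl_eq_zero fun y hy => ?_
    by_contra hb
    have h1 := (hκs (hsupp y (right_ne_zero_of_mul hb))).2
    exact hy (hεd (Metric.ball_subset_ball (min_le_right _ _) h1))
  rw [← hset] at hintg
  simp_rw [mul_assoc] at hintg
  rw [integral_const_mul, h b hbU, mul_zero] at hintg
  exact lt_irrefl _ hintg

lemma integral_face_eq_zero {e : E} {U : Set (Sp (m + 1))}
    (hU : Disjoint U (closure (M.face e).carrier)) {φ : Sp (m + 1) → ℝ} (hφ : IsTest U φ)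
    (g : MvPolynomial (Fin m) ℝ) :
    ∫ y in (M.face e).dom, pval g y * φ ((M.face e).chart y) = 0 := by
  rw [setIntegral_congr_fun (g := fun _ => (0 : ℝ)) (M.face e).isOpen_dom.measurableSet
    fun y hy => ?_]
  · simp
  · simp only
    rw [hφ.eq_zero (fun h => Set.disjoint_left.1 hU h (subset_closure ⟨y, hy, rfl⟩)), mul_zero]

/-- Test functions supported near one point of the face see no other face, so Green's formula
isolates the integrals over this face. -/
lemma HasNormalTrace.unique {P : T} {v : L2V (M.cell P)} {s : L2 (M.cell P)}
    {g g' : E → MvPolynomial (Fin m) ℝ} (h : M.HasNormalTrace P v s g)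
    (h' : M.HasNormalTrace P v s g') {f : E} (hf : f ∈ M.faces P) : g f = g' f := by
  obtain ⟨y₀, hy₀⟩ := (M.face f).nonempty_dom
  obtain ⟨ε, hε, hball⟩ := M.exists_ball_inter f ⟨y₀, hy₀, rfl⟩
  rw [← sub_eq_zero]
  refine eq_zero_of_forall_test_face hy₀ (Metric.ball_mem_nhds _ hε) fun φ hφ => ?_
  have hφ' := hφ.mono (Set.subset_univ _)
  have h1 := (h φ hφ').symm.trans (h' φ hφ')
  rw [Finset.sum_eq_single_of_mem f hf fun e _ he => integral_face_eq_zero (hball e he) hφ _,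
    Finset.sum_eq_single_of_mem f hf fun e _ he => integral_face_eq_zero (hball e he) hφ _] at h1
  simp_rw [map_sub, Pi.sub_apply, sub_mul]
  rw [integral_sub (integrable_face hφ' _) (integrable_face hφ' _), h1, sub_self]

/-- The total flux is the integral of the divergence. -/
lemma HasNormalTrace.compat {P : T} {v : L2V (M.cell P)} {s : L2 (M.cell P)}
    {g : E → MvPolynomial (Fin m) ℝ} (h : M.HasNormalTrace P v s g) :
    ∑ f ∈ M.faces P, ⟪M.fcls f (g f), M.fcls f 1⟫ = ⟪s, M.ccls P 1⟫ := by
  obtain ⟨φ, hφ, h1, h2, h3⟩ := M.exists_test_poly P 1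
  have h4 := M.hasNormalTrace_iff.1 h φ hφ
  have h5 : pgrad (1 : MvPolynomial (Fin (m + 1)) ℝ) = 0 := by
    ext1 i
    exact MvPolynomial.pderiv_one
  rw [h1, h2, h5, map_zero, inner_zero_right, zero_add] at h4
  rw [h4]
  refine Finset.sum_congr rfl fun f hf => ?_
  rw [h3 f hf, map_one (M.chartPoly f)]

end PolyMesh

end

/-! ### Gradients and their orthogonal complement; unisolvence of the velocity space -/

section

variable {m : ℕ} {T E : Type*}

section

variable {n : ℕ} {D : Set (Sp n)}

lemma IsTest.gradient_coord {φ : Sp n → ℝ} (hφ : IsTest D φ) (i : Fin n) :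
    IsTest D fun x => gradient φ x i := by
  have e : (fun x => gradient φ x i) = fun x => fderiv ℝ φ x (EuclideanSpace.single i 1) := by
    ext x; exact gradient_apply φ x i
  have hc : ContDiff ℝ ∞ fun x => gradient φ x i := by
    rw [e]
    exact (hφ.1.fderiv_right (m := ∞) (by simp)).clm_apply contDiff_const
  have hsub : tsupport (fun x => gradient φ x i) ⊆ tsupport φ := by
    refine closure_minimal (fun x hx => ?_) (isClosed_tsupport φ)
    by_contra hn
    apply hx
    rw [e]
    simp only
    rw [image_eq_zero_of_notMem_tsupport (f := fderiv ℝ φ)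
      (fun hx' => hn (tsupport_fderiv_subset ℝ hx'))]
    rfl
  exact ⟨hc, hφ.2.1.of_isClosed_subset (isClosed_tsupport _) hsub, hsub.trans hφ.2.2⟩

lemma gradient_gradient_comm {φ : Sp n → ℝ} (hφ : ContDiff ℝ ∞ φ) (i j : Fin n) (x : Sp n) :
    gradient (fun x => gradient φ x i) x j = gradient (fun x => gradient φ x j) x i := by
  have e : ∀ i, (fun x => gradient φ x i) = fun x => fderiv ℝ φ x (EuclideanSpace.single i 1) :=
    fun i => by ext x; exact gradient_apply φ x i
  have hd : DifferentiableAt ℝ (fderiv ℝ φ) x :=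
    ((hφ.fderiv_right (m := ∞) (by simp)).differentiable (by simp)) x
  have hsymm : IsSymmSndFDerivAt ℝ φ x := hφ.contDiffAt.isSymmSndFDerivAt
    (by simp only [minSmoothness_of_isRCLikeNormedField]; exact WithTop.coe_le_coe.2 (le_top : (2 : ℕ∞) ≤ ⊤))
  have key : ∀ i j, gradient (fun x => gradient φ x i) x j
      = fderiv ℝ (fderiv ℝ φ) x (EuclideanSpace.single j 1) (EuclideanSpace.single i 1) := by
    intro i j
    rw [gradient_apply, e, fderiv_clm_apply hd (differentiableAt_const _)]
    simp
  rw [key, key]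
  exact hsymm _ _

/-- A weak gradient is curl-free. -/
lemma IsWeakGrad.isWeakCurl {q : L2 D} {g : L2V D} (h : IsWeakGrad D q g) :
    IsWeakCurl D g (pcurl 0) := by
  intro i j φ hφ
  have h1 := isWeakGrad_iff.1 h j _ (hφ.gradient_coord i)
  have h2 := isWeakGrad_iff.1 h i _ (hφ.gradient_coord j)
  have h3 : ∫ x in D, q x * gradient (fun x => gradient φ x i) x j
      = ∫ x in D, q x * gradient (fun x => gradient φ x j) x i := by
    simp_rw [gradient_gradient_comm hφ.1 i j]
  have m1 := memLp_test (D := D) (cont_gradient hφ.1) (supp_gradient hφ.2.1)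
  rw [h1, h2, neg_inj] at h3
  rw [integral_sub (integrable_mul' (memLp_coord (Lp.memLp g) j) (memLp_coord m1 i))
    (integrable_mul' (memLp_coord (Lp.memLp g) i) (memLp_coord m1 j))]
  simp_rw [mul_comm (g _ _)]
  rw [h3, sub_self]
  simp [pcurl]

lemma mem_gradClosure_of_isWeakCurl_zero {c : Sp n} {r : ℝ} (hS : StarDom D c r) {v : L2V D}
    (h : IsWeakCurl D v (pcurl 0)) : v ∈ gradClosure D := by
  refine hS.mem_gradClosure_of_curl fun i j φ hφ => ?_
  rw [h i j φ hφ]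
  simp [pcurl]

lemma IsWeakCurl.sub_of_zero {v g : L2V D} {w : Fin n → MvPolynomial (Fin n) ℝ}
    (h : IsWeakCurl D v (pcurl w)) (h' : IsWeakCurl D g (pcurl 0)) :
    IsWeakCurl D (v - g) (pcurl w) := by
  have e : v - g = v + (-1 : ℝ) • g := by rw [neg_one_smul, sub_eq_add_neg]
  have e' : w + (-1 : ℝ) • (0 : Fin n → MvPolynomial (Fin n) ℝ) = w := by rw [smul_zero, add_zero]
  have h1 := h.add (h'.smul (-1))
  rw [e'] at h1
  rw [e]
  exact h1

/-- If a finite-dimensional space `F` meets `H` trivially, the components orthogonal to `H` of its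
members represent all functionals on `F`. -/
lemma exists_sub_starProjection_repr {X : Type*} [NormedAddCommGroup X] [InnerProductSpace ℝ X]
    (H F : Submodule ℝ X) [H.HasOrthogonalProjection] [FiniteDimensional ℝ F]
    (hHF : ∀ x ∈ F, x ∈ H → x = 0) (θ : F →ₗ[ℝ] ℝ) :
    ∃ w : F, ∀ w' : F, ⟪(w : X) - H.starProjection w, (w' : X)⟫ = θ w' := by
  -- `A w w` is the squared norm of w minus its projection onto `H`, which vanishes only for w in
  -- `H`, hence only for w = 0. Injectivity gives surjectivity because `F` is finite-dimensional.
  let A : F →ₗ[ℝ] Module.Dual ℝ F :=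
    (innerₗ X).compl₁₂ ((LinearMap.id - H.starProjection.toLinearMap) ∘ₗ F.subtype) F.subtype
  have hA : ∀ w w', A w w' = ⟪(w : X) - H.starProjection w, (w' : X)⟫ := fun _ _ => rfl
  have hinj : Function.Injective A := by
    rw [← LinearMap.ker_eq_bot, LinearMap.ker_eq_bot']
    intro w hw
    have h1 : ⟪(w : X) - H.starProjection w, (w : X)⟫ = 0 := by
      rw [← hA, hw]; rfl
    have h2 := (Submodule.mem_orthogonal' _ _).1
      (H.sub_starProjection_mem_orthogonal (w : X)) _ (H.starProjection_apply_mem (w : X))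
    have h3 : (w : X) - H.starProjection w = 0 := by
      rw [← inner_self_eq_zero (𝕜 := ℝ), inner_sub_right, h1, h2, sub_zero]
    ext1
    refine hHF _ w.2 ?_
    rw [sub_eq_zero.1 h3]
    exact H.starProjection_apply_mem _
  have hsurj : Function.Surjective A :=
    (LinearMap.injective_iff_surjective_of_finrank_eq_finrank
      (Subspace.dual_finrank_eq (K := ℝ)).symm).1 hinj
  obtain ⟨w, hw⟩ := hsurj θ
  exact ⟨w, fun w' => by rw [← hA, hw]⟩

/-- A polynomial whose class is curl-free in the weak sense is a gradient. -/
lemma mem_gradPoly_of_isWeakCurl_zero (hD : IsOpen D) (hb : Bornology.IsBounded D) {k : ℤ}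
    {w : Fin n → MvPolynomial (Fin n) ℝ} (hw : ∀ i, w i ∈ polyDeg n k) (hne : D.Nonempty)
    (h : IsWeakCurl D (pclsV hD hb w) (pcurl 0)) : pclsV hD hb w ∈ gradPoly D k := by
  have hcurl : ∀ i j, MvPolynomial.pderiv i (w j) = MvPolynomial.pderiv j (w i) := by
    intro i j
    have h0 : pcls hD hb (MvPolynomial.pderiv i (w j) - MvPolynomial.pderiv j (w i)) = 0 := by
      refine ae_eq_of_forall_test hD _ _ fun φ hφ => ?_
      have h1 := (isWeakCurl_pclsV hD hb w i j φ hφ).symm.trans (h i j φ hφ)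
      have e1 : ∫ x in D, φ x • (pcls hD hb (MvPolynomial.pderiv i (w j)
          - MvPolynomial.pderiv j (w i))) x = ∫ x in D, φ x * pcurl w i j x := by
        apply integral_congr_ae
        filter_upwards [coeFn_pcls hD hb (MvPolynomial.pderiv i (w j)
          - MvPolynomial.pderiv j (w i))] with x hx
        rw [hx]; rfl
      have e2 : ∫ x in D, φ x • (0 : L2 D) x = ∫ x in D, φ x * pcurl 0 i j x := by
        apply integral_congr_ae
        filter_upwards [Lp.coeFn_zero ℝ 2 (volume.restrict D)] with x hx
        rw [hx]; simp [pcurl]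
      rw [e1, e2]
      exact neg_inj.1 h1
    exact sub_eq_zero.1 (pcls_injective hD hb hne (h0.trans (map_zero _).symm))
  obtain ⟨q, hq, hqw⟩ := exists_pgrad_eq hw hcurl
  exact (mem_gradPoly_iff hD hb).2 ⟨q, hq, by rw [hqw]⟩

end

namespace PolyMesh

variable {M : PolyMesh m T E} [Fintype E]

lemma gradPoly_le_gradClosure (P : T) (k : ℤ) : gradPoly (M.cell P) k ≤ gradClosure (M.cell P) := by
  intro v hv
  obtain ⟨q, -, rfl⟩ := (mem_gradPoly_iff (M.isOpen_cell P) (M.bounded_cell P)).1 hv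
  obtain ⟨φ, hφ, -, h2, -⟩ := M.exists_test_poly P q
  rw [← h2]
  exact testGrad_le_gradClosure (tgrad_mem hφ)

/-- The Neumann problem: compatible data are the divergence and the normal trace of a gradient. -/
theorem exists_neumann {P : T} {c : Sp (m + 1)} {r : ℝ} (hS : StarDom (M.cell P) c r)
    (s : L2 (M.cell P)) (g : E → MvPolynomial (Fin m) ℝ)
    (hcomp : ∑ f ∈ M.faces P, ⟪M.fcls f (g f), M.fcls f 1⟫ = ⟪s, M.ccls P 1⟫) :
    ∃ v ∈ gradClosure (M.cell P), M.HasNormalTrace P v s g := by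
  classical
  obtain ⟨Cp, hCp⟩ := hS.poincare
  have htr : ∀ f, ∃ C : ℝ, 0 ≤ C ∧ (f ∈ M.faces P → ∀ φ (hφ : IsTest Set.univ φ),
      ‖M.ttrace f hφ‖ ≤ C * (‖tval (M.cell P) hφ‖ + ‖tgrad (M.cell P) hφ‖)) := by
    intro f
    by_cases hf : f ∈ M.faces P
    · obtain ⟨C, hC, h⟩ := exists_trace_bound hS hf
      exact ⟨C, hC, fun _ => h⟩
    · exact ⟨0, le_rfl, fun h => absurd h hf⟩
  choose Ct hCt0 hCt using htr
  -- The weak form of the Neumann problem: the field sought must satisfy ∫ v · ∇φ = l φ for all φ.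
  let l : (Sp (m + 1) → ℝ) → ℝ := fun φ =>
    (∑ f ∈ M.faces P, ∫ y in (M.face f).dom, pval (g f) y * φ ((M.face f).chart y))
      - ∫ x in M.cell P, s x * φ x
  have hl : ∀ φ (hφ : IsTest Set.univ φ), l φ =
      (∑ f ∈ M.faces P, ⟪M.fcls f (g f), M.ttrace f hφ⟫) - ⟪s, tval (M.cell P) hφ⟫ := by
    intro φ hφ
    simp_rw [l, inner_tval, M.inner_fcls_ttrace]
  have hadd : ∀ φ ψ, IsTest Set.univ φ → IsTest Set.univ ψ → l (fun x => φ x + ψ x) = l φ + l ψ := by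
    intro φ ψ hφ hψ
    simp only [l, mul_add]
    rw [integral_add (integrable_mul' (Lp.memLp s) hφ.memLp) (integrable_mul' (Lp.memLp s) hψ.memLp)]
    simp_rw [fun f => integral_add (integrable_face (M := M) (f := f) hφ (g f))
      (integrable_face (M := M) (f := f) hψ (g f))]
    rw [Finset.sum_add_distrib]
    ring
  have hsmul : ∀ (a : ℝ) φ, IsTest Set.univ φ → l (fun x => a * φ x) = a * l φ := by
    intro a φ hφ
    simp only [l, mul_left_comm _ a]
    simp_rw [integral_const_mul]
    rw [← Finset.mul_sum]
    ring
  set C0 : ℝ := (∑ f ∈ M.faces P, ‖M.fcls f (g f)‖ * Ct f) + ‖s‖ with hC0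
  have hC0' : 0 ≤ C0 := add_nonneg
    (Finset.sum_nonneg fun f _ => mul_nonneg (norm_nonneg _) (hCt0 f)) (norm_nonneg _)
  have hbd : ∀ φ (hφ : IsTest Set.univ φ),
      |l φ| ≤ C0 * (‖tval (M.cell P) hφ‖ + ‖tgrad (M.cell P) hφ‖) := by
    intro φ hφ
    rw [hl φ hφ, hC0, add_mul, Finset.sum_mul]
    refine (abs_sub _ _).trans (add_le_add ((Finset.abs_sum_le_sum_abs _ _).trans
      (Finset.sum_le_sum fun f hf => ?_)) ?_)
    · refine (abs_real_inner_le_norm _ _).trans ?_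
      rw [mul_assoc]
      exact mul_le_mul_of_nonneg_left (hCt f hf φ hφ) (norm_nonneg _)
    · refine (abs_real_inner_le_norm _ _).trans ?_
      exact mul_le_mul_of_nonneg_left (le_add_of_nonneg_right (norm_nonneg _)) (norm_nonneg _)
  -- The compatibility condition says that `l` kills constants. Poincaré's constant can therefore be
  -- subtracted from φ first, and the bound in the H¹ norm becomes one in the gradient norm alone.
  have hmain : ∀ φ (hφ : IsTest Set.univ φ),
      |l φ| ≤ (C0 * (Cp + 1)) * ‖tgrad (M.cell P) hφ‖ := by
    intro φ hφ
    obtain ⟨a, ha⟩ := hCp φ hφ.1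
    -- Constants have no compact support; χ is a test function whose classes on the cell and on its
    -- faces are those of 1.
    obtain ⟨χ, hχ, hχ1, hχ2, hχ3⟩ := M.exists_test_poly P 1
    have hψ := hφ.sub (IsTest.smul a hχ)
    have hl1 : l χ = 0 := by
      rw [hl χ hχ, hχ1, ← hcomp, sub_eq_zero]
      refine Finset.sum_congr rfl fun f hf => ?_
      rw [hχ3 f hf, map_one (M.chartPoly f)]
    have hlψ : l (fun x => φ x - a * χ x) = l φ := by
      have e : (fun x => φ x - a * χ x) = fun x => φ x + (-a) * χ x := by ext x; ring
      rw [e, hadd φ _ hφ (IsTest.smul (-a) hχ), hsmul _ χ hχ, hl1, mul_zero, add_zero]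
    have h5 : pgrad (1 : MvPolynomial (Fin (m + 1)) ℝ) = 0 := by
      ext1 i
      exact MvPolynomial.pderiv_one
    have hgχ : tgrad (M.cell P) (IsTest.smul a hχ) = 0 := by
      have h6 : tgrad (M.cell P) hχ = 0 := by rw [hχ2, h5, map_zero]
      apply Lp.ext
      filter_upwards [coeFn_tgrad (D := M.cell P) (IsTest.smul a hχ), coeFn_tgrad (D := M.cell P) hχ,
        Lp.coeFn_zero (Sp (m + 1)) 2 (volume.restrict (M.cell P))] with x h1 h2 h3
      rw [h1, gradient_smul' hχ.1, ← h2, h6, h3]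
      simp
    have hg : tgrad (M.cell P) hψ = tgrad (M.cell P) hφ := by
      rw [tgrad_sub hφ (IsTest.smul a hχ), hgχ, sub_zero]
    have hv : ‖tval (M.cell P) hψ‖ ≤ Cp * ‖tgrad (M.cell P) hφ‖ := by
      have e1 : eLpNorm (fun x => φ x - a * χ x) 2 (volume.restrict (M.cell P))
          = eLpNorm (fun x => φ x - a) 2 (volume.restrict (M.cell P)) := by
        apply eLpNorm_congr_ae
        have h8 := coeFn_tval (D := M.cell P) hχ
        rw [hχ1] at h8
        filter_upwards [h8, coeFn_pcls (M.isOpen_cell P) (M.bounded_cell P) 1] with x h9 h10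
        rw [h9] at h10
        rw [h10]
        simp [pval]
      rw [tval, tgrad, Lp.norm_toLp, Lp.norm_toLp, e1]
      refine (ENNReal.toReal_mono (ENNReal.mul_ne_top ENNReal.coe_ne_top
        (memLp_gradient hφ).eLpNorm_ne_top) ha).trans ?_
      rw [ENNReal.toReal_mul, ENNReal.coe_toReal]
    rw [← hlψ]
    refine (hbd _ hψ).trans ?_
    rw [hg, mul_assoc]
    refine mul_le_mul_of_nonneg_left ?_ hC0'
    rw [add_mul, one_mul]
    exact add_le_add hv le_rfl
  obtain ⟨v, hv, hvl⟩ := exists_mem_gradClosure (D := M.cell P) l hadd hsmul hmain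
  refine ⟨v, hv, M.hasNormalTrace_iff.2 fun φ hφ => ?_⟩
  rw [inner_tgrad, hvl φ hφ, hl φ hφ]
  ring

/-- A field with vanishing divergence and normal trace is orthogonal to all gradients. -/
lemma HasNormalTrace.mem_orthogonal {P : T} {v : L2V (M.cell P)}
    {g : E → MvPolynomial (Fin m) ℝ} (h : M.HasNormalTrace P v 0 g)
    (hg : ∀ f ∈ M.faces P, g f = 0) : v ∈ (gradClosure (M.cell P))ᗮ := by
  refine mem_orthogonal_gradClosure fun φ hφ => ?_
  have h1 := M.hasNormalTrace_iff.1 h φ hφ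
  rw [inner_zero_left, add_zero, Finset.sum_eq_zero fun f hf => by
    rw [hg f hf, map_zero, inner_zero_left]] at h1
  rw [← inner_tgrad v hφ, h1]

lemma hasNormalTrace_zero_of_mem_orthogonal {P : T} {v : L2V (M.cell P)}
    (h : v ∈ (gradClosure (M.cell P))ᗮ) : M.HasNormalTrace P v 0 0 := by
  refine M.hasNormalTrace_iff.2 fun φ hφ => ?_
  rw [inner_zero_left, add_zero, Finset.sum_eq_zero fun f _ => by
    rw [Pi.zero_apply, map_zero, inner_zero_left]]
  exact (Submodule.mem_orthogonal' _ _).1 h _ (testGrad_le_gradClosure (tgrad_mem hφ))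

/-- The degrees of freedom determine a member of the local velocity space. -/
theorem eq_zero_of_mem_velLoc {P : T} {c : Sp (m + 1)} {r : ℝ} (hS : StarDom (M.cell P) c r) {k : ℕ}
    {v : L2V (M.cell P)} (hv : v ∈ M.velLoc k P) {g : E → MvPolynomial (Fin m) ℝ}
    (hn : M.HasNormalTrace P v 0 g) (hg : ∀ f ∈ M.faces P, g f = 0)
    (hθ : ∀ w ∈ gradPolyPerp (M.cell P) k, ⟪v, w⟫ = 0) : v = 0 := by
  have hperp := hn.mem_orthogonal hg
  obtain ⟨-, w, hw, hc⟩ := hv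
  set W := M.cclsV P w with hW
  -- The curl of v is that of the polynomial field W, so v - W is a limit of gradients. As v is
  -- orthogonal to these, ‖v‖² = ⟨v, W⟩.
  have hz : v + (-1 : ℝ) • W ∈ gradClosure (M.cell P) := by
    refine mem_gradClosure_of_isWeakCurl_zero hS ?_
    have := hc.add ((isWeakCurl_pclsV (M.isOpen_cell P) (M.bounded_cell P) w).smul (-1))
    rwa [neg_one_smul ℝ w, add_neg_cancel] at this
  have h1 := (Submodule.mem_orthogonal' _ _).1 hperp _ hz
  rw [inner_add_right, real_inner_smul_right] at h1
  have hWp : W ∈ polyL2V (M.cell P) k :=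
    (mem_polyL2V_iff (M.isOpen_cell P) (M.bounded_cell P)).2 ⟨w, hw, rfl⟩
  have hle := gradPoly_le_polyL2V (M.isOpen_cell P) (M.bounded_cell P) k
  set G := gradPoly (M.cell P) (k : ℤ)
  have ha := G.starProjection_apply_mem W
  -- W splits into a gradient of a polynomial, to which v is orthogonal, and a member of 𝒢_k^⊥,
  -- against which the moments of v vanish by hypothesis.
  have hb : W - G.starProjection W ∈ gradPolyPerp (M.cell P) k :=
    ⟨Submodule.sub_mem _ hWp (hle ha), G.sub_starProjection_mem_orthogonal W⟩
  have h2 := hθ _ hb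
  have h3 := (Submodule.mem_orthogonal' _ _).1 hperp _ (gradPoly_le_gradClosure P k ha)
  rw [inner_sub_right, h3, sub_zero] at h2
  rw [h2, mul_zero, add_zero] at h1
  exact inner_self_eq_zero.1 h1

/-- A limit of gradients is a weak gradient, hence curl-free. A curl-free polynomial field is the
gradient of a polynomial, and the field is orthogonal to all of these, itself included. -/
lemma eq_zero_of_mem_gradPolyPerp_of_mem_gradClosure {P : T} {c : Sp (m + 1)} {r : ℝ}
    (hS : StarDom (M.cell P) c r) {k : ℕ} {x : L2V (M.cell P)}
    (hx : x ∈ gradPolyPerp (M.cell P) k) (hx' : x ∈ gradClosure (M.cell P)) : x = 0 := by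
  obtain ⟨q, hq⟩ := hS.exists_isWeakGrad hx'
  obtain ⟨W, hW, rfl⟩ := (mem_polyL2V_iff (M.isOpen_cell P) (M.bounded_cell P)).1 hx.1
  have h5 := mem_gradPoly_of_isWeakCurl_zero _ _ hW (M.nonempty_cell P) hq.isWeakCurl
  exact inner_self_eq_zero.1 ((Submodule.mem_orthogonal' _ _).1 hx.2 _ h5)

/-- Fields with vanishing divergence and normal trace and polynomial curl represent all functionals
on the complement of the polynomial gradients. -/
lemma exists_solenoidal {P : T} {c : Sp (m + 1)} {r : ℝ} (hS : StarDom (M.cell P) c r) {k : ℕ}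
    (θ : gradPolyPerp (M.cell P) k →ₗ[ℝ] ℝ) :
    ∃ v ∈ (gradClosure (M.cell P))ᗮ, (∃ W : Fin (m + 1) → MvPolynomial (Fin (m + 1)) ℝ,
      (∀ i, W i ∈ polyDeg (m + 1) k) ∧ IsWeakCurl (M.cell P) v (pcurl W)) ∧
      ∀ w : gradPolyPerp (M.cell P) k, ⟪v, (w : L2V (M.cell P))⟫ = θ w := by
  obtain ⟨⟨x, hx⟩, hw⟩ := exists_sub_starProjection_repr (gradClosure (M.cell P)) _
    (fun x hx hx' => eq_zero_of_mem_gradPolyPerp_of_mem_gradClosure hS hx hx') θ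
  obtain ⟨W, hW, rfl⟩ := (mem_polyL2V_iff (M.isOpen_cell P) (M.bounded_cell P)).1 hx.1
  obtain ⟨q, hq⟩ := hS.exists_isWeakGrad
    ((gradClosure (M.cell P)).starProjection_apply_mem (M.cclsV P W))
  -- The projection onto the gradients is curl-free, so removing it leaves the curl of the
  -- polynomial field W.
  have h1 := (isWeakCurl_pclsV (M.isOpen_cell P) (M.bounded_cell P) W).sub_of_zero hq.isWeakCurl
  exact ⟨_, Submodule.sub_starProjection_mem_orthogonal _, ⟨W, hW, h1⟩, hw⟩

/-- Every choice of degrees of freedom is taken in the local velocity space. -/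
theorem exists_mem_velLoc {P : T} {c : Sp (m + 1)} {r : ℝ} (hS : StarDom (M.cell P) c r) {k : ℕ}
    {s : L2 (M.cell P)} (hs : s ∈ polyL2 (M.cell P) k) {g : E → MvPolynomial (Fin m) ℝ}
    (hg : ∀ f, g f ∈ polyDeg m k)
    (hcomp : ∑ f ∈ M.faces P, ⟪M.fcls f (g f), M.fcls f 1⟫ = ⟪s, M.ccls P 1⟫)
    (θ : gradPolyPerp (M.cell P) k →ₗ[ℝ] ℝ) :
    ∃ v ∈ M.velLoc k P, M.HasNormalTrace P v s g ∧
      ∀ w : gradPolyPerp (M.cell P) k, ⟪v, (w : L2V (M.cell P))⟫ = θ w := by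
  obtain ⟨v₁, hv₁, hn₁⟩ := exists_neumann hS s g hcomp
  obtain ⟨q₁, hq₁⟩ := hS.exists_isWeakGrad hv₁
  -- The Neumann field `v₁` has the right divergence and normal trace but uncontrolled moments
  -- against 𝒢_k^⊥. The correction `v₂` repairs the moments and changes neither of the former.
  obtain ⟨v₂, hv₂, ⟨W, hW, hc₂⟩, h₂⟩ := exists_solenoidal hS
    (θ - (innerₗ (L2V (M.cell P)) v₁) ∘ₗ (gradPolyPerp (M.cell P) k).subtype)
  have hnt : M.HasNormalTrace P (v₁ + v₂) s g := by
    have := hn₁.add (hasNormalTrace_zero_of_mem_orthogonal hv₂)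
    rwa [add_zero, add_zero] at this
  refine ⟨v₁ + v₂, ⟨⟨s, hs, hnt.isWeakDiv, g, hg, hnt⟩, W, hW, ?_⟩, hnt, fun w => ?_⟩
  · have := hq₁.isWeakCurl.add hc₂
    rwa [zero_add] at this
  · have h1 := h₂ w
    have h2 : ((innerₗ (L2V (M.cell P)) v₁) ∘ₗ (gradPolyPerp (M.cell P) k).subtype) w
      = ⟪v₁, (w : L2V (M.cell P))⟫ := rfl
    rw [inner_add_left, h1, LinearMap.sub_apply, h2]
    ring

end PolyMesh

end

/-! ### Unisolvence of the auxiliary space W_h^r -/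

section

variable {m : ℕ} {T E : Type*}

/-- A single-valued additive relation that is defined everywhere is a linear map. -/
lemma exists_linearMap_of_rel {V W : Type*} [AddCommGroup V] [Module ℝ V] [AddCommGroup W]
    [Module ℝ W] (R : V → W → Prop) (hadd : ∀ v v' w w', R v w → R v' w' → R (v + v') (w + w'))
    (hsmul : ∀ (a : ℝ) v w, R v w → R (a • v) (a • w)) (hex : ∀ v, ∃ w, R v w)
    (huniq : ∀ w, R 0 w → w = 0) : ∃ A : V →ₗ[ℝ] W, ∀ v w, R v w ↔ w = A v := by
  have huniq' : ∀ v w w', R v w → R v w' → w = w' := by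
    intro v w w' h h'
    have h1 := hadd _ _ _ _ h (hsmul (-1) _ _ h')
    rw [neg_one_smul, neg_one_smul, add_neg_cancel] at h1
    exact add_neg_eq_zero.1 (huniq _ h1)
  choose A hA using hex
  refine ⟨{ toFun := A
            map_add' := fun v v' => huniq' _ _ _ (hA _) (hadd _ _ _ _ (hA v) (hA v'))
            map_smul' := fun a v => huniq' _ _ _ (hA _) (hsmul a _ _ (hA v)) }, fun v w => ?_⟩
  exact ⟨fun h => huniq' _ _ _ h (hA v), fun h => h ▸ hA v⟩

section

variable {n : ℕ} {D : Set (Sp n)} {c : Sp n} {r : ℝ}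

lemma inner_pcls (hD : IsOpen D) (hb : Bornology.IsBounded D) (q : L2 D)
    (p : MvPolynomial (Fin n) ℝ) : ⟪q, pcls hD hb p⟫ = ∫ x in D, q x * pval p x := by
  rw [l2_inner_eq]
  apply integral_congr_ae
  filter_upwards [coeFn_pcls hD hb p] with x hx
  rw [hx]

/-- A function with vanishing gradient and vanishing mean is zero. -/
lemma StarDom.eq_zero_of_isWeakGrad_zero (hS : StarDom D c r) {q : L2 D} (hq : IsWeakGrad D q 0)
    (h1 : ⟪q, pcls hS.isOpen hS.isBounded 1⟫ = 0) : q = 0 := by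
  obtain ⟨φ, hφ, h2, h3⟩ := hS.exists_test_tendsto hq
  have h2' : Tendsto (fun j => tval D (hφ j)) atTop (𝓝 q) := (tendsto_toLp_iff _ _).2 h2
  have h3' : Tendsto (fun j => tgrad D (hφ j)) atTop (𝓝 0) := (tendsto_toLp_iff _ _).2 h3
  obtain ⟨C, hC⟩ := hS.poincare
  -- As q is orthogonal to the constants, Poincaré's constant may be subtracted from φⱼ. The
  -- right-hand side tends to zero, while the left-hand side tends to ‖q‖².
  have key : ∀ j, ⟪q, tval D (hφ j)⟫ ≤ ‖q‖ * (C * ‖tgrad D (hφ j)‖) := by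
    intro j
    obtain ⟨a, ha⟩ := hC (φ j) (hφ j).1
    have e1 : ⟪q, tval D (hφ j)⟫ = ⟪q, tval D (hφ j) - a • pcls hS.isOpen hS.isBounded 1⟫ := by
      rw [inner_sub_right, real_inner_smul_right, h1, mul_zero, sub_zero]
    rw [e1]
    refine (real_inner_le_norm _ _).trans (mul_le_mul_of_nonneg_left ?_ (norm_nonneg _))
    have e2 : ‖tval D (hφ j) - a • pcls hS.isOpen hS.isBounded 1‖
        = (eLpNorm (fun x => φ j x - a) 2 (volume.restrict D)).toReal := by
      rw [Lp.norm_def]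
      congr 1
      apply eLpNorm_congr_ae
      filter_upwards [Lp.coeFn_sub (tval D (hφ j)) (a • pcls hS.isOpen hS.isBounded 1),
        Lp.coeFn_smul a (pcls hS.isOpen hS.isBounded 1), coeFn_tval (D := D) (hφ j),
        coeFn_pcls hS.isOpen hS.isBounded 1] with x k1 k2 k3 k4
      rw [k1, Pi.sub_apply, k2, Pi.smul_apply, k3, k4]
      simp [pval]
    rw [e2, tgrad, Lp.norm_toLp]
    refine (ENNReal.toReal_mono (ENNReal.mul_ne_top ENNReal.coe_ne_top
      (memLp_gradient (hφ j)).eLpNorm_ne_top) ha).trans ?_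
    rw [ENNReal.toReal_mul, ENNReal.coe_toReal]
  have k1 : Tendsto (fun j => ⟪q, tval D (hφ j)⟫) atTop (𝓝 ⟪q, q⟫) :=
    tendsto_const_nhds.inner h2'
  have k2 := (h3'.norm.const_mul (C : ℝ)).const_mul ‖q‖
  rw [norm_zero, mul_zero, mul_zero] at k2
  have k3 : ⟪q, q⟫ ≤ 0 := le_of_tendsto_of_tendsto' k1 k2 key
  rw [real_inner_self_eq_norm_sq] at k3
  exact norm_eq_zero.1 (pow_eq_zero_iff two_ne_zero |>.1 (le_antisymm k3 (by positivity)))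

end

namespace PolyMesh

section

variable {M : PolyMesh m T E}

/-- The moments of a function on a face, as a functional on polynomials. -/
def momentF (M : PolyMesh m T E) (f : E) (t : M.L2F f) : MvPolynomial (Fin m) ℝ →ₗ[ℝ] ℝ :=
  innerₗ (M.L2F f) t ∘ₗ M.fcls f

lemma momentF_apply (f : E) (t : M.L2F f) (μ : MvPolynomial (Fin m) ℝ) :
    M.momentF f t μ = M.faceMoment f t μ := by
  rw [M.faceMoment_eq_inner, real_inner_comm]
  rfl

/-- The moments of a function on an element, as a functional on polynomials. -/
def momentC (M : PolyMesh m T E) (P : T) (q : L2 (M.cell P)) :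
    MvPolynomial (Fin (m + 1)) ℝ →ₗ[ℝ] ℝ :=
  innerₗ (L2 (M.cell P)) q ∘ₗ M.ccls P

lemma momentC_eq_inner (P : T) (q : L2 (M.cell P)) (p : MvPolynomial (Fin (m + 1)) ℝ) :
    M.momentC P q p = ⟪q, M.ccls P p⟫ := rfl

lemma momentC_apply (P : T) (q : L2 (M.cell P)) (p : MvPolynomial (Fin (m + 1)) ℝ) :
    M.momentC P q p = ∫ x in M.cell P, q x * pval p x := inner_pcls _ _ q p

lemma momentC_add (P : T) (q q' : L2 (M.cell P)) (p : MvPolynomial (Fin (m + 1)) ℝ) :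
    M.momentC P (q + q') p = M.momentC P q p + M.momentC P q' p := by
  simp only [momentC_eq_inner, inner_add_left]

lemma momentC_smul (P : T) (a : ℝ) (q : L2 (M.cell P)) (p : MvPolynomial (Fin (m + 1)) ℝ) :
    M.momentC P (a • q) p = a * M.momentC P q p := by
  simp only [momentC_eq_inner, real_inner_smul_left]

end

variable {M : PolyMesh m T E} [Fintype E]

lemma IsTraceFamily.add {P : T} {q q' : L2 (M.cell P)} {t t' : ∀ f, M.L2F f}
    (h : M.IsTraceFamily P q t) (h' : M.IsTraceFamily P q' t') :
    M.IsTraceFamily P (q + q') (fun f => t f + t' f) := fun f hf => (h f hf).add (h' f hf)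

lemma IsTraceFamily.smul {P : T} {q : L2 (M.cell P)} {t : ∀ f, M.L2F f} (a : ℝ)
    (h : M.IsTraceFamily P q t) : M.IsTraceFamily P (a • q) (fun f => a • t f) :=
  fun f hf => (h f hf).smul a

lemma pgrad_one : pgrad (1 : MvPolynomial (Fin m) ℝ) = 0 := by
  ext1 i
  exact MvPolynomial.pderiv_one

lemma ccls_mem_auxLoc {P : T} {c : Sp (m + 1)} {ρ : ℝ} (hS : StarDom (M.cell P) c ρ) {r : ℕ}
    {p : MvPolynomial (Fin (m + 1)) ℝ} (hp : p ∈ polyDeg (m + 1) r) :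
    M.ccls P p ∈ M.auxLoc r P := by
  have hg : ∀ i, pgrad p i ∈ polyDeg (m + 1) ((r : ℤ) - 1) := fun i => pderiv_mem_polyDeg hp i
  have hd : pdiv (pgrad p) ∈ polyDeg (m + 1) r :=
    Submodule.sum_mem _ fun i _ => polyDeg_mono (by linarith) (pderiv_mem_polyDeg (hg i) i)
  refine ⟨_, isWeakGrad_pcls _ _ p, _,
    (mem_polyL2_iff (M.isOpen_cell P) (M.bounded_cell P)).2 ⟨_, hd, rfl⟩, isWeakDiv_pclsV _ _ _,
    _, fun f => M.normalPoly_mem hg f, hasNormalTrace_cclsV hS (pgrad p)⟩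

/-- A member of the auxiliary space is determined by its moments. -/
theorem eq_zero_of_mem_auxLoc {P : T} {c : Sp (m + 1)} {ρ : ℝ} (hS : StarDom (M.cell P) c ρ)
    {r : ℕ} {q : L2 (M.cell P)} (hq : q ∈ M.auxLoc r P) {t : ∀ f, M.L2F f}
    (ht : M.IsTraceFamily P q t)
    (h1 : ∀ f ∈ M.faces P, ∀ μ ∈ polyDeg m ((r : ℤ) - 1), M.faceMoment f (t f) μ = 0)
    (h2 : ∀ μ ∈ polyDeg (m + 1) r, M.momentC P q μ = 0) : q = 0 := by
  obtain ⟨g, hg, s, hs, -, d, hd, hn⟩ := hq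
  obtain ⟨σ, hσ, rfl⟩ := (mem_polyL2_iff (M.isOpen_cell P) (M.bounded_cell P)).1 hs
  -- Green's formula with v = ∇q reads ‖∇q‖² + ⟨Δq, q⟩ = ∑ ∫ ∂ₙq · q. As Δq is a polynomial of
  -- degree at most r and ∂ₙq one of degree at most r - 1, all terms but the first are moments that
  -- vanish.
  have hG := hn.green hS hg ht
  have h3 := h2 σ hσ
  rw [momentC_eq_inner, real_inner_comm] at h3
  rw [Finset.sum_eq_zero fun f hf => h1 f hf _ (hd f), h3, add_zero] at hG
  rw [inner_self_eq_zero.1 hG] at hg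
  refine hS.eq_zero_of_isWeakGrad_zero hg (h2 1 ?_)
  rw [← MvPolynomial.C_1]
  exact C_mem_polyDeg 1 (by positivity)

/-- The moments, as a linear map on the auxiliary space. -/
lemma exists_momentMap {P : T} {c : Sp (m + 1)} {ρ : ℝ} (hS : StarDom (M.cell P) c ρ) (r : ℕ) :
    ∃ Λ : M.auxLoc r P →ₗ[ℝ] (M.faces P → Module.Dual ℝ (polyDeg m ((r : ℤ) - 1))) ×
      Module.Dual ℝ (polyDeg (m + 1) (r : ℤ)), ∀ (q : M.auxLoc r P) z, ((∃ t, M.IsTraceFamily P q t ∧ ∀ (f : M.faces P) (μ : polyDeg m ((r : ℤ) - 1)),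
      z.1 f μ = M.faceMoment f (t f) μ) ∧
      ∀ μ : polyDeg (m + 1) (r : ℤ), z.2 μ = M.momentC P q μ) ↔ z = Λ q := by
  classical
  exact exists_linearMap_of_rel (V := M.auxLoc r P)
    (W := (M.faces P → Module.Dual ℝ (polyDeg m ((r : ℤ) - 1))) × Module.Dual ℝ (polyDeg (m + 1) (r : ℤ)))
    (fun q z => (∃ t, M.IsTraceFamily P q t ∧ ∀ (f : M.faces P) (μ : (polyDeg m ((r : ℤ) - 1))),
      z.1 f μ = M.faceMoment f (t f) μ) ∧ ∀ μ : (polyDeg (m + 1) (r : ℤ)), z.2 μ = M.momentC P q μ)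
    (by
      rintro q q' z z' ⟨⟨t, ht, h1⟩, h2⟩ ⟨⟨t', ht', h1'⟩, h2'⟩
      refine ⟨⟨_, ht.add ht', fun f μ => ?_⟩, fun μ => ?_⟩
      · rw [faceMoment_add, ← h1, ← h1']; rfl
      · rw [Submodule.coe_add, momentC_add, ← h2, ← h2']; rfl)
    (by
      rintro x q z ⟨⟨t, ht, h1⟩, h2⟩
      refine ⟨⟨_, ht.smul x, fun f μ => ?_⟩, fun μ => ?_⟩
      · rw [faceMoment_smul, ← h1]; rfl
      · rw [Submodule.coe_smul, momentC_smul, ← h2]; rfl)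
    (by
      rintro ⟨q, hq⟩
      obtain ⟨g, hg, -⟩ := id hq
      obtain ⟨t, ht⟩ := exists_isTraceFamily hS hg
      refine ⟨(fun f => M.momentF f (t f) ∘ₗ (polyDeg m ((r : ℤ) - 1)).subtype, M.momentC P q ∘ₗ (polyDeg (m + 1) (r : ℤ)).subtype),
        ⟨t, ht, fun f μ => M.momentF_apply f (t f) μ⟩, fun μ => rfl⟩)
    (by
      rintro ⟨z1, z2⟩ ⟨⟨t, ht, h1⟩, h2⟩
      refine Prod.ext ?_ ?_
      · ext f μ
        have : t f = 0 := (ht f f.2).unique hS f.2 IsTrace.zero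
        rw [h1, this, faceMoment_zero]
        rfl
      · ext μ
        rw [h2, momentC_eq_inner, ZeroMemClass.coe_zero, inner_zero_left]
        rfl)

lemma momentMap_injective {P : T} {c : Sp (m + 1)} {ρ : ℝ} (hS : StarDom (M.cell P) c ρ) {r : ℕ}
    {Λ : M.auxLoc r P →ₗ[ℝ] (M.faces P → Module.Dual ℝ (polyDeg m ((r : ℤ) - 1))) ×
      Module.Dual ℝ (polyDeg (m + 1) (r : ℤ))} (hΛ : ∀ (q : M.auxLoc r P) z, ((∃ t, M.IsTraceFamily P q t ∧ ∀ (f : M.faces P) (μ : polyDeg m ((r : ℤ) - 1)),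
      z.1 f μ = M.faceMoment f (t f) μ) ∧
      ∀ μ : polyDeg (m + 1) (r : ℤ), z.2 μ = M.momentC P q μ) ↔ z = Λ q) :
    Function.Injective Λ := by
  rw [← LinearMap.ker_eq_bot, LinearMap.ker_eq_bot']
  rintro ⟨q, hq⟩ h0
  obtain ⟨⟨t, ht, h1⟩, h2⟩ := (hΛ ⟨q, hq⟩ _).2 rfl
  rw [h0] at h1 h2
  ext1
  exact eq_zero_of_mem_auxLoc hS hq ht (fun f hf μ hμ => (h1 ⟨f, hf⟩ ⟨μ, hμ⟩).symm)
    fun μ hμ => (h2 ⟨μ, hμ⟩).symm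

/-- The Neumann data, as a linear map on the auxiliary space. -/
lemma exists_neumannMap (M : PolyMesh m T E) (P : T) (r : ℕ) :
    ∃ A : M.auxLoc r P →ₗ[ℝ] (M.faces P → polyDeg m ((r : ℤ) - 1)) × polyDeg (m + 1) (r : ℤ),
      ∀ (q : M.auxLoc r P) y, (∃ g, IsWeakGrad (M.cell P) q g ∧ ∃ d : E → MvPolynomial (Fin m) ℝ,
      (∀ f : M.faces P, d f = y.1 f) ∧ M.HasNormalTrace P g (M.ccls P y.2) d) ↔ y = A q := by
  classical
  exact exists_linearMap_of_rel (V := M.auxLoc r P) (W := (M.faces P → (polyDeg m ((r : ℤ) - 1))) × (polyDeg (m + 1) (r : ℤ)))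
    (fun q y => ∃ g, IsWeakGrad (M.cell P) q g ∧ ∃ d : E → MvPolynomial (Fin m) ℝ,
      (∀ f : M.faces P, d f = y.1 f) ∧ M.HasNormalTrace P g (M.ccls P y.2) d)
    (by
      rintro q q' y y' ⟨g, hg, d, hd, hn⟩ ⟨g', hg', d', hd', hn'⟩
      have e : M.ccls P (y + y').2 = M.ccls P y.2 + M.ccls P y'.2 := map_add (M.ccls P) _ _
      refine ⟨g + g', hg.add hg', d + d', fun f => ?_, ?_⟩
      · rw [Pi.add_apply, hd, hd']; rfl
      · rw [e]; exact hn.add hn')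
    (by
      rintro x q y ⟨g, hg, d, hd, hn⟩
      have e : M.ccls P (x • y).2 = x • M.ccls P y.2 := map_smul (M.ccls P) _ _
      refine ⟨x • g, hg.smul x, x • d, fun f => ?_, ?_⟩
      · rw [Pi.smul_apply, hd]; rfl
      · rw [e]; exact hn.smul x)
    (by
      rintro ⟨q, g, hg, s, hs, -, d, hd, hn⟩
      obtain ⟨σ, hσ, rfl⟩ := (mem_polyL2_iff (M.isOpen_cell P) (M.bounded_cell P)).1 hs
      exact ⟨(fun f => ⟨d f, hd f⟩, ⟨σ, hσ⟩), g, hg, d, fun f => rfl, hn⟩)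
    (by
      rintro ⟨y1, y2⟩ ⟨g, hg, d, hd, hn⟩
      obtain rfl := hg.unique (M.isOpen_cell P) IsWeakGrad.zero
      have h0 : M.ccls P y2 = 0 := hn.isWeakDiv.unique (M.isOpen_cell P) IsWeakDiv.zero
      refine Prod.ext ?_ ?_
      · ext1 f
        ext1
        rw [← hd f]
        refine HasNormalTrace.unique hn ?_ f.2 (g' := 0)
        rw [h0]
        exact HasNormalTrace.zero
      · ext1
        exact pcls_injective _ _ (M.nonempty_cell P) (h0.trans (map_zero _).symm))

/-- Every choice of moments is taken in the auxiliary space. -/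
theorem exists_mem_auxLoc {P : T} {c : Sp (m + 1)} {ρ : ℝ} (hS : StarDom (M.cell P) c ρ)
    (r : ℕ) (a : E → MvPolynomial (Fin m) ℝ →ₗ[ℝ] ℝ) (b : MvPolynomial (Fin (m + 1)) ℝ →ₗ[ℝ] ℝ) :
    ∃ q ∈ M.auxLoc r P, ∃ t, M.IsTraceFamily P q t ∧
      (∀ f ∈ M.faces P, ∀ μ ∈ polyDeg m ((r : ℤ) - 1), M.faceMoment f (t f) μ = a f μ) ∧
      ∀ μ ∈ polyDeg (m + 1) r, M.momentC P q μ = b μ := by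
  classical
  let X := polyDeg m ((r : ℤ) - 1)
  let X' := polyDeg (m + 1) (r : ℤ)
  obtain ⟨Λ, hΛ⟩ := exists_momentMap hS r
  have hΛinj := momentMap_injective hS hΛ
  have hfin : FiniteDimensional ℝ (M.auxLoc r P) := FiniteDimensional.of_injective Λ hΛinj
  obtain ⟨A, hA⟩ := exists_neumannMap M P r
  let κ : (M.faces P → X) × X' →ₗ[ℝ] ℝ :=
    (∑ f : M.faces P, M.momentF f (M.fcls f 1) ∘ₗ X.subtype ∘ₗ LinearMap.proj f ∘ₗ
      LinearMap.fst ℝ _ _) - M.momentC P (M.ccls P 1) ∘ₗ X'.subtype ∘ₗ LinearMap.snd ℝ _ _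
  have hκ : ∀ y, κ y = (∑ f : M.faces P, ⟪M.fcls f (y.1 f), M.fcls f 1⟫)
      - ⟪M.ccls P y.2, M.ccls P 1⟫ := by
    intro y
    simp only [κ, LinearMap.sub_apply, LinearMap.sum_apply, LinearMap.comp_apply,
      LinearMap.proj_apply, LinearMap.fst_apply, LinearMap.snd_apply, Submodule.subtype_apply,
      momentF_apply, faceMoment_eq_inner, momentC_eq_inner]
    rw [real_inner_comm]
  -- All compatible Neumann data are attained, so the range of `A` has codimension at most one.
  have hrange : LinearMap.ker κ ≤ LinearMap.range A := by
    intro y hy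
    rw [LinearMap.mem_ker, hκ, sub_eq_zero] at hy
    let d : E → MvPolynomial (Fin m) ℝ := fun f => if hf : f ∈ M.faces P then y.1 ⟨f, hf⟩ else 0
    have hd : ∀ f : M.faces P, d f = y.1 f := fun f => dif_pos f.2
    have hdm : ∀ f, d f ∈ X := by
      intro f
      by_cases hf : f ∈ M.faces P
      · exact hd ⟨f, hf⟩ ▸ (y.1 ⟨f, hf⟩).2
      · simp only [d, dif_neg hf]; exact zero_mem _
    obtain ⟨v, hv, hn⟩ := exists_neumann hS (M.ccls P y.2) d (by
      rw [← hy, ← Finset.sum_coe_sort (M.faces P)]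
      exact Finset.sum_congr rfl fun f _ => by rw [hd])
    obtain ⟨q, hq⟩ := hS.exists_isWeakGrad hv
    exact ⟨⟨q, v, hq, _, (mem_polyL2_iff (M.isOpen_cell P) (M.bounded_cell P)).2 ⟨_, y.2.2, rfl⟩,
      hn.isWeakDiv, d, hdm, hn⟩, ((hA _ _).1 ⟨v, hq, d, hd, hn⟩).symm⟩
  have hone : (1 : MvPolynomial (Fin (m + 1)) ℝ) ∈ polyDeg (m + 1) (r : ℤ) := by
    rw [← MvPolynomial.C_1]
    exact C_mem_polyDeg 1 (by positivity)
  have hker : LinearMap.ker A ≠ ⊥ := by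
    intro h
    have h1 : (⟨M.ccls P 1, ccls_mem_auxLoc hS hone⟩ : M.auxLoc r P) ∈ LinearMap.ker A := by
      rw [LinearMap.mem_ker, eq_comm, ← hA]
      refine ⟨_, isWeakGrad_pcls _ _ 1, 0, fun f => rfl, ?_⟩
      rw [pgrad_one, map_zero]
      exact (map_zero (M.ccls P)).symm ▸ HasNormalTrace.zero
    rw [h, Submodule.mem_bot] at h1
    have h2 : M.ccls P 1 = 0 := congrArg Subtype.val h1
    exact one_ne_zero (pcls_injective _ _ (M.nonempty_cell P) (h2.trans (map_zero _).symm))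
  -- Injectivity of `Λ` bounds the dimension by the number of moments, which is the number of
  -- Neumann data. Conversely the kernel of κ loses at most one dimension, and the constants in the
  -- kernel of `A` restore it.
  have hdim : Module.finrank ℝ (M.auxLoc r P)
      = Module.finrank ℝ ((M.faces P → Module.Dual ℝ X) × Module.Dual ℝ X') := by
    refine le_antisymm (LinearMap.finrank_le_finrank_of_injective hΛinj) ?_
    have e1 := A.finrank_range_add_finrank_ker
    have e2 := Submodule.finrank_mono hrange
    have e12 : Module.finrank ℝ (LinearMap.ker κ) + Module.finrank ℝ (LinearMap.ker A)
        ≤ Module.finrank ℝ (M.auxLoc r P) := (Nat.add_le_add_right e2 _).trans e1.le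
    have e3 := κ.finrank_range_add_finrank_ker
    have e4 : Module.finrank ℝ (LinearMap.range κ) ≤ 1 := by
      simpa using Submodule.finrank_le (LinearMap.range κ)
    have e5 : 0 < Module.finrank ℝ (LinearMap.ker A) := by
      rw [Nat.pos_iff_ne_zero]
      exact fun h => hker (Submodule.finrank_eq_zero.1 h)
    have e6 : Module.finrank ℝ ((M.faces P → Module.Dual ℝ X) × Module.Dual ℝ X')
        = Module.finrank ℝ ((M.faces P → X) × X') := by
      rw [Module.finrank_prod, Module.finrank_prod, Module.finrank_pi_fintype,
        Module.finrank_pi_fintype, Subspace.dual_finrank_eq, Subspace.dual_finrank_eq]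
    omega
  have hsurj : Function.Surjective Λ :=
    (LinearMap.injective_iff_surjective_of_finrank_eq_finrank hdim).1 hΛinj
  obtain ⟨⟨q, hq⟩, hΛq⟩ := hsurj (fun f => a f ∘ₗ X.subtype, b ∘ₗ X'.subtype)
  obtain ⟨⟨t, ht, h1⟩, h2⟩ := (hΛ ⟨q, hq⟩ _).2 hΛq.symm
  exact ⟨q, hq, t, ht, fun f hf μ hμ => (h1 ⟨f, hf⟩ ⟨μ, hμ⟩).symm, fun μ hμ => (h2 ⟨μ, hμ⟩).symm⟩

end PolyMesh

end

/-! ### Unisolvence of the local nonconforming space N_h^r -/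

section

variable {m : ℕ} {T E : Type*}

section truncation

open MvPolynomial

variable {n : ℕ}

/-- Truncation of a polynomial at degree `j`. -/
def truncDeg (n : ℕ) (j : ℤ) : MvPolynomial (Fin n) ℝ →ₗ[ℝ] MvPolynomial (Fin n) ℝ :=
  (basisMonomials (Fin n) ℝ).constr ℝ fun a =>
    if (a.degree : ℤ) ≤ j then monomial a 1 else 0

lemma truncDeg_monomial (j : ℤ) (a : Fin n →₀ ℕ) (c : ℝ) :
    truncDeg n j (monomial a c) = if (a.degree : ℤ) ≤ j then monomial a c else 0 := by
  have h1 : truncDeg n j (monomial a 1) = if (a.degree : ℤ) ≤ j then monomial a 1 else 0 := by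
    have := (basisMonomials (Fin n) ℝ).constr_basis ℝ
      (fun a => if (a.degree : ℤ) ≤ j then monomial a (1 : ℝ) else 0) a
    rwa [coe_basisMonomials] at this
  have h2 : monomial a c = c • monomial a (1 : ℝ) := by rw [smul_monomial, smul_eq_mul, mul_one]
  rw [h2, map_smul, h1, smul_ite, smul_zero]

lemma truncDeg_eq_sum (j : ℤ) (p : MvPolynomial (Fin n) ℝ) :
    truncDeg n j p = ∑ a ∈ p.support, if (a.degree : ℤ) ≤ j then monomial a (coeff a p) else 0 := by
  conv_lhs => rw [p.as_sum, map_sum]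
  exact Finset.sum_congr rfl fun a _ => truncDeg_monomial j a _

lemma monomial_mem_polyDeg {k : ℤ} {a : Fin n →₀ ℕ} (ha : (a.degree : ℤ) ≤ k) (c : ℝ) :
    monomial a c ∈ polyDeg n k := by
  classical
  refine mem_polyDeg_iff.2 fun b hb => ?_
  rw [coeff_monomial] at hb
  split_ifs at hb with h
  · rwa [← h]
  · exact absurd rfl hb

lemma truncDeg_mem (j : ℤ) (p : MvPolynomial (Fin n) ℝ) : truncDeg n j p ∈ polyDeg n j := by
  rw [truncDeg_eq_sum]
  refine Submodule.sum_mem _ fun a _ => ?_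
  split_ifs with h
  · exact monomial_mem_polyDeg h _
  · exact zero_mem _

lemma truncDeg_of_mem {j : ℤ} {p : MvPolynomial (Fin n) ℝ} (hp : p ∈ polyDeg n j) :
    truncDeg n j p = p := by
  conv_rhs => rw [p.as_sum]
  rw [truncDeg_eq_sum]
  exact Finset.sum_congr rfl fun a ha =>
    if_pos (mem_polyDeg_iff.1 hp a (mem_support_iff.1 ha))

lemma sub_truncDeg_mem {j r : ℤ} {p : MvPolynomial (Fin n) ℝ} (hp : p ∈ polyDeg n r) :
    p - truncDeg n j p ∈ Submodule.span ℝ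
      ((fun a => monomial a (1 : ℝ)) '' {a : Fin n →₀ ℕ | j < a.degree ∧ (a.degree : ℤ) ≤ r}) := by
  have e : p - truncDeg n j p
      = ∑ a ∈ p.support, (monomial a (coeff a p)
        - if (a.degree : ℤ) ≤ j then monomial a (coeff a p) else 0) := by
    rw [Finset.sum_sub_distrib, ← truncDeg_eq_sum, ← p.as_sum]
  rw [e]
  refine Submodule.sum_mem _ fun a ha => ?_
  split_ifs with h
  · rw [sub_self]; exact zero_mem _
  · rw [sub_zero]
    have h2 : monomial a (coeff a p) = coeff a p • monomial a (1 : ℝ) := by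
      rw [smul_monomial, smul_eq_mul, mul_one]
    rw [h2]
    exact Submodule.smul_mem _ _ (Submodule.subset_span
      ⟨a, ⟨not_le.1 h, mem_polyDeg_iff.1 hp a (mem_support_iff.1 ha)⟩, rfl⟩)

/-- The polynomial that represents a scaled monomial. -/
def scaledPoly (D : Set (Sp n)) : MvPolynomial (Fin n) ℝ →ₐ[ℝ] MvPolynomial (Fin n) ℝ :=
  bind₁ fun i => C (Metric.diam D)⁻¹ * (X i - C ((⨍ z in D, z) i))

/-- The inverse of the scaling of polynomials. -/
def unscaledPoly (D : Set (Sp n)) : MvPolynomial (Fin n) ℝ →ₐ[ℝ] MvPolynomial (Fin n) ℝ :=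
  bind₁ fun i => C (Metric.diam D) * X i + C ((⨍ z in D, z) i)

lemma pval_scaledPoly (D : Set (Sp n)) (a : Fin n →₀ ℕ) (x : Sp n) :
    pval (scaledPoly D (monomial a 1)) x = PolyMesh.scaledMono D a x := by
  rw [scaledPoly, bind₁_monomial, PolyMesh.scaledMono, C_1, one_mul]
  change eval (fun i => x i) _ = _
  rw [map_prod]
  refine (Finset.prod_subset (Finset.subset_univ _) fun i _ hi => ?_).trans
    (Finset.prod_congr rfl fun i _ => ?_)
  · simp [Finsupp.notMem_support_iff.1 hi]
  · simp [div_eq_inv_mul]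

lemma scaledPoly_mem (D : Set (Sp n)) {k : ℤ} {p : MvPolynomial (Fin n) ℝ} (hp : p ∈ polyDeg n k) :
    scaledPoly D p ∈ polyDeg n k := by
  refine bind₁_mem_polyDeg _ (fun i => ?_) hp
  refine (totalDegree_mul _ _).trans ?_
  rw [totalDegree_C, zero_add]
  refine (totalDegree_sub _ _).trans ?_
  rw [totalDegree_C, totalDegree_X]
  simp

lemma unscaledPoly_mem (D : Set (Sp n)) {k : ℤ} {p : MvPolynomial (Fin n) ℝ}
    (hp : p ∈ polyDeg n k) : unscaledPoly D p ∈ polyDeg n k := by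
  refine bind₁_mem_polyDeg _ (fun i => ?_) hp
  refine (totalDegree_add _ _).trans ?_
  rw [totalDegree_C]
  refine max_le ((totalDegree_mul _ _).trans ?_) (Nat.zero_le _)
  rw [totalDegree_C, totalDegree_X, zero_add]

lemma unscaledPoly_scaledPoly {D : Set (Sp n)} (hD : 0 < Metric.diam D)
    (p : MvPolynomial (Fin n) ℝ) : unscaledPoly D (scaledPoly D p) = p := by
  have : (unscaledPoly D).comp (scaledPoly D) = AlgHom.id ℝ _ := by
    ext1 i
    simp only [AlgHom.comp_apply, scaledPoly, unscaledPoly, bind₁_X_right, map_mul, map_sub,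
      AlgHom.id_apply]
    rw [bind₁_C_right, bind₁_C_right, add_sub_cancel_right, ← mul_assoc, ← C_mul,
      inv_mul_cancel₀ hD.ne', C_1, one_mul]
  exact congrArg (fun h => h p) this

lemma scaledPoly_unscaledPoly {D : Set (Sp n)} (hD : 0 < Metric.diam D)
    (p : MvPolynomial (Fin n) ℝ) : scaledPoly D (unscaledPoly D p) = p := by
  have : (scaledPoly D).comp (unscaledPoly D) = AlgHom.id ℝ _ := by
    ext1 i
    simp only [AlgHom.comp_apply, scaledPoly, unscaledPoly, bind₁_X_right, map_mul, map_add,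
      AlgHom.id_apply]
    rw [bind₁_C_right, bind₁_C_right, ← mul_assoc, ← C_mul, mul_inv_cancel₀ hD.ne', C_1, one_mul,
      sub_add_cancel]
  exact congrArg (fun h => h p) this

/-- The projection onto the polynomials of degree at most `j` along the scaled monomials of higher
degree. -/
lemma exists_scaled_projection {D : Set (Sp n)} (hD : 0 < Metric.diam D) (j : ℤ) :
    ∃ π : MvPolynomial (Fin n) ℝ →ₗ[ℝ] MvPolynomial (Fin n) ℝ,
      (∀ p ∈ polyDeg n j, π p = p) ∧ (∀ p, π p ∈ polyDeg n j) ∧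
      (∀ a : Fin n →₀ ℕ, j < a.degree → π (scaledPoly D (monomial a 1)) = 0) ∧
      ∀ (r : ℤ), ∀ p ∈ polyDeg n r, p - π p ∈ Submodule.span ℝ
        ((fun a => scaledPoly D (monomial a (1 : ℝ))) ''
          {a : Fin n →₀ ℕ | j < a.degree ∧ (a.degree : ℤ) ≤ r}) := by
  -- Truncation is conjugated with the scaling, so that the discarded part is spanned by scaled
  -- monomials, those in the definition of `ncLoc`.
  refine ⟨(scaledPoly D).toLinearMap ∘ₗ truncDeg n j ∘ₗ (unscaledPoly D).toLinearMap,
    fun p hp => ?_, fun p => ?_, fun a ha => ?_, fun r p hp => ?_⟩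
  · simp only [LinearMap.comp_apply, AlgHom.toLinearMap_apply]
    rw [truncDeg_of_mem (unscaledPoly_mem D hp), scaledPoly_unscaledPoly hD]
  · exact scaledPoly_mem D (truncDeg_mem j _)
  · simp only [LinearMap.comp_apply, AlgHom.toLinearMap_apply]
    rw [unscaledPoly_scaledPoly hD, truncDeg_monomial, if_neg (not_le.2 ha), map_zero]
  · simp only [LinearMap.comp_apply, AlgHom.toLinearMap_apply]
    have h1 := sub_truncDeg_mem (j := j) (unscaledPoly_mem D hp)
    have h2 := Submodule.mem_map_of_mem (f := (scaledPoly D).toLinearMap) h1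
    rw [Submodule.map_span, ← Set.image_comp, map_sub] at h2
    simp only [AlgHom.toLinearMap_apply] at h2
    rw [scaledPoly_unscaledPoly hD] at h2
    exact h2

end truncation

namespace PolyMesh

variable {M : PolyMesh m T E} [Fintype E]

lemma diam_cell_pos (M : PolyMesh m T E) (P : T) : 0 < Metric.diam (M.cell P) := by
  refine Metric.diam_pos ?_ (M.bounded_cell P)
  obtain ⟨x, hx⟩ := M.nonempty_cell P
  exact (infinite_of_mem_nhds x ((M.isOpen_cell P).mem_nhds hx)).nontrivial

lemma integral_scaledMono (P : T) (q : L2 (M.cell P)) (a : Fin (m + 1) →₀ ℕ) :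
    ∫ x in M.cell P, q x * scaledMono (M.cell P) a x
      = M.momentC P q (scaledPoly (M.cell P) (MvPolynomial.monomial a 1)) := by
  rw [momentC_apply]
  simp_rw [pval_scaledPoly]

lemma momentC_sub (P : T) (q q' : L2 (M.cell P)) (p : MvPolynomial (Fin (m + 1)) ℝ) :
    M.momentC P (q - q') p = M.momentC P q p - M.momentC P q' p := by
  simp only [momentC_eq_inner, inner_sub_left]

/-- The degrees r - 1 and r are written as an interval of integers, the form in which
`exists_scaled_projection` uses them. -/
lemma mem_ncLoc_iff {pr : ∀ P, L2 (M.cell P) →ₗ[ℝ] L2 (M.cell P)} {r : ℕ} {P : T}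
    {q : L2 (M.cell P)} : q ∈ M.ncLoc pr r P ↔ q ∈ M.auxLoc r P ∧
      ∀ a : Fin (m + 1) →₀ ℕ, ((r : ℤ) - 2 < a.degree ∧ (a.degree : ℤ) ≤ r) →
        M.momentC P (q - pr P q) (scaledPoly (M.cell P) (MvPolynomial.monomial a 1)) = 0 := by
  have h0 : q ∈ M.ncLoc pr r P ↔ q ∈ M.auxLoc r P ∧ ∀ a : Fin (m + 1) →₀ ℕ,
      a.degree + 1 = r ∨ a.degree = r →
      ∫ x in M.cell P, (q - pr P q : L2 (M.cell P)) x * scaledMono (M.cell P) a x = 0 := Iff.rfl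
  rw [h0]
  refine and_congr_right fun _ => forall_congr' fun a => ?_
  rw [integral_scaledMono]
  have : (a.degree + 1 = r ∨ a.degree = r) ↔ ((r : ℤ) - 2 < a.degree ∧ (a.degree : ℤ) ≤ r) := by
    omega
  rw [this]

/-- A member of the local nonconforming space is determined by its degrees of freedom. -/
theorem eq_zero_of_mem_ncLoc {P : T} {c : Sp (m + 1)} {ρ : ℝ} (hS : StarDom (M.cell P) c ρ)
    {pr : ∀ P, L2 (M.cell P) →ₗ[ℝ] L2 (M.cell P)} {r : ℕ} (hpr : M.IsDofProjection r P (pr P))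
    {q : L2 (M.cell P)} (hq : q ∈ M.ncLoc pr r P) {t : ∀ f, M.L2F f}
    (ht : M.IsTraceFamily P q t)
    (h1 : ∀ f ∈ M.faces P, ∀ μ ∈ polyDeg m ((r : ℤ) - 1), M.faceMoment f (t f) μ = 0)
    (h2 : ∀ μ ∈ polyDeg (m + 1) ((r : ℤ) - 2), M.momentC P q μ = 0) : q = 0 := by
  obtain ⟨hqa, hqm⟩ := mem_ncLoc_iff.1 hq
  -- Since Π*_r depends on the degrees of freedom only, Π*_r q = 0. The enhancement condition then
  -- says that the scaled moments of degrees r - 1 and r of q itself vanish, so all moments up to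
  -- degree r do.
  have hp0 : pr P q = 0 := hpr.from_dofs q hqa ⟨t, ht, h1⟩ fun μ hμ => by
    rw [← momentC_apply]; exact h2 μ hμ
  refine eq_zero_of_mem_auxLoc hS hqa ht h1 fun μ hμ => ?_
  obtain ⟨π, -, hπ2, -, hπ4⟩ := exists_scaled_projection (M.diam_cell_pos P) ((r : ℤ) - 2)
  have h3 : μ - π μ ∈ LinearMap.ker (M.momentC P q) := by
    refine Submodule.span_le.2 ?_ (hπ4 r μ hμ)
    rintro _ ⟨a, ha, rfl⟩
    have := hqm a ha
    rw [hp0, sub_zero] at this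
    exact this
  rw [LinearMap.mem_ker, map_sub, h2 _ (hπ2 μ), sub_zero] at h3
  exact h3

/-- Every choice of degrees of freedom is taken in the local nonconforming space. -/
theorem exists_mem_ncLoc {P : T} {c : Sp (m + 1)} {ρ : ℝ} (hS : StarDom (M.cell P) c ρ)
    {pr : ∀ P, L2 (M.cell P) →ₗ[ℝ] L2 (M.cell P)} {r : ℕ} (hpr : M.IsDofProjection r P (pr P))
    (a : E → MvPolynomial (Fin m) ℝ →ₗ[ℝ] ℝ) (b : MvPolynomial (Fin (m + 1)) ℝ →ₗ[ℝ] ℝ) :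
    ∃ q ∈ M.ncLoc pr r P, ∃ t, M.IsTraceFamily P q t ∧
      (∀ f ∈ M.faces P, ∀ μ ∈ polyDeg m ((r : ℤ) - 1), M.faceMoment f (t f) μ = a f μ) ∧
      ∀ μ ∈ polyDeg (m + 1) ((r : ℤ) - 2), M.momentC P q μ = b μ := by
  obtain ⟨π, hπ1, -, hπ3, -⟩ := exists_scaled_projection (M.diam_cell_pos P) ((r : ℤ) - 2)
  have hle : polyDeg (m + 1) ((r : ℤ) - 2) ≤ polyDeg (m + 1) r := polyDeg_mono (by linarith)
  -- Any member of W_h^r with the wanted degrees of freedom already reveals what Π*_r of the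
  -- solution must be, because Π*_r reads nothing else.
  obtain ⟨q₀, hq₀, t₀, ht₀, ha₀, hb₀⟩ := exists_mem_auxLoc hS r a b
  set p := pr P q₀ with hp
  -- This functional equals `b` up to degree r - 2, where π is the identity, and equals the moments
  -- of `p` on the scaled monomials of degrees r - 1 and r, which π kills.
  obtain ⟨q, hq, t, ht, ha, hb⟩ := exists_mem_auxLoc hS r a
    (M.momentC P p + (b - M.momentC P p) ∘ₗ π)
  have hb' : ∀ μ ∈ polyDeg (m + 1) ((r : ℤ) - 2), M.momentC P q μ = b μ := by
    intro μ hμ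
    rw [hb μ (hle hμ)]
    simp only [LinearMap.add_apply, LinearMap.comp_apply, LinearMap.sub_apply]
    rw [hπ1 μ hμ]
    ring
  have hdiff : pr P (q + (-1 : ℝ) • q₀) = 0 := by
    refine hpr.from_dofs _ (add_mem hq (Submodule.smul_mem _ _ hq₀))
      ⟨_, ht.add (ht₀.smul (-1)), fun f hf μ hμ => ?_⟩ fun μ hμ => ?_
    · rw [faceMoment_add, faceMoment_smul, ha f hf μ hμ, ha₀ f hf μ hμ]
      ring
    · rw [← momentC_apply, momentC_add, momentC_smul, hb' μ hμ, hb₀ μ (hle hμ)]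
      ring
  have hpq : pr P q = p := by
    rw [map_add, map_smul, ← hp, neg_one_smul, add_neg_eq_zero] at hdiff
    exact hdiff
  refine ⟨q, mem_ncLoc_iff.2 ⟨hq, fun α hα => ?_⟩, t, ht, ha, hb'⟩
  rw [hpq, momentC_sub, hb _ (scaledPoly_mem _ (monomial_mem_polyDeg hα.2 1))]
  simp only [LinearMap.add_apply, LinearMap.comp_apply]
  rw [hπ3 α hα.1, map_zero, add_zero, sub_self]

lemma polyL2_le_ncLoc {P : T} {c : Sp (m + 1)} {ρ : ℝ} (hS : StarDom (M.cell P) c ρ)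
    {pr : ∀ P, L2 (M.cell P) →ₗ[ℝ] L2 (M.cell P)} {r : ℕ} (hpr : M.IsDofProjection r P (pr P)) :
    polyL2 (M.cell P) r ≤ M.ncLoc pr r P := by
  intro q hq
  refine mem_ncLoc_iff.2 ⟨?_, fun a _ => ?_⟩
  · obtain ⟨p, hp, rfl⟩ := (mem_polyL2_iff (M.isOpen_cell P) (M.bounded_cell P)).1 hq
    exact ccls_mem_auxLoc hS hp
  · rw [hpr.fixes q hq, sub_self, momentC_eq_inner, inner_zero_left]

/-- The degrees of freedom, as a linear isomorphism on the local nonconforming space. -/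
lemma exists_ncLoc_equiv {P : T} {c : Sp (m + 1)} {ρ : ℝ} (hS : StarDom (M.cell P) c ρ)
    {pr : ∀ P, L2 (M.cell P) →ₗ[ℝ] L2 (M.cell P)} {r : ℕ} (hpr : M.IsDofProjection r P (pr P)) :
    Nonempty (M.ncLoc pr r P ≃ₗ[ℝ] (M.faces P → Module.Dual ℝ (polyDeg m ((r : ℤ) - 1))) ×
      Module.Dual ℝ (polyDeg (m + 1) ((r : ℤ) - 2))) := by
  classical
  obtain ⟨Λ, hΛ⟩ := exists_linearMap_of_rel (V := M.ncLoc pr r P)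
    (W := (M.faces P → Module.Dual ℝ (polyDeg m ((r : ℤ) - 1))) ×
      Module.Dual ℝ (polyDeg (m + 1) ((r : ℤ) - 2)))
    (fun q z => (∃ t, M.IsTraceFamily P q t ∧ ∀ (f : M.faces P) (μ : polyDeg m ((r : ℤ) - 1)),
      z.1 f μ = M.faceMoment f (t f) μ) ∧
      ∀ μ : polyDeg (m + 1) ((r : ℤ) - 2), z.2 μ = M.momentC P q μ)
    (by
      rintro q q' z z' ⟨⟨t, ht, h1⟩, h2⟩ ⟨⟨t', ht', h1'⟩, h2'⟩
      refine ⟨⟨_, ht.add ht', fun f μ => ?_⟩, fun μ => ?_⟩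
      · rw [faceMoment_add, ← h1, ← h1']; rfl
      · rw [Submodule.coe_add, momentC_add, ← h2, ← h2']; rfl)
    (by
      rintro x q z ⟨⟨t, ht, h1⟩, h2⟩
      refine ⟨⟨_, ht.smul x, fun f μ => ?_⟩, fun μ => ?_⟩
      · rw [faceMoment_smul, ← h1]; rfl
      · rw [Submodule.coe_smul, momentC_smul, ← h2]; rfl)
    (by
      rintro ⟨q, hq⟩
      obtain ⟨g, hg, -⟩ := hq.1
      obtain ⟨t, ht⟩ := exists_isTraceFamily hS hg
      refine ⟨(fun f => M.momentF f (t f) ∘ₗ (polyDeg m ((r : ℤ) - 1)).subtype,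
        M.momentC P q ∘ₗ (polyDeg (m + 1) ((r : ℤ) - 2)).subtype),
        ⟨t, ht, fun f μ => M.momentF_apply f (t f) μ⟩, fun μ => rfl⟩)
    (by
      rintro ⟨z1, z2⟩ ⟨⟨t, ht, h1⟩, h2⟩
      refine Prod.ext ?_ ?_
      · ext f μ
        have : t f = 0 := (ht f f.2).unique hS f.2 IsTrace.zero
        rw [h1, this, faceMoment_zero]
        rfl
      · ext μ
        rw [h2, momentC_eq_inner, ZeroMemClass.coe_zero, inner_zero_left]
        rfl)
  refine ⟨LinearEquiv.ofBijective Λ ⟨?_, fun z => ?_⟩⟩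
  · rw [← LinearMap.ker_eq_bot, LinearMap.ker_eq_bot']
    rintro ⟨q, hq⟩ h0
    obtain ⟨⟨t, ht, h1⟩, h2⟩ := (hΛ ⟨q, hq⟩ _).2 rfl
    rw [h0] at h1 h2
    ext1
    exact eq_zero_of_mem_ncLoc hS hpr hq ht (fun f hf μ hμ => (h1 ⟨f, hf⟩ ⟨μ, hμ⟩).symm)
      fun μ hμ => (h2 ⟨μ, hμ⟩).symm
  · have hext : ∀ f : M.faces P, ∃ g : MvPolynomial (Fin m) ℝ →ₗ[ℝ] ℝ,
        g ∘ₗ (polyDeg m ((r : ℤ) - 1)).subtype = z.1 f := fun f => LinearMap.exists_extend (z.1 f)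
    choose a ha using hext
    obtain ⟨b, hb⟩ := LinearMap.exists_extend z.2
    obtain ⟨q, hq, t, ht, h1, h2⟩ := exists_mem_ncLoc hS hpr
      (fun f => if hf : f ∈ M.faces P then a ⟨f, hf⟩ else 0) b
    refine ⟨⟨q, hq⟩, ((hΛ _ _).1 ⟨⟨t, ht, fun f μ => ?_⟩, fun μ => ?_⟩).symm⟩
    · rw [h1 f f.2 μ μ.2, dif_pos f.2, ← ha]
      rfl
    · rw [h2 μ μ.2, ← hb]
      rfl

lemma finiteDimensional_ncLoc {P : T} {c : Sp (m + 1)} {ρ : ℝ} (hS : StarDom (M.cell P) c ρ)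
    {pr : ∀ P, L2 (M.cell P) →ₗ[ℝ] L2 (M.cell P)} {r : ℕ} (hpr : M.IsDofProjection r P (pr P)) :
    FiniteDimensional ℝ (M.ncLoc pr r P) := by
  obtain ⟨e⟩ := exists_ncLoc_equiv hS hpr
  exact FiniteDimensional.of_injective e.toLinearMap e.injective

lemma finrank_ncLoc {P : T} {c : Sp (m + 1)} {ρ : ℝ} (hS : StarDom (M.cell P) c ρ)
    {pr : ∀ P, L2 (M.cell P) →ₗ[ℝ] L2 (M.cell P)} {r : ℕ} (hpr : M.IsDofProjection r P (pr P)) :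
    Module.finrank ℝ (M.ncLoc pr r P)
      = (M.faces P).card * polyDim ((r : ℤ) - 1) m + polyDim ((r : ℤ) - 2) (m + 1) := by
  obtain ⟨e⟩ := exists_ncLoc_equiv hS hpr
  rw [e.finrank_eq, Module.finrank_prod, Module.finrank_pi_fintype, Subspace.dual_finrank_eq,
    Subspace.dual_finrank_eq]
  simp [polyDim]

end PolyMesh

end

section

/-! ### Gluing functions on the elements -/

namespace PolyMesh

variable {m : ℕ} {T E : Type*} (M : PolyMesh m T E)
variable {F : Type*} [NormedAddCommGroup F] [NormedSpace ℝ F]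

lemma coeFn_rest (P : T) (v : Lp F 2 (volume.restrict M.domain)) :
    M.rest P v =ᵐ[volume.restrict (M.cell P)] v :=
  MemLp.coeFn_toLp ((Lp.memLp v).mono_measure (Measure.restrict_mono_set volume (M.cell_subset P)))

lemma domain_ae_eq [Fintype E] [Finite T] : M.domain =ᵐ[volume] ⋃ P, M.cell P := by
  refine EventuallyLE.antisymm (ae_le_set.2 M.volume_domain_diff) ?_
  exact LE.le.eventuallyLE (Set.iUnion_subset M.cell_subset)

lemma eq_of_rest_eq [Fintype E] [Finite T] {v w : Lp F 2 (volume.restrict M.domain)}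
    (h : ∀ P, M.rest P v = M.rest P w) : v = w := by
  apply Lp.ext
  have e : ∀ᵐ x ∂volume.restrict (⋃ P, M.cell P), v x = w x := by
    rw [ae_restrict_iUnion_iff]
    intro P
    have h1 := M.coeFn_rest P v
    rw [h P] at h1
    exact h1.symm.trans (M.coeFn_rest P w)
  rwa [← Measure.restrict_congr_set M.domain_ae_eq] at e

lemma exists_rest_eq [Finite T] (v : ∀ P, Lp F 2 (volume.restrict (M.cell P))) :
    ∃ w : Lp F 2 (volume.restrict M.domain), ∀ P, M.rest P w = v P := by
  have := Fintype.ofFinite T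
  have hm : ∀ P, MemLp ((M.cell P).indicator (v P)) 2 (volume.restrict M.domain) := fun P =>
    ((memLp_indicator_iff_restrict (M.isOpen_cell P).measurableSet).2 (Lp.memLp (v P))).restrict _
  refine ⟨(memLp_finsetSum' Finset.univ fun P _ => hm P).toLp, fun P => ?_⟩
  apply Lp.ext
  have h1 := ae_mono (Measure.restrict_mono_set volume (M.cell_subset P))
    (memLp_finsetSum' Finset.univ fun P _ => hm P).coeFn_toLp
  filter_upwards [M.coeFn_rest P (memLp_finsetSum' Finset.univ fun P _ => hm P).toLp, h1,
    ae_restrict_mem (M.isOpen_cell P).measurableSet] with x hx hx' hxP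
  rw [hx, hx', Finset.sum_apply, Finset.sum_eq_single P]
  · exact Set.indicator_of_mem hxP _
  · intro Q _ hQ
    exact Set.indicator_of_notMem (fun h => (M.disjoint_cell Q P hQ).ne_of_mem h hxP rfl) _
  · simp

variable [Fintype E]

lemma integral_domain_eq_sum [Fintype T] {h : Sp (m + 1) → F}
    (hh : Integrable h (volume.restrict M.domain)) :
    ∫ x in M.domain, h x = ∑ P, ∫ x in M.cell P, h x := by
  rw [setIntegral_congr_set M.domain_ae_eq]
  refine integral_iUnion_fintype (fun P => (M.isOpen_cell P).measurableSet)
    (fun P Q hPQ => M.disjoint_cell P Q hPQ) fun P => ?_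
  exact hh.mono_measure (Measure.restrict_mono_set volume (M.cell_subset P))

variable {M}

lemma sum_faces_eq_sum [Fintype T] (a : T → E → ℝ) :
    ∑ P, ∑ f ∈ M.faces P, a P f = ∑ f, ∑ P, by
      classical exact if f ∈ M.faces P then a P f else 0 := by
  classical
  rw [Finset.sum_comm]
  refine Finset.sum_congr rfl fun P _ => ?_
  rw [← Finset.sum_filter]
  congr 1
  ext f; simp

/-- Terms that cancel on interior faces and vanish on boundary faces add up to zero. -/
lemma sum_faces_eq_zero [Fintype T] (hM : M.StarCells) {a : T → E → ℝ}
    (h : ∀ f ∈ M.intFaces, ∀ P Q, f ∈ M.faces P → f ∈ M.faces Q → P ≠ Q → a P f + a Q f = 0)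
    (h' : ∀ f ∈ M.bdFaces, ∀ P, f ∈ M.faces P → a P f = 0) :
    ∑ P, ∑ f ∈ M.faces P, a P f = 0 := by
  classical
  rw [sum_faces_eq_sum]
  refine Finset.sum_eq_zero fun f _ => ?_
  rw [← Finset.sum_filter]
  by_cases hf : f ∈ M.intFaces
  · obtain ⟨P, Q, hPQ, hR⟩ := exists_pair_of_mem_intFaces hM hf
    have e : Finset.univ.filter (fun R => f ∈ M.faces R) = {P, Q} := by ext R; simp [hR]
    rw [e, Finset.sum_pair hPQ]
    exact h f hf P Q ((hR P).2 (Or.inl rfl)) ((hR Q).2 (Or.inr rfl)) hPQ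
  · exact Finset.sum_eq_zero fun P hP =>
      h' f (mem_bdFaces_of_not_mem_intFaces hM hf) P (Finset.mem_filter.1 hP).2

lemma sum_faces_eq_pair [Fintype T] (hM : M.StarCells) {a : T → E → ℝ} {f : E} {P Q : T}
    (hP : f ∈ M.faces P) (hQ : f ∈ M.faces Q) (hne : P ≠ Q) (h : ∀ R, ∀ e ≠ f, a R e = 0) :
    ∑ R, ∑ e ∈ M.faces R, a R e = a P f + a Q f := by
  classical
  rw [sum_faces_eq_sum, Finset.sum_eq_single f]
  · obtain ⟨P', Q', -, hR⟩ := exists_pair_of_mem_intFaces hM (mem_intFaces_of_ne hM hP hQ hne)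
    have e : Finset.univ.filter (fun R => f ∈ M.faces R) = {P, Q} := by
      ext R
      have h1 := (hR P).1 hP
      have h2 := (hR Q).1 hQ
      simp only [Finset.mem_filter, Finset.mem_univ, true_and, hR, Finset.mem_insert,
        Finset.mem_singleton]
      grind
    rw [← Finset.sum_filter, e, Finset.sum_pair hne]
  · intro e _ he
    refine Finset.sum_eq_zero fun R _ => ?_
    rw [h R e he, ite_self]
  · simp

/-! ### Conformity in `H(div)` -/

lemma sum_normalTrace [Fintype T] {v : L2V M.domain} {s : L2 M.domain}
    {γ : T → E → MvPolynomial (Fin m) ℝ}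
    (h : ∀ P, M.HasNormalTrace P (M.rest P v) (M.rest P s) (γ P)) {φ : Sp (m + 1) → ℝ}
    (hφ : IsTest Set.univ φ) :
    ∫ x in M.domain, (⟪v x, gradient φ x⟫ + s x * φ x) =
      ∑ P, ∑ f ∈ M.faces P, ∫ y in (M.face f).dom, pval (γ P f) y * φ ((M.face f).chart y) := by
  have hi : Integrable (fun x => ⟪v x, gradient φ x⟫ + s x * φ x) (volume.restrict M.domain) :=
    (integrable_inner' (Lp.memLp v) (memLp_test (cont_gradient hφ.1) (supp_gradient hφ.2.1))).add
      (integrable_mul' (Lp.memLp s) (memLp_test hφ.1.continuous hφ.2.1))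
  rw [M.integral_domain_eq_sum hi]
  refine Finset.sum_congr rfl fun P _ => ?_
  rw [← h P φ hφ]
  apply integral_congr_ae
  filter_upwards [M.coeFn_rest P v, M.coeFn_rest P s] with x h1 h2
  rw [h1, h2]

lemma isWeakDiv_iff_integral {n : ℕ} {D : Set (Sp n)} {v : L2V D} {s : L2 D} : IsWeakDiv D v s ↔
    ∀ φ, IsTest D φ → ∫ x in D, (⟪v x, gradient φ x⟫ + s x * φ x) = 0 := by
  refine forall₂_congr fun φ hφ => ?_
  rw [integral_add (integrable_inner' (Lp.memLp v)
      (memLp_test (cont_gradient hφ.1) (supp_gradient hφ.2.1)))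
      (integrable_mul' (Lp.memLp s) (memLp_test hφ.1.continuous hφ.2.1)), ← eq_neg_iff_add_eq_zero]
  simp only [mul_comm]

lemma integral_test_bdFace {f : E} (hf : f ∈ M.bdFaces) {φ : Sp (m + 1) → ℝ}
    (hφ : IsTest M.domain φ) (g : MvPolynomial (Fin m) ℝ) :
    ∫ y in (M.face f).dom, pval g y * φ ((M.face f).chart y) = 0 := by
  refine setIntegral_eq_zero_of_forall_eq_zero fun y hy => ?_
  have h1 := (M.mem_bdFaces.1 hf) ⟨y, hy, rfl⟩
  rw [M.isOpen_domain.frontier_eq] at h1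
  rw [hφ.eq_zero h1.2, mul_zero]

/-- In the sum of the elementwise Green formulas the two contributions of an interior face cancel,
and test functions of the domain vanish on boundary faces. -/
lemma isWeakDiv_of_jump [Fintype T] (hM : M.StarCells) {v : L2V M.domain} {s : L2 M.domain}
    {γ : T → E → MvPolynomial (Fin m) ℝ}
    (h : ∀ P, M.HasNormalTrace P (M.rest P v) (M.rest P s) (γ P))
    (hj : ∀ f P Q, f ∈ M.faces P → f ∈ M.faces Q → P ≠ Q → γ P f + γ Q f = 0) :
    IsWeakDiv M.domain v s := by
  refine isWeakDiv_iff_integral.2 fun φ hφ => ?_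
  have hφ' := hφ.mono (Set.subset_univ _)
  rw [sum_normalTrace h hφ']
  refine sum_faces_eq_zero hM (fun f _ P Q hP hQ hne => ?_) fun f hf P _ =>
    integral_test_bdFace hf hφ _
  rw [← integral_add (integrable_face hφ' _) (integrable_face hφ' _)]
  refine integral_eq_zero_of_ae (ae_of_all _ fun y => ?_)
  change pval (γ P f) y * _ + pval (γ Q f) y * _ = 0
  rw [← add_mul, ← Pi.add_apply, ← map_add, hj f P Q hP hQ hne, map_zero, Pi.zero_apply, zero_mul]

lemma isWeakDiv_rest {v : L2V M.domain} {s : L2 M.domain} (h : IsWeakDiv M.domain v s) (P : T) :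
    IsWeakDiv (M.cell P) (M.rest P v) (M.rest P s) := by
  refine isWeakDiv_iff_integral.2 fun φ hφ => ?_
  rw [← isWeakDiv_iff_integral.1 h φ (hφ.mono (M.cell_subset P))]
  rw [setIntegral_eq_of_subset_of_forall_sdiff_eq_zero M.isOpen_domain.measurableSet
    (M.cell_subset P) (f := fun x => ⟪v x, gradient φ x⟫ + s x * φ x)]
  · apply integral_congr_ae
    filter_upwards [M.coeFn_rest P v, M.coeFn_rest P s] with x h1 h2
    rw [h1, h2]
  · rintro x ⟨_, hx⟩
    rw [hφ.eq_zero hx, hφ.gradient_eq_zero hx, inner_zero_right, mul_zero, add_zero]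

/-- A test function supported in the domain near one point of the face sees no other face, so the
sum of the Green formulas reduces to the two sides of this face. -/
lemma jump_of_isWeakDiv [Fintype T] (hM : M.StarCells) {v : L2V M.domain} {s : L2 M.domain}
    {γ : T → E → MvPolynomial (Fin m) ℝ}
    (h : ∀ P, M.HasNormalTrace P (M.rest P v) (M.rest P s) (γ P)) (hs : IsWeakDiv M.domain v s)
    {f : E} {P Q : T} (hP : f ∈ M.faces P) (hQ : f ∈ M.faces Q) (hne : P ≠ Q) :
    γ P f + γ Q f = 0 := by
  obtain ⟨y₀, hy₀⟩ := (M.face f).nonempty_dom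
  have hx : (M.face f).chart y₀ ∈ (M.face f).carrier := ⟨y₀, hy₀, rfl⟩
  obtain ⟨ε, hε, hd⟩ := M.exists_ball_inter f hx
  have hdom : (M.face f).chart y₀ ∈ M.domain :=
    M.mem_intFaces.1 (mem_intFaces_of_ne hM hP hQ hne) hx
  refine eq_zero_of_forall_test_face hy₀ (U := Metric.ball ((M.face f).chart y₀) ε ∩ M.domain)
    (inter_mem (Metric.ball_mem_nhds _ hε) (M.isOpen_domain.mem_nhds hdom)) fun φ hφ => ?_
  have hφ' := hφ.mono (Set.subset_univ _)
  have h1 := isWeakDiv_iff_integral.1 hs φ (hφ.mono Set.inter_subset_right)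
  rw [sum_normalTrace h hφ', sum_faces_eq_pair hM hP hQ hne
    (a := fun P f => ∫ y in (M.face f).dom, pval (γ P f) y * φ ((M.face f).chart y)),
    ← integral_add (integrable_face hφ' _) (integrable_face hφ' _)] at h1
  · rw [← h1]
    refine integral_congr_ae (ae_of_all _ fun y => ?_)
    change pval (γ P f + γ Q f) y * _ = _
    rw [map_add, Pi.add_apply, add_mul]
  · intro R e he
    exact integral_face_eq_zero (hd e he) (hφ.mono Set.inter_subset_left) _

lemma mem_vel_of_jump [Fintype T] (hM : M.StarCells) {k : ℕ} {v : L2V M.domain}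
    (hv : ∀ P, M.rest P v ∈ M.velLoc k P) {s : ∀ P, L2 (M.cell P)}
    {γ : T → E → MvPolynomial (Fin m) ℝ} (h : ∀ P, M.HasNormalTrace P (M.rest P v) (s P) (γ P))
    (hj : ∀ f P Q, f ∈ M.faces P → f ∈ M.faces Q → P ≠ Q → γ P f + γ Q f = 0) :
    v ∈ M.vel k := by
  obtain ⟨σ, hσ⟩ := M.exists_rest_eq s
  refine ⟨⟨σ, isWeakDiv_of_jump hM (fun P => ?_) hj⟩, hv⟩
  rw [hσ P]
  exact h P

/-- The elementwise divergences in the hypothesis are forced to be the restrictions of the global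
one, by uniqueness of weak divergences. -/
lemma jump_of_mem_vel [Fintype T] (hM : M.StarCells) {k : ℕ} {v : L2V M.domain}
    (hv : v ∈ M.vel k) {s : ∀ P, L2 (M.cell P)}
    {γ : T → E → MvPolynomial (Fin m) ℝ} (h : ∀ P, M.HasNormalTrace P (M.rest P v) (s P) (γ P))
    {f : E} {P Q : T} (hP : f ∈ M.faces P) (hQ : f ∈ M.faces Q) (hne : P ≠ Q) :
    γ P f + γ Q f = 0 := by
  obtain ⟨⟨σ, hσ⟩, -⟩ := hv
  refine jump_of_isWeakDiv hM (s := σ) (fun R => ?_) hσ hP hQ hne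
  rw [(isWeakDiv_rest hσ R).unique (M.isOpen_cell R) (h R).isWeakDiv]
  exact h R

end PolyMesh

end

section

/-! ### The dimension of the velocity space -/

namespace PolyMesh

variable {m : ℕ} {T E : Type*} (M : PolyMesh m T E) [Fintype E]

/-- An element that has the face `f`, which fixes the orientation of `f`. -/
def refCell (f : E) : T := (M.face_used f).choose

lemma mem_faces_refCell (f : E) : f ∈ M.faces (M.refCell f) :=
  M.mem_faces.2 (M.face_used f).choose_spec

open Classical in
/-- The orientation of `f` relative to `P`. -/
def orient (P : T) (f : E) : ℝ := if P = M.refCell f then 1 else -1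

lemma orient_refCell (f : E) : M.orient (M.refCell f) f = 1 := if_pos rfl

variable {M}

lemma orient_add (hM : M.StarCells) {f : E} {P Q : T} (hP : f ∈ M.faces P) (hQ : f ∈ M.faces Q)
    (hne : P ≠ Q) : M.orient P f + M.orient Q f = 0 := by
  obtain ⟨P', Q', -, hR⟩ := exists_pair_of_mem_intFaces hM (mem_intFaces_of_ne hM hP hQ hne)
  have h1 := (hR P).1 hP
  have h2 := (hR Q).1 hQ
  have h3 := (hR _).1 (M.mem_faces_refCell f)
  have h4 : M.refCell f = P ∨ M.refCell f = Q := by grind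
  unfold orient
  rcases h4 with h | h
  · rw [if_pos h.symm, if_neg (fun h' => hne (h.symm.trans h'.symm))]; norm_num
  · rw [if_neg (fun h' => hne (h'.trans h)), if_pos h.symm]; norm_num

lemma HasNormalTrace.congr {P : T} {v : L2V (M.cell P)} {s : L2 (M.cell P)}
    {g g' : E → MvPolynomial (Fin m) ℝ} (h : M.HasNormalTrace P v s g)
    (hg : ∀ f ∈ M.faces P, g f = g' f) : M.HasNormalTrace P v s g' := by
  intro φ hφ
  rw [h φ hφ]
  exact Finset.sum_congr rfl fun f hf => by rw [hg f hf]

variable (M) in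
/-- The degrees of freedom of the velocity space: oriented normal traces, divergences, and moments
against `𝒢_k(P)^⊥`. -/
abbrev VelData (k : ℕ) :=
  (E → polyDeg m k) × (T → polyDeg (m + 1) k) × (∀ P, Module.Dual ℝ (gradPolyPerp (M.cell P) k))

variable (M) in
/-- The defect in the compatibility of normal traces and divergence. -/
def compat (k : ℕ) : M.VelData k →ₗ[ℝ] (T → ℝ) where
  toFun d P := ∑ f ∈ M.faces P, ⟪M.fcls f (M.orient P f • (d.1 f : MvPolynomial (Fin m) ℝ)),
    M.fcls f 1⟫ - ⟪M.ccls P (d.2.1 P), M.ccls P 1⟫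
  map_add' d d' := by
    ext P
    simp only [Prod.fst_add, Prod.snd_add, Pi.add_apply, Submodule.coe_add, smul_add, map_add,
      inner_add_left, Finset.sum_add_distrib]
    ring
  map_smul' c d := by
    ext P
    simp only [Prod.smul_fst, Prod.smul_snd, Pi.smul_apply, Submodule.coe_smul, map_smul,
      inner_smul_left, Finset.mul_sum, RingHom.id_apply, smul_eq_mul, mul_sub]
    congr 1
    · exact Finset.sum_congr rfl fun f _ => by simp only [RCLike.conj_to_real]; ring

lemma compat_apply (k : ℕ) (d : M.VelData k) (P : T) : M.compat k d P =
    ∑ f ∈ M.faces P, ⟪M.fcls f (M.orient P f • (d.1 f : MvPolynomial (Fin m) ℝ)),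
      M.fcls f 1⟫ - ⟪M.ccls P (d.2.1 P), M.ccls P 1⟫ := rfl

lemma ccls_injective (M : PolyMesh m T E) (P : T) : Function.Injective (M.ccls P) :=
  pcls_injective _ _ (M.nonempty_cell P)

/-- The compatibility conditions, one per element, are independent: a constant divergence on each
element, -y_P divided by the measure ⟨1, 1⟩ of P, adjusts its defect without touching the others. -/
lemma compat_surjective (k : ℕ) : Function.Surjective (M.compat k) := by
  intro y
  have h0 : ∀ P, ⟪M.ccls P 1, M.ccls P 1⟫ ≠ 0 := fun P h => by
    have h1 := inner_self_eq_zero.1 h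
    exact one_ne_zero (M.ccls_injective P (h1.trans (map_zero _).symm))
  have h1 : (1 : MvPolynomial (Fin (m + 1)) ℝ) ∈ polyDeg (m + 1) k := by
    have := C_mem_polyDeg (n := m + 1) 1 (Int.natCast_nonneg k)
    rwa [MvPolynomial.C_1] at this
  refine ⟨(0, fun P => (-(y P) / ⟪M.ccls P 1, M.ccls P 1⟫) • ⟨1, h1⟩, 0), ?_⟩
  ext P
  rw [compat_apply]
  have e1 : ∑ f ∈ M.faces P, ⟪M.fcls f (M.orient P f •
      (((0 : E → polyDeg m k) f : polyDeg m k) : MvPolynomial (Fin m) ℝ)), M.fcls f 1⟫ = 0 :=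
    Finset.sum_eq_zero fun f _ => by
      rw [Pi.zero_apply, Submodule.coe_zero, smul_zero, map_zero, inner_zero_left]
  rw [e1]
  change 0 - ⟪M.ccls P ((-(y P) / ⟪M.ccls P 1, M.ccls P 1⟫) • 1), M.ccls P 1⟫ = _
  rw [map_smul, inner_smul_left, RCLike.conj_to_real, div_mul_cancel₀ _ (h0 P)]
  ring

/-- `v` has the degrees of freedom `d`. -/
def HasVelData {k : ℕ} (d : M.VelData k) (v : L2V M.domain) : Prop :=
  ∀ P, M.HasNormalTrace P (M.rest P v) (M.ccls P (d.2.1 P)) (fun f => M.orient P f • (d.1 f).1) ∧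
    ∀ w : gradPolyPerp (M.cell P) k, ⟪M.rest P v, (w : L2V (M.cell P))⟫ = d.2.2 P w

lemma HasVelData.add {k : ℕ} {d d' : M.VelData k} {v v' : L2V M.domain} (h : HasVelData d v)
    (h' : HasVelData d' v') : HasVelData (d + d') (v + v') := by
  intro P
  have e : M.rest P (v + v') = M.rest P v + M.rest P v' := map_add (res (M.cell_subset P)) _ _
  refine ⟨?_, fun w => ?_⟩
  · have es : M.ccls P ((d + d').2.1 P) = M.ccls P (d.2.1 P) + M.ccls P (d'.2.1 P) :=
      map_add (M.ccls P) _ _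
    rw [e, es]
    exact ((h P).1.add (h' P).1).congr fun f _ => (smul_add _ _ _).symm
  · rw [e, inner_add_left, (h P).2, (h' P).2]
    rfl

lemma HasVelData.smul {k : ℕ} {d : M.VelData k} {v : L2V M.domain} (a : ℝ) (h : HasVelData d v) :
    HasVelData (a • d) (a • v) := by
  intro P
  have e : M.rest P (a • v) = a • M.rest P v := map_smul (res (M.cell_subset P)) _ _
  refine ⟨?_, fun w => ?_⟩
  · have es : M.ccls P ((a • d).2.1 P) = a • M.ccls P (d.2.1 P) := map_smul (M.ccls P) _ _
    rw [e, es]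
    exact ((h P).1.smul a).congr fun f _ =>
      smul_comm a (M.orient P f) (d.1 f).1
  · rw [e, inner_smul_left, (h P).2]
    rfl

lemma HasVelData.eq_zero_of_data [Finite T] (hM : M.StarCells) {k : ℕ} {v : L2V M.domain}
    (hv : v ∈ M.vel k) {d : M.VelData k} (hd : d = 0) (h : HasVelData d v) : v = 0 := by
  subst hd
  refine M.eq_of_rest_eq fun P => ?_
  have e : M.rest P (0 : L2V M.domain) = 0 := map_zero (res (M.cell_subset P))
  rw [e]
  obtain ⟨c, r, hS⟩ := hM P
  have h1 := (h P).1
  have e2 : M.ccls P (((0 : M.VelData k).2.1 P : polyDeg (m + 1) k) : MvPolynomial _ ℝ) = 0 :=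
    map_zero _
  rw [e2] at h1
  exact eq_zero_of_mem_velLoc hS (hv.2 P) h1 (fun f _ => smul_zero _)
    fun w hw => (h P).2 ⟨w, hw⟩

lemma HasVelData.data_eq_zero {k : ℕ} {d : M.VelData k} (h : HasVelData d (0 : L2V M.domain)) :
    d = 0 := by
  have e : ∀ P, M.rest P (0 : L2V M.domain) = 0 := fun P => map_zero (res (M.cell_subset P))
  have hn : ∀ P, M.HasNormalTrace P 0 (M.ccls P (d.2.1 P))
      (fun f => M.orient P f • (d.1 f).1) := fun P => by
    rw [← e P]; exact (h P).1
  have hs : ∀ P, M.ccls P (d.2.1 P) = 0 := fun P =>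
    (hn P).isWeakDiv.unique (M.isOpen_cell P) IsWeakDiv.zero
  refine Prod.ext (funext fun f => ?_) (Prod.ext (funext fun P => ?_) (funext fun P => ?_))
  · have h1 := hn (M.refCell f)
    rw [hs] at h1
    have h2 := h1.unique HasNormalTrace.zero (M.mem_faces_refCell f)
    simp only [orient_refCell, one_smul] at h2
    exact Subtype.ext h2
  · exact Subtype.ext (M.ccls_injective P ((hs P).trans (map_zero _).symm))
  · ext w
    rw [← (h P).2 w, e P, inner_zero_left]
    rfl

/-- Local unisolvence supplies the pieces; the two orientations of a face are opposite, so the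
normal traces cancel and the pieces glue in H(div). -/
lemma exists_hasVelData_of_mem_ker [Fintype T] (hM : M.StarCells) {k : ℕ} {d : M.VelData k}
    (hd : M.compat k d = 0) : ∃ v ∈ M.vel k, HasVelData d v := by
  have h1 : ∀ P, ∃ v ∈ M.velLoc k P, M.HasNormalTrace P v (M.ccls P (d.2.1 P))
      (fun f => M.orient P f • (d.1 f).1) ∧
      ∀ w : gradPolyPerp (M.cell P) k, ⟪v, (w : L2V (M.cell P))⟫ = d.2.2 P w := fun P => by
    obtain ⟨c, r, hS⟩ := hM P
    refine exists_mem_velLoc hS ?_ (fun f => Submodule.smul_mem _ _ (d.1 f).2) ?_ _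
    · rw [polyL2_eq_map (M.isOpen_cell P) (M.bounded_cell P)]
      exact ⟨_, (d.2.1 P).2, rfl⟩
    · have := congrFun hd P
      rw [compat_apply, Pi.zero_apply, sub_eq_zero] at this
      exact this
  choose v hv hn hθ using h1
  obtain ⟨u, hu⟩ := M.exists_rest_eq v
  refine ⟨u, mem_vel_of_jump hM (fun P => hu P ▸ hv P) (fun P => hu P ▸ hn P)
    fun f P Q hP hQ hne => ?_, fun P => hu P ▸ ⟨hn P, hθ P⟩⟩
  rw [← add_smul, orient_add hM hP hQ hne, zero_smul]

lemma exists_hasVelData_of_mem_vel [Fintype T] (hM : M.StarCells) {k : ℕ} {v : L2V M.domain}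
    (hv : v ∈ M.vel k) : ∃ d : M.VelData k, M.compat k d = 0 ∧ HasVelData d v := by
  have h1 : ∀ P, ∃ (s : polyDeg (m + 1) k) (g : E → MvPolynomial (Fin m) ℝ),
      (∀ f, g f ∈ polyDeg m k) ∧ M.HasNormalTrace P (M.rest P v) (M.ccls P s) g := fun P => by
    obtain ⟨s, hs, -, g, hg, hn⟩ := (hv.2 P).1
    rw [polyL2_eq_map (M.isOpen_cell P) (M.bounded_cell P)] at hs
    obtain ⟨s, hs, rfl⟩ := hs
    exact ⟨⟨s, hs⟩, g, hg, hn⟩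
  choose s g hg hn using h1
  -- The trace on a face is read off from its reference element; on the other side it is determined
  -- by the vanishing jump.
  let d : M.VelData k := (fun f => ⟨g (M.refCell f) f, hg _ f⟩, s, fun P =>
    (innerₛₗ ℝ (M.rest P v)) ∘ₗ (gradPolyPerp (M.cell P) k).subtype)
  have hd : HasVelData d v := fun P => by
    refine ⟨(hn P).congr fun f hf => ?_, fun w => rfl⟩
    change _ = M.orient P f • g (M.refCell f) f
    by_cases hP : P = M.refCell f
    · rw [hP, orient_refCell, one_smul, ← hP]
    · have h2 := jump_of_mem_vel hM hv hn hf (M.mem_faces_refCell f) hP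
      have h3 : M.orient P f = -1 := if_neg hP
      rw [h3, eq_neg_of_add_eq_zero_left h2]
      module
  refine ⟨d, funext fun P => ?_, hd⟩
  rw [compat_apply, (hd P).1.compat, sub_self]
  rfl

/-- A linear relation between two subspaces that is one-to-one is a linear equivalence. -/
lemma exists_equiv_of_rel {V W : Type*} [AddCommGroup V] [Module ℝ V] [AddCommGroup W]
    [Module ℝ W] (p : Submodule ℝ V) (q : Submodule ℝ W) (R : V → W → Prop)
    (hadd : ∀ v v' w w', R v w → R v' w' → R (v + v') (w + w'))
    (hsmul : ∀ (a : ℝ) v w, R v w → R (a • v) (a • w)) (hex : ∀ v ∈ p, ∃ w ∈ q, R v w)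
    (huniq : ∀ w ∈ q, R 0 w → w = 0) (hinj : ∀ v, R v 0 → v = 0)
    (hsurj : ∀ w ∈ q, ∃ v ∈ p, R v w) : Nonempty (p ≃ₗ[ℝ] q) := by
  obtain ⟨A, hA⟩ := exists_linearMap_of_rel (V := p) (W := q) (fun v w => R v.1 w.1)
    (fun _ _ _ _ h h' => hadd _ _ _ _ h h') (fun a _ _ h => hsmul a _ _ h)
    (fun v => by
      obtain ⟨w, hw, h⟩ := hex v v.2
      exact ⟨⟨w, hw⟩, h⟩)
    (fun w h => Subtype.ext (huniq w w.2 h))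
  refine ⟨LinearEquiv.ofBijective A ⟨?_, fun w => ?_⟩⟩
  · rw [← LinearMap.ker_eq_bot, LinearMap.ker_eq_bot']
    intro v hv
    exact Subtype.ext (hinj v ((hA v 0).2 hv.symm))
  · obtain ⟨v, hv, h⟩ := hsurj w w.2
    exact ⟨⟨v, hv⟩, ((hA ⟨v, hv⟩ w).1 h).symm⟩

lemma exists_vel_equiv [Fintype T] (hM : M.StarCells) (k : ℕ) :
    Nonempty (LinearMap.ker (M.compat k) ≃ₗ[ℝ] M.vel k) := by
  refine exists_equiv_of_rel (LinearMap.ker (M.compat k)) (M.vel k) HasVelData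
    (fun _ _ _ _ h h' => h.add h') (fun a _ _ h => h.smul a) (fun d hd => ?_)
    (fun v hv h => h.eq_zero_of_data hM hv rfl) (fun d h => h.data_eq_zero) (fun v hv => ?_)
  · exact exists_hasVelData_of_mem_ker hM (LinearMap.mem_ker.1 hd)
  · obtain ⟨d, hd, h⟩ := exists_hasVelData_of_mem_vel hM hv
    exact ⟨d, LinearMap.mem_ker.2 hd, h⟩

instance (P : T) (k : ℤ) : FiniteDimensional ℝ (gradPolyPerp (M.cell P) k) :=
  Submodule.finiteDimensional_of_le (inf_le_left (b := (gradPoly (M.cell P) k)ᗮ))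

lemma finrank_add_of_ker_equiv {V W X : Type*} [AddCommGroup V] [Module ℝ V] [AddCommGroup W]
    [Module ℝ W] [AddCommGroup X] [Module ℝ X] [Module.Finite ℝ V] {κ : V →ₗ[ℝ] W}
    (hκ : Function.Surjective κ) (A : LinearMap.ker κ ≃ₗ[ℝ] X) :
    Module.finrank ℝ X + Module.finrank ℝ W = Module.finrank ℝ V := by
  rw [← κ.finrank_range_add_finrank_ker, LinearMap.range_eq_top.2 hκ, finrank_top, A.finrank_eq,
    add_comm]

lemma finrank_data [Fintype T] (A B : Type*) (C : T → Type*) [AddCommGroup A] [Module ℝ A]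
    [Module.Finite ℝ A] [AddCommGroup B] [Module ℝ B] [Module.Finite ℝ B]
    [∀ P, AddCommGroup (C P)] [∀ P, Module ℝ (C P)] [∀ P, Module.Finite ℝ (C P)] :
    Module.finrank ℝ ((E → A) × (T → B) × (∀ P, Module.Dual ℝ (C P))) =
      Fintype.card E * Module.finrank ℝ A + (Fintype.card T * Module.finrank ℝ B
        + ∑ P, Module.finrank ℝ (C P)) := by
  rw [Module.finrank_prod, Module.finrank_prod, Module.finrank_pi_fintype,
    Module.finrank_pi_fintype, Module.finrank_pi_fintype]
  simp only [Subspace.dual_finrank_eq, Finset.sum_const, Finset.card_univ, smul_eq_mul]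

lemma finite_data [Finite T] (A B : Type*) (C : T → Type*) [AddCommGroup A] [Module ℝ A]
    [Module.Finite ℝ A] [AddCommGroup B] [Module ℝ B] [Module.Finite ℝ B]
    [∀ P, AddCommGroup (C P)] [∀ P, Module ℝ (C P)] [∀ P, Module.Finite ℝ (C P)] :
    Module.Finite ℝ ((E → A) × (T → B) × (∀ P, Module.Dual ℝ (C P))) := inferInstance

lemma finiteDimensional_vel [Fintype T] (hM : M.StarCells) (k : ℕ) :
    FiniteDimensional ℝ (M.vel k) := by
  obtain ⟨A⟩ := exists_vel_equiv hM k
  have : Module.Finite ℝ (M.VelData k) := finite_data _ _ _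
  exact Module.Finite.equiv A

/-- The number of data minus one compatibility condition per element, stated additively to avoid
subtraction of natural numbers. -/
lemma finrank_vel [Fintype T] (hM : M.StarCells) (k : ℕ) :
    Module.finrank ℝ (M.vel k) + Fintype.card T = Fintype.card E * polyDim k m
      + (Fintype.card T * polyDim k (m + 1)
        + ∑ P, Module.finrank ℝ (gradPolyPerp (M.cell P) k)) := by
  obtain ⟨A⟩ := exists_vel_equiv hM k
  have : Module.Finite ℝ (M.VelData k) := finite_data _ _ _
  have h1 := finrank_add_of_ker_equiv (compat_surjective k) A
  rw [Module.finrank_fintype_fun_eq_card] at h1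
  exact h1.trans (finrank_data _ _ _)

end PolyMesh

end

section

/-! ### Degrees of freedom of the nonconforming spaces -/

namespace PolyMesh

variable {m : ℕ} {T E : Type*} {M : PolyMesh m T E} [Fintype E]

/-- `q` has the face moments `a` and the interior moments `b`. -/
def HasNcData {r : ℕ} (P : T) (a : E → Module.Dual ℝ (polyDeg m ((r : ℤ) - 1)))
    (b : Module.Dual ℝ (polyDeg (m + 1) ((r : ℤ) - 2))) (q : L2 (M.cell P)) : Prop :=
  ∃ t, M.IsTraceFamily P q t ∧
    (∀ f ∈ M.faces P, ∀ μ : polyDeg m ((r : ℤ) - 1), M.faceMoment f (t f) μ = a f μ) ∧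
    ∀ μ : polyDeg (m + 1) ((r : ℤ) - 2), M.momentC P q μ = b μ

variable {r : ℕ} {P : T}

lemma HasNcData.add {a a' : E → Module.Dual ℝ (polyDeg m ((r : ℤ) - 1))}
    {b b' : Module.Dual ℝ (polyDeg (m + 1) ((r : ℤ) - 2))} {q q' : L2 (M.cell P)}
    (h : HasNcData P a b q) (h' : HasNcData P a' b' q') :
    HasNcData P (a + a') (b + b') (q + q') := by
  obtain ⟨t, ht, h1, h2⟩ := h
  obtain ⟨t', ht', h1', h2'⟩ := h'
  refine ⟨_, ht.add ht', fun f hf μ => ?_, fun μ => ?_⟩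
  · rw [faceMoment_add, h1 f hf, h1' f hf]; rfl
  · rw [momentC_add, h2, h2']; rfl

lemma HasNcData.smul {a : E → Module.Dual ℝ (polyDeg m ((r : ℤ) - 1))}
    {b : Module.Dual ℝ (polyDeg (m + 1) ((r : ℤ) - 2))} {q : L2 (M.cell P)} (c : ℝ)
    (h : HasNcData P a b q) : HasNcData P (c • a) (c • b) (c • q) := by
  obtain ⟨t, ht, h1, h2⟩ := h
  refine ⟨_, ht.smul c, fun f hf μ => ?_, fun μ => ?_⟩
  · rw [faceMoment_smul, h1 f hf]; rfl
  · rw [momentC_smul, h2]; rfl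

lemma HasNcData.congr {a a' : E → Module.Dual ℝ (polyDeg m ((r : ℤ) - 1))}
    {b : Module.Dual ℝ (polyDeg (m + 1) ((r : ℤ) - 2))} {q : L2 (M.cell P)}
    (h : HasNcData P a b q) (ha : ∀ f ∈ M.faces P, a f = a' f) : HasNcData P a' b q := by
  obtain ⟨t, ht, h1, h2⟩ := h
  exact ⟨t, ht, fun f hf μ => by rw [h1 f hf, ha f hf], h2⟩

lemma HasNcData.zero : HasNcData (r := r) P 0 0 (0 : L2 (M.cell P)) := by
  refine ⟨0, fun f _ => IsTrace.zero, fun f _ μ => M.faceMoment_zero f _, fun μ => ?_⟩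
  rw [momentC_eq_inner, inner_zero_left]; rfl

lemma HasNcData.eq_of_traces (hM : M.StarCells)
    {a : E → Module.Dual ℝ (polyDeg m ((r : ℤ) - 1))}
    {b : Module.Dual ℝ (polyDeg (m + 1) ((r : ℤ) - 2))} {q : L2 (M.cell P)}
    (h : HasNcData P a b q) {t : ∀ f, M.L2F f} (ht : M.IsTraceFamily P q t) {f : E}
    (hf : f ∈ M.faces P) (μ : polyDeg m ((r : ℤ) - 1)) : M.faceMoment f (t f) μ = a f μ := by
  obtain ⟨c, ρ, hS⟩ := hM P
  obtain ⟨t', ht', h1, -⟩ := h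
  rw [← h1 f hf μ, (ht f hf).unique hS hf (ht' f hf)]

lemma HasNcData.eq_of_mem_faces (hM : M.StarCells)
    {a a' : E → Module.Dual ℝ (polyDeg m ((r : ℤ) - 1))}
    {b b' : Module.Dual ℝ (polyDeg (m + 1) ((r : ℤ) - 2))} {q : L2 (M.cell P)}
    (h : HasNcData P a b q) (h' : HasNcData P a' b' q) {f : E} (hf : f ∈ M.faces P) :
    a f = a' f := by
  obtain ⟨t, ht, h1, -⟩ := h
  ext μ
  rw [← eq_of_traces hM h' ht hf μ, h1 f hf μ]

variable {pr : ∀ P, L2 (M.cell P) →ₗ[ℝ] L2 (M.cell P)}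

lemma HasNcData.eq_zero (hM : M.StarCells) (hpr : M.IsDofProjection r P (pr P))
    {q : L2 (M.cell P)} (hq : q ∈ M.ncLoc pr r P)
    (h : HasNcData (r := r) P 0 0 q) : q = 0 := by
  obtain ⟨c, ρ, hS⟩ := hM P
  obtain ⟨t, ht, h1, h2⟩ := h
  exact eq_zero_of_mem_ncLoc hS hpr hq ht (fun f hf μ hμ => h1 f hf ⟨μ, hμ⟩) fun μ hμ => h2 ⟨μ, hμ⟩

lemma exists_mem_ncLoc_hasNcData (hM : M.StarCells) (hpr : M.IsDofProjection r P (pr P))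
    (a : E → Module.Dual ℝ (polyDeg m ((r : ℤ) - 1)))
    (b : Module.Dual ℝ (polyDeg (m + 1) ((r : ℤ) - 2))) :
    ∃ q ∈ M.ncLoc pr r P, HasNcData P a b q := by
  obtain ⟨c, ρ, hS⟩ := hM P
  choose a' ha' using fun f => LinearMap.exists_extend (a f)
  obtain ⟨b', hb'⟩ := LinearMap.exists_extend b
  obtain ⟨q, hq, t, ht, h1, h2⟩ := exists_mem_ncLoc hS hpr a' b'
  refine ⟨q, hq, t, ht, fun f hf μ => ?_, fun μ => ?_⟩
  · rw [h1 f hf μ μ.2, ← ha' f]; rfl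
  · rw [h2 μ μ.2, ← hb']; rfl

lemma isWeakGrad_of_mem_ncLoc {q : L2 (M.cell P)} (hq : q ∈ M.ncLoc pr r P) :
    IsWeakGrad (M.cell P) q (wgrad (M.cell P) q) := by
  obtain ⟨⟨g, hg, -⟩, -⟩ := hq
  rwa [hg.wgrad_eq (M.isOpen_cell P)]

lemma hasNcData_of_isTraceFamily {q : L2 (M.cell P)} {t : ∀ f, M.L2F f}
    (ht : M.IsTraceFamily P q t) :
    HasNcData (r := r) P (fun f => M.momentF f (t f) ∘ₗ (polyDeg m ((r : ℤ) - 1)).subtype)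
      (M.momentC P q ∘ₗ (polyDeg (m + 1) ((r : ℤ) - 2)).subtype) q :=
  ⟨t, ht, fun f _ μ => (momentF_apply f (t f) μ).symm, fun _ => rfl⟩

lemma exists_traces_of_mem_ncLoc (hM : M.StarCells) {q : L2 (M.cell P)}
    (hq : q ∈ M.ncLoc pr r P) : ∃ t, M.IsTraceFamily P q t := by
  obtain ⟨c, ρ, hS⟩ := hM P
  exact exists_isTraceFamily hS (isWeakGrad_of_mem_ncLoc hq)

variable (M pr r) in
-- The inverse of the degrees of freedom as a linear map. Its argument carries data on all faces of
-- the mesh, of which only those on the faces of `P` matter.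
lemma exists_ncLift (hM : M.StarCells) (hpr : M.IsDofProjection r P (pr P)) :
    ∃ Z : (E → Module.Dual ℝ (polyDeg m ((r : ℤ) - 1))) ×
      Module.Dual ℝ (polyDeg (m + 1) ((r : ℤ) - 2)) →ₗ[ℝ] M.ncLoc pr r P,
      ∀ z (q : M.ncLoc pr r P), HasNcData P z.1 z.2 (q : L2 (M.cell P)) ↔ q = Z z :=
  exists_linearMap_of_rel (V := (E → Module.Dual ℝ (polyDeg m ((r : ℤ) - 1))) ×
      Module.Dual ℝ (polyDeg (m + 1) ((r : ℤ) - 2)))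
    (fun z (q : M.ncLoc pr r P) => HasNcData P z.1 z.2 q.1) (fun _ _ _ _ h h' => h.add h')
    (fun c _ _ h => h.smul c)
    (fun z => by
      obtain ⟨q, hq, h⟩ := exists_mem_ncLoc_hasNcData hM hpr z.1 z.2
      exact ⟨⟨q, hq⟩, h⟩)
    (fun q h => Subtype.ext (h.eq_zero hM hpr q.2))

/-! ### The global nonconforming space -/

lemma mem_nc_of_hasNcData {q : L2 M.domain} (hq : ∀ P, M.rest P q ∈ M.ncLoc pr r P)
    {a : E → Module.Dual ℝ (polyDeg m ((r : ℤ) - 1))}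
    {b : T → Module.Dual ℝ (polyDeg (m + 1) ((r : ℤ) - 2))}
    (h : ∀ P, HasNcData P a (b P) (M.rest P q)) (ha : ∀ f ∈ M.bdFaces, a f = 0) :
    q ∈ M.nc pr r := by
  choose t ht h1 h2 using h
  refine ⟨hq, t, ht, fun f _ P Q hP hQ μ hμ => ?_, fun f hf P hP μ hμ => ?_⟩
  · exact (h1 P f hP ⟨μ, hμ⟩).trans (h1 Q f hQ ⟨μ, hμ⟩).symm
  · rw [h1 P f hP ⟨μ, hμ⟩, ha f hf]; rfl

/-- Moments agree across interior faces and vanish on boundary faces, so one functional per face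
describes all elements; it is read off from the reference element. -/
lemma exists_hasNcData_of_mem_nc (hM : M.StarCells) {q : L2 M.domain} (hq : q ∈ M.nc pr r) :
    ∃ (a : E → Module.Dual ℝ (polyDeg m ((r : ℤ) - 1)))
      (b : T → Module.Dual ℝ (polyDeg (m + 1) ((r : ℤ) - 2))),
      (∀ f ∈ M.bdFaces, a f = 0) ∧ ∀ P, HasNcData P a (b P) (M.rest P q) := by
  obtain ⟨-, t, ht, h1, h2⟩ := hq
  have hbd : ∀ f ∈ M.bdFaces, M.momentF f (t (M.refCell f) f) ∘ₗ
      (polyDeg m ((r : ℤ) - 1)).subtype = 0 := fun f hf => by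
    ext μ
    exact (momentF_apply _ _ _).trans (h2 f hf _ (M.mem_faces_refCell f) μ μ.2)
  refine ⟨fun f => M.momentF f (t (M.refCell f) f) ∘ₗ (polyDeg m ((r : ℤ) - 1)).subtype, _, hbd,
    fun P => (hasNcData_of_isTraceFamily (ht P)).congr fun f hf => ?_⟩
  ext μ
  change M.momentF f (t P f) μ = M.momentF f (t (M.refCell f) f) μ
  rw [momentF_apply, momentF_apply]
  by_cases hi : f ∈ M.intFaces
  · exact h1 f hi _ _ hf (M.mem_faces_refCell f) μ μ.2
  · have hb := mem_bdFaces_of_not_mem_intFaces hM hi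
    rw [h2 f hb P hf μ μ.2, h2 f hb _ (M.mem_faces_refCell f) μ μ.2]

lemma exists_mem_nc_hasNcData [Finite T] (hM : M.StarCells)
    (hpr : ∀ P, M.IsDofProjection r P (pr P))
    (a : E → Module.Dual ℝ (polyDeg m ((r : ℤ) - 1)))
    (b : T → Module.Dual ℝ (polyDeg (m + 1) ((r : ℤ) - 2))) (ha : ∀ f ∈ M.bdFaces, a f = 0) :
    ∃ q ∈ M.nc pr r, ∀ P, HasNcData P a (b P) (M.rest P q) := by
  choose q hq h using fun P => exists_mem_ncLoc_hasNcData hM (hpr P) a (b P)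
  obtain ⟨χ, hχ⟩ := M.exists_rest_eq q
  have h' : ∀ P, HasNcData P a (b P) (M.rest P χ) := fun P => by rw [hχ P]; exact h P
  exact ⟨χ, mem_nc_of_hasNcData (fun P => by rw [hχ P]; exact hq P) h' ha, h'⟩

open Classical in
/-- Extension by zero of data on the interior faces. -/
def extendInt (M : PolyMesh m T E) {A : Type*} [AddCommGroup A] [Module ℝ A]
    (a : M.intFaces → A) (f : E) : A :=
  if h : f ∈ M.intFaces then a ⟨f, h⟩ else 0

lemma extendInt_mem {A : Type*} [AddCommGroup A] [Module ℝ A] (a : M.intFaces → A)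
    (f : M.intFaces) : M.extendInt a f = a f := dif_pos f.2

lemma extendInt_bdFaces {A : Type*} [AddCommGroup A] [Module ℝ A] (a : M.intFaces → A) {f : E}
    (hf : f ∈ M.bdFaces) : M.extendInt a f = 0 :=
  dif_neg fun h => not_mem_bdFaces_of_mem_intFaces h hf

lemma extendInt_add {A : Type*} [AddCommGroup A] [Module ℝ A] (a a' : M.intFaces → A) :
    M.extendInt (a + a') = M.extendInt a + M.extendInt a' := by
  ext f
  simp only [extendInt, Pi.add_apply]
  split_ifs <;> simp

lemma extendInt_smul {A : Type*} [AddCommGroup A] [Module ℝ A] (c : ℝ) (a : M.intFaces → A) :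
    M.extendInt (c • a) = c • M.extendInt a := by
  ext f
  simp only [extendInt, Pi.smul_apply]
  split_ifs <;> simp

lemma extendInt_zero {A : Type*} [AddCommGroup A] [Module ℝ A] :
    M.extendInt (0 : M.intFaces → A) = 0 := by
  ext f
  simp only [extendInt, Pi.zero_apply, dite_eq_ite, ite_self]

/-- The free parameters are the moments on interior faces and those in the elements. They are
presented as `⊤` because `exists_equiv_of_rel` relates subspaces. -/
lemma exists_nc_equiv [Finite T] (hM : M.StarCells) (hpr : ∀ P, M.IsDofProjection r P (pr P)) :
    Nonempty ((⊤ : Submodule ℝ ((M.intFaces → Module.Dual ℝ (polyDeg m ((r : ℤ) - 1))) ×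
      (T → Module.Dual ℝ (polyDeg (m + 1) ((r : ℤ) - 2))))) ≃ₗ[ℝ] M.nc pr r) := by
  have e0 : ∀ P, M.rest P (0 : L2 M.domain) = 0 := fun P => map_zero (res (M.cell_subset P))
  refine exists_equiv_of_rel _ (M.nc pr r)
    (fun z q => ∀ P, HasNcData P (M.extendInt z.1) (z.2 P) (M.rest P q))
    (fun z z' q q' h h' P => ?_) (fun c z q h P => ?_) (fun z _ => ?_) (fun q hq h => ?_)
    (fun z h => ?_) fun q hq => ?_
  · have e : M.rest P (q + q') = M.rest P q + M.rest P q' := map_add (res (M.cell_subset P)) _ _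
    rw [e, Prod.fst_add, extendInt_add]
    exact (h P).add (h' P)
  · have e : M.rest P (c • q) = c • M.rest P q := map_smul (res (M.cell_subset P)) _ _
    rw [e, Prod.smul_fst, extendInt_smul]
    exact (h P).smul c
  · exact exists_mem_nc_hasNcData hM hpr _ _ fun f hf => extendInt_bdFaces _ hf
  · refine M.eq_of_rest_eq fun P => ?_
    rw [e0 P]
    have h1 := h P
    rw [Prod.fst_zero, extendInt_zero] at h1
    exact h1.eq_zero hM (hpr P) (hq.1 P)
  · refine Prod.ext (funext fun f => ?_) (funext fun P => ?_)
    · have h1 := h (M.refCell f)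
      rw [e0] at h1
      rw [← extendInt_mem z.1 f]
      exact h1.eq_of_mem_faces hM HasNcData.zero (M.mem_faces_refCell f)
    · obtain ⟨t, -, -, h2⟩ := h P
      ext μ
      rw [← h2 μ, e0, momentC_eq_inner, inner_zero_left]
      rfl
  · obtain ⟨a, b, ha, h⟩ := exists_hasNcData_of_mem_nc hM hq
    refine ⟨(fun f => a f, b), trivial, fun P => (h P).congr fun f _ => ?_⟩
    by_cases hf : f ∈ M.intFaces
    · exact (extendInt_mem (fun f : M.intFaces => a f) ⟨f, hf⟩).symm
    · have hb := mem_bdFaces_of_not_mem_intFaces hM hf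
      rw [ha f hb, extendInt_bdFaces _ hb]

lemma finiteDimensional_nc [Finite T] (hM : M.StarCells)
    (hpr : ∀ P, M.IsDofProjection r P (pr P)) : FiniteDimensional ℝ (M.nc pr r) := by
  obtain ⟨A⟩ := exists_nc_equiv hM hpr
  exact Module.Finite.equiv A

lemma finrank_nc [Fintype T] (hM : M.StarCells) (hpr : ∀ P, M.IsDofProjection r P (pr P)) :
    Module.finrank ℝ (M.nc pr r) = M.intFaces.card * polyDim ((r : ℤ) - 1) m
      + Fintype.card T * polyDim ((r : ℤ) - 2) (m + 1) := by
  obtain ⟨A⟩ := exists_nc_equiv hM hpr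
  rw [← A.finrank_eq, finrank_top, Module.finrank_prod, Module.finrank_pi_fintype,
    Module.finrank_pi_fintype]
  simp only [Subspace.dual_finrank_eq, Finset.sum_const, Finset.card_univ, smul_eq_mul,
    Fintype.card_coe]
  rfl

end PolyMesh

end

section

/-! ### The coefficient -/

section

variable {n : ℕ} {D D' : Set (Sp n)} {K : Sp n → Sp n →L[ℝ] Sp n}

lemma PolyMesh.IsDiffusion.mono (hK : PolyMesh.IsDiffusion D K) (h : D' ⊆ D) :
    PolyMesh.IsDiffusion D' K where
  smooth := hK.smooth.mono h
  bounded := hK.bounded.imp fun _ hC x hx => hC x (h hx)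
  symm x hx := hK.symm x (h hx)
  posDef := hK.posDef.imp fun _ hκ => ⟨hκ.1, fun x hx => hκ.2 x (h hx)⟩

namespace PolyMesh.IsDiffusion

lemma memLp (hK : PolyMesh.IsDiffusion D K) (hD : IsOpen D) (v : L2V D) :
    MemLp (fun x => K x (v x)) 2 (volume.restrict D) := by
  obtain ⟨C, hC⟩ := hK.bounded
  refine (Lp.memLp v).of_le_mul (c := C) ?_ ?_
  · exact isBoundedBilinearMap_apply.continuous.comp_aestronglyMeasurable₂
      (hK.smooth.continuousOn.aestronglyMeasurable hD.measurableSet) (Lp.aestronglyMeasurable v)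
  · filter_upwards [ae_restrict_mem hD.measurableSet] with x hx
    exact (K x).le_of_opNorm_le (hC x hx) _

lemma coeFn_mulK (hK : PolyMesh.IsDiffusion D K) (hD : IsOpen D) (v : L2V D) :
    PolyMesh.mulK D K v =ᵐ[volume.restrict D] fun x => K x (v x) := by
  rw [PolyMesh.mulK, dif_pos (hK.memLp hD v)]
  exact MemLp.coeFn_toLp _

lemma integral_inner_eq (hK : PolyMesh.IsDiffusion D K) (hD : IsOpen D) (v w : L2V D) :
    ∫ x in D, ⟪K x (v x), w x⟫ = ⟪PolyMesh.mulK D K v, w⟫ := by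
  rw [l2v_inner_eq]
  apply integral_congr_ae
  filter_upwards [hK.coeFn_mulK hD v] with x hx
  rw [hx]

lemma inner_mulK_comm (hK : PolyMesh.IsDiffusion D K) (hD : IsOpen D) (v w : L2V D) :
    ⟪PolyMesh.mulK D K v, w⟫ = ⟪v, PolyMesh.mulK D K w⟫ := by
  rw [l2v_inner_eq, l2v_inner_eq]
  apply integral_congr_ae
  filter_upwards [hK.coeFn_mulK hD v, hK.coeFn_mulK hD w, ae_restrict_mem hD.measurableSet]
    with x h1 h2 hx
  rw [h1, h2, hK.symm x hx]

end PolyMesh.IsDiffusion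

lemma inner_pclsV (hD : IsOpen D) (hb : Bornology.IsBounded D) (v : L2V D)
    (w : Fin n → MvPolynomial (Fin n) ℝ) : ⟪v, pclsV hD hb w⟫ = ∫ x in D, ⟪v x, pvalV w x⟫ := by
  rw [l2v_inner_eq]
  apply integral_congr_ae
  filter_upwards [coeFn_pclsV hD hb w] with x hx
  rw [hx]

lemma proj_mem (k : ℤ) (q : L2 D) : proj D k q ∈ polyL2 D k := Submodule.starProjection_apply_mem _ _

lemma projV_mem (k : ℤ) (v : L2V D) : projV D k v ∈ polyL2V D k :=
  Submodule.starProjection_apply_mem _ _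

lemma proj_of_mem {k : ℤ} {q : L2 D} (h : q ∈ polyL2 D k) : proj D k q = q :=
  Submodule.starProjection_eq_self_iff.2 h

lemma projV_of_mem {k : ℤ} {v : L2V D} (h : v ∈ polyL2V D k) : projV D k v = v :=
  Submodule.starProjection_eq_self_iff.2 h

lemma inner_projV_comm (k : ℤ) (v w : L2V D) : ⟪projV D k v, w⟫ = ⟪v, projV D k w⟫ :=
  Submodule.inner_starProjection_left_eq_right _ v w

lemma proj_add (k : ℤ) (q q' : L2 D) : proj D k (q + q') = proj D k q + proj D k q' := map_add _ _ _

lemma proj_smul (k : ℤ) (c : ℝ) (q : L2 D) : proj D k (c • q) = c • proj D k q := map_smul _ _ _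

lemma projV_add (k : ℤ) (q q' : L2V D) : projV D k (q + q') = projV D k q + projV D k q' :=
  map_add _ _ _

lemma projV_smul (k : ℤ) (c : ℝ) (q : L2V D) : projV D k (c • q) = c • projV D k q := map_smul _ _ _

lemma projV_zero (k : ℤ) : projV D k (0 : L2V D) = 0 := map_zero _

/-- Constant fields are gradients of affine functions. This is why equation (b) can be imposed for k
≥ 1 only. -/
lemma gradPolyPerp_zero_eq_bot (hD : IsOpen D) (hb : Bornology.IsBounded D) :
    gradPolyPerp D 0 = ⊥ := by
  rw [eq_bot_iff]
  rintro v ⟨hv, hv'⟩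
  obtain ⟨w, hw, rfl⟩ := (mem_polyL2V_iff hD hb).1 hv
  obtain ⟨q, hq, rfl⟩ := exists_pgrad_eq hw fun i j => by
    obtain ⟨a, ha⟩ := mem_polyDeg_zero.1 (hw i)
    obtain ⟨b, hb⟩ := mem_polyDeg_zero.1 (hw j)
    rw [ha, hb, MvPolynomial.pderiv_C, MvPolynomial.pderiv_C]
  have h1 : pclsV hD hb (pgrad q) ∈ gradPoly D 0 := (mem_gradPoly_iff hD hb).2 ⟨q, hq, rfl⟩
  exact inner_self_eq_zero.1 (hv' _ h1)

end

/-! ### The local form -/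

namespace PolyMesh

variable {m : ℕ} {T E : Type*} {M : PolyMesh m T E}
variable {K : Sp (m + 1) → Sp (m + 1) →L[ℝ] Sp (m + 1)}
  {S : ∀ P, L2 (M.cell P) →ₗ[ℝ] L2 (M.cell P) →ₗ[ℝ] ℝ}

lemma formLoc_eq (hK : IsDiffusion M.domain K) (k : ℕ) (P : T) (p q : L2 (M.cell P)) :
    M.formLoc K S k P p q =
      ⟪mulK (M.cell P) K (projV (M.cell P) k (wgrad (M.cell P) p)),
        projV (M.cell P) k (wgrad (M.cell P) q)⟫
      + S P (p - proj (M.cell P) (k + 1) p) (q - proj (M.cell P) (k + 1) q) := by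
  rw [formLoc, (hK.mono (M.cell_subset P)).integral_inner_eq (M.isOpen_cell P)]

lemma formLoc_add (hK : IsDiffusion M.domain K) (k : ℕ) (P : T) (p : L2 (M.cell P))
    {q q' : L2 (M.cell P)} (hq : IsWeakGrad (M.cell P) q (wgrad (M.cell P) q))
    (hq' : IsWeakGrad (M.cell P) q' (wgrad (M.cell P) q')) :
    M.formLoc K S k P p (q + q') = M.formLoc K S k P p q + M.formLoc K S k P p q' := by
  rw [formLoc_eq hK, formLoc_eq hK, formLoc_eq hK, (hq.add hq').wgrad_eq (M.isOpen_cell P),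
    projV_add, inner_add_right, proj_add, add_sub_add_comm,
    (S P (p - proj (M.cell P) (k + 1) p)).map_add]
  ring

lemma formLoc_smul (hK : IsDiffusion M.domain K) (k : ℕ) (P : T) (p : L2 (M.cell P))
    (c : ℝ) {q : L2 (M.cell P)} (hq : IsWeakGrad (M.cell P) q (wgrad (M.cell P) q)) :
    M.formLoc K S k P p (c • q) = c * M.formLoc K S k P p q := by
  rw [formLoc_eq hK, formLoc_eq hK, (hq.smul c).wgrad_eq (M.isOpen_cell P),
    projV_smul, inner_smul_right, proj_smul, ← smul_sub,
    (S P (p - proj (M.cell P) (k + 1) p)).map_smul, smul_eq_mul]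
  ring

lemma wgrad_of_mem_polyL2_zero {P : T} {c : L2 (M.cell P)} (hc : c ∈ polyL2 (M.cell P) 0) :
    wgrad (M.cell P) c = 0 := by
  obtain ⟨p, hp, rfl⟩ := (mem_polyL2_iff (M.isOpen_cell P) (M.bounded_cell P)).1 hc
  rw [wgrad_pcls, pgrad_eq_zero_iff.2 (mem_polyDeg_zero.1 hp), map_zero]

lemma polyL2_mono (P : T) {j k : ℤ} (h : j ≤ k) : polyL2 (M.cell P) j ≤ polyL2 (M.cell P) k := by
  rw [polyL2_eq_map (M.isOpen_cell P) (M.bounded_cell P),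
    polyL2_eq_map (M.isOpen_cell P) (M.bounded_cell P)]
  exact Submodule.map_mono (polyDeg_mono h)

/-- A constant has zero gradient and is reproduced by Π_{k+1}⁰, so both parts of the form vanish.
This makes the constant test function trivial in (a), and it makes the recovered fluxes compatible
with the source. -/
lemma formLoc_const (hK : IsDiffusion M.domain K) (k : ℕ) (P : T) (p : L2 (M.cell P))
    {c : L2 (M.cell P)} (hc : c ∈ polyL2 (M.cell P) 0) : M.formLoc K S k P p c = 0 := by
  rw [formLoc_eq hK, wgrad_of_mem_polyL2_zero hc, projV_zero, inner_zero_right,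
    proj_of_mem (polyL2_mono P (by positivity) hc), sub_self,
    (S P (p - proj (M.cell P) (k + 1) p)).map_zero, add_zero]

/-! ### The equations on one element -/

variable [Fintype E]

/-- The equations of the mixed method on the element `P`, with source `F` and scalar part `p`. -/
structure LocalEqs (K : Sp (m + 1) → Sp (m + 1) →L[ℝ] Sp (m + 1))
    (S : ∀ P, L2 (M.cell P) →ₗ[ℝ] L2 (M.cell P) →ₗ[ℝ] ℝ)
    (pr : ∀ P, L2 (M.cell P) →ₗ[ℝ] L2 (M.cell P)) (k : ℕ) (P : T) (F p : L2 (M.cell P))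
    (u : L2V (M.cell P)) : Prop where
  mem_velLoc : u ∈ M.velLoc k P
  inner_wgrad : ∀ χ ∈ M.ncLoc pr (k + 1) P,
    ⟪u, wgrad (M.cell P) χ⟫ = - M.formLoc K S k P p χ
  inner_perp : ∀ v ∈ gradPolyPerp (M.cell P) k,
    ⟪u, v⟫ = - ⟪mulK (M.cell P) K (projV (M.cell P) k (wgrad (M.cell P) p)), v⟫
  isWeakDiv : IsWeakDiv (M.cell P) u (proj (M.cell P) k F)

variable {pr : ∀ P, L2 (M.cell P) →ₗ[ℝ] L2 (M.cell P)} {k : ℕ} {P : T}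

lemma exists_isNormalTrace_of_mem_velLoc {u : L2V (M.cell P)} (hu : u ∈ M.velLoc k P) :
    ∃ g, M.IsNormalTrace k P u g := by
  obtain ⟨⟨s, -, hd, g, hg, hn⟩, -⟩ := hu
  refine ⟨g, hg, ?_⟩
  rwa [hd.wdiv_eq (M.isOpen_cell P)]

lemma wdiv_mem_polyL2 {u : L2V (M.cell P)} (hu : u ∈ M.velLoc k P) :
    wdiv (M.cell P) u ∈ polyL2 (M.cell P) k := by
  obtain ⟨⟨s, hs, hd, -⟩, -⟩ := hu
  rwa [hd.wdiv_eq (M.isOpen_cell P)]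

lemma isWeakDiv_wdiv {u : L2V (M.cell P)} (hu : u ∈ M.velLoc k P) :
    IsWeakDiv (M.cell P) u (wdiv (M.cell P) u) := by
  obtain ⟨⟨s, hs, hd, -⟩, -⟩ := hu
  rwa [hd.wdiv_eq (M.isOpen_cell P)]

/-- Both sides are polynomials of degree at most k, so their difference is an admissible test
function in (c). -/
lemma IsMVVM.wdiv_eq {F : L2 M.domain} {u : L2V M.domain} {p : L2 M.domain}
    (h : M.IsMVVM K S pr k F u p) (P : T) :
    wdiv (M.cell P) (M.rest P u) = proj (M.cell P) k (M.rest P F) := by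
  have h1 := Submodule.sub_mem _ (wdiv_mem_polyL2 (h.mem_vel.2 P)) (proj_mem k (M.rest P F))
  have h2 := h.eq_c P _ h1
  rw [← l2_inner_eq, ← l2_inner_eq, ← sub_eq_zero, ← inner_sub_left] at h2
  exact sub_eq_zero.1 (inner_self_eq_zero.1 h2)

lemma IsMVVM.localEqs (hK : IsDiffusion M.domain K) {F : L2 M.domain} {u : L2V M.domain}
    {p : L2 M.domain} (h : M.IsMVVM K S pr k F u p) (P : T) :
    LocalEqs K S pr k P (M.rest P F) (M.rest P p) (M.rest P u) where
  mem_velLoc := h.mem_vel.2 P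
  inner_wgrad χ hχ := by
    rw [l2v_inner_eq]
    exact eq_neg_of_add_eq_zero_left (h.eq_a P χ hχ)
  inner_perp v hv := by
    -- For k = 0 equation (b) is absent, but the space of its test functions is zero.
    rcases Nat.eq_zero_or_pos k with rfl | hk
    · have hv' : v ∈ gradPolyPerp (M.cell P) 0 := hv
      rw [gradPolyPerp_zero_eq_bot (M.isOpen_cell P) (M.bounded_cell P), Submodule.mem_bot] at hv'
      rw [hv', inner_zero_right, inner_zero_right, neg_zero]
    · have h1 := h.eq_b hk P v hv
      refine eq_neg_of_add_eq_zero_left ?_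
      rw [← inner_add_left, l2v_inner_eq, ← h1]
      apply integral_congr_ae
      filter_upwards [Lp.coeFn_add (M.rest P u) (mulK (M.cell P) K
        (projV (M.cell P) k (wgrad (M.cell P) (M.rest P p)))),
        (hK.mono (M.cell_subset P)).coeFn_mulK (M.isOpen_cell P)
          (projV (M.cell P) k (wgrad (M.cell P) (M.rest P p)))] with x h2 h3
      rw [h2, Pi.add_apply, h3]
  isWeakDiv := by
    rw [← h.wdiv_eq P]
    exact isWeakDiv_wdiv (h.mem_vel.2 P)

lemma isMVVM_of_localEqs (hK : IsDiffusion M.domain K) {F : L2 M.domain} {u : L2V M.domain}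
    {p : L2 M.domain} (hu : u ∈ M.vel k) (hp : p ∈ M.nc pr (k + 1))
    (h : ∀ P, LocalEqs K S pr k P (M.rest P F) (M.rest P p) (M.rest P u)) :
    M.IsMVVM K S pr k F u p where
  mem_vel := hu
  mem_nc := hp
  eq_a P χ hχ := by
    rw [← l2v_inner_eq, (h P).inner_wgrad χ hχ, neg_add_cancel]
  eq_b _ P v hv := by
    have h1 := (h P).inner_perp v hv
    rw [eq_neg_iff_add_eq_zero, ← inner_add_left, l2v_inner_eq] at h1
    rw [← h1]
    apply integral_congr_ae
    filter_upwards [Lp.coeFn_add (M.rest P u) (mulK (M.cell P) K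
      (projV (M.cell P) k (wgrad (M.cell P) (M.rest P p)))),
      (hK.mono (M.cell_subset P)).coeFn_mulK (M.isOpen_cell P)
        (projV (M.cell P) k (wgrad (M.cell P) (M.rest P p)))] with x h2 h3
    rw [h2, Pi.add_apply, h3]
  eq_c P φ _ := by rw [(h P).isWeakDiv.wdiv_eq (M.isOpen_cell P)]

end PolyMesh

end

section

/-! ### Local recovery of the velocity -/

namespace PolyMesh

variable {m : ℕ} {T E : Type*} {M : PolyMesh m T E} [Fintype E]
variable {K : Sp (m + 1) → Sp (m + 1) →L[ℝ] Sp (m + 1)}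
  {S : ∀ P, L2 (M.cell P) →ₗ[ℝ] L2 (M.cell P) →ₗ[ℝ] ℝ}
  {pr : ∀ P, L2 (M.cell P) →ₗ[ℝ] L2 (M.cell P)} {k : ℕ} {P : T}
  {F p : L2 (M.cell P)} {u : L2V (M.cell P)}

lemma natCast_succ_sub_one (k : ℕ) : ((k + 1 : ℕ) : ℤ) - 1 = k := by push_cast; ring

lemma natCast_succ_sub_two (k : ℕ) : ((k + 1 : ℕ) : ℤ) - 2 = k - 1 := by push_cast; ring

lemma fcls_injective (M : PolyMesh m T E) (f : E) : Function.Injective (M.fcls f) :=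
  pcls_injective _ _ (M.face f).nonempty_dom

lemma inner_fcls_fcls (f : E) (μ ν : MvPolynomial (Fin m) ℝ) :
    ⟪M.fcls f μ, M.fcls f ν⟫ = ∫ y in (M.face f).dom, pval μ y * pval ν y := by
  rw [l2_inner_eq]
  apply integral_congr_ae
  filter_upwards [M.coeFn_fcls f μ, M.coeFn_fcls f ν] with y h1 h2
  rw [h1, h2]

lemma LocalEqs.hasNormalTrace (h : LocalEqs K S pr k P F p u) {g : E → MvPolynomial (Fin m) ℝ}
    (hg : M.IsNormalTrace k P u g) : M.HasNormalTrace P u (proj (M.cell P) k F) g := by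
  rw [← h.isWeakDiv.wdiv_eq (M.isOpen_cell P)]
  exact hg.2

/-- Green's formula with the divergence Π_k⁰F, in which equation (a) replaces ⟨u, ∇χ⟩ by minus the
local form. -/
lemma LocalEqs.sum_faceMoment (hM : M.StarCells) (h : LocalEqs K S pr k P F p u)
    {g : E → MvPolynomial (Fin m) ℝ} (hg : M.IsNormalTrace k P u g) {χ : L2 (M.cell P)}
    (hχ : χ ∈ M.ncLoc pr (k + 1) P) {t : ∀ f, M.L2F f} (ht : M.IsTraceFamily P χ t) :
    ∑ f ∈ M.faces P, M.faceMoment f (t f) (g f) =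
      (∫ x in M.cell P, proj (M.cell P) k F x * χ x) - M.formLoc K S k P p χ := by
  obtain ⟨c, r, hS⟩ := hM P
  rw [← (h.hasNormalTrace hg).green hS (isWeakGrad_of_mem_ncLoc hχ) ht, h.inner_wgrad χ hχ,
    l2_inner_eq]
  ring

lemma LocalEqs.integral_pgrad (h : LocalEqs K S pr k P F p u)
    {g : E → MvPolynomial (Fin m) ℝ} (hg : M.IsNormalTrace k P u g)
    (q : MvPolynomial (Fin (m + 1)) ℝ) :
    ∫ x in M.cell P, ⟪u x, pvalV (pgrad q) x⟫ =
      ∑ f ∈ M.faces P, (∫ y in (M.face f).dom, pval (g f) y * pval q ((M.face f).chart y))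
        - ∫ x in M.cell P, proj (M.cell P) k F x * pval q x := by
  obtain ⟨φ, hφ, h1, h2, h3⟩ := M.exists_test_poly P q
  have h4 := M.hasNormalTrace_iff.1 (h.hasNormalTrace hg) φ hφ
  rw [h1, h2, inner_pclsV, inner_pcls] at h4
  rw [eq_sub_iff_add_eq, h4]
  refine Finset.sum_congr rfl fun f hf => ?_
  rw [h3 f hf, inner_fcls_fcls]
  simp only [pval_chartPoly]

/-- The tensor is symmetric and the projection self-adjoint, so both can be moved onto v. -/
lemma LocalEqs.inner_perp_projV (hK : IsDiffusion M.domain K) (h : LocalEqs K S pr k P F p u)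
    {v : L2V (M.cell P)} (hv : v ∈ gradPolyPerp (M.cell P) k) :
    ⟪u, v⟫ = - ⟪wgrad (M.cell P) p, projV (M.cell P) k (mulK (M.cell P) K v)⟫ := by
  rw [h.inner_perp v hv, (hK.mono (M.cell_subset P)).inner_mulK_comm (M.isOpen_cell P),
    inner_projV_comm]

/-- Green's formula for the polynomial field Π_k⁰(Kv) against p. Its normal components have degree
at most k and its divergence at most k - 1, so only degrees of freedom of p enter. -/
lemma LocalEqs.inner_perp_traces (hM : M.StarCells) (hK : IsDiffusion M.domain K)
    (h : LocalEqs K S pr k P F p u) (hp : p ∈ M.ncLoc pr (k + 1) P)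
    {v : L2V (M.cell P)} (hv : v ∈ gradPolyPerp (M.cell P) k)
    {w : Fin (m + 1) → MvPolynomial (Fin (m + 1)) ℝ}
    (hw : projV (M.cell P) k (mulK (M.cell P) K v) =ᵐ[volume.restrict (M.cell P)] pvalV w)
    {t : ∀ f, M.L2F f} (ht : M.IsTraceFamily P p t) :
    ⟪u, v⟫ = - ∑ f ∈ M.faces P, (∫ y in (M.face f).dom,
        t f y * ⟪pvalV w ((M.face f).chart y), M.outerNormal P f⟫)
      + ∫ x in M.cell P, p x * pval (pdiv w) x := by
  obtain ⟨c, r, hS⟩ := hM P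
  have h1 : projV (M.cell P) k (mulK (M.cell P) K v) = M.cclsV P w := (eq_pclsV_iff _ _).2 hw
  have h2 := (hasNormalTrace_cclsV hS w).green hS (isWeakGrad_of_mem_ncLoc hp) ht
  rw [h.inner_perp_projV hK hv, h1, real_inner_comm, ← inner_pcls (M.isOpen_cell P)
    (M.bounded_cell P), real_inner_comm (M.ccls P (pdiv w)) p, eq_sub_of_add_eq h2]
  simp only [faceMoment, pval_normalPoly]
  ring

lemma wgrad_mem_gradPoly {q : L2 (M.cell P)} (hq : q ∈ polyL2 (M.cell P) (k + 1)) :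
    wgrad (M.cell P) q ∈ gradPoly (M.cell P) k := by
  obtain ⟨p, hp, rfl⟩ := (mem_polyL2_iff (M.isOpen_cell P) (M.bounded_cell P)).1 hq
  rw [wgrad_pcls]
  exact (mem_gradPoly_iff _ _).2 ⟨p, hp, rfl⟩

lemma mem_gradPoly_iff_wgrad {v : L2V (M.cell P)} : v ∈ gradPoly (M.cell P) k ↔
    ∃ q ∈ polyL2 (M.cell P) (k + 1), wgrad (M.cell P) q = v := by
  constructor
  · intro hv
    obtain ⟨p, hp, rfl⟩ := (mem_gradPoly_iff (M.isOpen_cell P) (M.bounded_cell P)).1 hv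
    exact ⟨M.ccls P p, (mem_polyL2_iff _ _).2 ⟨p, hp, rfl⟩, wgrad_pcls _ _ p⟩
  · rintro ⟨q, hq, rfl⟩
    exact wgrad_mem_gradPoly hq

lemma polyL2_succ_le_ncLoc (hM : M.StarCells) (hpr : M.IsDofProjection (k + 1) P (pr P)) :
    polyL2 (M.cell P) (k + 1) ≤ M.ncLoc pr (k + 1) P := by
  obtain ⟨c, r, hS⟩ := hM P
  have := polyL2_le_ncLoc hS hpr
  push_cast at this
  exact this

/-- A polynomial field of degree k is determined by its pairings with 𝒢_k and 𝒢_k^⊥. The gradients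
in 𝒢_k come from polynomials in P_{k+1}, which are admissible in (a) because they belong to the
nonconforming space. -/
lemma LocalEqs.eq_projV_iff (hM : M.StarCells) (hpr : M.IsDofProjection (k + 1) P (pr P))
    (h : LocalEqs K S pr k P F p u) {w : L2V (M.cell P)} (hw : w ∈ polyL2V (M.cell P) k) :
    w = projV (M.cell P) k u ↔
      (∀ q ∈ polyL2 (M.cell P) (k + 1), ⟪w, wgrad (M.cell P) q⟫ = - M.formLoc K S k P p q) ∧
      ∀ v ∈ gradPolyPerp (M.cell P) k,
        ⟪w, v⟫ = - ⟪mulK (M.cell P) K (projV (M.cell P) k (wgrad (M.cell P) p)), v⟫ := by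
  have hle := gradPoly_le_polyL2V (M.isOpen_cell P) (M.bounded_cell P) k
  have h1 : ∀ q ∈ polyL2 (M.cell P) (k + 1),
      ⟪projV (M.cell P) k u, wgrad (M.cell P) q⟫ = - M.formLoc K S k P p q := fun q hq => by
    rw [inner_projV_comm, projV_of_mem (hle (wgrad_mem_gradPoly hq)),
      h.inner_wgrad q (polyL2_succ_le_ncLoc hM hpr hq)]
  have h2 : ∀ v ∈ gradPolyPerp (M.cell P) k, ⟪projV (M.cell P) k u, v⟫
      = - ⟪mulK (M.cell P) K (projV (M.cell P) k (wgrad (M.cell P) p)), v⟫ := fun v hv => by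
    rw [inner_projV_comm, projV_of_mem hv.1, h.inner_perp v hv]
  refine ⟨fun e => by rw [e]; exact ⟨h1, h2⟩, fun ⟨h3, h4⟩ => ?_⟩
  have h5 : w - projV (M.cell P) k u ∈ gradPolyPerp (M.cell P) k := by
    refine ⟨Submodule.sub_mem _ hw (projV_mem _ _), fun v hv => ?_⟩
    obtain ⟨q, hq, rfl⟩ := mem_gradPoly_iff_wgrad.1 hv
    rw [real_inner_comm, inner_sub_left, h3 q hq, h1 q hq, sub_self]
  have h6 : ⟪w - projV (M.cell P) k u, w - projV (M.cell P) k u⟫ = 0 := by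
    rw [inner_sub_left, h4 _ h5, h2 _ h5, sub_self]
  exact sub_eq_zero.1 (inner_self_eq_zero.1 h6)

/-- The difference of two solutions has zero divergence and is orthogonal to all ∇χ, so by Green's
formula its normal trace vanishes. Its moments against 𝒢_k^⊥ vanish too, and unisolvence applies. -/
lemma LocalEqs.unique (hM : M.StarCells) (hpr : M.IsDofProjection (k + 1) P (pr P))
    (h : LocalEqs K S pr k P F p u) {u' : L2V (M.cell P)} (h' : LocalEqs K S pr k P F p u') :
    u = u' := by
  obtain ⟨c, r, hS⟩ := hM P
  have hv : u - u' ∈ M.velLoc k P := Submodule.sub_mem _ h.mem_velLoc h'.mem_velLoc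
  have hd : IsWeakDiv (M.cell P) (u - u') 0 := by
    have e1 : u - u' = u + (-1 : ℝ) • u' := by module
    have e2 : (0 : L2 (M.cell P)) = proj (M.cell P) k F + (-1 : ℝ) • proj (M.cell P) k F := by
      module
    rw [e1, e2]
    exact h.isWeakDiv.add (h'.isWeakDiv.smul (-1))
  obtain ⟨g, hg, hn⟩ := exists_isNormalTrace_of_mem_velLoc hv
  rw [hd.wdiv_eq (M.isOpen_cell P)] at hn
  have hg0 : ∀ f ∈ M.faces P, g f = 0 := by
    -- The test function has the moments of the normal trace g itself, so Green's formula gives ∑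
    -- ‖g_f‖² = 0; its interior moments are irrelevant.
    obtain ⟨χ, hχ, t, ht, h1, -⟩ := exists_mem_ncLoc hS hpr
      (fun f => M.momentF f (M.fcls f (g f))) 0
    have h2 := hn.green hS (isWeakGrad_of_mem_ncLoc hχ) ht
    rw [inner_sub_left, h.inner_wgrad χ hχ, h'.inner_wgrad χ hχ, sub_self, inner_zero_left,
      add_zero] at h2
    have h3 : ∀ f ∈ M.faces P, M.faceMoment f (t f) (g f)
        = ⟪M.fcls f (g f), M.fcls f (g f)⟫ := fun f hf => by
      rw [h1 f hf (g f) (by rw [natCast_succ_sub_one]; exact hg f), momentF_apply,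
        faceMoment_eq_inner]
    rw [Finset.sum_congr rfl h3, eq_comm,
      Finset.sum_eq_zero_iff_of_nonneg fun f _ => real_inner_self_nonneg] at h2
    intro f hf
    exact M.fcls_injective f ((inner_self_eq_zero.1 (h2 f hf)).trans (map_zero _).symm)
  refine sub_eq_zero.1 (eq_zero_of_mem_velLoc hS hv hn hg0 fun w hw => ?_)
  rw [inner_sub_left, h.inner_perp w hw, h'.inner_perp w hw, sub_self]

/-- A test function whose only nonzero degrees of freedom are the moments of `μ` on one face. -/
lemma exists_face_test (hM : M.StarCells) (hpr : M.IsDofProjection (k + 1) P (pr P)) (f : E)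
    (μ : MvPolynomial (Fin m) ℝ) : ∃ χ ∈ M.ncLoc pr (k + 1) P, ∃ t, M.IsTraceFamily P χ t ∧
      (f ∈ M.faces P → ∀ ν ∈ polyDeg m k,
        M.faceMoment f (t f) ν = ∫ y in (M.face f).dom, pval μ y * pval ν y) ∧
      (∀ e ∈ M.faces P, e ≠ f → ∀ ν ∈ polyDeg m k, M.faceMoment e (t e) ν = 0) ∧
      ∀ q ∈ polyDeg (m + 1) (k - 1), ∫ x in M.cell P, χ x * pval q x = 0 := by
  classical
  obtain ⟨c, r, hS⟩ := hM P
  obtain ⟨χ, hχ, t, ht, h1, h2⟩ := exists_mem_ncLoc hS hpr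
    (Pi.single f (M.momentF f (M.fcls f μ))) 0
  rw [natCast_succ_sub_one] at h1
  rw [natCast_succ_sub_two] at h2
  refine ⟨χ, hχ, t, ht, fun hf ν hν => ?_, fun e he hne ν hν => ?_, fun q hq => ?_⟩
  · rw [h1 f hf ν hν, Pi.single_eq_same, momentF_apply, faceMoment_eq_inner, real_inner_comm,
      inner_fcls_fcls]
  · rw [h1 e he ν hν, Pi.single_eq_of_ne hne, LinearMap.zero_apply]
  · rw [← momentC_apply, h2 q hq, LinearMap.zero_apply]

lemma LocalEqs.integral_face (hM : M.StarCells) (h : LocalEqs K S pr k P F p u)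
    {g : E → MvPolynomial (Fin m) ℝ} (hg : M.IsNormalTrace k P u g) {f : E} (hf : f ∈ M.faces P)
    {μ : MvPolynomial (Fin m) ℝ} {χ : L2 (M.cell P)} (hχ : χ ∈ M.ncLoc pr (k + 1) P)
    {t : ∀ f, M.L2F f} (ht : M.IsTraceFamily P χ t)
    (h1 : ∀ ν ∈ polyDeg m k, M.faceMoment f (t f) ν = ∫ y in (M.face f).dom, pval μ y * pval ν y)
    (h2 : ∀ e ∈ M.faces P, e ≠ f → ∀ ν ∈ polyDeg m k, M.faceMoment e (t e) ν = 0) :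
    ∫ y in (M.face f).dom, pval (g f) y * pval μ y =
      (∫ x in M.cell P, proj (M.cell P) k F x * χ x) - M.formLoc K S k P p χ := by
  rw [← h.sum_faceMoment hM hg hχ ht, Finset.sum_eq_single f (fun e he hne => h2 e he hne _ (hg.1 e))
    (fun hf' => absurd hf hf'), h1 _ (hg.1 f)]
  simp only [mul_comm]

end PolyMesh

end

section

/-! ### Equivalence of the two schemes -/

namespace PolyMesh

variable {m : ℕ} {T E : Type*} {M : PolyMesh m T E} [Fintype E] [Fintype T]
variable {K : Sp (m + 1) → Sp (m + 1) →L[ℝ] Sp (m + 1)}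
  {S : ∀ P, L2 (M.cell P) →ₗ[ℝ] L2 (M.cell P) →ₗ[ℝ] ℝ}
  {pr : ∀ P, L2 (M.cell P) →ₗ[ℝ] L2 (M.cell P)} {k : ℕ}

/-- The local flux identities are summed over the elements. The face moments of χ are single-valued,
the normal traces are polynomials of the matching degree and cancel on interior faces, and on
boundary faces the moments of χ vanish. -/
theorem IsMVVM.isNCVEM (hM : M.StarCells) (hK : IsDiffusion M.domain K) {F : L2 M.domain}
    {u : L2V M.domain} {p : L2 M.domain} (h : M.IsMVVM K S pr k F u p) :
    M.IsNCVEM K S pr k F p := by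
  refine ⟨h.mem_nc, fun χ hχ => ?_⟩
  choose g hg using fun P => exists_isNormalTrace_of_mem_velLoc (h.mem_vel.2 P)
  obtain ⟨a, b, ha, hab⟩ := exists_hasNcData_of_mem_nc hM hχ
  have hg' : ∀ P f, g P f ∈ polyDeg m (((k + 1 : ℕ) : ℤ) - 1) := fun P f => by
    rw [natCast_succ_sub_one]; exact (hg P).1 f
  have h1 : ∀ P, ∑ f ∈ M.faces P, a f ⟨g P f, hg' P f⟩ =
      (∫ x in M.cell P, proj (M.cell P) k (M.rest P F) x * M.rest P χ x)
        - M.formLoc K S k P (M.rest P p) (M.rest P χ) := fun P => by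
    obtain ⟨t, ht, h2, -⟩ := hab P
    rw [← (h.localEqs hK P).sum_faceMoment hM (hg P) (hχ.1 P) ht]
    exact Finset.sum_congr rfl fun f hf => (h2 f hf ⟨g P f, hg' P f⟩).symm
  have h2 : ∑ P, ∑ f ∈ M.faces P, a f ⟨g P f, hg' P f⟩ = 0 := by
    refine sum_faces_eq_zero hM (a := fun P f => a f ⟨g P f, hg' P f⟩)
      (fun f _ P Q hP hQ hne => ?_) fun f hf P _ => ?_
    · rw [← map_add]
      have h3 := jump_of_mem_vel hM h.mem_vel (fun P => (hg P).2) hP hQ hne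
      have h4 : (⟨g P f, hg' P f⟩ + ⟨g Q f, hg' Q f⟩ : polyDeg m (((k + 1 : ℕ) : ℤ) - 1)) = 0 :=
        Subtype.ext h3
      rw [h4, map_zero]
    · rw [ha f hf]; rfl
  rw [Finset.sum_congr rfl fun P _ => h1 P, Finset.sum_sub_distrib, sub_eq_zero] at h2
  exact h2.symm

/-- The residual of the local form, as a functional on the local nonconforming space. -/
def residual (pr : ∀ P, L2 (M.cell P) →ₗ[ℝ] L2 (M.cell P))
    (S : ∀ P, L2 (M.cell P) →ₗ[ℝ] L2 (M.cell P) →ₗ[ℝ] ℝ) (hK : IsDiffusion M.domain K) (k : ℕ)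
    (P : T) (s p : L2 (M.cell P)) : M.ncLoc pr (k + 1) P →ₗ[ℝ] ℝ where
  toFun q := ⟪s, (q : L2 (M.cell P))⟫ - M.formLoc K S k P p q
  map_add' q q' := by
    rw [Submodule.coe_add, inner_add_right, formLoc_add hK k P p (isWeakGrad_of_mem_ncLoc q.2)
      (isWeakGrad_of_mem_ncLoc q'.2)]
    ring
  map_smul' c q := by
    rw [Submodule.coe_smul, inner_smul_right, formLoc_smul hK k P p c
      (isWeakGrad_of_mem_ncLoc q.2), RingHom.id_apply, smul_eq_mul]
    ring

lemma residual_apply (hK : IsDiffusion M.domain K) (P : T) (s p : L2 (M.cell P))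
    (q : M.ncLoc pr (k + 1) P) : residual pr S hK k P s p q
      = ⟪s, (q : L2 (M.cell P))⟫ - M.formLoc K S k P p q := rfl

/-- For each face, the functional restricted to data on that face lies in the bidual of V, so by
reflexivity it is the evaluation at an element of V. -/
lemma exists_dual_repr {V W : Type*} [AddCommGroup V] [Module ℝ V] [Module.Finite ℝ V]
    [AddCommGroup W] [Module ℝ W] (N : Finset E) (L : (E → Module.Dual ℝ V) × W →ₗ[ℝ] ℝ)
    (hN : ∀ a, (∀ f ∈ N, a f = 0) → L (a, 0) = 0) (hb : ∀ b, L (0, b) = 0) :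
    ∃ γ : E → V, ∀ a b, L (a, b) = ∑ f ∈ N, a f (γ f) := by
  classical
  let l : E → Module.Dual ℝ (Module.Dual ℝ V) := fun f =>
    L ∘ₗ LinearMap.inl ℝ _ W ∘ₗ LinearMap.single ℝ (fun _ : E => Module.Dual ℝ V) f
  have hγ : ∀ f α, α ((Module.evalEquiv ℝ V).symm (l f)) = L (Pi.single f α, 0) := fun f α =>
    Module.apply_evalEquiv_symm_apply _ _ α (l f)
  refine ⟨fun f => (Module.evalEquiv ℝ V).symm (l f), fun a b => ?_⟩
  have e1 : (a, b) = (0, b) + ∑ f, LinearMap.inl ℝ _ W (Pi.single f (a f)) := by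
    rw [← map_sum, Finset.univ_sum_single, LinearMap.inl_apply, Prod.mk_add_mk, zero_add, add_zero]
  rw [e1, map_add, hb, zero_add, map_sum, ← Finset.sum_subset (Finset.subset_univ N)]
  · exact Finset.sum_congr rfl fun f _ => (hγ f (a f)).symm
  · intro f _ hf
    refine hN _ fun e he => ?_
    exact Pi.single_eq_of_ne (fun h : e = f => hf (by rw [← h]; exact he)) _

lemma HasNcData.ext {r : ℕ} {P : T} (hM : M.StarCells) (hpr : M.IsDofProjection r P (pr P))
    {a : E → Module.Dual ℝ (polyDeg m ((r : ℤ) - 1))}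
    {b : Module.Dual ℝ (polyDeg (m + 1) ((r : ℤ) - 2))} {q q' : L2 (M.cell P)}
    (hq : q ∈ M.ncLoc pr r P) (hq' : q' ∈ M.ncLoc pr r P) (h : HasNcData P a b q)
    (h' : HasNcData P a b q') : q = q' := by
  have h1 := h.add (h'.smul (-1))
  have e1 : a + (-1 : ℝ) • a = 0 := by module
  have e2 : b + (-1 : ℝ) • b = 0 := by module
  have e3 : q + (-1 : ℝ) • q' = q - q' := by module
  rw [e1, e2, e3] at h1
  exact sub_eq_zero.1 (h1.eq_zero hM hpr (Submodule.sub_mem _ hq hq'))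

section flux

variable {r : ℕ} {Λ : ∀ P, M.ncLoc pr r P →ₗ[ℝ] ℝ}

/-- A local function without face moments extends by zero to a member of the global space, for which
the sum reduces to a single term. -/
lemma apply_eq_zero_of_sum_eq_zero (hM : M.StarCells)
    (hpr : ∀ P, M.IsDofProjection r P (pr P))
    (hΛ : ∀ χ (hχ : χ ∈ M.nc pr r), ∑ P, Λ P ⟨M.rest P χ, hχ.1 P⟩ = 0) {P : T}
    {b : Module.Dual ℝ (polyDeg (m + 1) ((r : ℤ) - 2))} {q : M.ncLoc pr r P}
    (hq : HasNcData P 0 b (q : L2 (M.cell P))) : Λ P q = 0 := by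
  classical
  obtain ⟨χ, hχ, h⟩ := exists_mem_nc_hasNcData hM hpr 0 (Pi.single P b) fun _ _ => rfl
  have h1 := hΛ χ hχ
  rw [Finset.sum_eq_single P] at h1
  · have e : q = ⟨M.rest P χ, hχ.1 P⟩ := by
      have h2 := h P
      rw [Pi.single_eq_same] at h2
      exact Subtype.ext (hq.ext hM (hpr P) q.2 (hχ.1 P) h2)
    rw [e, h1]
  · intro Q _ hQ
    have h2 := h Q
    rw [Pi.single_eq_of_ne hQ] at h2
    have e : (⟨M.rest Q χ, hχ.1 Q⟩ : M.ncLoc pr r Q) = 0 :=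
      Subtype.ext (h2.eq_zero hM (hpr Q) (hχ.1 Q))
    rw [e]
    exact (Λ Q).map_zero
  · simp

lemma exists_face_repr (hM : M.StarCells) {P : T} (hpr : M.IsDofProjection r P (pr P))
    (L : M.ncLoc pr r P →ₗ[ℝ] ℝ)
    (hL : ∀ b (q : M.ncLoc pr r P), HasNcData (r := r) P 0 b (q : L2 (M.cell P)) → L q = 0) :
    ∃ γ : E → polyDeg m ((r : ℤ) - 1), ∀ a b (q : M.ncLoc pr r P),
      HasNcData (r := r) P a b (q : L2 (M.cell P)) → L q = ∑ f ∈ M.faces P, a f (γ f) := by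
  obtain ⟨Z, hZ⟩ := exists_ncLift M r pr hM hpr
  obtain ⟨γ, hγ⟩ := exists_dual_repr (M.faces P) (L ∘ₗ Z)
    (fun a ha => by
      have h1 := (hZ (a, 0) (Z (a, 0))).2 rfl
      exact hL 0 _ (h1.congr ha))
    (fun b => hL b _ ((hZ (0, b) (Z (0, b))).2 rfl))
  refine ⟨γ, fun a b q h => ?_⟩
  rw [← hγ a b, (hZ (a, b) q).1 h]
  rfl

/-- Functionals on the local nonconforming spaces whose sum vanishes on the global one are given
on each element by polynomials on the faces, which cancel on interior faces. -/
lemma exists_flux (hM : M.StarCells) (hpr : ∀ P, M.IsDofProjection r P (pr P))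
    (hΛ : ∀ χ (hχ : χ ∈ M.nc pr r), ∑ P, Λ P ⟨M.rest P χ, hχ.1 P⟩ = 0) :
    ∃ γ : T → E → polyDeg m ((r : ℤ) - 1),
      (∀ f P Q, f ∈ M.faces P → f ∈ M.faces Q → P ≠ Q → γ P f + γ Q f = 0) ∧
      ∀ P (q : M.ncLoc pr r P) t, M.IsTraceFamily P (q : L2 (M.cell P)) t →
        Λ P q = ∑ f ∈ M.faces P, M.faceMoment f (t f) (γ P f) := by
  classical
  choose γ hγ using fun P => exists_face_repr hM (hpr P) (Λ P)
    fun _ _ h => apply_eq_zero_of_sum_eq_zero hM hpr hΛ h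
  refine ⟨γ, fun f P Q hP hQ hne => ?_, fun P q t ht => ?_⟩
  · refine (Module.forall_dual_apply_eq_zero_iff ℝ _).1 fun α => ?_
    have hf := mem_intFaces_of_ne hM hP hQ hne
    -- For the global function whose only data are α on this face, the sum reduces to α(γ_P) +
    -- α(γ_Q). As α is arbitrary, γ_P + γ_Q = 0.
    obtain ⟨χ, hχ, h⟩ := exists_mem_nc_hasNcData hM hpr (Pi.single f α) 0 fun e he =>
      Pi.single_eq_of_ne (fun h : e = f => not_mem_bdFaces_of_mem_intFaces hf (h ▸ he)) _
    have h1 := hΛ χ hχ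
    rw [Finset.sum_congr rfl fun R _ => hγ R _ _ _ (h R), sum_faces_eq_pair hM hP hQ hne
      (a := fun R e =>
        (Pi.single f α : E → Module.Dual ℝ (polyDeg m ((r : ℤ) - 1))) e (γ R e))] at h1
    · rw [map_add, ← h1, Pi.single_eq_same]
    · intro R e he
      rw [Pi.single_eq_of_ne he, LinearMap.zero_apply]
  · rw [hγ P _ _ q (hasNcData_of_isTraceFamily ht)]
    exact Finset.sum_congr rfl fun f _ => momentF_apply f (t f) (γ P f)

end flux

/-- The local residuals of the scheme sum to zero on the global space, so `exists_flux` turns them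
into fluxes that cancel across faces. These serve as normal traces of the velocity, together with
the prescribed divergence and moments. -/
theorem IsNCVEM.exists_isMVVM (hM : M.StarCells) (hK : IsDiffusion M.domain K)
    (hpr : ∀ P, M.IsDofProjection (k + 1) P (pr P)) {F p : L2 M.domain}
    (h : M.IsNCVEM K S pr k F p) : ∃ u, M.IsMVVM K S pr k F u p := by
  obtain ⟨γ, hj, hγ⟩ := exists_flux hM hpr (Λ := fun P => residual pr S hK k P
    (proj (M.cell P) k (M.rest P F)) (M.rest P p)) fun χ hχ => by
      simp only [residual_apply, l2_inner_eq]
      rw [Finset.sum_sub_distrib, h.eq χ hχ, sub_self]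
  have hu : ∀ P, ∃ u ∈ M.velLoc k P,
      M.HasNormalTrace P u (proj (M.cell P) k (M.rest P F)) (fun f => (γ P f).1) ∧
      ∀ v : gradPolyPerp (M.cell P) k, ⟪u, (v : L2V (M.cell P))⟫ =
        - ⟪mulK (M.cell P) K (projV (M.cell P) k (wgrad (M.cell P) (M.rest P p))),
          (v : L2V (M.cell P))⟫ := fun P => by
    obtain ⟨c, r, hS⟩ := hM P
    have hc : M.ccls P 1 ∈ polyL2 (M.cell P) 0 := by
      refine (mem_polyL2_iff (M.isOpen_cell P) (M.bounded_cell P)).2 ⟨1, ?_, rfl⟩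
      exact mem_polyDeg_zero.2 ⟨1, rfl⟩
    have hc' := polyL2_succ_le_ncLoc hM (hpr P) (polyL2_mono P (k := (k : ℤ) + 1) (by positivity) hc)
    refine exists_mem_velLoc hS (proj_mem _ _) (fun f => ?_) ?_
      (-(innerₛₗ ℝ (mulK (M.cell P) K (projV (M.cell P) k (wgrad (M.cell P) (M.rest P p)))) ∘ₗ
        (gradPolyPerp (M.cell P) k).subtype))
    · exact (polyDeg_mono (natCast_succ_sub_one k).le) (γ P f).2
    -- The residual at the test function 1 is the integral of the projected source, since the form
    -- vanishes on constants. This is the compatibility condition for the fluxes.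
    · have h1 := hγ P ⟨_, hc'⟩ _ fun f hf => M.isTrace_ccls hf 1
      rw [residual_apply, formLoc_const hK k P _ hc, sub_zero] at h1
      rw [h1]
      refine Finset.sum_congr rfl fun f _ => ?_
      rw [faceMoment_eq_inner, map_one (M.chartPoly f)]
  choose u hv hn hθ using hu
  obtain ⟨w, hw⟩ := M.exists_rest_eq u
  refine ⟨w, isMVVM_of_localEqs hK (mem_vel_of_jump hM (fun P => hw P ▸ hv P)
    (fun P => hw P ▸ hn P) fun f P Q hP hQ hne => ?_) h.mem_nc fun P => ?_⟩
  · exact congrArg Subtype.val (hj f P Q hP hQ hne)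
  · rw [hw P]
    refine ⟨hv P, fun χ hχ => ?_, fun v hv => hθ P ⟨v, hv⟩, (hn P).isWeakDiv⟩
    obtain ⟨c, r, hS⟩ := hM P
    obtain ⟨t, ht⟩ := exists_traces_of_mem_ncLoc hM hχ
    -- Green's formula identifies the residual at χ with ⟨u, ∇χ⟩ plus the source term; the source
    -- terms cancel, which leaves equation (a).
    have h1 := (hn P).green hS (isWeakGrad_of_mem_ncLoc hχ) ht
    have h2 := hγ P ⟨χ, hχ⟩ t ht
    rw [← h1, residual_apply] at h2
    linarith

theorem IsMVVM.unique (hM : M.StarCells) (hK : IsDiffusion M.domain K)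
    (hpr : ∀ P, M.IsDofProjection (k + 1) P (pr P)) {F p : L2 M.domain} {u u' : L2V M.domain}
    (h : M.IsMVVM K S pr k F u p) (h' : M.IsMVVM K S pr k F u' p) : u = u' :=
  M.eq_of_rest_eq fun P => (h.localEqs hK P).unique hM (hpr P) (h'.localEqs hK P)

/-! ### The scheme is square -/

lemma numUnknowns_eq (hM : M.StarCells) (hpr : ∀ P, M.IsDofProjection (k + 1) P (pr P)) :
    M.numUnknowns pr k =
        polyDim k m * Fintype.card E
        + (polyDim k (m + 1) - 1 + (m + 1) * polyDim k (m + 1) - polyDim (k + 1) (m + 1) + 1)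
          * Fintype.card T
        + polyDim k m * M.intFaces.card + polyDim (k - 1) (m + 1) * Fintype.card T := by
  have := finiteDimensional_vel hM k
  have := finiteDimensional_nc hM hpr
  have h1 := finrank_vel hM k
  have h2 := finrank_nc hM hpr
  rw [natCast_succ_sub_one, natCast_succ_sub_two] at h2
  have h3 : ((∑ P, Module.finrank ℝ (gradPolyPerp (M.cell P) k) : ℕ) : ℤ)
      = Fintype.card T * ((m + 1) * polyDim k (m + 1) - polyDim (k + 1) (m + 1) + 1) := by
    rw [Nat.cast_sum, Finset.sum_congr rfl fun P _ => finrank_gradPolyPerp (M.isOpen_cell P)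
      (M.bounded_cell P) (M.nonempty_cell P) k, Finset.sum_const, Finset.card_univ, nsmul_eq_mul]
    push_cast
    ring
  rw [numUnknowns, Module.finrank_prod]
  zify at h1 h2
  push_cast at h3 ⊢
  rw [h3] at h1
  linear_combination h1 + h2

lemma numEquations_eq (hM : M.StarCells) (hpr : ∀ P, M.IsDofProjection (k + 1) P (pr P)) :
    M.numEquations pr k =
        ∑ P, (polyDim k m * (M.faces P).card + polyDim (k - 1) (m + 1) - 1
          + (m + 1) * polyDim k (m + 1) - polyDim (k + 1) (m + 1) + 1
          + (polyDim k (m + 1) : ℤ)) := by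
  refine Finset.sum_congr rfl fun P _ => ?_
  obtain ⟨c, r, hS⟩ := hM P
  have h2 := finrank_ncLoc hS (hpr P)
  rw [natCast_succ_sub_one, natCast_succ_sub_two] at h2
  rw [h2, finrank_gradPolyPerp (M.isOpen_cell P) (M.bounded_cell P) (M.nonempty_cell P),
    finrank_polyL2 (M.isOpen_cell P) (M.bounded_cell P) (M.nonempty_cell P)]
  push_cast
  ring

/-- The interior terms agree element by element. What remains is that the number of faces plus the
number of interior faces equals the sum of the n_P, which is Euler's formula. -/
lemma numUnknowns_eq_numEquations (hM : M.StarCells)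
    (hpr : ∀ P, M.IsDofProjection (k + 1) P (pr P)) :
    M.numUnknowns pr k = M.numEquations pr k := by
  have h1 := sum_card_faces hM
  have h2 := card_intFaces_add_card_bdFaces hM
  rw [numUnknowns_eq hM hpr, numEquations_eq hM hpr]
  have h3 : ∑ P, (polyDim k m * (M.faces P).card + polyDim (k - 1) (m + 1) - 1
          + (m + 1) * polyDim k (m + 1) - polyDim (k + 1) (m + 1) + 1
          + (polyDim k (m + 1) : ℤ)) = polyDim k m * ((∑ P, (M.faces P).card : ℕ) : ℤ)
        + Fintype.card T * (polyDim (k - 1) (m + 1) - 1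
          + (m + 1) * polyDim k (m + 1) - polyDim (k + 1) (m + 1) + 1
          + (polyDim k (m + 1) : ℤ)) := by
    rw [Nat.cast_sum, Finset.mul_sum, ← nsmul_eq_mul (Fintype.card T), ← Finset.card_univ,
      ← Finset.sum_const, ← Finset.sum_add_distrib]
    exact Finset.sum_congr rfl fun P _ => by ring
  rw [h3, h1, ← h2]
  push_cast
  ring

end PolyMesh

end

end MVVM

end

/-! ### The theorem -/

theorem mainTheorem2 {m : ℕ} (hm : m = 1 ∨ m = 2) {T E : Type*} [Fintype T] [Fintype E]
    (M : PolyMesh m T E) {ρ : ℝ} (hρ : 0 < ρ) (hM : M.Regular ρ) (k : ℕ)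
    (K : Sp (m + 1) → Sp (m + 1) →L[ℝ] Sp (m + 1)) (hK : PolyMesh.IsDiffusion M.domain K)
    (S : ∀ P, L2 (M.cell P) →ₗ[ℝ] L2 (M.cell P) →ₗ[ℝ] ℝ)
    (pr : ∀ P, L2 (M.cell P) →ₗ[ℝ] L2 (M.cell P))
    (hpr : ∀ P, M.IsDofProjection (k + 1) P (pr P)) :
    -- Euler's formula
    (∑ P, (M.faces P).card = 2 * M.intFaces.card + M.bdFaces.card ∧
      ∀ n, (∀ P, (M.faces P).card = n) →
        n * Fintype.card T = 2 * M.intFaces.card + M.bdFaces.card) ∧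
    -- the scheme is square
    (FiniteDimensional ℝ (M.vel k) ∧ FiniteDimensional ℝ (M.nc pr (k + 1)) ∧
      (∀ P, FiniteDimensional ℝ (M.ncLoc pr (k + 1) P)) ∧
      M.numUnknowns pr k =
        polyDim k m * Fintype.card E
        + (polyDim k (m + 1) - 1 + (m + 1) * polyDim k (m + 1) - polyDim (k + 1) (m + 1) + 1)
          * Fintype.card T
        + polyDim k m * M.intFaces.card + polyDim (k - 1) (m + 1) * Fintype.card T ∧
      M.numEquations pr k =
        ∑ P, (polyDim k m * (M.faces P).card + polyDim (k - 1) (m + 1) - 1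
          + (m + 1) * polyDim k (m + 1) - polyDim (k + 1) (m + 1) + 1
          + (polyDim k (m + 1) : ℤ)) ∧
      M.numUnknowns pr k = M.numEquations pr k ∧
      -- the constant test functions, which are not counted, give a trivial equation
      ∀ P, ∀ c ∈ polyL2 (M.cell P) 0, c ∈ M.ncLoc pr (k + 1) P ∧
        ∀ (u : L2V (M.cell P)) (p : L2 (M.cell P)),
          (∫ x in M.cell P, ⟪u x, wgrad (M.cell P) c x⟫) + M.formLoc K S k P p c = 0) ∧
    -- elementwise divergence, and the scalar part solves the nonconforming method
    (∀ F u p, M.IsMVVM K S pr k F u p →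
      (∀ P, IsWeakDiv (M.cell P) (M.rest P u) (proj (M.cell P) k (M.rest P F))) ∧
      M.IsNCVEM K S pr k F p) ∧
    -- conversely, every solution of the nonconforming method arises in this way, from a unique `u`
    (∀ F p, M.IsNCVEM K S pr k F p → ∃! u, M.IsMVVM K S pr k F u p) ∧
    -- local recovery of the degrees of freedom and of the projection of `u`
    (∀ P, polyL2 (M.cell P) (k + 1) ≤ M.ncLoc pr (k + 1) P) ∧
    (∀ F u p, M.IsMVVM K S pr k F u p → ∀ P,
      (∃ g, M.IsNormalTrace k P (M.rest P u) g) ∧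
      (∀ g, M.IsNormalTrace k P (M.rest P u) g →
        -- the normal trace tested with the local nonconforming space
        (∀ χ ∈ M.ncLoc pr (k + 1) P, (∃ t, M.IsTraceFamily P χ t) ∧
          ∀ t, M.IsTraceFamily P χ t →
            ∑ f ∈ M.faces P, M.faceMoment f (t f) (g f) =
              (∫ x in M.cell P, proj (M.cell P) k (M.rest P F) x * χ x)
                - M.formLoc K S k P (M.rest P p) χ) ∧
        -- interior moments against gradients of polynomials of degree at most `k`
        (∀ q ∈ polyDeg (m + 1) k,
          ∫ x in M.cell P, ⟪M.rest P u x, pvalV (pgrad q) x⟫ =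
            ∑ f ∈ M.faces P, (∫ y in (M.face f).dom, pval (g f) y * pval q ((M.face f).chart y))
              - ∫ x in M.cell P, proj (M.cell P) k (M.rest P F) x * pval q x)) ∧
      -- interior moments against `𝒢_k(P)^⊥`
      (∀ v ∈ gradPolyPerp (M.cell P) k,
        ∫ x in M.cell P, ⟪M.rest P u x, v x⟫ =
          - ∫ x in M.cell P, ⟪K x (projV (M.cell P) k (wgrad (M.cell P) (M.rest P p)) x), v x⟫ ∧
        ∫ x in M.cell P, ⟪M.rest P u x, v x⟫ =
          - ∫ x in M.cell P, ⟪wgrad (M.cell P) (M.rest P p) x,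
              projV (M.cell P) k (PolyMesh.mulK (M.cell P) K v) x⟫ ∧
        ∀ w : Fin (m + 1) → MvPolynomial (Fin (m + 1)) ℝ,
          projV (M.cell P) k (PolyMesh.mulK (M.cell P) K v)
            =ᵐ[volume.restrict (M.cell P)] pvalV w →
          ∀ t, M.IsTraceFamily P (M.rest P p) t →
            ∫ x in M.cell P, ⟪M.rest P u x, v x⟫ =
              - ∑ f ∈ M.faces P, (∫ y in (M.face f).dom,
                  t f y * ⟪pvalV w ((M.face f).chart y), M.outerNormal P f⟫)
                + ∫ x in M.cell P, M.rest P p x * pval (pdiv w) x) ∧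
      -- the projection of `u` onto `(P_k(P))^d`
      (∀ w ∈ polyL2V (M.cell P) k, w = projV (M.cell P) k (M.rest P u) ↔
        (∀ q ∈ polyL2 (M.cell P) (k + 1),
          ∫ x in M.cell P, ⟪w x, wgrad (M.cell P) q x⟫ =
            - M.formLoc K S k P (M.rest P p) q) ∧
        (∀ v ∈ gradPolyPerp (M.cell P) k,
          ∫ x in M.cell P, ⟪w x, v x⟫ =
            - ∫ x in M.cell P,
                ⟪K x (projV (M.cell P) k (wgrad (M.cell P) (M.rest P p)) x), v x⟫))) ∧
    -- each face moment of `u · n` is obtained from one local test function, fixed beforehand by its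
    -- degrees of freedom
    (∀ P, ∀ f ∈ M.faces P, ∀ μ ∈ polyDeg m k, ∃ χ ∈ M.ncLoc pr (k + 1) P,
      (∃ t, M.IsTraceFamily P χ t ∧ ∀ ν ∈ polyDeg m k,
        M.faceMoment f (t f) ν = ∫ y in (M.face f).dom, pval μ y * pval ν y ∧
        ∀ e ∈ M.faces P, e ≠ f → M.faceMoment e (t e) ν = 0) ∧
      (∀ q ∈ polyDeg (m + 1) (k - 1), ∫ x in M.cell P, χ x * pval q x = 0) ∧
      ∀ F u p, M.IsMVVM K S pr k F u p → ∀ g, M.IsNormalTrace k P (M.rest P u) g →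
        ∫ y in (M.face f).dom, pval (g f) y * pval μ y =
          (∫ x in M.cell P, proj (M.cell P) k (M.rest P F) x * χ x)
            - M.formLoc K S k P (M.rest P p) χ) ∧
    -- on each element, `u` is a function of the restrictions of the source and of `p`
    (∀ P, ∃ R : L2 (M.cell P) → L2 (M.cell P) → L2V (M.cell P),
      ∀ F u p, M.IsMVVM K S pr k F u p → M.rest P u = R (M.rest P F) (M.rest P p)) := by
  have hS := hM.starCells hρ
  have hE := PolyMesh.sum_card_faces hS
  refine ⟨⟨hE, fun n hn => ?_⟩, ⟨PolyMesh.finiteDimensional_vel hS k,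
    PolyMesh.finiteDimensional_nc hS hpr, fun P => ?_, PolyMesh.numUnknowns_eq hS hpr,
    PolyMesh.numEquations_eq hS hpr, PolyMesh.numUnknowns_eq_numEquations hS hpr,
    fun P c hc => ⟨?_, fun u p => ?_⟩⟩, fun F u p h => ⟨fun P => (h.localEqs hK P).isWeakDiv,
    h.isNCVEM hS hK⟩, fun F p h => ?_, fun P => PolyMesh.polyL2_succ_le_ncLoc hS (hpr P),
    fun F u p h P => ?_, fun P f hf μ hμ => ?_, fun P => ?_⟩
  · rw [← hE, Finset.sum_congr rfl fun P _ => hn P, Finset.sum_const, Finset.card_univ, smul_eq_mul,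
      mul_comm]
  · obtain ⟨c, r, hP⟩ := hS P
    exact PolyMesh.finiteDimensional_ncLoc hP (hpr P)
  · exact PolyMesh.polyL2_succ_le_ncLoc hS (hpr P) (PolyMesh.polyL2_mono P (by positivity) hc)
  · rw [← l2v_inner_eq, PolyMesh.wgrad_of_mem_polyL2_zero hc, inner_zero_right,
      PolyMesh.formLoc_const hK k P p hc, add_zero]
  · obtain ⟨u, hu⟩ := h.exists_isMVVM hS hK hpr
    exact ⟨u, hu, fun u' hu' => hu'.unique hS hK hpr hu⟩
  · have hl := h.localEqs hK P
    have hKP := hK.mono (M.cell_subset P)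
    refine ⟨PolyMesh.exists_isNormalTrace_of_mem_velLoc hl.mem_velLoc, fun g hg =>
      ⟨fun χ hχ => ⟨PolyMesh.exists_traces_of_mem_ncLoc hS hχ, fun t ht =>
        hl.sum_faceMoment hS hg hχ ht⟩, fun q _ => hl.integral_pgrad hg q⟩,
      fun v hv => ?_, fun w hw => ?_⟩
    · simp only [← l2v_inner_eq, hKP.integral_inner_eq (M.isOpen_cell P)]
      exact ⟨hl.inner_perp v hv, hl.inner_perp_projV hK hv, fun w hw t ht =>
        hl.inner_perp_traces hS hK (h.mem_nc.1 P) hv hw ht⟩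
    · simp only [← l2v_inner_eq, hKP.integral_inner_eq (M.isOpen_cell P)]
      exact hl.eq_projV_iff hS (hpr P) hw
  · obtain ⟨χ, hχ, t, ht, h1, h2, h3⟩ := PolyMesh.exists_face_test hS (hpr P) f μ
    exact ⟨χ, hχ, ⟨t, ht, fun ν hν => ⟨h1 hf ν hν, fun e he hne => h2 e he hne ν hν⟩⟩, h3,
      fun F u p h g hg => (h.localEqs hK P).integral_face hS hg hf hχ ht (h1 hf) h2⟩
  · classical
    -- The local equations involve only the restrictions to P and have at most one solution; the
    -- value 0 is taken where they have none.
    refine ⟨fun F p => if h : ∃ u, PolyMesh.LocalEqs K S pr k P F p u then h.choose else 0,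
      fun F u p h => ?_⟩
    have hl := h.localEqs hK P
    have hex : ∃ u, PolyMesh.LocalEqs K S pr k P (M.rest P F) (M.rest P p) u := ⟨_, hl⟩
    beta_reduce
    rw [dif_pos hex]
    exact hl.unique hS (hpr P) hex.choose_spec
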